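/- Fix $n\ge 3$. Let $\mathcal H_{reg}=\{\theta\in[0,1)^n:\theta_1>\dots>\theta_n\}$, $|\theta|=\sum_i\theta_i$, and for $r\in\mathbb R$ let $\mathcal H_{reg}^{r}=\{\theta\in\mathcal H_{reg}:|\theta|\in r+\mathbb Z\}$, a union of pieces of dimension $n-1$, with the measure $du$ that is on each piece the pull-back of Lebesgue measure under the projection forgetting one coordinate (the result does not depend on which one). For $u\in\mathcal H_{reg}$ put $\tilde u=(1-u_n,\dots,1-u_1)$. **Triangular honeycombs.** Let $T$ be the equilateral triangle with vertices $0,1,e^{i\pi/3}$, with coordinates $v=v_1+v_2e^{i\pi/3}$, $v_0=1-v_1-v_2$, and sides $\partial_iT=\{v\in T: v_i=0\}$, $i\in\mathbb Z/3$. A triangular honeycomb $h$ of size $n$ is a finite set of non-trivial segments of $T$ (edges), coloured by $\{0,1,3\}$, such that: (a) the interiors of two distinct edges $e,e'$ meet only if, up to exchanging them, $c(e)=0$, $c(e')=1$ and the line of $e'$ is that of $e$ turned counterclockwise by $\pi/3$; (b) two distinct edges with a common end point make an angle $2\pi/3$ there, and their colours, in counterclockwise order, form one of the pairs $(0,0),(1,1),(0,1),(1,3),(3,0)$;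 (c) every end point has degree $1$ or $3$, and the union $t(h)$ of the edges meets $\partial T$ exactly in the end points of degree $1$; (d) every edge $e$ has direction $e^{2\pi i(\ell+1)/3}$ for some $\ell=\ell(e)\in\{0,1,2\}$, its type; its height $L(e)$ is the constant value of $v_{\ell(e)}$ on $e$; (e) $t(h)$ has exactly $n$ points on each $\partial_iT$; an edge ending on $\partial_iT$ has colour $0$ and type $i+1$, or colour $1$ and type $i+2$; and along $\partial_iT$ the colour is non-decreasing in the coordinate $v_{i+1}$. The structure graph has the end points as vertices and the edges as edges; it is coloured, and the vertices on $\partial_iT$ are ordered by $v_{i+1}$. For a vertex $v$ put $s(v)=1$ if the edges at $v$ leave it in directions $-e^{2\pi i(\ell+1)/3}$, and $s(v)=-1$ if they leave it in directions $+e^{2\pi i(\ell+1)/3}$. **Surfaces.** Let $\mathcal T$ be a connected oriented surface obtained from $N\geq 1$ copies $T^1,\dots,T^N$ of $T$ by gluing some sides in pairs, isometrically and reversing orientation, and let $L_1,\dots,L_p$, $p\ge1$, be the sides left free. A honeycomb on $\mathcal T$ is a family of triangular honeycombs of size $n$, one on each $T^i$, having the same points on glued sides. It has boundary $(\gamma^1,\dots,\gamma^p)$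 if the points on $L_j=\partial_\ell T^i$ have $v_{\ell+1}$-coordinates $\gamma^j_1>\dots>\gamma^j_n$. Its structure graph is obtained from those of the triangles by identifying equal points of glued sides. Isomorphisms of structure graphs respect the triangles, the colours, and the ordered vertices on every side of every triangle. Let $\mathcal G_{\mathcal T}$ be the set of isomorphism classes that occur, and $\mathcal G=\mathcal G_T$. For $G\in\mathcal G_{\mathcal T}$ let $\mathrm{Honey}^G_{\mathcal T}(\gamma^1,\dots,\gamma^p)$ be the set of honeycombs with structure graph isomorphic to $G$ and boundary $(\gamma^1,\dots,\gamma^p)$. **Volumes.** Let $\Omega^1(G)$ be the space of antisymmetric functions on the oriented edges of $G$, with $\langle\omega,\omega'\rangle=\sum_{e}\omega(e)\omega'(e)$ (each edge counted once). Through the isomorphism with $G$, the label map $\mathcal L[h]\in\Omega^1(G)$ of $h\in\mathrm{Honey}^G_{\mathcal T}$ is $\mathcal L[h](v,v')=s(v)L(e)$ at the oriented edge $(v,v')$ given by the segment $e$. On an affine space of flows with prescribed divergence put $$d\mathrm{Vol}=\frac{1}{\sqrt{\#\{\text{spanning trees of }G\}}}\,d\mathrm{Leb}.$$ **Proposition.**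 Let $\mathcal T'$ be obtained by gluing $\mathcal T$ and a new triangle $T^{N+1}$ along $L_p$ and $\partial_0T^{N+1}$; its free sides are, in this order, $L_1,\dots,L_{p-1},\partial_1T^{N+1},\partial_2T^{N+1}$. Let $\gamma^1,\dots,\gamma^{p+1}\in\mathcal H_{reg}$ with $\sum_{i=1}^{p+1}|\gamma^i|\in\mathbb N$, and let $\theta=-\sum_{i=1}^{p-1}|\gamma^i| \bmod \mathbb Z$. Then $$\sum_{G\in\mathcal G_{\mathcal T'}}\mathrm{Vol}\big[\mathcal L(\mathrm{Honey}^{G}_{\mathcal T'}(\gamma^1,\dots,\gamma^{p+1}))\big]=\int_{\mathcal H_{reg}^{\theta}}\ \sum_{(G_1,G_2)\in\mathcal G\times\mathcal G_{\mathcal T}}\mathrm{Vol}\big[\mathcal L(\mathrm{Honey}^{G_2}_{\mathcal T}(\gamma^1,\dots,\gamma^{p-1},u))\big]\,\mathrm{Vol}\big[\mathcal L(\mathrm{Honey}^{G_1}_T(\tilde u,\gamma^p,\gamma^{p+1}))\big]\,du ,$$ where the triangle $T$ has the boundary values $\tilde u,\gamma^p,\gamma^{p+1}$ on $\partial_0T,\partial_1T,\partial_2T$;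 the integrand is measurable and both sides are finite. -/

import Mathlib

open MeasureTheory Set
open scoped ENNReal

noncomputable section

namespace HoneycombGluing

/-! ### Regular conjugacy classes -/

/-- The regular conjugacy classes: `1 > θ₁ > θ₂ > … > θₙ ≥ 0`. -/
def Hreg (n : ℕ) : Set (Fin n → ℝ) :=
  {θ | StrictAnti θ ∧ ∀ i, 0 ≤ θ i ∧ θ i < 1}

/-- `ũ = (1 - uₙ, …, 1 - u₁)`. -/
def dualTuple {n : ℕ} (u : Fin n → ℝ) : Fin n → ℝ := fun i => 1 - u (Fin.rev i)

/-- The measure `du` on `{u ∈ 𝓗_reg : ∑ uᵢ = r mod ℤ}`: on each affine piece `∑ uᵢ = r + k` it is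
the pull-back of Lebesgue measure under the projection forgetting the coordinate `j`, that is,
the image of Lebesgue measure under the parametrisation of the piece by the other coordinates. -/
def sliceMeasure (n : ℕ) (r : ℝ) (j : Fin n) : Measure (Fin n → ℝ) :=
  (Measure.sum fun k : ℤ =>
    (volume : Measure ({i : Fin n // i ≠ j} → ℝ)).map
      (fun x i => if h : i = j then r + k - ∑ l, x l else x ⟨i, h⟩)).restrict (Hreg n)

/-! ### The equilateral triangle -/

/-- The coordinates `(v₀, v₁, v₂)` of a point of the plane:
`v = v₁ + v₂ e^{iπ/3}` and `v₀ = 1 - v₁ - v₂`. -/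
def coord (i : Fin 3) (v : ℂ) : ℝ :=
  ![1 - (v.re - v.im / √3) - 2 * v.im / √3, v.re - v.im / √3, 2 * v.im / √3] i

theorem coord_spec (v : ℂ) :
    v = coord 1 v + coord 2 v * Complex.exp (Real.pi / 3 * Complex.I) ∧
      coord 0 v = 1 - coord 1 v - coord 2 v := by
  have h3 : √3 * √3 = 3 := Real.mul_self_sqrt (by norm_num)
  have h0 : √3 ≠ 0 := by positivity
  have he : Complex.exp (Real.pi / 3 * Complex.I) = ⟨1 / 2, √3 / 2⟩ := by
    have : ((Real.pi : ℂ) / 3) = ((Real.pi / 3 : ℝ) : ℂ) := by push_cast; rfl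
    rw [this, Complex.exp_mul_I, ← Complex.ofReal_cos, ← Complex.ofReal_sin,
      Real.cos_pi_div_three, Real.sin_pi_div_three]
    apply Complex.ext <;> simp
  refine ⟨?_, by simp [coord]⟩
  rw [he]
  apply Complex.ext
  · simp [coord]
    field_simp
    ring
  · simp [coord]
    field_simp

/-- The closed equilateral triangle `T` with vertices `0`, `1`, `e^{iπ/3}`. -/
def triangle : Set ℂ := {v | ∀ i, 0 ≤ coord i v}

/-- The side `∂ᵢT`. -/
def side (i : Fin 3) : Set ℂ := {v ∈ triangle | coord i v = 0}

/-- The direction `e^{2πi(ℓ+1)/3}` of the edges of type `ℓ`. -/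
def dir (l : Fin 3) : ℂ := Complex.exp (2 * Real.pi * Complex.I * ((l : ℕ) + 1) / 3)

/-! ### Honeycombs -/

/-- The closed segment with the given pair of end points. -/
def seg : Sym2 ℂ → Set ℂ :=
  Sym2.lift ⟨fun a b => segment ℝ a b, fun a b => segment_symm ℝ a b⟩

/-- The interior of the segment with the given pair of end points. -/
def openSeg : Sym2 ℂ → Set ℂ :=
  Sym2.lift ⟨fun a b => openSegment ℝ a b, fun a b => openSegment_symm ℝ a b⟩

/-- The determinant of two plane vectors. -/
def det2 (u u' : ℂ) : ℝ := u.re * u'.im - u.im * u'.re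

/-- The angle from the segment `e` to the segment `e'` equals `α`: there are tangent vectors `u` of
`e` and `u'` of `e'` with `det(u, u') > 0` and `arccos ⟨u / |u|, u' / |u'|⟩ = α`. -/
def AngleFromTo (e e' : Sym2 ℂ) (α : ℝ) : Prop :=
  ∃ a b a' b' : ℂ, e = s(a, b) ∧ e' = s(a', b') ∧ 0 < det2 (b - a) (b' - a') ∧
    InnerProductGeometry.angle (b - a) (b' - a') = α

/-- A (non-degenerate) honeycomb in a plane domain `S`. A non-trivial segment is encoded by the
unordered pair of its distinct end points. -/
structure Honeycomb (S : Set ℂ) where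
  edges : Set (Sym2 ℂ)
  finite_edges : edges.Finite
  nontrivial : ∀ e ∈ edges, ¬ e.IsDiag
  seg_subset : ∀ e ∈ edges, seg e ⊆ S
  color : edges → ℕ
  color_mem : ∀ e, color e = 0 ∨ color e = 1 ∨ color e = 3
  /-- The interiors of two edges meet only if one edge has colour `0`, the other has colour `1`,
  and the angle from the former to the latter is `π/3`. -/
  crossing : ∀ e e' : edges, e ≠ e' → (openSeg e ∩ openSeg e').Nonempty →
    (color e = 0 ∧ color e' = 1 ∧ AngleFromTo e e' (Real.pi / 3)) ∨
    (color e' = 0 ∧ color e = 1 ∧ AngleFromTo e' e (Real.pi / 3))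
  /-- Two edges with a common end point `v` make an angle `2π/3` at `v`, and their colours, read
  counterclockwise, form one of the five allowed pairs. -/
  corner : ∀ (v w w' : ℂ) (hw : s(v, w) ∈ edges) (hw' : s(v, w') ∈ edges), w ≠ w' →
    InnerProductGeometry.angle (w - v) (w' - v) = 2 * Real.pi / 3 ∧
    (0 < det2 (w - v) (w' - v) →
      (color ⟨s(v, w), hw⟩, color ⟨s(v, w'), hw'⟩) ∈
        ({(0, 0), (1, 1), (0, 1), (1, 3), (3, 0)} : Set (ℕ × ℕ)))

namespace Honeycomb

variable {S : Set ℂ} (h : Honeycomb S)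

/-- The vertices of the structure graph: all end points of edges. -/
def vertices : Set ℂ := {v | ∃ e ∈ h.edges, v ∈ e}

/-- The degree of a point in the structure graph. -/
def degree (v : ℂ) : ℕ := {e ∈ h.edges | v ∈ e}.ncard

/-- The union `t(h)` of all edges. -/
def support : Set ℂ := ⋃ e ∈ h.edges, seg e

theorem finite_vertices : h.vertices.Finite := by
  have : h.vertices = ⋃ e ∈ h.edges, {v : ℂ | v ∈ e} := by
    ext v; simp [vertices]
  rw [this]
  refine h.finite_edges.biUnion fun e _ => ?_
  induction e using Sym2.ind with
  | _ a b =>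
    refine (Set.toFinite ({a, b} : Set ℂ)).subset ?_
    intro v hv
    simpa using hv

end Honeycomb

/-- `e` lies on the line through the point `x` of `T` in the direction of type `l`. -/
def OnLine (e : Sym2 ℂ) (l : Fin 3) (x : ℂ) : Prop :=
  x ∈ triangle ∧ seg e ⊆ {y | ∃ r : ℝ, y = x + r * dir l}

/-- `e` has type `l`. -/
def HasType (e : Sym2 ℂ) (l : Fin 3) : Prop := ∃ x, OnLine e l x

/-- A triangular honeycomb of size `n`. Indices in `Fin 3` are added modulo `3`. -/
structure TriHoneycomb (n : ℕ) extends Honeycomb triangle where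
  degree_eq : ∀ v ∈ toHoneycomb.vertices, toHoneycomb.degree v = 1 ∨ toHoneycomb.degree v = 3
  support_inter_boundary : toHoneycomb.support ∩ ⋃ i, side i =
    {v ∈ toHoneycomb.vertices | toHoneycomb.degree v = 1}
  typed : ∀ e : edges, ∃ l, HasType e l
  ncard_side : ∀ i, (toHoneycomb.support ∩ side i).ncard = n
  side_color : ∀ (i : Fin 3) (e : edges) (v : ℂ), v ∈ (e : Sym2 ℂ) → v ∈ side i →
    (color e = 0 ∧ HasType e (i + 1)) ∨ (color e = 1 ∧ HasType e (i + 2))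
  color_mono : ∀ (i : Fin 3) (e₁ e₂ : edges) (v₁ v₂ : ℂ),
    v₁ ∈ (e₁ : Sym2 ℂ) → v₂ ∈ (e₂ : Sym2 ℂ) → v₁ ∈ side i → v₂ ∈ side i →
    coord (i + 1) v₁ < coord (i + 1) v₂ → color e₁ ≤ color e₂

namespace TriHoneycomb

variable {n : ℕ} (h : TriHoneycomb n)

/-- The type `ℓ(e)` of an edge. -/
def edgeType (e : h.edges) : Fin 3 := (h.typed e).choose

/-- The height `L(e) = x_{ℓ(e)}`, where `x` is a point of the line supporting `e`. -/
def height (e : h.edges) : ℝ := coord (h.edgeType e) (h.typed e).choose_spec.choose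

open Classical in
/-- The sign `s(v)`: it is `1` if the edges at `v` leave `v` in the directions
`-e^{2πi(ℓ+1)/3}`, and `-1` if they leave `v` in the directions `e^{2πi(ℓ+1)/3}`. -/
def sign (v : ℂ) : ℝ :=
  if ∃ (l : Fin 3) (r : ℝ), 0 < r ∧ s(v, v - r * dir l) ∈ h.edges then 1 else -1

/-- The `i+1`-coordinates of the points of the honeycomb on the side `∂ᵢT`. -/
def sideCoords (i : Fin 3) : Set ℝ := coord (i + 1) '' (h.support ∩ side i)

/-- An isomorphism between the structure graphs of two triangular honeycombs, as coloured graphs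
with ordered boundary: boundary vertices on `∂ᵢT` correspond to boundary vertices on `∂ᵢT`, in the
same order with respect to the `i+1`-coordinate. -/
structure Iso {n : ℕ} (h h' : TriHoneycomb n) where
  toEquiv : h.vertices ≃ h'.vertices
  adj_iff : ∀ a b : h.vertices, s((a : ℂ), (b : ℂ)) ∈ h.edges ↔
    s((toEquiv a : ℂ), (toEquiv b : ℂ)) ∈ h'.edges
  color_eq : ∀ (a b : h.vertices) (hab : s((a : ℂ), (b : ℂ)) ∈ h.edges)
    (hab' : s((toEquiv a : ℂ), (toEquiv b : ℂ)) ∈ h'.edges),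
    h.color ⟨_, hab⟩ = h'.color ⟨_, hab'⟩
  side_iff : ∀ (i : Fin 3) (a : h.vertices), (a : ℂ) ∈ side i ↔ (toEquiv a : ℂ) ∈ side i
  order_iff : ∀ (i : Fin 3) (a b : h.vertices), (a : ℂ) ∈ side i → (b : ℂ) ∈ side i →
    (coord (i + 1) (a : ℂ) < coord (i + 1) (b : ℂ) ↔
      coord (i + 1) (toEquiv a : ℂ) < coord (i + 1) (toEquiv b : ℂ))

/-- The identity isomorphism. -/
def Iso.refl : Iso h h where
  toEquiv := Equiv.refl _
  adj_iff := by simp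
  color_eq := by simp
  side_iff := by simp
  order_iff := by simp

/-- The inverse isomorphism. -/
def Iso.symm {h h' : TriHoneycomb n} (f : Iso h h') : Iso h' h where
  toEquiv := f.toEquiv.symm
  adj_iff a b := by
    have := f.adj_iff (f.toEquiv.symm a) (f.toEquiv.symm b)
    simpa using this.symm
  color_eq a b hab hab' := by
    have := f.color_eq (f.toEquiv.symm a) (f.toEquiv.symm b) hab' (by simpa using hab)
    simpa using this.symm
  side_iff i a := by
    have := f.side_iff i (f.toEquiv.symm a)
    simpa using this.symm
  order_iff i a b ha hb := by
    have := f.order_iff i (f.toEquiv.symm a) (f.toEquiv.symm b)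
      ((f.side_iff i _).2 (by simpa using ha)) ((f.side_iff i _).2 (by simpa using hb))
    simpa using this.symm

/-- The composition of two isomorphisms. -/
def Iso.trans {h h' h'' : TriHoneycomb n} (f : Iso h h') (g : Iso h' h'') : Iso h h'' where
  toEquiv := f.toEquiv.trans g.toEquiv
  adj_iff a b := (f.adj_iff a b).trans (g.adj_iff _ _)
  color_eq a b hab hab' :=
    (f.color_eq a b hab ((f.adj_iff a b).1 hab)).trans (g.color_eq _ _ _ hab')
  side_iff i a := (f.side_iff i a).trans (g.side_iff i _)
  order_iff i a b ha hb := (f.order_iff i a b ha hb).trans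
    (g.order_iff i _ _ ((f.side_iff i a).1 ha) ((f.side_iff i b).1 hb))

end TriHoneycomb

/-! ### Surfaces glued from triangles -/

/-- A connected oriented surface obtained from the triangles `Tⁱ`, `i : ι`, by gluing some of their
sides in pairs, isometrically and reversing orientation. The side `∂ₖTⁱ` is the pair `(i, k)`;
`opp` exchanges the two sides of each glued pair and fixes the `p` sides
`L₁, …, L_p` that are not glued, which are listed by `bdry`. -/
structure TriangleGluing (ι : Type) (p : ℕ) where
  opp : ι × Fin 3 → ι × Fin 3
  opp_opp : ∀ x, opp (opp x) = x
  bdry : Fin p → ι × Fin 3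
  bdry_injective : Function.Injective bdry
  opp_eq_self_iff : ∀ x, opp x = x ↔ ∃ j, bdry j = x
  connected : ∀ i i', Relation.ReflTransGen (fun a b => ∃ k l, opp (a, k) = (b, l)) i i'

/-- The surface consisting of the single triangle `T`, with boundary sides `∂₀T, ∂₁T, ∂₂T`. -/
def singleTriangle : TriangleGluing Unit 3 where
  opp x := x
  opp_opp _ := rfl
  bdry k := ((), k)
  bdry_injective k l h := by simpa using h
  opp_eq_self_iff x := by simp
  connected _ _ := Relation.ReflTransGen.refl

namespace TriangleGluing

variable {ι : Type} {q : ℕ}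

/-- The side `(i, k)` viewed as a side of the enlarged family of triangles. -/
def liftSide (x : ι × Fin 3) : Option ι × Fin 3 := (some x.1, x.2)

/-- The side pairing after gluing a new triangle `none` along its side `∂₀` to the last boundary
side of `𝒯`. -/
def glueOpp [DecidableEq ι] (𝒯 : TriangleGluing ι (q + 1)) :
    Option ι × Fin 3 → Option ι × Fin 3
  | (some i, k) =>
      if (i, k) = 𝒯.bdry (Fin.last q) then (none, 0) else liftSide (𝒯.opp (i, k))
  | (none, k) => if k = 0 then liftSide (𝒯.bdry (Fin.last q)) else (none, k)

/-- The surface `𝒯'` obtained by gluing `𝒯` and a new triangle along the last boundary side `L_p`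
of `𝒯` and the side `∂₀` of the new triangle. Its boundary sides are `L₁, …, L_{p-1}` followed by
the sides `∂₁` and `∂₂` of the new triangle. -/
def glueTriangle [DecidableEq ι] (𝒯 : TriangleGluing ι (q + 1)) :
    TriangleGluing (Option ι) (q + 2) where
  opp := 𝒯.glueOpp
  opp_opp := by
    have hl : 𝒯.opp (𝒯.bdry (Fin.last q)) = 𝒯.bdry (Fin.last q) :=
      (𝒯.opp_eq_self_iff _).2 ⟨_, rfl⟩
    rintro ⟨_ | i, k⟩
    · by_cases hk : k = 0
      · subst hk; simp [glueOpp, liftSide]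
      · simp [glueOpp, hk]
    · by_cases hk : (i, k) = 𝒯.bdry (Fin.last q)
      · have h1 : liftSide (𝒯.bdry (Fin.last q)) = (some i, k) := by rw [← hk]; rfl
        simp only [glueOpp, hk, if_true, h1]
      · have h2 : 𝒯.opp (i, k) ≠ 𝒯.bdry (Fin.last q) := by
          intro h
          apply hk
          rw [← 𝒯.opp_opp (i, k), h, hl]
        have h3 : ((𝒯.opp (i, k)).1, (𝒯.opp (i, k)).2) = 𝒯.opp (i, k) := rfl
        simp [glueOpp, hk, liftSide, h2, 𝒯.opp_opp]
  bdry := Fin.append (fun j : Fin q => liftSide (𝒯.bdry j.castSucc)) ![(none, 1), (none, 2)]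
  bdry_injective := by
    intro a b
    refine Fin.addCases (fun i => ?_) (fun i => ?_) a <;>
      refine Fin.addCases (fun j => ?_) (fun j => ?_) b
    · intro h
      simp only [Fin.append_left, liftSide, Prod.mk.injEq, Option.some.injEq] at h
      have := 𝒯.bdry_injective (Prod.ext h.1 h.2)
      rw [Fin.castSucc_injective _ this]
    · intro h
      fin_cases j <;> simp [liftSide] at h
    · intro h
      fin_cases i <;> simp [liftSide] at h
    · intro h
      fin_cases i <;> fin_cases j <;> simp at h ⊢
  opp_eq_self_iff := by
    rintro ⟨_ | i, k⟩
    · constructor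
      · intro h
        fin_cases k
        · simp [glueOpp, liftSide] at h
        · exact ⟨Fin.natAdd q 0, by simp⟩
        · exact ⟨Fin.natAdd q 1, by simp⟩
      · rintro ⟨a, ha⟩
        revert ha
        refine Fin.addCases (fun j => ?_) (fun j => ?_) a
        · intro h; simp [liftSide] at h
        · intro h
          fin_cases j <;> simp at h <;> subst h <;> simp [glueOpp]
    · constructor
      · intro h
        by_cases hk : (i, k) = 𝒯.bdry (Fin.last q)
        · simp [glueOpp, hk] at h
        · simp only [glueOpp, hk, if_false, liftSide, Prod.mk.injEq, Option.some.injEq] at h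
          obtain ⟨j, hj⟩ := (𝒯.opp_eq_self_iff (i, k)).1 (Prod.ext h.1 h.2)
          have hjl : j ≠ Fin.last q := by rintro rfl; exact hk hj.symm
          obtain ⟨j', rfl⟩ := Fin.exists_castSucc_eq.2 hjl
          exact ⟨Fin.castAdd 2 j', by simp [liftSide, hj]⟩
      · rintro ⟨a, ha⟩
        revert ha
        refine Fin.addCases (fun j => ?_) (fun j => ?_) a
        · intro h
          simp only [Fin.append_left, liftSide, Prod.mk.injEq, Option.some.injEq] at h
          have hj : 𝒯.bdry j.castSucc = (i, k) := Prod.ext h.1 h.2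
          have hne : (i, k) ≠ 𝒯.bdry (Fin.last q) := by
            rw [← hj]
            intro h'
            exact (Fin.castSucc_lt_last j).ne (𝒯.bdry_injective h')
          have ho : 𝒯.opp (i, k) = (i, k) := (𝒯.opp_eq_self_iff _).2 ⟨_, hj⟩
          simp [glueOpp, hne, ho, liftSide]
        · intro h
          fin_cases j <;> simp at h
  connected := by
    set R : Option ι → Option ι → Prop := fun a b => ∃ k l, 𝒯.glueOpp (a, k) = (b, l) with hR
    obtain ⟨i₀, k₀, hik⟩ : ∃ i₀, ∃ k₀, 𝒯.bdry (Fin.last q) = (i₀, k₀) := ⟨_, _, rfl⟩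
    have h1 : R none (some i₀) := ⟨0, k₀, by simp [glueOpp, liftSide, hik]⟩
    have h2 : R (some i₀) none := ⟨k₀, 0, by simp [glueOpp, hik]⟩
    have h3 : ∀ i i', Relation.ReflTransGen R (some i) (some i') := by
      intro i i'
      induction 𝒯.connected i i' with
      | refl => exact Relation.ReflTransGen.refl
      | @tail a b _ hab ih =>
      obtain ⟨k, l, hkl⟩ := hab
      refine ih.trans ?_
      by_cases hk : (a, k) = 𝒯.bdry (Fin.last q)
      · have ho : 𝒯.opp (a, k) = (a, k) := (𝒯.opp_eq_self_iff _).2 ⟨_, hk.symm⟩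
        rw [ho] at hkl
        rw [(Prod.mk.inj hkl).1]
      · exact Relation.ReflTransGen.single ⟨k, l, by simp [glueOpp, hk, hkl, liftSide]⟩
    rintro (_ | i) (_ | i')
    · exact Relation.ReflTransGen.refl
    · exact (Relation.ReflTransGen.single h1).trans (h3 _ _)
    · exact (h3 _ _).trans (Relation.ReflTransGen.single h2)
    · exact h3 _ _

end TriangleGluing

/-! ### Honeycombs on glued surfaces -/

/-- A honeycomb on `𝒯`: a triangular honeycomb on each triangle, such that honeycombs on glued
sides have the same points on the common side. Since glued sides are identified isometrically with
reversed orientation, the coordinate `x` on one side is the coordinate `1 - x` on the other. -/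
structure SurfaceHoneycomb {ι : Type} {p : ℕ} (𝒯 : TriangleGluing ι p) (n : ℕ) where
  tri : ι → TriHoneycomb n
  compat : ∀ x, 𝒯.opp x ≠ x →
    (tri (𝒯.opp x).1).sideCoords (𝒯.opp x).2 = (fun t => 1 - t) '' (tri x.1).sideCoords x.2

namespace SurfaceHoneycomb

variable {ι : Type} {p : ℕ} {𝒯 : TriangleGluing ι p} {n : ℕ} (h : SurfaceHoneycomb 𝒯 n)

/-- Two vertices of the triangles of `𝒯` which are the same point of a glued side. -/
def Glued (x y : Σ i, (h.tri i).vertices) : Prop :=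
  ∃ k l, 𝒯.opp (x.1, k) = (y.1, l) ∧ (x.1, k) ≠ (y.1, l) ∧
    (x.2 : ℂ) ∈ side k ∧ (y.2 : ℂ) ∈ side l ∧
    coord (l + 1) (y.2 : ℂ) = 1 - coord (k + 1) (x.2 : ℂ)

/-- The vertices of the structure graph `G(h)`. -/
def Vertex : Type := Quot h.Glued

/-- The vertex of `G(h)` given by a vertex of the honeycomb on the triangle `i`. -/
def mkVertex (i : ι) (a : (h.tri i).vertices) : h.Vertex := Quot.mk _ ⟨i, a⟩

instance [Finite ι] : Finite h.Vertex := by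
  have (i : ι) : Finite (h.tri i).vertices := (h.tri i).finite_vertices
  unfold Vertex
  infer_instance

instance [Finite ι] : Fintype h.Vertex := Fintype.ofFinite _

/-- The structure graph `G(h)`. -/
def graph : SimpleGraph h.Vertex :=
  SimpleGraph.fromRel fun x y => ∃ (i : ι) (a b : (h.tri i).vertices),
    s((a : ℂ), (b : ℂ)) ∈ (h.tri i).edges ∧ h.mkVertex i a = x ∧ h.mkVertex i b = y

/-- `h` has boundary values `γ¹, …, γᵖ`: for each `j` the strictly decreasing tuple `γʲ` lists the
coordinates of the points of `h` on `L_j`. -/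
def HasBoundary (γ : Fin p → Fin n → ℝ) : Prop :=
  ∀ j, StrictAnti (γ j) ∧
    (h.tri (𝒯.bdry j).1).sideCoords (𝒯.bdry j).2 = Set.range (γ j)

/-- An isomorphism between the structure graphs of two honeycombs on `𝒯`, seen as obtained by
sieving the coloured graphs with ordered boundary of the triangles. -/
def Iso (h h' : SurfaceHoneycomb 𝒯 n) : Type := ∀ i, TriHoneycomb.Iso (h.tri i) (h'.tri i)

end SurfaceHoneycomb

/-- Honeycombs on `𝒯` are equivalent when they have isomorphic structure graphs. -/
def graphSetoid {ι : Type} {p : ℕ} (𝒯 : TriangleGluing ι p) (n : ℕ) :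
    Setoid (SurfaceHoneycomb 𝒯 n) where
  r h h' := Nonempty (h.Iso h')
  iseqv :=
    { refl := fun h => ⟨fun i => TriHoneycomb.Iso.refl (h.tri i)⟩
      symm := fun ⟨f⟩ => ⟨fun i => (f i).symm⟩
      trans := fun ⟨f⟩ ⟨g⟩ => ⟨fun i => (f i).trans (g i)⟩ }

/-- The set `𝒢_𝒯` of isomorphism classes of structure graphs of honeycombs on `𝒯`. -/
def GraphClass {ι : Type} {p : ℕ} (𝒯 : TriangleGluing ι p) (n : ℕ) : Type :=
  Quotient (graphSetoid 𝒯 n)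

/-! ### Flows and volumes -/

/-- The space `Ω¹(G)` of flows: antisymmetric functions on oriented edges, extended by zero to all
pairs of vertices. -/
def flows {V : Type} (G : SimpleGraph V) : Submodule ℝ (V × V → ℝ) where
  carrier := {ω | (∀ v w, ω (v, w) = -ω (w, v)) ∧ ∀ v w, ¬ G.Adj v w → ω (v, w) = 0}
  add_mem' := by
    rintro a b ⟨ha, ha'⟩ ⟨hb, hb'⟩
    refine ⟨fun v w => ?_, fun v w hvw => by simp [ha' v w hvw, hb' v w hvw]⟩
    simp only [Pi.add_apply]
    rw [ha v w, hb v w]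
    ring
  zero_mem' := by simp
  smul_mem' := by
    rintro c a ⟨ha, ha'⟩
    refine ⟨fun v w => ?_, fun v w hvw => by simp [ha' v w hvw]⟩
    simp only [Pi.smul_apply, smul_eq_mul]
    rw [ha v w]
    ring

/-- The space `𝓕(0)` of flows with zero divergence. -/
def divFree {V : Type} [Fintype V] (G : SimpleGraph V) : Submodule ℝ (V × V → ℝ) where
  carrier := {ω | ω ∈ flows G ∧ ∀ v, ∑ w, ω (v, w) = 0}
  add_mem' := by
    rintro a b ⟨ha, ha'⟩ ⟨hb, hb'⟩
    exact ⟨(flows G).add_mem ha hb, fun v => by simp [Finset.sum_add_distrib, ha' v, hb' v]⟩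
  zero_mem' := ⟨(flows G).zero_mem, by simp⟩
  smul_mem' := by
    rintro c a ⟨ha, ha'⟩
    exact ⟨(flows G).smul_mem c ha, fun v => by simp [← Finset.mul_sum, ha' v]⟩

/-- The number of spanning trees of `G`. -/
def numSpanningTrees {V : Type} (G : SimpleGraph V) : ℕ :=
  Nat.card {T : SimpleGraph V // T ≤ G ∧ T.IsTree}

/-- The map `ω ↦ ω / √2` from functions on pairs of vertices to a Euclidean space. Restricted to
`Ω¹(G)` it is an isometry for the inner product `⟨ω, ω'⟩ = ∑_{e ∈ E} ω(e) ω'(e)`, in which each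
unoriented edge is counted once. -/
def flowEmbedding {V : Type} (ω : V × V → ℝ) : EuclideanSpace ℝ (V × V) :=
  WithLp.toLp 2 fun e => ω e / √2

/-- The volume of a set `A` of flows with the same divergence `φ`: the Lebesgue measure of `A` in
the affine Euclidean space `𝓕(φ) = λ₀ + 𝓕(0)` (that is, the Euclidean Hausdorff measure of the
dimension of `𝓕(0)`), divided by the square root of the number of spanning trees of `G`. -/
def flowVolume {V : Type} [Fintype V] (G : SimpleGraph V) (A : Set (V × V → ℝ)) : ℝ≥0∞ :=
  (Measure.euclideanHausdorffMeasure (Module.finrank ℝ (divFree G)) :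
      Measure (EuclideanSpace ℝ (V × V))) (flowEmbedding '' A) /
    ENNReal.ofReal (√(numSpanningTrees G : ℝ))

/-- The set `𝓛(Honey^G(γ)) ⊆ Ω¹(G)`, where `G` is the structure graph of `h₀`: the label maps of all
honeycombs `h` with boundary `γ` whose structure graph is isomorphic to `G`. The label map takes
the value `s(a) L(e)` at the oriented edge `(a, b)` with underlying segment `e`. -/
def labelSet {ι : Type} {p : ℕ} {𝒯 : TriangleGluing ι p} {n : ℕ} (h₀ : SurfaceHoneycomb 𝒯 n)
    (γ : Fin p → Fin n → ℝ) : Set (h₀.Vertex × h₀.Vertex → ℝ) :=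
  {ω | ω ∈ flows h₀.graph ∧ ∃ h : SurfaceHoneycomb 𝒯 n, h.HasBoundary γ ∧ ∃ f : h.Iso h₀,
    ∀ (i : ι) (a b : (h.tri i).vertices) (hab : s((a : ℂ), (b : ℂ)) ∈ (h.tri i).edges),
      ω (h₀.mkVertex i ((f i).toEquiv a), h₀.mkVertex i ((f i).toEquiv b)) =
        (h.tri i).sign a * (h.tri i).height ⟨_, hab⟩}

/-- The honeycomb volume `Vol[𝓛(Honey_𝒯^G(γ¹, …, γᵖ))]`, computed on a representative of the
isomorphism class `G`. -/
def honeyVolume {ι : Type} [Finite ι] {p : ℕ} {𝒯 : TriangleGluing ι p} {n : ℕ}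
    (G : GraphClass 𝒯 n) (γ : Fin p → Fin n → ℝ) : ℝ≥0∞ :=
  flowVolume (Quotient.out G : SurfaceHoneycomb 𝒯 n).graph
    (labelSet (Quotient.out G : SurfaceHoneycomb 𝒯 n) γ)

/-- The integrand of the gluing formula. -/
def gluingIntegrand {ι : Type} [Finite ι] {q n : ℕ} (𝒯 : TriangleGluing ι (q + 1))
    (γ : Fin (q + 2) → Fin n → ℝ) (u : Fin n → ℝ) : ℝ≥0∞ :=
  ∑' G : GraphClass singleTriangle n × GraphClass 𝒯 n,
    honeyVolume G.2 (Fin.snoc (α := fun _ => Fin n → ℝ) (fun i : Fin q => γ (Fin.castAdd 2 i)) u) *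
    honeyVolume G.1 ![dualTuple u, γ (Fin.natAdd q 0), γ (Fin.natAdd q 1)]

end HoneycombGluing

end

/-!
The volume of a set of flows is a Lebesgue measure of coordinates. On a connected graph, call a
family of oriented edges a chart if the values on these edges are linear coordinates of the
circulations, and integral values belong to integral circulations. The edges outside a spanning tree
form a chart, and any two charts differ by a unimodular matrix. By the Cauchy–Binet formula the Gram
determinant of a chart is therefore the number of spanning trees, and the normalisation
`1 / √#trees` makes the volume of a set of flows with a common divergence equal to the Lebesgue
measure of its coordinates in any chart (`IsChart.flowVolume_eq`).

Label maps of honeycombs form such sets. The three heights at an inner vertex are its coordinates,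
which have sum `1`, and the label of an edge ending on a side is affine in the position of its end
point. Hence the divergence of a label map is the difference of an integral function that depends on
the structure graph only and of the boundary values (`IsLabel.divg_eq`). Conversely, the values of a
flow with this divergence near a label map are the heights of a slightly deformed honeycomb
(`TriHoneycomb.eventually_isDeformation`, `IsLabel.eventually`), so that the label set of a
structure graph is cut out of the affine space of flows with the right divergence by an open set
which is the same for all boundary values (`SurfaceHoneycomb.exists_open_labelSet`). As heights lie
in `[0, 1]`, the volumes are finite, and they are measurable functions of the boundary values.

Two facts about honeycombs in a triangle enter. Structure graphs are connected
(`TriHoneycomb.nbr_connected`): one can follow the edges of given colours monotonically up to a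
prescribed side, such paths have to cross for topological reasons (`exists_crossing`), and crossings
are permitted only between colours `0` and `1`, in one of the two possible orders. There are
finitely many structure graphs (`finite_graphClass`): an edge is determined by its type and by the
boundary points where the two zigzag paths through it end, so there are at most `3 n ^ 2` edges.

The gluing formula is then Fubini's theorem. A honeycomb on the enlarged surface is a pair of
honeycombs on the original surface and on the new triangle with the same points `u` on the common
side. In the new triangle the vertices on this side are pendant, so charts of the two structure
graphs together with all but one of the pendant edges form a chart of the glued structure graph
(`IsGluing.isChart`). The coordinates on the pendant edges are, up to integers, those of `u`, and
the omitted one is determined by the sum of `u`, which the structure graph and the other boundary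
values prescribe. This expresses the volume for one structure graph of the enlarged surface as the
integral over `u` of the product of the volumes for its restrictions
(`SurfaceHoneycomb.flowVolume_glueTriangle`), and only the piece of the slice with the prescribed
sum contributes (`lintegral_sliceMeasure`). Finally, a structure graph of the enlarged surface is
determined by its two restrictions, and pairs of structure graphs that do not arise in this way
contribute zero, because honeycombs with the same `u` can be glued.
-/

noncomputable section

namespace HoneycombGluing

set_option linter.unusedSectionVars false

/-! ### Flows on graphs -/

section Flows

variable {V : Type} [Fintype V]

/-- The divergence of a function on oriented pairs of vertices. -/
def divg (ω : V × V → ℝ) (v : V) : ℝ := ∑ w, ω (v, w)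

/-- The function is integer-valued. -/
def IsIntegral {α : Type} (ω : α → ℝ) : Prop := ∀ e, ∃ m : ℤ, ω e = m

theorem IsIntegral.add {α : Type} {ω ω' : α → ℝ} (h : IsIntegral ω) (h' : IsIntegral ω') :
    IsIntegral (ω + ω') := fun e => by
  obtain ⟨m, hm⟩ := h e
  obtain ⟨m', hm'⟩ := h' e
  exact ⟨m + m', by simp [hm, hm']⟩

theorem IsIntegral.sub {α : Type} {ω ω' : α → ℝ} (h : IsIntegral ω) (h' : IsIntegral ω') :
    IsIntegral (ω - ω') := fun e => by
  obtain ⟨m, hm⟩ := h e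
  obtain ⟨m', hm'⟩ := h' e
  exact ⟨m - m', by simp [hm, hm']⟩

theorem IsIntegral.sum_smul {α ι : Type} (s : Finset ι) {c : ι → ℝ} {ω : ι → α → ℝ}
    (hc : IsIntegral c) (h : ∀ i ∈ s, IsIntegral (ω i)) : IsIntegral (∑ i ∈ s, c i • ω i) := by
  classical
  induction s using Finset.induction_on with
  | empty => exact fun e => ⟨0, by simp⟩
  | insert a s ha ih =>
    rw [Finset.sum_insert ha]
    refine IsIntegral.add (fun e => ?_) (ih fun i hi => h i (Finset.mem_insert_of_mem hi))
    obtain ⟨m, hm⟩ := hc a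
    obtain ⟨m', hm'⟩ := h a (Finset.mem_insert_self _ _) e
    exact ⟨m * m', by simp [hm, hm']⟩

theorem divg_add (ω ω' : V × V → ℝ) : divg (ω + ω') = divg ω + divg ω' := by
  ext v; simp [divg, Finset.sum_add_distrib]

theorem divg_sub (ω ω' : V × V → ℝ) : divg (ω - ω') = divg ω - divg ω' := by
  ext v; simp [divg, Finset.sum_sub_distrib]

theorem divg_smul (c : ℝ) (ω : V × V → ℝ) : divg (c • ω) = c • divg ω := by
  ext v; simp [divg, Finset.mul_sum]

theorem divg_zero : divg (0 : V × V → ℝ) = 0 := by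
  ext v; simp [divg]

theorem divg_sum {ι : Type} (s : Finset ι) (ω : ι → V × V → ℝ) :
    divg (∑ i ∈ s, ω i) = ∑ i ∈ s, divg (ω i) := by
  classical
  induction s using Finset.induction_on with
  | empty => simp [divg_zero]
  | insert a s ha ih => rw [Finset.sum_insert ha, Finset.sum_insert ha, divg_add, ih]

theorem mem_divFree_iff {G : SimpleGraph V} {ω : V × V → ℝ} :
    ω ∈ divFree G ↔ ω ∈ flows G ∧ divg ω = 0 :=
  and_congr_right fun _ => ⟨fun h => funext h, fun h v => congrFun h v⟩

theorem flows_mono {G H : SimpleGraph V} (h : H ≤ G) {ω : V × V → ℝ} (hω : ω ∈ flows H) :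
    ω ∈ flows G :=
  ⟨hω.1, fun v w hvw => hω.2 v w fun hh => hvw (h hh)⟩

theorem sum_divg {G : SimpleGraph V} {ω : V × V → ℝ} (hω : ω ∈ flows G) : ∑ v, divg ω v = 0 := by
  have h : ∑ v, ∑ w, ω (v, w) = ∑ v, ∑ w, -ω (v, w) := by
    rw [Finset.sum_comm]
    exact Finset.sum_congr rfl fun v _ => Finset.sum_congr rfl fun w _ => hω.1 _ _
  simp only [Finset.sum_neg_distrib] at h
  simp only [divg]
  linarith

open Classical in
/-- The flow through a cut is the total divergence of one of its shores. -/
theorem sum_cut {G : SimpleGraph V} {ω : V × V → ℝ} (hω : ω ∈ flows G) (K : Set V) :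
    ∑ v, ∑ w, (if v ∈ K ∧ w ∉ K then ω (v, w) else 0) = ∑ v, if v ∈ K then divg ω v else 0 := by
  have h1 : ∑ v, ∑ w, (if v ∈ K ∧ w ∈ K then ω (v, w) else 0) = 0 := by
    have h : ∑ v, ∑ w, (if v ∈ K ∧ w ∈ K then ω (v, w) else 0) =
        ∑ v, ∑ w, -(if v ∈ K ∧ w ∈ K then ω (v, w) else 0) := by
      rw [Finset.sum_comm]
      refine Finset.sum_congr rfl fun v _ => Finset.sum_congr rfl fun w _ => ?_
      by_cases hv : v ∈ K <;> by_cases hw : w ∈ K <;> simp [hv, hw, hω.1 w v]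
    simp only [Finset.sum_neg_distrib] at h
    linarith
  have h2 : ∑ v, (if v ∈ K then divg ω v else 0) =
      ∑ v, ∑ w, (if v ∈ K ∧ w ∉ K then ω (v, w) else 0) +
        ∑ v, ∑ w, (if v ∈ K ∧ w ∈ K then ω (v, w) else 0) := by
    rw [← Finset.sum_add_distrib]
    refine Finset.sum_congr rfl fun v _ => ?_
    rw [← Finset.sum_add_distrib]
    by_cases hv : v ∈ K
    · simp only [hv, divg, if_true, true_and]
      refine Finset.sum_congr rfl fun w _ => ?_
      by_cases hw : w ∈ K <;> simp [hw]
    · simp [hv]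
  rw [h2, h1, add_zero]

open Classical in
/-- The unit flow along the oriented pair `(a, b)`. -/
def unitFlow (a b : V) : V × V → ℝ :=
  fun p => (if p = (a, b) then 1 else 0) - (if p = (b, a) then 1 else 0)

theorem unitFlow_mem {G : SimpleGraph V} {a b : V} (h : G.Adj a b) : unitFlow a b ∈ flows G := by
  classical
  refine ⟨fun v w => ?_, fun v w hvw => ?_⟩
  · simp only [unitFlow, Prod.mk.injEq]
    by_cases h1 : v = a ∧ w = b <;> by_cases h2 : v = b ∧ w = a <;>
      simp [h1, h2, and_comm]
  · have h1 : ¬ (v = a ∧ w = b) := by rintro ⟨rfl, rfl⟩; exact hvw h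
    have h2 : ¬ (v = b ∧ w = a) := by rintro ⟨rfl, rfl⟩; exact hvw h.symm
    simp [unitFlow, h1, h2]

theorem unitFlow_integral (a b : V) : IsIntegral (unitFlow a b) := by
  classical
  intro e
  refine ⟨(if e = (a, b) then 1 else 0) - (if e = (b, a) then 1 else 0), ?_⟩
  simp only [unitFlow]
  split_ifs <;> simp

open Classical in
theorem divg_unitFlow (a b : V) : divg (unitFlow a b) = Pi.single a 1 - Pi.single b 1 := by
  ext v
  simp only [divg, unitFlow, Finset.sum_sub_distrib, Prod.mk.injEq, Pi.sub_apply, Pi.single_apply]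
  congr 1
  · by_cases h : v = a <;> simp [h]
  · by_cases h : v = b <;> simp [h]

open Classical in
theorem exists_pathFlow {G : SimpleGraph V} {a b : V} (h : G.Reachable a b) :
    ∃ ω ∈ flows G, IsIntegral ω ∧ divg ω = Pi.single a 1 - Pi.single b 1 := by
  obtain ⟨p⟩ := h
  induction p with
  | nil => exact ⟨0, (flows G).zero_mem, fun e => ⟨0, by simp⟩, by simp [divg_zero]⟩
  | @cons u v w huv p ih =>
    obtain ⟨ω, h1, h2, h3⟩ := ih
    exact ⟨unitFlow u v + ω, (flows G).add_mem (unitFlow_mem huv) h1,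
      (unitFlow_integral _ _).add h2, by rw [divg_add, divg_unitFlow, h3]; abel⟩

/-- A chart of the space of circulations of `G`: oriented pairs `o k` on which the values of a
circulation can be prescribed freely, determine it, and give an integral circulation when they are
integers. -/
structure IsChart (G : SimpleGraph V) {κ : Type} (o : κ → V × V) : Prop where
  inj : ∀ ω ∈ divFree G, (∀ k, ω (o k) = 0) → ω = 0
  ext : ∀ z : κ → ℝ, ∃ ω ∈ divFree G, ∀ k, ω (o k) = z k
  int : ∀ z : κ → ℝ, IsIntegral z → ∃ ω ∈ divFree G, IsIntegral ω ∧ ∀ k, ω (o k) = z k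

/-- The values of a circulation on the edges off a spanning tree form a chart. -/
theorem isChart_of_isTree {G T : SimpleGraph V} (hT : T.IsTree) (hTG : T ≤ G)
    {κ : Type} [Finite κ] (o : κ → V × V) (hG : ∀ k, G.Adj (o k).1 (o k).2)
    (hoT : ∀ k, ¬ T.Adj (o k).1 (o k).2)
    (hsurj : ∀ v w, G.Adj v w → ¬ T.Adj v w → ∃ k, o k = (v, w) ∨ o k = (w, v))
    (hinj : ∀ k l, s((o k).1, (o k).2) = s((o l).1, (o l).2) → k = l) : IsChart G o := by
  classical
  have := Fintype.ofFinite κ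
  have key : ∀ z : κ → ℝ, ∃ ω ∈ divFree G, (IsIntegral z → IsIntegral ω) ∧
      ∀ k, ω (o k) = z k := by
    have hp : ∀ k, ∃ ω ∈ flows T, IsIntegral ω ∧
        divg ω = Pi.single (o k).2 1 - Pi.single (o k).1 1 :=
      fun k => exists_pathFlow (hT.connected.preconnected _ _)
    choose p hp1 hp2 hp3 using hp
    intro z
    refine ⟨∑ k, z k • (unitFlow (o k).1 (o k).2 + p k), ?_, ?_, ?_⟩
    · refine mem_divFree_iff.2 ⟨Submodule.sum_mem _ fun k _ => Submodule.smul_mem _ _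
        (Submodule.add_mem _ (unitFlow_mem (hG k)) (flows_mono hTG (hp1 k))), ?_⟩
      rw [divg_sum]
      refine Finset.sum_eq_zero fun k _ => ?_
      rw [divg_smul, divg_add, divg_unitFlow, hp3]
      simp
    · intro hz
      exact IsIntegral.sum_smul _ hz fun k _ => (unitFlow_integral _ _).add (hp2 k)
    · intro l
      simp only [Finset.sum_apply, Pi.smul_apply, Pi.add_apply, smul_eq_mul]
      have h0 : ∀ k, p k (o l) = 0 := fun k => (hp1 k).2 _ _ (hoT l)
      rw [Finset.sum_eq_single l]
      · have hne : o l ≠ ((o l).2, (o l).1) := by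
          intro h
          exact (hG l).ne (congrArg Prod.fst h)
        simp [h0, unitFlow, hne]
      · intro k _ hkl
        have h1 : o l ≠ ((o k).1, (o k).2) := by
          intro h
          exact hkl (hinj k l (by rw [h]))
        have h2 : o l ≠ ((o k).2, (o k).1) := by
          intro h
          exact hkl (hinj k l (by rw [h]; exact Sym2.eq_swap))
        simp only [h0, unitFlow, h1, h2]
        simp
      · simp
  refine ⟨?_, fun z => ?_, fun z hz => ?_⟩
  · intro ω hω h0
    have hωT : ∀ v w, ¬ T.Adj v w → ω (v, w) = 0 := by
      intro v w hvw
      by_cases hg : G.Adj v w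
      · obtain ⟨k, hk | hk⟩ := hsurj v w hg hvw
        · rw [← hk, h0]
        · rw [hω.1.1, ← hk, h0, neg_zero]
      · exact hω.1.2 v w hg
    ext ⟨a, b⟩
    by_cases hab : T.Adj a b
    · -- Removing the bridge `ab` of `T` leaves a cut through which only `ab` passes.
      have hbr : T.IsBridge s(a, b) :=
        SimpleGraph.isAcyclic_iff_forall_adj_isBridge.1 hT.isAcyclic hab
      rw [SimpleGraph.isBridge_iff] at hbr
      obtain ⟨K, hK⟩ : ∃ K : Set V, ∀ v, v ∈ K ↔ (T.deleteEdges {s(a, b)}).Reachable a v :=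
        ⟨{v | (T.deleteEdges {s(a, b)}).Reachable a v}, fun v => Iff.rfl⟩
      have hcut := sum_cut hω.1 K
      have hdiv : ∀ v, divg ω v = 0 := fun v => hω.2 v
      simp only [hdiv, ite_self, Finset.sum_const_zero] at hcut
      have haK : a ∈ K := (hK a).2 (SimpleGraph.Reachable.refl _)
      have hbK : b ∉ K := fun h => hbr ((hK b).1 h)
      have hval : ∀ v w, (if v ∈ K ∧ w ∉ K then ω (v, w) else 0) =
          if v = a ∧ w = b then ω (a, b) else 0 := by
        intro v w
        by_cases h : v = a ∧ w = b
        · obtain ⟨rfl, rfl⟩ := h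
          simp [haK, hbK]
        · rw [if_neg h]
          split_ifs with hvw
          · by_contra hne
            have hadj : T.Adj v w := by
              by_contra hh
              exact hne (hωT v w hh)
            refine hvw.2 ((hK w).2 (SimpleGraph.Reachable.trans ((hK v).1 hvw.1)
              (SimpleGraph.Adj.reachable ?_)))
            rw [SimpleGraph.deleteEdges_adj]
            refine ⟨hadj, ?_⟩
            simp only [Set.mem_singleton_iff, Sym2.eq_iff]
            rintro (h' | ⟨rfl, rfl⟩)
            · exact h h'
            · exact hbK hvw.1
          · rfl
      simp only [hval] at hcut
      have : ∑ v, ∑ w, (if v = a ∧ w = b then ω (a, b) else 0) = ω (a, b) := by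
        rw [Finset.sum_eq_single a, Finset.sum_eq_single b] <;> simp +contextual
      rw [this] at hcut
      exact hcut
    · exact hωT a b hab
  · obtain ⟨ω, h1, -, h3⟩ := key z
    exact ⟨ω, h1, h3⟩
  · obtain ⟨ω, h1, h2, h3⟩ := key z
    exact ⟨ω, h1, h2 hz, h3⟩

end Flows

/-! ### The matrix-tree theorem for charts of circulations -/

section Kirchhoff

/-- The Cauchy–Binet formula, summed over all maps from the columns to the rows. -/
theorem factorial_mul_det_transpose_mul {E κ : Type} [Fintype E] [Fintype κ] [DecidableEq κ]
    (M : Matrix E κ ℝ) :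
    ((Fintype.card κ).factorial : ℝ) * (M.transpose * M).det =
      ∑ f : κ → E, (M.submatrix f id).det ^ 2 := by
  classical
  -- Expand each row as a combination of the rows of `M`; the determinant is multilinear.
  have h1 : (M.transpose * M).det = ∑ f : κ → E, (∏ i, M (f i) i) * (M.submatrix f id).det := by
    have h : M.transpose * M = fun i => ∑ e, M e i • M e := by
      ext i j
      simp [Matrix.mul_apply, Finset.sum_apply]
    rw [h]
    change Matrix.detRowAlternating (fun i => ∑ e, M e i • M e) = _
    rw [← AlternatingMap.coe_multilinearMap, MultilinearMap.map_sum]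
    refine Finset.sum_congr rfl fun f _ => ?_
    rw [MultilinearMap.map_smul_univ]
    rfl
  -- Reindexing the maps by a permutation gives the same sum with the sign of the permutation; the
  -- sum over all permutations then recombines to a second determinant.
  have h2 : ∀ σ : Equiv.Perm κ, (M.transpose * M).det =
      ∑ f : κ → E, (Equiv.Perm.sign σ : ℝ) * (∏ i, M (f (σ i)) i) * (M.submatrix f id).det := by
    intro σ
    rw [h1]
    refine Fintype.sum_equiv (Equiv.arrowCongr σ (Equiv.refl E)) _ _ fun f => ?_
    have h3 : M.submatrix f id =
        (M.submatrix (Equiv.arrowCongr σ (Equiv.refl E) f) id).submatrix σ id := by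
      ext i j; simp [Equiv.arrowCongr]
    rw [h3, Matrix.det_permute]
    simp [Equiv.arrowCongr]
    ring
  have h4 : ∑ σ : Equiv.Perm κ, (M.transpose * M).det =
      ∑ f : κ → E, (M.submatrix f id).det ^ 2 := by
    rw [Finset.sum_congr rfl fun σ _ => h2 σ, Finset.sum_comm]
    refine Finset.sum_congr rfl fun f _ => ?_
    rw [← Finset.sum_mul, sq]
    congr 1
    rw [Matrix.det_apply]
    refine Finset.sum_congr rfl fun σ _ => ?_
    rw [Units.smul_def, zsmul_eq_mul]
    simp
  rw [← h4, Finset.sum_const, Finset.card_univ, Fintype.card_perm, nsmul_eq_mul]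

variable {V : Type} [Fintype V] {G : SimpleGraph V} {κ : Type}

/-- The linear coordinates given by a chart. -/
def IsChart.equiv {o : κ → V × V} (h : IsChart G o) : divFree G ≃ₗ[ℝ] (κ → ℝ) :=
  LinearEquiv.ofBijective
    ({ toFun := fun ω k => (ω : V × V → ℝ) (o k)
       map_add' := fun _ _ => rfl
       map_smul' := fun _ _ => rfl } : divFree G →ₗ[ℝ] (κ → ℝ))
    ⟨by
      refine (injective_iff_map_eq_zero _).2 ?_
      intro ω hω
      exact Subtype.ext (h.inj ω ω.2 fun k => congrFun hω k), fun z => by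
      obtain ⟨ω, h1, h2⟩ := h.ext z
      exact ⟨⟨ω, h1⟩, funext h2⟩⟩

theorem IsChart.equiv_apply {o : κ → V × V} (h : IsChart G o) (ω : divFree G) (k : κ) :
    h.equiv ω k = (ω : V × V → ℝ) (o k) := rfl

/-- The circulation with given coordinates in a chart. -/
def IsChart.flow {o : κ → V × V} (h : IsChart G o) : (κ → ℝ) →ₗ[ℝ] (V × V → ℝ) :=
  (divFree G).subtype ∘ₗ h.equiv.symm.toLinearMap

theorem IsChart.flow_mem {o : κ → V × V} (h : IsChart G o) (z : κ → ℝ) :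
    h.flow z ∈ divFree G := (h.equiv.symm z).2

theorem IsChart.flow_apply {o : κ → V × V} (h : IsChart G o) (z : κ → ℝ) (k : κ) :
    h.flow z (o k) = z k := by
  have := h.equiv_apply (h.equiv.symm z) k
  rw [LinearEquiv.apply_symm_apply] at this
  exact this.symm

theorem IsChart.ext_flow {o : κ → V × V} (h : IsChart G o) {ω ω' : V × V → ℝ}
    (hω : ω ∈ divFree G) (hω' : ω' ∈ divFree G) (he : ∀ k, ω (o k) = ω' (o k)) : ω = ω' :=
  sub_eq_zero.1 (h.inj _ ((divFree G).sub_mem hω hω') fun k => by simp [he k])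

theorem IsChart.flow_integral {o : κ → V × V} (h : IsChart G o) {z : κ → ℝ} (hz : IsIntegral z) :
    IsIntegral (h.flow z) := by
  obtain ⟨ω, h1, h2, h3⟩ := h.int z hz
  rw [h.ext_flow (h.flow_mem z) h1 fun k => by rw [h.flow_apply, h3]]
  exact h2

theorem IsChart.finrank [Fintype κ] {o : κ → V × V} (h : IsChart G o) :
    Module.finrank ℝ (divFree G) = Fintype.card κ := by
  rw [h.equiv.finrank_eq, Module.finrank_fintype_fun_eq_card]

variable [Fintype κ] [DecidableEq κ]

/-- The matrix whose columns are the circulations of the coordinate vectors of a chart, read on the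
oriented pairs `o'`. -/
def IsChart.matrix {o : κ → V × V} (h : IsChart G o) {E : Type} (o' : E → V × V) : Matrix E κ ℝ :=
  fun e k => h.flow (Pi.single k 1) (o' e)

theorem IsChart.matrix_mulVec {o : κ → V × V} (h : IsChart G o) {E : Type} (o' : E → V × V)
    (z : κ → ℝ) (e : E) : (h.matrix o').mulVec z e = h.flow z (o' e) := by
  have hz : z = ∑ k, z k • (Pi.single k 1 : κ → ℝ) := by
    ext i
    simp [Finset.sum_apply, Pi.single_apply]
  conv_rhs => rw [hz, map_sum, Finset.sum_apply]
  simp only [Matrix.mulVec, dotProduct, IsChart.matrix, map_smul, Pi.smul_apply, smul_eq_mul]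
  exact Finset.sum_congr rfl fun k _ => mul_comm _ _

theorem IsChart.det_mem_int {o : κ → V × V} (h : IsChart G o) (o' : κ → V × V) :
    ∃ m : ℤ, (h.matrix o').det = m := by
  have hz : ∀ k : κ, IsIntegral (Pi.single k 1 : κ → ℝ) := fun k l => by
    refine ⟨if l = k then 1 else 0, ?_⟩
    by_cases hl : l = k
    · subst hl; simp
    · simp [hl]
  choose M hM using fun (e k : κ) => h.flow_integral (hz k) (o' e)
  refine ⟨(Matrix.of M).det, ?_⟩
  have : h.matrix o' = (Matrix.of M).map (Int.castRingHom ℝ) := by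
    ext e k
    simp [IsChart.matrix, hM]
  rw [this, ← RingHom.mapMatrix_apply, ← RingHom.map_det]
  simp

/-- Two charts differ by a unimodular matrix. -/
theorem IsChart.det_sq_eq_one {o o' : κ → V × V} (h : IsChart G o) (h' : IsChart G o') :
    (h.matrix o').det ^ 2 = 1 := by
  have hmul : h.matrix o' * h'.matrix o = 1 := by
    refine Matrix.ext_of_mulVec_single fun k => ?_
    rw [← Matrix.mulVec_mulVec, Matrix.one_mulVec]
    ext e
    rw [h.matrix_mulVec]
    have h1 : (h'.matrix o).mulVec (Pi.single k 1) =
        fun l => h'.flow (Pi.single k 1) (o l) := funext fun l => h'.matrix_mulVec o _ l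
    rw [h1, h.ext_flow (h.flow_mem _) (h'.flow_mem (Pi.single k 1))
      (fun l => h.flow_apply _ l), h'.flow_apply]
  obtain ⟨m, hm⟩ := h.det_mem_int o'
  obtain ⟨m', hm'⟩ := h'.det_mem_int o
  have hd := congrArg Matrix.det hmul
  rw [Matrix.det_mul, Matrix.det_one, hm, hm'] at hd
  have hd' : m * m' = 1 := by exact_mod_cast hd
  rw [hm]
  rcases Int.isUnit_iff.1 (IsUnit.of_mul_eq_one _ hd') with rfl | rfl <;> simp

open Classical in
/-- An orientation of an edge. -/
def edgeOut (G : SimpleGraph V) (e : G.edgeSet) : V × V := (e : Sym2 V).out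

theorem edgeOut_mk (e : G.edgeSet) : s((edgeOut G e).1, (edgeOut G e).2) = (e : Sym2 V) :=
  Quot.out_eq (e : Sym2 V)

theorem edgeOut_adj (e : G.edgeSet) : G.Adj (edgeOut G e).1 (edgeOut G e).2 := by
  have := e.2
  rw [← edgeOut_mk e] at this
  exact this

/-- A symmetric function on pairs of vertices, zero off the edges, has twice the sum over edges. -/
theorem sum_pairs_eq_two_mul [Fintype G.edgeSet] (F : V × V → ℝ) (hs : ∀ v w, F (v, w) = F (w, v))
    (h0 : ∀ v w, ¬ G.Adj v w → F (v, w) = 0) :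
    ∑ p, F p = 2 * ∑ e : G.edgeSet, F (edgeOut G e) := by
  classical
  have h1 : ∑ p, F p = ∑ p ∈ Finset.univ.filter (fun p : V × V => G.Adj p.1 p.2), F p := by
    rw [Finset.sum_filter]
    refine Finset.sum_congr rfl fun p _ => ?_
    split_ifs with h
    · rfl
    · exact h0 p.1 p.2 h
  rw [h1, ← Finset.sum_fiberwise_of_maps_to (t := G.edgeFinset) (g := fun p : V × V => s(p.1, p.2))
    (fun p hp => by simpa using (Finset.mem_filter.1 hp).2)]
  rw [Finset.mul_sum, ← Finset.sum_coe_sort G.edgeFinset]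
  refine Fintype.sum_equiv (Equiv.subtypeEquivRight fun e => by simp) _ _ fun e => ?_
  set e' : G.edgeSet := (Equiv.subtypeEquivRight fun e => by simp) e with he'
  have hee : (e : Sym2 V) = s((edgeOut G e').1, (edgeOut G e').2) := by rw [edgeOut_mk]; rfl
  have hadj := edgeOut_adj e'
  have hset : (Finset.univ.filter (fun p : V × V => G.Adj p.1 p.2)).filter
      (fun p : V × V => s(p.1, p.2) = (e : Sym2 V)) =
      {edgeOut G e', ((edgeOut G e').2, (edgeOut G e').1)} := by
    ext ⟨v, w⟩
    simp only [Finset.mem_filter, Finset.mem_univ, true_and, Finset.mem_insert,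
      Finset.mem_singleton, hee, Sym2.eq_iff, Prod.ext_iff]
    constructor
    · rintro ⟨-, h⟩; exact h
    · rintro (⟨rfl, rfl⟩ | ⟨rfl, rfl⟩)
      · exact ⟨hadj, Or.inl ⟨rfl, rfl⟩⟩
      · exact ⟨hadj.symm, Or.inr ⟨rfl, rfl⟩⟩
  rw [hset, Finset.sum_pair]
  · rw [← hs (edgeOut G e').1]; ring
  · intro h
    exact hadj.ne (congrArg Prod.fst h)

/-- The edges of a subgraph of `G` and the complementary edges add up. -/
theorem card_edges_of_injective [Fintype G.edgeSet] {f : κ → G.edgeSet}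
    (hf : Function.Injective f) :
    Nat.card (G.deleteEdges (range fun k => (f k : Sym2 V))).edgeSet + Fintype.card κ =
      Fintype.card G.edgeSet := by
  classical
  rw [SimpleGraph.edgeSet_deleteEdges]
  have h1 : (range fun k => (f k : Sym2 V)) ⊆ G.edgeSet := by
    rintro _ ⟨k, rfl⟩; exact (f k).2
  have h2 : (range fun k => (f k : Sym2 V)).ncard = Fintype.card κ := by
    rw [← Nat.card_coe_set_eq, Nat.card_range_of_injective, Nat.card_eq_fintype_card]
    exact fun a b h => hf (Subtype.ext h)
  rw [Nat.card_coe_set_eq, ← h2, Set.ncard_sdiff_add_ncard_of_subset h1 (Set.toFinite _),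
    ← Nat.card_coe_set_eq, Nat.card_eq_fintype_card]

/-- The maximal minors of the matrix of a chart are `±1` on complements of spanning trees. -/
theorem IsChart.det_sq_of_isTree [Fintype G.edgeSet] {o : κ → V × V} (h : IsChart G o)
    {f : κ → G.edgeSet} (hf : Function.Injective f)
    (hT : (G.deleteEdges (range fun k => (f k : Sym2 V))).IsTree) :
    (h.matrix fun k => edgeOut G (f k)).det ^ 2 = 1 := by
  refine h.det_sq_eq_one (isChart_of_isTree hT (SimpleGraph.deleteEdges_le _) _
    (fun k => edgeOut_adj _) (fun k => ?_) (fun v w hvw hn => ?_) fun k l hkl => ?_)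
  · rw [SimpleGraph.deleteEdges_adj, edgeOut_mk]
    exact fun hh => hh.2 ⟨k, rfl⟩
  · rw [SimpleGraph.deleteEdges_adj] at hn
    push Not at hn
    obtain ⟨k, hk⟩ := hn hvw
    refine ⟨k, ?_⟩
    have hk' := (edgeOut_mk (f k)).trans hk
    rw [Sym2.eq_iff] at hk'
    simpa [Prod.ext_iff] using hk'
  · rw [edgeOut_mk, edgeOut_mk] at hkl
    exact hf (Subtype.ext hkl)

/-- A spanning tree gives a chart, so its complement has as many edges as any chart has
coordinates. -/
theorem IsChart.card_of_isTree [Fintype G.edgeSet] {o : κ → V × V} (h : IsChart G o)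
    {T : SimpleGraph V} (hTG : T ≤ G) (hT : T.IsTree) :
    ({e : G.edgeSet | (e : Sym2 V) ∉ T.edgeSet} : Set G.edgeSet).ncard = Fintype.card κ := by
  classical
  have hc := isChart_of_isTree hT hTG (κ := {e : G.edgeSet // (e : Sym2 V) ∉ T.edgeSet})
    (fun k => edgeOut G k) (fun k => edgeOut_adj _) (fun k hk => ?_) (fun v w hvw hn => ?_)
    fun k l hkl => ?_
  · rw [← h.finrank, hc.finrank, ← Nat.card_eq_fintype_card, ← Nat.card_coe_set_eq]
    rfl
  · apply k.2
    rw [← edgeOut_mk k.1]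
    exact hk
  · refine ⟨⟨⟨s(v, w), hvw⟩, hn⟩, ?_⟩
    have hk' := edgeOut_mk (G := G) ⟨s(v, w), hvw⟩
    rw [Sym2.eq_iff] at hk'
    simpa [Prod.ext_iff] using hk'
  · rw [edgeOut_mk, edgeOut_mk] at hkl
    exact Subtype.ext (Subtype.ext hkl)

/-- The other maximal minors vanish: if the complement of the chosen edges is not a spanning tree,
it is disconnected for reasons of cardinality, and the values of a circulation on the edges of a cut
are linearly dependent. -/
theorem IsChart.det_eq_zero [Fintype G.edgeSet] {o : κ → V × V} (h : IsChart G o)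
    (hG : G.Connected) {f : κ → G.edgeSet} (hf : Function.Injective f)
    (hT : ¬ (G.deleteEdges (range fun k => (f k : Sym2 V))).IsTree) :
    (h.matrix fun k => edgeOut G (f k)).det = 0 := by
  classical
  by_contra hdet
  set H := G.deleteEdges (range fun k => (f k : Sym2 V)) with hH
  -- Were the minor nonzero, the complement could only fail to be a tree by being disconnected: it
  -- has the number of edges of a tree.
  have hnc : ¬ H.Connected := by
    intro hc
    refine hT (SimpleGraph.isTree_iff_connected_and_card.2 ⟨hc, ?_⟩)
    obtain ⟨T, hTG, hTT⟩ := hG.exists_isTree_le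
    have h1 := (SimpleGraph.isTree_iff_connected_and_card.1 hTT).2
    have h2 := h.card_of_isTree hTG hTT
    have h3 := card_edges_of_injective hf
    rw [← hH] at h3
    have h4 : Nat.card T.edgeSet + Fintype.card κ = Fintype.card G.edgeSet := by
      have h5 : ({e : G.edgeSet | (e : Sym2 V) ∉ T.edgeSet} : Set G.edgeSet).ncard =
          (G.edgeSet \ T.edgeSet).ncard := by
        rw [← Set.ncard_image_of_injective _ Subtype.val_injective]
        congr 1
        ext e
        simp [and_comm]
      have h6 : T.edgeSet ⊆ G.edgeSet := SimpleGraph.edgeSet_mono hTG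
      rw [← h2, h5, Nat.card_coe_set_eq, add_comm,
        Set.ncard_sdiff_add_ncard_of_subset h6 (Set.toFinite _), ← Nat.card_coe_set_eq,
        Nat.card_eq_fintype_card]
    omega
  have := hG.nonempty
  rw [SimpleGraph.connected_iff] at hnc
  have hnp : ¬ H.Preconnected := fun hp => hnc ⟨hp, this⟩
  simp only [SimpleGraph.Preconnected] at hnp
  push Not at hnp
  obtain ⟨a, b, hab⟩ := hnp
  obtain ⟨K, hK⟩ : ∃ K : Set V, ∀ v, v ∈ K ↔ H.Reachable a v :=
    ⟨{v | H.Reachable a v}, fun v => Iff.rfl⟩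
  have haK : a ∈ K := (hK a).2 (SimpleGraph.Reachable.refl _)
  have hbK : b ∉ K := fun h => hab ((hK b).1 h)
  have hcutH : ∀ v w, v ∈ K → w ∉ K → ¬ H.Adj v w := fun v w hv hw hh =>
    hw ((hK w).2 (((hK v).1 hv).trans hh.reachable))
  -- The circulation whose value is `1` on each edge leaving `K`.
  set t : κ → ℝ := fun k => if (edgeOut G (f k)).1 ∈ K then 1 else -1 with ht
  set z : κ → ℝ := (h.matrix fun k => edgeOut G (f k))⁻¹.mulVec t with hz
  have hunit : IsUnit (h.matrix fun k => edgeOut G (f k)).det := isUnit_iff_ne_zero.2 hdet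
  have hval : ∀ k, h.flow z (edgeOut G (f k)) = t k := by
    intro k
    rw [← h.matrix_mulVec (fun k => edgeOut G (f k)), hz, Matrix.mulVec_mulVec,
      Matrix.mul_nonsing_inv _ hunit, Matrix.one_mulVec]
  have hω := h.flow_mem z
  have hone : ∀ v w, v ∈ K → w ∉ K → G.Adj v w → h.flow z (v, w) = 1 := by
    intro v w hv hw hvw
    have hn := hcutH v w hv hw
    rw [hH, SimpleGraph.deleteEdges_adj] at hn
    push Not at hn
    obtain ⟨k, hk⟩ := hn hvw
    have hk' := (edgeOut_mk (f k)).trans hk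
    rw [Sym2.eq_iff] at hk'
    have hv' := hval k
    rcases hk' with ⟨h1, h2⟩ | ⟨h1, h2⟩
    · rw [← h1, ← h2]
      change h.flow z (edgeOut G (f k)) = 1
      rw [hv', ht]
      simp [h1, hv]
    · rw [hω.1.1, ← h1, ← h2]
      change -h.flow z (edgeOut G (f k)) = 1
      rw [hv', ht]
      simp [h1, hw]
  -- The total flow out of `K` is the sum of the divergences in `K`, hence zero, but every summand
  -- is nonnegative and one of them is `1`.
  have hsum := sum_cut hω.1 K
  have hdiv : ∀ v, divg (h.flow z) v = 0 := fun v => hω.2 v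
  simp only [hdiv, ite_self, Finset.sum_const_zero] at hsum
  obtain ⟨p⟩ := hG.preconnected a b
  obtain ⟨d, -, hd1, hd2⟩ := p.exists_boundary_dart K haK hbK
  have hpos : ∀ v w, 0 ≤ if v ∈ K ∧ w ∉ K then h.flow z (v, w) else 0 := by
    intro v w
    split_ifs with hvw
    · by_cases hg : G.Adj v w
      · rw [hone v w hvw.1 hvw.2 hg]; norm_num
      · rw [hω.1.2 v w hg]
    · rfl
  rw [Finset.sum_eq_zero_iff_of_nonneg fun v _ => Finset.sum_nonneg fun w _ => hpos v w] at hsum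
  have h1 := hsum d.fst (Finset.mem_univ _)
  rw [Finset.sum_eq_zero_iff_of_nonneg fun w _ => hpos d.fst w] at h1
  have h2 := h1 d.snd (Finset.mem_univ _)
  rw [if_pos ⟨hd1, hd2⟩, hone _ _ hd1 hd2 d.adj] at h2
  exact one_ne_zero h2

/-- The sum of the squared maximal minors counts the spanning trees, each of them once for every
enumeration of its complement. -/
theorem IsChart.sum_det_sq [Fintype G.edgeSet] {o : κ → V × V} (h : IsChart G o)
    (hG : G.Connected) :
    ∑ f : κ → G.edgeSet, (h.matrix fun k => edgeOut G (f k)).det ^ 2 =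
      ((Fintype.card κ).factorial : ℝ) * numSpanningTrees G := by
  classical
  set good : (κ → G.edgeSet) → Prop := fun f => Function.Injective f ∧
    (G.deleteEdges (range fun k => (f k : Sym2 V))).IsTree with hgood
  -- Minors with a repeated row vanish; the others are `±1` or `0` according to whether the chosen
  -- edges form the complement of a spanning tree.
  have h1 : ∀ f : κ → G.edgeSet, (h.matrix fun k => edgeOut G (f k)).det ^ 2 =
      if good f then 1 else 0 := by
    intro f
    split_ifs with hf
    · exact h.det_sq_of_isTree hf.1 hf.2
    · by_cases hi : Function.Injective f
      · rw [h.det_eq_zero hG hi fun ht => hf ⟨hi, ht⟩]; norm_num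
      · simp only [Function.Injective] at hi
        push Not at hi
        obtain ⟨k, l, hkl, hne⟩ := hi
        rw [Matrix.det_zero_of_row_eq hne (by ext e; simp [IsChart.matrix, hkl])]
        norm_num
  rw [Finset.sum_congr rfl fun f _ => h1 f, ← Finset.natCast_card_filter]
  have hfin : Fintype {T : SimpleGraph V // T ≤ G ∧ T.IsTree} := Fintype.ofFinite _
  -- Sort the good maps by the spanning tree that they leave; the default value outside the good
  -- maps is irrelevant.
  have h2 : (Finset.univ.filter good).card =
      ∑ T : {T : SimpleGraph V // T ≤ G ∧ T.IsTree}, (Fintype.card κ).factorial := by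
    rw [Finset.card_eq_sum_card_fiberwise (t := Finset.univ)
      (f := fun f => if hf : good f then
        (⟨_, SimpleGraph.deleteEdges_le _, hf.2⟩ : {T : SimpleGraph V // T ≤ G ∧ T.IsTree})
        else (⟨_, (hG.exists_isTree_le.choose_spec)⟩)) (fun _ _ => Finset.mem_univ _)]
    refine Finset.sum_congr rfl fun T _ => ?_
    -- The fibre over `T` consists of the bijections from `κ` onto the complement of `T`.
    have hcard := h.card_of_isTree T.2.1 T.2.2
    obtain ⟨e₀⟩ : Nonempty (κ ≃ {e : G.edgeSet | (e : Sym2 V) ∉ T.1.edgeSet}) := by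
      rw [← Fintype.card_eq, ← hcard, ← Nat.card_coe_set_eq, Nat.card_eq_fintype_card]
    rw [← Fintype.card_perm, ← Fintype.card_congr (Equiv.equivCongr (Equiv.refl κ) e₀.symm),
      ← Fintype.card_coe]
    have hT_iff : ∀ f : κ → G.edgeSet,
        G.deleteEdges (range fun k => (f k : Sym2 V)) = T.1 ↔
          range f = {e : G.edgeSet | (e : Sym2 V) ∉ T.1.edgeSet} := by
      intro f
      rw [← SimpleGraph.edgeSet_inj, SimpleGraph.edgeSet_deleteEdges]
      have hTG : T.1.edgeSet ⊆ G.edgeSet := SimpleGraph.edgeSet_mono T.2.1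
      constructor
      · intro hh
        ext e
        have h3 := Set.ext_iff.1 hh e
        simp only [Set.mem_sdiff, e.2, true_and, Set.mem_range] at h3
        simp only [Set.mem_range, Set.mem_ofPred_eq, ← h3, not_not]
        exact exists_congr fun k => ⟨fun h => by rw [h], fun h => Subtype.ext h⟩
      · intro hh
        ext e
        by_cases he : e ∈ G.edgeSet
        · have h3 := Set.ext_iff.1 hh ⟨e, he⟩
          simp only [Set.mem_range, Set.mem_ofPred_eq] at h3
          simp only [Set.mem_sdiff, he, true_and, Set.mem_range]
          rw [← not_iff_not, not_not, ← h3]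
          exact exists_congr fun k => ⟨fun h => Subtype.ext h, fun h => by rw [h]⟩
        · exact ⟨fun h3 => absurd h3.1 he, fun h3 => absurd (hTG h3) he⟩
    refine Fintype.card_congr
      { toFun := fun f => ?_
        invFun := fun e => ⟨fun k => (e k).1, ?_⟩
        left_inv := ?_
        right_inv := ?_ }
    · have hf := f.2
      simp only [Finset.mem_filter, Finset.mem_univ, true_and] at hf
      have hr : range f.1 = {e : G.edgeSet | (e : Sym2 V) ∉ T.1.edgeSet} := by
        rw [← hT_iff]
        have := hf.2
        rw [dif_pos hf.1] at this
        exact congrArg Subtype.val this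
      exact (Equiv.ofInjective f.1 hf.1.1).trans (Equiv.setCongr hr)
    · simp only [Finset.mem_filter, Finset.mem_univ, true_and]
      have hinj : Function.Injective fun k => (e k).1 :=
        Subtype.val_injective.comp e.injective
      have hr : G.deleteEdges (range fun k => ((e k).1 : Sym2 V)) = T.1 := by
        rw [hT_iff fun k => (e k).1]
        ext x
        exact ⟨by rintro ⟨k, rfl⟩; exact (e k).2, fun hx => ⟨e.symm ⟨x, hx⟩, by simp⟩⟩
      have hgd : good fun k => (e k).1 := ⟨hinj, by rw [hr]; exact T.2.2⟩
      exact ⟨hgd, by rw [dif_pos hgd]; exact Subtype.ext hr⟩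
    · intro f
      ext k
      rfl
    · intro e
      ext k
      rfl
  rw [h2, Finset.sum_const, Finset.card_univ, numSpanningTrees, Nat.card_eq_fintype_card,
    smul_eq_mul]
  push_cast
  ring

theorem numSpanningTrees_pos (hG : G.Connected) : 0 < numSpanningTrees G := by
  obtain ⟨T, hT⟩ := hG.exists_isTree_le
  have : Nonempty {T : SimpleGraph V // T ≤ G ∧ T.IsTree} := ⟨⟨T, hT⟩⟩
  exact Nat.card_pos

/-- The parametrisation of the circulations by the coordinates of a chart, as a map between
Euclidean spaces. -/
def IsChart.euclidean {o : κ → V × V} (h : IsChart G o) :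
    EuclideanSpace ℝ κ →ₗ[ℝ] EuclideanSpace ℝ (V × V) where
  toFun z := flowEmbedding (h.flow z.ofLp)
  map_add' z z' := by
    ext e
    simp [flowEmbedding, add_div]
  map_smul' c z := by
    ext e
    simp [flowEmbedding, mul_div_assoc]

/-- The volume factor of a chart is the square root of the number of spanning trees. -/
theorem IsChart.normDet_euclidean {o : κ → V × V} (h : IsChart G o) (hG : G.Connected) :
    h.euclidean.normDet = √(numSpanningTrees G : ℝ) := by
  classical
  have : Fintype G.edgeSet := Fintype.ofFinite _
  rw [eq_comm, Real.sqrt_eq_iff_mul_self_eq (Nat.cast_nonneg _) h.euclidean.normDet_nonneg, ← sq]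
  have hg := h.euclidean.normDet_sq_eq_det_gram (EuclideanSpace.basisFun κ ℝ)
  -- The embedding divides by `√2` because every edge occurs with both orientations, so the Gram
  -- matrix of the chart is the sum over edges of the products of the values.
  have hM : Matrix.gram ℝ (fun i => h.euclidean (EuclideanSpace.basisFun κ ℝ i)) =
      (h.matrix (edgeOut G)).transpose * h.matrix (edgeOut G) := by
    ext a b
    have hin : Matrix.gram ℝ (fun i => h.euclidean (EuclideanSpace.basisFun κ ℝ i)) a b =
        ∑ p : V × V, h.flow (Pi.single a 1) p * h.flow (Pi.single b 1) p / 2 := by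
      rw [Matrix.gram_apply, PiLp.inner_apply]
      refine Finset.sum_congr rfl fun p _ => ?_
      have h2 : √(2 : ℝ) * √2 = 2 := Real.mul_self_sqrt (by norm_num)
      simp only [IsChart.euclidean, flowEmbedding, LinearMap.coe_mk, AddHom.coe_mk,
        EuclideanSpace.basisFun_apply, RCLike.inner_apply, conj_trivial, PiLp.ofLp_single]
      rw [div_mul_div_comm, h2, mul_comm]
    rw [hin, ← Finset.sum_div, sum_pairs_eq_two_mul (G := G), mul_div_cancel_left₀ _ two_ne_zero,
      Matrix.mul_apply]
    · rfl
    · intro v w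
      rw [(h.flow_mem _).1.1 v w, (h.flow_mem (Pi.single b 1)).1.1 v w]
      ring
    · intro v w hvw
      rw [(h.flow_mem _).1.2 v w hvw, zero_mul]
  rw [hM] at hg
  have hcb := factorial_mul_det_transpose_mul (h.matrix (edgeOut G))
  have hs := h.sum_det_sq hG
  have hk : ((Fintype.card κ).factorial : ℝ) ≠ 0 := Nat.cast_ne_zero.2 (Nat.factorial_ne_zero _)
  have hdet : ((h.matrix (edgeOut G)).transpose * h.matrix (edgeOut G)).det =
      numSpanningTrees G := by
    apply mul_left_cancel₀ hk
    rw [hcb, ← hs]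
    rfl
  rw [← hdet, ← hg]
  norm_num

/-- The volume of a set of flows with the same divergence is the Lebesgue measure of its coordinates
in any chart. -/
theorem IsChart.flowVolume_eq {o : κ → V × V} (h : IsChart G o) (hG : G.Connected)
    {A : Set (V × V → ℝ)} (hA : ∀ ω ∈ A, ∀ ω' ∈ A, ω - ω' ∈ divFree G) :
    flowVolume G A = volume ((fun (ω : V × V → ℝ) (k : κ) => ω (o k)) '' A) := by
  rcases A.eq_empty_or_nonempty with rfl | ⟨ω₀, h₀⟩
  · simp [flowVolume]
  set z₀ : κ → ℝ := fun k => ω₀ (o k) with hz₀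
  set Z : Set (κ → ℝ) :=
    (fun z => z - z₀) '' ((fun (ω : V × V → ℝ) (k : κ) => ω (o k)) '' A) with hZ
  -- Subtracting the base flow `ω₀` moves the set into the space of circulations.
  have h1 : flowEmbedding '' A =
      (fun x => flowEmbedding ω₀ + x) '' (h.euclidean '' (WithLp.toLp 2 '' Z)) := by
    rw [hZ, Set.image_image, Set.image_image, Set.image_image, Set.image_image]
    refine Set.image_congr fun ω hω => ?_
    have h2 : h.flow ((fun k => ω (o k)) - z₀) = ω - ω₀ :=
      h.ext_flow (h.flow_mem _) (hA ω hω ω₀ h₀) fun k => by rw [h.flow_apply]; rfl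
    change _ = flowEmbedding ω₀ + flowEmbedding (h.flow ((fun k => ω (o k)) - z₀))
    rw [h2]
    ext e
    simp [flowEmbedding, sub_div]
  have hfr : Module.finrank ℝ (divFree G) = Module.finrank ℝ (EuclideanSpace ℝ κ) := by
    rw [h.finrank, finrank_euclideanSpace]
  have h3 : volume (WithLp.toLp 2 '' Z) = volume Z := by
    rw [← (EuclideanSpace.volume_preserving_symm_measurableEquiv_toLp κ).measure_preimage_equiv Z]
    congr 1
    ext x
    exact ⟨by rintro ⟨y, hy, rfl⟩; exact hy, fun hx => ⟨x.ofLp, hx, rfl⟩⟩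
  have h4 : volume Z = volume ((fun (ω : V × V → ℝ) (k : κ) => ω (o k)) '' A) := by
    rw [hZ]
    simp only [sub_eq_add_neg, Set.image_add_right, neg_neg]
    rw [measure_preimage_add_right]
  have hpos : 0 < √(numSpanningTrees G : ℝ) :=
    Real.sqrt_pos.2 (Nat.cast_pos.2 (numSpanningTrees_pos hG))
  rw [flowVolume, h1, (isometry_add_left _).euclideanHausdorffMeasure_image, hfr,
    h.euclidean.euclideanHausdorffMeasure_image_eq_normDet_mul_volume, h3, h4,
    h.normDet_euclidean hG]
  rw [mul_comm]
  exact ENNReal.mul_div_cancel_right (by simpa using hpos) ENNReal.ofReal_ne_top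

/-- A connected graph has a chart of its circulations. -/
theorem exists_isChart (hG : G.Connected) :
    ∃ (κ : Type) (_ : Fintype κ) (o : κ → V × V), IsChart G o ∧ ∀ k, G.Adj (o k).1 (o k).2 := by
  classical
  have : Fintype G.edgeSet := Fintype.ofFinite _
  obtain ⟨T, hTG, hT⟩ := hG.exists_isTree_le
  refine ⟨{e : G.edgeSet // (e : Sym2 V) ∉ T.edgeSet}, inferInstance, fun k => edgeOut G k,
    isChart_of_isTree hT hTG _ (fun k => edgeOut_adj _) (fun k hk => ?_) (fun v w hvw hn => ?_)
    fun k l hkl => ?_, fun k => edgeOut_adj _⟩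
  · apply k.2
    rw [← edgeOut_mk k.1]
    exact hk
  · refine ⟨⟨⟨s(v, w), hvw⟩, hn⟩, ?_⟩
    have hk' := edgeOut_mk (G := G) ⟨s(v, w), hvw⟩
    rw [Sym2.eq_iff] at hk'
    simpa [Prod.ext_iff] using hk'
  · rw [edgeOut_mk, edgeOut_mk] at hkl
    exact Subtype.ext (Subtype.ext hkl)

/-- In a connected graph, a flow with given divergence and given coordinates in a chart can be
chosen linearly and integrally in these data. -/
theorem IsChart.exists_section {o : κ → V × V} (h : IsChart G o) (hG : G.Connected) :
    ∃ J : (κ → ℝ) × (V → ℝ) →ₗ[ℝ] (V × V → ℝ),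
      (∀ z δ, ∑ v, δ v = 0 → J (z, δ) ∈ flows G ∧ divg (J (z, δ)) = δ ∧
        ∀ k, J (z, δ) (o k) = z k) ∧
      ∀ z δ, IsIntegral z → IsIntegral δ → IsIntegral (J (z, δ)) := by
  classical
  -- `E δ` carries the divergence `δ` along fixed paths to the root `r`; the circulation with the
  -- missing coordinates is then added.
  obtain ⟨r⟩ := hG.nonempty
  choose p hp1 hp2 hp3 using fun v => exists_pathFlow (hG.preconnected v r)
  set E : (V → ℝ) →ₗ[ℝ] (V × V → ℝ) := ∑ v, (LinearMap.proj v : (V → ℝ) →ₗ[ℝ] ℝ).smulRight (p v)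
    with hE
  have hEa : ∀ δ, E δ = ∑ v, δ v • p v := by
    intro δ
    rw [hE, LinearMap.sum_apply]
    rfl
  set R : (V × V → ℝ) →ₗ[ℝ] (κ → ℝ) := LinearMap.funLeft ℝ ℝ o with hR
  have hRa : ∀ ω k, R ω k = ω (o k) := fun ω k => rfl
  set J : (κ → ℝ) × (V → ℝ) →ₗ[ℝ] (V × V → ℝ) :=
    h.flow ∘ₗ (LinearMap.fst ℝ _ _ - R ∘ₗ E ∘ₗ LinearMap.snd ℝ _ _) + E ∘ₗ LinearMap.snd ℝ _ _
    with hJ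
  have hJa : ∀ z δ, J (z, δ) = h.flow (z - R (E δ)) + E δ := fun z δ => rfl
  refine ⟨J, fun z δ hδ => ⟨?_, ?_, fun k => ?_⟩, fun z δ hz hδ => ?_⟩
  · rw [hJa, hEa]
    exact (flows G).add_mem (h.flow_mem _).1
      (Submodule.sum_mem _ fun v _ => Submodule.smul_mem _ _ (hp1 v))
  · rw [hJa, divg_add, (mem_divFree_iff.1 (h.flow_mem _)).2, zero_add, hEa, divg_sum]
    ext w
    simp only [divg_smul, hp3, Finset.sum_apply, Pi.smul_apply, Pi.sub_apply, smul_eq_mul, mul_sub,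
      Finset.sum_sub_distrib, ← Finset.sum_mul, hδ, zero_mul, sub_zero, Pi.single_apply]
    simp
  · rw [hJa, Pi.add_apply, h.flow_apply, Pi.sub_apply, hRa]
    ring
  · have hEi : IsIntegral (E δ) := by
      rw [hEa]
      exact IsIntegral.sum_smul _ hδ fun v _ => hp2 v
    rw [hJa]
    exact (h.flow_integral (hz.sub fun k => hEi _)).add hEi

end Kirchhoff

/-! ### Gluing graphs along pendant vertices -/

section GraphGluing

open Classical in
/-- The image of a function on pairs under a map of the vertices. -/
def pushFlow {V W : Type} [Fintype V] (f : V → W) (ω : V × V → ℝ) : W × W → ℝ :=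
  fun p => ∑ x, ∑ y, if f x = p.1 ∧ f y = p.2 then ω (x, y) else 0

open Classical in
theorem divg_pushFlow {V W : Type} [Fintype V] [Fintype W] (f : V → W) (ω : V × V → ℝ) (v : W) :
    divg (pushFlow f ω) v = ∑ x, if f x = v then divg ω x else 0 := by
  simp only [divg, pushFlow]
  rw [Finset.sum_comm]
  refine Finset.sum_congr rfl fun x _ => ?_
  rw [Finset.sum_comm]
  by_cases hx : f x = v
  · simp [hx]
  · simp [hx]

theorem pushFlow_neg {V W : Type} [Fintype V] (f : V → W) {ω : V × V → ℝ}
    (h : ∀ x y, ω (x, y) = -ω (y, x)) (v w : W) : pushFlow f ω (v, w) = -pushFlow f ω (w, v) := by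
  simp only [pushFlow, ← Finset.sum_neg_distrib]
  rw [Finset.sum_comm]
  refine Finset.sum_congr rfl fun x _ => Finset.sum_congr rfl fun y _ => ?_
  rw [h y x]
  by_cases h1 : f x = w <;> by_cases h2 : f y = v <;> simp [h1, h2]

theorem pushFlow_apply {V W : Type} [Fintype V] {f : V → W} (hf : Function.Injective f)
    (ω : V × V → ℝ) (x y : V) : pushFlow f ω (f x, f y) = ω (x, y) := by
  classical
  simp only [pushFlow, hf.eq_iff]
  rw [Finset.sum_eq_single x, Finset.sum_eq_single y] <;> simp +contextual

theorem pushFlow_eq_zero {V W : Type} [Fintype V] {f : V → W} {ω : V × V → ℝ} {v w : W}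
    (h : ∀ x y, f x = v → f y = w → ω (x, y) = 0) : pushFlow f ω (v, w) = 0 := by
  classical
  refine Finset.sum_eq_zero fun x _ => Finset.sum_eq_zero fun y _ => ?_
  split_ifs with hxy
  · exact h x y hxy.1 hxy.2
  · rfl

/-- `G'` is obtained from `G₂` and `G₁` by identifying the vertices `b₂ i` of `G₂` with the vertices
`b₁ i` of `G₁`, each of which has the single neighbour `c i` in `G₁`. -/
structure IsGluing {V₂ V₁ V' : Type} (G₂ : SimpleGraph V₂) (G₁ : SimpleGraph V₁)
    (G' : SimpleGraph V') {n : ℕ} (in₂ : V₂ → V') (in₁ : V₁ → V') (b₂ : Fin n → V₂)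
    (b₁ c : Fin n → V₁) : Prop where
  inj₂ : Function.Injective in₂
  inj₁ : Function.Injective in₁
  injb₂ : Function.Injective b₂
  injb₁ : Function.Injective b₁
  surj : ∀ v, (∃ x, in₂ x = v) ∨ ∃ y, in₁ y = v
  meet : ∀ x y, in₂ x = in₁ y ↔ ∃ i, x = b₂ i ∧ y = b₁ i
  adj : ∀ v w, G'.Adj v w ↔ (∃ x y, G₂.Adj x y ∧ in₂ x = v ∧ in₂ y = w) ∨
    ∃ x y, G₁.Adj x y ∧ in₁ x = v ∧ in₁ y = w
  pendant : ∀ i y, G₁.Adj (b₁ i) y ↔ y = c i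
  c_ne : ∀ i k, c i ≠ b₁ k
  not_adj₂ : ∀ i k, ¬ G₂.Adj (b₂ i) (b₂ k)

namespace IsGluing

variable {V₂ V₁ V' : Type} [Fintype V₂] [Fintype V₁] [Fintype V'] {G₂ : SimpleGraph V₂}
  {G₁ : SimpleGraph V₁} {G' : SimpleGraph V'} {n : ℕ} {in₂ : V₂ → V'} {in₁ : V₁ → V'}
  {b₂ : Fin n → V₂} {b₁ c : Fin n → V₁} (g : IsGluing G₂ G₁ G' in₂ in₁ b₂ b₁ c)
include g

theorem not_adj (i k : Fin n) : ¬ G₁.Adj (b₁ i) (b₁ k) := fun h =>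
  g.c_ne i k ((g.pendant i _).1 h).symm

theorem res₂_mem {ω : V' × V' → ℝ} (hω : ω ∈ flows G') :
    (fun p : V₂ × V₂ => ω (in₂ p.1, in₂ p.2)) ∈ flows G₂ := by
  refine ⟨fun v w => hω.1 _ _, fun v w hvw => hω.2 _ _ fun h => ?_⟩
  obtain ⟨x, y, hxy, hx, hy⟩ | ⟨x, y, hxy, hx, hy⟩ := (g.adj _ _).1 h
  · rw [g.inj₂ hx, g.inj₂ hy] at hxy
    exact hvw hxy
  · obtain ⟨i, -, rfl⟩ := (g.meet v x).1 hx.symm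
    obtain ⟨k, -, rfl⟩ := (g.meet w y).1 hy.symm
    exact g.not_adj _ _ hxy

theorem res₁_mem {ω : V' × V' → ℝ} (hω : ω ∈ flows G') :
    (fun p : V₁ × V₁ => ω (in₁ p.1, in₁ p.2)) ∈ flows G₁ := by
  refine ⟨fun v w => hω.1 _ _, fun v w hvw => hω.2 _ _ fun h => ?_⟩
  obtain ⟨x, y, hxy, hx, hy⟩ | ⟨x, y, hxy, hx, hy⟩ := (g.adj _ _).1 h
  · obtain ⟨i, rfl, -⟩ := (g.meet x v).1 hx
    obtain ⟨k, rfl, -⟩ := (g.meet y w).1 hy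
    exact g.not_adj₂ _ _ hxy
  · rw [g.inj₁ hx, g.inj₁ hy] at hxy
    exact hvw hxy

omit g in
/-- The function on `V'` obtained from functions on `V₂` and `V₁`. -/
def glueFlow (in₂ : V₂ → V') (in₁ : V₁ → V') (ω₂ : V₂ × V₂ → ℝ) (ω₁ : V₁ × V₁ → ℝ) :
    V' × V' → ℝ := pushFlow in₂ ω₂ + pushFlow in₁ ω₁

theorem glueFlow_apply₂ (ω₂ : V₂ × V₂ → ℝ) {ω₁ : V₁ × V₁ → ℝ} (h₁ : ω₁ ∈ flows G₁) (x y : V₂) :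
    glueFlow in₂ in₁ ω₂ ω₁ (in₂ x, in₂ y) = ω₂ (x, y) := by
  rw [glueFlow, Pi.add_apply, pushFlow_apply g.inj₂, pushFlow_eq_zero, add_zero]
  intro v w hv hw
  obtain ⟨i, -, rfl⟩ := (g.meet _ _).1 hv.symm
  obtain ⟨k, -, rfl⟩ := (g.meet _ _).1 hw.symm
  exact h₁.2 _ _ (g.not_adj i k)

theorem glueFlow_apply₁ {ω₂ : V₂ × V₂ → ℝ} (ω₁ : V₁ × V₁ → ℝ) (h₂ : ω₂ ∈ flows G₂) (x y : V₁) :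
    glueFlow in₂ in₁ ω₂ ω₁ (in₁ x, in₁ y) = ω₁ (x, y) := by
  rw [glueFlow, Pi.add_apply, pushFlow_apply g.inj₁, pushFlow_eq_zero, zero_add]
  intro v w hv hw
  obtain ⟨i, rfl, -⟩ := (g.meet _ _).1 hv
  obtain ⟨k, rfl, -⟩ := (g.meet _ _).1 hw
  exact h₂.2 _ _ (g.not_adj₂ i k)

theorem glueFlow_mem {ω₂ : V₂ × V₂ → ℝ} {ω₁ : V₁ × V₁ → ℝ} (h₂ : ω₂ ∈ flows G₂)
    (h₁ : ω₁ ∈ flows G₁) : glueFlow in₂ in₁ ω₂ ω₁ ∈ flows G' := by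
  refine (flows G').add_mem ⟨pushFlow_neg in₂ h₂.1, fun v w hvw => ?_⟩
    ⟨pushFlow_neg in₁ h₁.1, fun v w hvw => ?_⟩
  · exact pushFlow_eq_zero fun x y hx hy => h₂.2 _ _ fun h =>
      hvw ((g.adj _ _).2 (Or.inl ⟨x, y, h, hx, hy⟩))
  · exact pushFlow_eq_zero fun x y hx hy => h₁.2 _ _ fun h =>
      hvw ((g.adj _ _).2 (Or.inr ⟨x, y, h, hx, hy⟩))

/-- A flow on the glued graph is determined by its restrictions. -/
theorem ext_res {ω ω' : V' × V' → ℝ} (hω : ω ∈ flows G') (hω' : ω' ∈ flows G')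
    (h₂ : ∀ x y, ω (in₂ x, in₂ y) = ω' (in₂ x, in₂ y))
    (h₁ : ∀ x y, ω (in₁ x, in₁ y) = ω' (in₁ x, in₁ y)) : ω = ω' := by
  ext ⟨v, w⟩
  by_cases h : G'.Adj v w
  · obtain ⟨x, y, -, rfl, rfl⟩ | ⟨x, y, -, rfl, rfl⟩ := (g.adj _ _).1 h
    · exact h₂ x y
    · exact h₁ x y
  · rw [hω.2 _ _ h, hω'.2 _ _ h]

theorem divg_glueFlow₂ {ω₂ : V₂ × V₂ → ℝ} {ω₁ : V₁ × V₁ → ℝ} {x : V₂} (hx : ∀ i, x ≠ b₂ i) :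
    divg (glueFlow in₂ in₁ ω₂ ω₁) (in₂ x) = divg ω₂ x := by
  classical
  rw [glueFlow, divg_add, Pi.add_apply, divg_pushFlow, divg_pushFlow, Finset.sum_eq_single x]
  · rw [if_pos rfl, Finset.sum_eq_zero, add_zero]
    intro y _
    rw [if_neg]
    intro h
    obtain ⟨i, hi, -⟩ := (g.meet _ _).1 h.symm
    exact hx i hi
  · intro y _ hy
    rw [if_neg fun h => hy (g.inj₂ h)]
  · simp

theorem divg_glueFlow₁ {ω₂ : V₂ × V₂ → ℝ} {ω₁ : V₁ × V₁ → ℝ} {x : V₁} (hx : ∀ i, x ≠ b₁ i) :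
    divg (glueFlow in₂ in₁ ω₂ ω₁) (in₁ x) = divg ω₁ x := by
  classical
  rw [glueFlow, divg_add, Pi.add_apply, divg_pushFlow, divg_pushFlow, add_comm,
    Finset.sum_eq_single x]
  · rw [if_pos rfl, Finset.sum_eq_zero, add_zero]
    intro y _
    rw [if_neg]
    intro h
    obtain ⟨i, -, hi⟩ := (g.meet _ _).1 h
    exact hx i hi
  · intro y _ hy
    rw [if_neg fun h => hy (g.inj₁ h)]
  · simp

theorem divg_glueFlow_b {ω₂ : V₂ × V₂ → ℝ} {ω₁ : V₁ × V₁ → ℝ} (i : Fin n) :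
    divg (glueFlow in₂ in₁ ω₂ ω₁) (in₂ (b₂ i)) = divg ω₂ (b₂ i) + divg ω₁ (b₁ i) := by
  classical
  have hm : in₂ (b₂ i) = in₁ (b₁ i) := (g.meet _ _).2 ⟨i, rfl, rfl⟩
  rw [glueFlow, divg_add, Pi.add_apply, divg_pushFlow, divg_pushFlow]
  congr 1
  · rw [Finset.sum_eq_single (b₂ i)]
    · simp
    · intro y _ hy
      rw [if_neg fun h => hy (g.inj₂ h)]
    · simp
  · rw [Finset.sum_eq_single (b₁ i)]
    · simp [hm]
    · intro y _ hy
      rw [if_neg fun h => hy (g.inj₁ (h.trans hm))]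
    · simp

theorem divg_b₁ {ω₁ : V₁ × V₁ → ℝ} (h₁ : ω₁ ∈ flows G₁) (i : Fin n) :
    divg ω₁ (b₁ i) = ω₁ (b₁ i, c i) := by
  rw [divg, Finset.sum_eq_single (c i)]
  · intro y _ hy
    exact h₁.2 _ _ fun h => hy ((g.pendant i y).1 h)
  · simp

theorem glue_res {ω : V' × V' → ℝ} (hω : ω ∈ flows G') :
    glueFlow in₂ in₁ (fun p => ω (in₂ p.1, in₂ p.2)) (fun p => ω (in₁ p.1, in₁ p.2)) = ω :=
  g.ext_res (g.glueFlow_mem (g.res₂_mem hω) (g.res₁_mem hω)) hω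
    (fun x y => g.glueFlow_apply₂ _ (g.res₁_mem hω) x y)
    (fun x y => g.glueFlow_apply₁ _ (g.res₂_mem hω) x y)

omit g in
/-- The chart of the glued graph: charts of the two pieces, and all pendant edges but one. -/
def glueChart (in₂ : V₂ → V') (in₁ : V₁ → V') (b₁ c : Fin n → V₁) {κ₂ κ₁ : Type}
    (o₂ : κ₂ → V₂ × V₂) (o₁ : κ₁ → V₁ × V₁) (j : Fin n) :
    (κ₂ ⊕ κ₁) ⊕ {i : Fin n // i ≠ j} → V' × V' :=
  Sum.elim (Sum.elim (fun k => (in₂ (o₂ k).1, in₂ (o₂ k).2)) fun k => (in₁ (o₁ k).1, in₁ (o₁ k).2))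
    fun i => (in₁ (b₁ i), in₁ (c i))

/-- Charts of the two pieces, together with all pendant edges but one, form a chart of the glued
graph: the values on the pendant edges have total sum zero, so the omitted one is determined, and
they prescribe the divergence of the flows on both pieces at the identified vertices. -/
theorem isChart {κ₂ κ₁ : Type} {o₂ : κ₂ → V₂ × V₂} {o₁ : κ₁ → V₁ × V₁} [Fintype κ₂] [Fintype κ₁]
    (h₂ : IsChart G₂ o₂) (h₁ : IsChart G₁ o₁) (hG₂ : G₂.Connected) (hG₁ : G₁.Connected)
    (j : Fin n) : IsChart G' (glueChart in₂ in₁ b₁ c o₂ o₁ j) := by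
  classical
  obtain ⟨J₂, hJ₂, hJ₂i⟩ := h₂.exists_section hG₂
  obtain ⟨J₁, hJ₁, hJ₁i⟩ := h₁.exists_section hG₁
  have key : ∀ z : (κ₂ ⊕ κ₁) ⊕ {i : Fin n // i ≠ j} → ℝ, ∃ ω ∈ divFree G',
      (IsIntegral z → IsIntegral ω) ∧ ∀ k, ω (glueChart in₂ in₁ b₁ c o₂ o₁ j k) = z k := by
    intro z
    -- The values on all pendant edges; the one at `j` makes their sum zero.
    set W : Fin n → ℝ := fun i => if h : i = j then -∑ l, z (Sum.inr l) else z (Sum.inr ⟨i, h⟩)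
      with hW
    have hWs : ∑ i, W i = 0 := by
      rw [← Finset.add_sum_erase _ _ (Finset.mem_univ j)]
      have h1 : ∑ i ∈ Finset.univ.erase j, W i = ∑ l : {i : Fin n // i ≠ j}, z (Sum.inr l) := by
        rw [Finset.sum_subtype (p := fun i => i ≠ j) _ (by simp) W]
        exact Finset.sum_congr rfl fun l _ => by simp [hW, l.2]
      rw [h1]
      simp [hW]
    -- The pieces carry opposite divergences at the identified vertices, which cancel in the glued
    -- graph.
    set δ₁ : V₁ → ℝ := ∑ i, W i • Pi.single (b₁ i) 1 with hδ₁
    set δ₂ : V₂ → ℝ := -∑ i, W i • Pi.single (b₂ i) 1 with hδ₂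
    have hs₁ : ∑ v, δ₁ v = 0 := by
      simp only [hδ₁, Finset.sum_apply, Pi.smul_apply, smul_eq_mul]
      rw [Finset.sum_comm]
      simp [← Finset.mul_sum, Finset.sum_pi_single', hWs]
    have hs₂ : ∑ v, δ₂ v = 0 := by
      simp only [hδ₂, Finset.sum_apply, Pi.smul_apply, smul_eq_mul, Pi.neg_apply,
        Finset.sum_neg_distrib]
      rw [Finset.sum_comm]
      simp [← Finset.mul_sum, Finset.sum_pi_single', hWs]
    have hb₁ : ∀ i, δ₁ (b₁ i) = W i := by
      intro i
      simp [hδ₁, Finset.sum_apply, Pi.single_apply, g.injb₁.eq_iff]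
    have hb₂ : ∀ i, δ₂ (b₂ i) = -W i := by
      intro i
      simp [hδ₂, Finset.sum_apply, Pi.single_apply, g.injb₂.eq_iff]
    have hn₁ : ∀ y, (∀ i, y ≠ b₁ i) → δ₁ y = 0 := by
      intro y hy
      simp [hδ₁, Finset.sum_apply, hy]
    have hn₂ : ∀ y, (∀ i, y ≠ b₂ i) → δ₂ y = 0 := by
      intro y hy
      simp [hδ₂, Finset.sum_apply, hy]
    obtain ⟨a1, a2, a3⟩ := hJ₁ (fun k => z (Sum.inl (Sum.inr k))) δ₁ hs₁
    obtain ⟨c1, c2, c3⟩ := hJ₂ (fun k => z (Sum.inl (Sum.inl k))) δ₂ hs₂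
    set ω₁ := J₁ (fun k => z (Sum.inl (Sum.inr k)), δ₁) with hω₁
    set ω₂ := J₂ (fun k => z (Sum.inl (Sum.inl k)), δ₂) with hω₂
    refine ⟨glueFlow in₂ in₁ ω₂ ω₁, mem_divFree_iff.2 ⟨g.glueFlow_mem c1 a1, ?_⟩, ?_, ?_⟩
    · ext v
      obtain ⟨x, rfl⟩ | ⟨y, rfl⟩ := g.surj v
      · by_cases hx : ∀ i, x ≠ b₂ i
        · rw [g.divg_glueFlow₂ hx, c2, hn₂ x hx]; rfl
        · push Not at hx
          obtain ⟨i, rfl⟩ := hx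
          rw [g.divg_glueFlow_b, c2, a2, hb₁, hb₂]
          simp
      · by_cases hy : ∀ i, y ≠ b₁ i
        · rw [g.divg_glueFlow₁ hy, a2, hn₁ y hy]; rfl
        · push Not at hy
          obtain ⟨i, rfl⟩ := hy
          rw [← (g.meet (b₂ i) (b₁ i)).2 ⟨i, rfl, rfl⟩, g.divg_glueFlow_b, c2, a2, hb₁, hb₂]
          simp
    · intro hz
      have hWi : IsIntegral W := by
        intro i
        choose m hm using hz
        by_cases h : i = j
        · exact ⟨-∑ l, m (Sum.inr l), by simp [hW, h, hm]⟩
        · exact ⟨m (Sum.inr ⟨i, h⟩), by simp [hW, h, hm]⟩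
      have hsing : ∀ {U : Type} (u : U), IsIntegral (Pi.single u 1 : U → ℝ) := by
        intro U u x
        refine ⟨if x = u then 1 else 0, ?_⟩
        by_cases hx : x = u
        · subst hx; simp
        · simp [hx]
      have hi₁ : IsIntegral δ₁ := IsIntegral.sum_smul _ hWi fun i _ => hsing _
      have hi₂ : IsIntegral δ₂ := by
        have h0 : IsIntegral (0 : V₂ → ℝ) := fun _ => ⟨0, by simp⟩
        have := h0.sub (IsIntegral.sum_smul Finset.univ hWi fun i _ => hsing (b₂ i))
        rwa [zero_sub] at this
      have h1 := hJ₁i _ _ (fun k => hz (Sum.inl (Sum.inr k))) hi₁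
      have h2 := hJ₂i _ _ (fun k => hz (Sum.inl (Sum.inl k))) hi₂
      rintro ⟨v, w⟩
      by_cases h : G'.Adj v w
      · obtain ⟨x, y, -, rfl, rfl⟩ | ⟨x, y, -, rfl, rfl⟩ := (g.adj _ _).1 h
        · rw [g.glueFlow_apply₂ _ a1]; exact h2 _
        · rw [g.glueFlow_apply₁ _ c1]; exact h1 _
      · rw [(g.glueFlow_mem c1 a1).2 _ _ h]
        exact ⟨0, by simp⟩
    · rintro ((k | k) | i)
      · exact (g.glueFlow_apply₂ _ a1 _ _).trans (c3 k)
      · exact (g.glueFlow_apply₁ _ c1 _ _).trans (a3 k)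
      · refine (g.glueFlow_apply₁ _ c1 _ _).trans ?_
        rw [← g.divg_b₁ a1, a2, hb₁, hW]
        simp [i.2]
  refine ⟨fun ω hω h0 => ?_, fun z => ?_, fun z hz => ?_⟩
  · set ω₂ : V₂ × V₂ → ℝ := fun p => ω (in₂ p.1, in₂ p.2) with hω₂
    set ω₁ : V₁ × V₁ → ℝ := fun p => ω (in₁ p.1, in₁ p.2) with hω₁
    have m₂ : ω₂ ∈ flows G₂ := g.res₂_mem hω.1
    have m₁ : ω₁ ∈ flows G₁ := g.res₁_mem hω.1
    have hglue : glueFlow in₂ in₁ ω₂ ω₁ = ω := g.glue_res hω.1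
    -- A circulation with vanishing coordinates: the restriction to `G₁` has divergence zero away
    -- from `b₁ j`, hence also there, so it vanishes; then the same holds for the restriction to
    -- `G₂`.
    have hdiv : divg (glueFlow in₂ in₁ ω₂ ω₁) = 0 := by
      rw [hglue]; exact (mem_divFree_iff.1 hω).2
    have d₁ : ∀ y, (∀ i, y ≠ b₁ i) → divg ω₁ y = 0 := fun y hy => by
      rw [← g.divg_glueFlow₁ hy (ω₂ := ω₂), hdiv]; rfl
    have e₁ : ∀ i, i ≠ j → divg ω₁ (b₁ i) = 0 := fun i hi => by
      rw [g.divg_b₁ m₁]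
      exact h0 (Sum.inr ⟨i, hi⟩)
    have f₁ : divg ω₁ (b₁ j) = 0 := by
      have hs := sum_divg m₁
      rw [Finset.sum_eq_single (b₁ j)] at hs
      · exact hs
      · intro y _ hy
        by_cases hb : ∀ i, y ≠ b₁ i
        · exact d₁ y hb
        · push Not at hb
          obtain ⟨i, rfl⟩ := hb
          exact e₁ i fun h => hy (by rw [h])
      · simp
    have z₁ : ω₁ = 0 := by
      refine h₁.inj ω₁ (mem_divFree_iff.2 ⟨m₁, ?_⟩) fun k => h0 (Sum.inl (Sum.inr k))
      ext y
      by_cases hb : ∀ i, y ≠ b₁ i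
      · exact d₁ y hb
      · push Not at hb
        obtain ⟨i, rfl⟩ := hb
        by_cases hi : i = j
        · rw [hi]; exact f₁
        · exact e₁ i hi
    have z₂ : ω₂ = 0 := by
      refine h₂.inj ω₂ (mem_divFree_iff.2 ⟨m₂, ?_⟩) fun k => h0 (Sum.inl (Sum.inl k))
      ext x
      by_cases hb : ∀ i, x ≠ b₂ i
      · rw [← g.divg_glueFlow₂ hb (ω₁ := ω₁), hdiv]
        rfl
      · push Not at hb
        obtain ⟨i, rfl⟩ := hb
        have h3 := g.divg_glueFlow_b (ω₂ := ω₂) (ω₁ := ω₁) i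
        rw [hdiv, z₁, divg_zero] at h3
        simpa using h3.symm
    rw [← hglue, z₁, z₂]
    exact g.ext_res (g.glueFlow_mem (flows G₂).zero_mem (flows G₁).zero_mem) (flows G').zero_mem
      (fun x y => g.glueFlow_apply₂ _ (flows G₁).zero_mem x y)
      (fun x y => g.glueFlow_apply₁ _ (flows G₂).zero_mem x y)
  · obtain ⟨ω, h1, -, h3⟩ := key z
    exact ⟨ω, h1, h3⟩
  · obtain ⟨ω, h1, h2, h3⟩ := key z
    exact ⟨ω, h1, h2 hz, h3⟩

end IsGluing

end GraphGluing

/-! ### Triangular coordinates -/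

section Coordinates

/-- The rate of change of the coordinate `v_k` in the direction of type `l`. -/
def inc (k l : Fin 3) : ℝ := if k = l then 0 else if k = l + 1 then -1 else 1

theorem dir_eq (l : Fin 3) : dir l = ![(⟨-1 / 2, √3 / 2⟩ : ℂ), ⟨-1 / 2, -√3 / 2⟩, ⟨1, 0⟩] l := by
  have h1 : Real.cos (2 * Real.pi / 3) = -1 / 2 := by
    rw [show 2 * Real.pi / 3 = Real.pi - Real.pi / 3 by ring, Real.cos_pi_sub,
      Real.cos_pi_div_three]; ring
  have h2 : Real.sin (2 * Real.pi / 3) = √3 / 2 := by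
    rw [show 2 * Real.pi / 3 = Real.pi - Real.pi / 3 by ring, Real.sin_pi_sub,
      Real.sin_pi_div_three]
  have h3 : Real.cos (4 * Real.pi / 3) = -1 / 2 := by
    rw [show 4 * Real.pi / 3 = Real.pi / 3 + Real.pi by ring, Real.cos_add_pi,
      Real.cos_pi_div_three]; ring
  have h4 : Real.sin (4 * Real.pi / 3) = -√3 / 2 := by
    rw [show 4 * Real.pi / 3 = Real.pi / 3 + Real.pi by ring, Real.sin_add_pi,
      Real.sin_pi_div_three]; ring
  have he : ∀ x : ℝ, Complex.exp (x * Complex.I) = ⟨Real.cos x, Real.sin x⟩ := by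
    intro x
    apply Complex.ext <;> simp [Complex.exp_re, Complex.exp_im]
  fin_cases l
  · have := he (2 * Real.pi / 3)
    rw [h1, h2] at this
    simp only [dir]
    rw [show 2 * (Real.pi : ℂ) * Complex.I * ((((⟨0, by decide⟩ : Fin 3) : ℕ) : ℂ) + 1) / 3 =
      ((2 * Real.pi / 3 : ℝ) : ℂ) * Complex.I by push_cast; ring]
    exact this
  · have := he (4 * Real.pi / 3)
    rw [h3, h4] at this
    simp only [dir]
    rw [show 2 * (Real.pi : ℂ) * Complex.I * ((((⟨1, by decide⟩ : Fin 3) : ℕ) : ℂ) + 1) / 3 =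
      ((4 * Real.pi / 3 : ℝ) : ℂ) * Complex.I by push_cast; ring]
    exact this
  · have := he (2 * Real.pi)
    rw [Real.cos_two_pi, Real.sin_two_pi] at this
    simp only [dir]
    rw [show 2 * (Real.pi : ℂ) * Complex.I * ((((⟨2, by decide⟩ : Fin 3) : ℕ) : ℂ) + 1) / 3 =
      ((2 * Real.pi : ℝ) : ℂ) * Complex.I by push_cast; ring]
    exact this

theorem coord_add_dir (k l : Fin 3) (a : ℂ) (r : ℝ) :
    coord k (a + r * dir l) = coord k a + r * inc k l := by
  have h3 : √3 * √3 = 3 := Real.mul_self_sqrt (by norm_num)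
  have h0 : √3 ≠ 0 := by positivity
  rw [dir_eq]
  fin_cases k <;> fin_cases l <;> simp [coord, inc] <;> field_simp <;> ring_nf

theorem coord_sum (i : Fin 3) (z : ℂ) : coord i z + coord (i + 1) z + coord (i + 2) z = 1 := by
  fin_cases i <;> simp [coord] <;> ring

theorem coord_convex (k : Fin 3) (a b : ℂ) {x y : ℝ} (h : x + y = 1) :
    coord k (x • a + y • b) = x * coord k a + y * coord k b := by
  obtain rfl : y = 1 - x := by linarith
  fin_cases k <;> simp [coord] <;> ring

theorem coord_continuous (k : Fin 3) : Continuous (coord k) := by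
  fin_cases k
  · change Continuous fun v : ℂ => 1 - (v.re - v.im / √3) - 2 * v.im / √3
    fun_prop
  · change Continuous fun v : ℂ => v.re - v.im / √3
    fun_prop
  · change Continuous fun v : ℂ => 2 * v.im / √3
    fun_prop

theorem coord_ext {i j : Fin 3} (hij : i ≠ j) {a b : ℂ} (hi : coord i a = coord i b)
    (hj : coord j a = coord j b) : a = b := by
  have h0 : √3 ≠ 0 := by positivity
  have hall : ∀ k, coord k a = coord k b := by
    intro k
    have h1 := coord_sum i a
    have h2 := coord_sum i b
    obtain rfl | rfl | rfl : k = i ∨ k = i + 1 ∨ k = i + 2 := by omega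
    · exact hi
    · obtain rfl | rfl : j = i + 1 ∨ j = i + 2 := by omega
      · exact hj
      · linarith
    · obtain rfl | rfl : j = i + 1 ∨ j = i + 2 := by omega
      · linarith
      · exact hj
  have h2 := hall 2
  have h1 := hall 1
  simp only [coord, Matrix.cons_val] at h1 h2
  have him : a.im = b.im := by field_simp at h2; linarith
  rw [him] at h1
  exact Complex.ext (by linarith) him

/-- Two points on a line of type `l` differ by a multiple of its direction. -/
theorem eq_add_dir {l : Fin 3} {a b : ℂ} (h : coord l a = coord l b) :
    b = a + ((coord (l + 2) b - coord (l + 2) a : ℝ) : ℂ) * dir l := by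
  have h1 : inc l l = 0 := by simp [inc]
  have h2 : inc (l + 2) l = 1 := by fin_cases l <;> simp [inc]
  refine coord_ext (i := l) (j := l + 2) (by omega) ?_ ?_
  · rw [coord_add_dir, h1]; linarith
  · rw [coord_add_dir, h2]; ring

theorem sub_eq_dir {l : Fin 3} {a b : ℂ} (h : coord l a = coord l b) :
    b - a = ((coord (l + 2) b - coord (l + 2) a : ℝ) : ℂ) * dir l := by
  conv_lhs => rw [eq_add_dir h]
  ring

theorem det2_dir (l l' : Fin 3) (r r' : ℝ) :
    det2 (r * dir l) (r' * dir l') = r * r' * (√3 / 2 * -inc l' l) := by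
  rw [dir_eq, dir_eq]
  fin_cases l <;> fin_cases l' <;> simp [det2, inc] <;> ring

theorem inner_dir (l l' : Fin 3) (r r' : ℝ) :
    inner ℝ ((r : ℂ) * dir l) ((r' : ℂ) * dir l') = r * r' * if l = l' then 1 else -1 / 2 := by
  have h3 : √3 * √3 = 3 := Real.mul_self_sqrt (by norm_num)
  rw [dir_eq, dir_eq, Complex.inner]
  fin_cases l <;> fin_cases l' <;> simp <;> ring_nf <;>
    (try rw [show √3 ^ 2 = 3 by rw [sq, h3]]) <;> ring

theorem norm_dir (l : Fin 3) (r : ℝ) : ‖(r : ℂ) * dir l‖ = |r| := by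
  have h := inner_dir l l r r
  rw [if_pos rfl, real_inner_self_eq_norm_sq, mul_one, ← sq] at h
  rw [← Real.sqrt_sq (norm_nonneg _), h, Real.sqrt_sq_eq_abs]

theorem angle_dir {l l' : Fin 3} {r r' : ℝ} {α : ℝ}
    (h : InnerProductGeometry.angle ((r : ℂ) * dir l) ((r' : ℂ) * dir l') = α) :
    Real.cos α * |r * r'| = r * r' * if l = l' then 1 else -1 / 2 := by
  rw [← h, abs_mul, ← norm_dir l r, ← norm_dir l' r',
    InnerProductGeometry.cos_angle_mul_norm_mul_norm, inner_dir]

theorem angle_two_pi_div_three {l l' : Fin 3} {r r' : ℝ} (hr : r ≠ 0) (hr' : r' ≠ 0)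
    (h : InnerProductGeometry.angle ((r : ℂ) * dir l) ((r' : ℂ) * dir l') = 2 * Real.pi / 3) :
    l ≠ l' ∧ 0 < r * r' := by
  have h1 : Real.cos (2 * Real.pi / 3) = -1 / 2 := by
    rw [show 2 * Real.pi / 3 = Real.pi - Real.pi / 3 by ring, Real.cos_pi_sub,
      Real.cos_pi_div_three]; ring
  have h2 := angle_dir h
  rw [h1] at h2
  have h0 : r * r' ≠ 0 := mul_ne_zero hr hr'
  rcases lt_or_gt_of_ne h0 with h3 | h3
  · rw [abs_of_neg h3] at h2
    split_ifs at h2 <;> linarith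
  · refine ⟨?_, h3⟩
    rintro rfl
    rw [abs_of_pos h3, if_pos rfl] at h2
    linarith

theorem angle_pi_div_three {l l' : Fin 3} {r r' : ℝ} (hr : r ≠ 0) (hr' : r' ≠ 0)
    (h : InnerProductGeometry.angle ((r : ℂ) * dir l) ((r' : ℂ) * dir l') = Real.pi / 3) :
    l ≠ l' ∧ r * r' < 0 := by
  have h2 := angle_dir h
  rw [Real.cos_pi_div_three] at h2
  have h0 : r * r' ≠ 0 := mul_ne_zero hr hr'
  rcases lt_or_gt_of_ne h0 with h3 | h3
  · refine ⟨?_, h3⟩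
    rintro rfl
    rw [abs_of_neg h3, if_pos rfl] at h2
    linarith
  · rw [abs_of_pos h3] at h2
    split_ifs at h2 <;> linarith

theorem angleFromTo_type {a b a' b' : ℂ} {l l' : Fin 3} (hab : a ≠ b) (hab' : a' ≠ b')
    (h : coord l a = coord l b) (h' : coord l' a' = coord l' b')
    (hα : AngleFromTo s(a, b) s(a', b') (Real.pi / 3)) : l' = l + 2 := by
  have key : ∀ x y x' y' : ℂ, x ≠ y → x' ≠ y' → coord l x = coord l y → coord l' x' = coord l' y' →
      0 < det2 (y - x) (y' - x') →
      InnerProductGeometry.angle (y - x) (y' - x') = Real.pi / 3 → l' = l + 2 := by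
    intro x y x' y' hxy hxy' e e' hd ha
    rw [sub_eq_dir e, sub_eq_dir e'] at hd ha
    have n1 : coord (l + 2) y - coord (l + 2) x ≠ 0 := fun hh =>
      hxy (coord_ext (i := l) (j := l + 2) (by omega) e (by linarith))
    have n2 : coord (l' + 2) y' - coord (l' + 2) x' ≠ 0 := fun hh =>
      hxy' (coord_ext (i := l') (j := l' + 2) (by omega) e' (by linarith))
    obtain ⟨h1, h2⟩ := angle_pi_div_three n1 n2 ha
    rw [det2_dir] at hd
    obtain rfl | rfl : l' = l + 1 ∨ l' = l + 2 := by omega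
    · exfalso
      have h4 : inc (l + 1) l = -1 := by fin_cases l <;> simp [inc]
      rw [h4] at hd
      have : 0 < √3 / 2 := by positivity
      nlinarith
    · rfl
  obtain ⟨x, y, x', y', e1, e2, hd, ha⟩ := hα
  rw [Sym2.eq_iff] at e1 e2
  rcases e1 with ⟨rfl, rfl⟩ | ⟨rfl, rfl⟩ <;> rcases e2 with ⟨rfl, rfl⟩ | ⟨rfl, rfl⟩
  · exact key _ _ _ _ hab hab' h h' hd ha
  · exact key _ _ _ _ hab hab'.symm h h'.symm hd ha
  · exact key _ _ _ _ hab.symm hab' h.symm h' hd ha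
  · exact key _ _ _ _ hab.symm hab'.symm h.symm h'.symm hd ha

end Coordinates

/-! ### Edges and vertices of a triangular honeycomb -/

namespace TriHoneycomb

variable {n : ℕ} (h : TriHoneycomb n)

/-- `a` and `b` are joined by an edge of colour `c`. -/
def Ed (c : ℕ) (a b : ℂ) : Prop := ∃ hab : s(a, b) ∈ h.edges, h.color ⟨_, hab⟩ = c

/-- The edge from `a` to `b` has colour `c` and type `l`, and leaves `a` in the direction `σ` times
that of type `l`. -/
def Dart (c : ℕ) (l : Fin 3) (σ : ℝ) (a b : ℂ) : Prop :=
  h.Ed c a b ∧ coord l a = coord l b ∧ (σ = 1 ∨ σ = -1) ∧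
    0 < σ * (coord (l + 2) b - coord (l + 2) a)

variable {h}

theorem Ed.symm {c : ℕ} {a b : ℂ} (e : h.Ed c a b) : h.Ed c b a := by
  obtain ⟨hab, hc⟩ := e
  have : s(b, a) = s(a, b) := Sym2.eq_swap
  refine ⟨this ▸ hab, ?_⟩
  rw [← hc]
  congr 1
  exact Subtype.ext this

theorem Ed.congr {c : ℕ} {a b a' b' : ℂ} (e : h.Ed c a b) (hs : s(a, b) = s(a', b')) :
    h.Ed c a' b' := by
  rcases Sym2.eq_iff.1 hs with ⟨rfl, rfl⟩ | ⟨rfl, rfl⟩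
  · exact e
  · exact e.symm

theorem Ed.ne {c : ℕ} {a b : ℂ} (e : h.Ed c a b) : a ≠ b := by
  obtain ⟨hab, -⟩ := e
  have := h.nontrivial _ hab
  simpa using this

theorem Ed.mem {c : ℕ} {a b : ℂ} (e : h.Ed c a b) : a ∈ h.vertices :=
  ⟨s(a, b), e.1, by simp⟩

theorem Ed.color_unique {c c' : ℕ} {a b : ℂ} (e : h.Ed c a b) (e' : h.Ed c' a b) : c = c' :=
  e.2.symm.trans e'.2

theorem Ed.color_mem {c : ℕ} {a b : ℂ} (e : h.Ed c a b) : c = 0 ∨ c = 1 ∨ c = 3 := by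
  obtain ⟨hab, rfl⟩ := e
  exact h.color_mem _

theorem exists_Ed {a b : ℂ} (hab : s(a, b) ∈ h.edges) : ∃ c, h.Ed c a b := ⟨_, hab, rfl⟩

theorem exists_Ed_of_mem {a : ℂ} (ha : a ∈ h.vertices) : ∃ c b, h.Ed c a b := by
  obtain ⟨e, he, hae⟩ := ha
  obtain ⟨b, rfl⟩ := Sym2.mem_iff_exists.1 hae
  exact ⟨_, b, he, rfl⟩

theorem Ed.segment_subset {c : ℕ} {a b : ℂ} (e : h.Ed c a b) : segment ℝ a b ⊆ triangle :=
  h.seg_subset _ e.1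

theorem mem_triangle {a : ℂ} (ha : a ∈ h.vertices) : a ∈ triangle := by
  obtain ⟨c, b, e⟩ := exists_Ed_of_mem ha
  exact e.segment_subset (left_mem_segment ℝ a b)

theorem hasType_iff {c : ℕ} {a b : ℂ} (e : h.Ed c a b) (l : Fin 3) :
    HasType s(a, b) l ↔ coord l a = coord l b := by
  constructor
  · rintro ⟨x, -, hx⟩
    obtain ⟨r, hr⟩ := hx (left_mem_segment ℝ a b)
    obtain ⟨r', hr'⟩ := hx (right_mem_segment ℝ a b)
    have h0 : inc l l = 0 := by simp [inc]
    rw [hr, hr', coord_add_dir, coord_add_dir, h0]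
    ring
  · intro hl
    refine ⟨a, mem_triangle e.mem, ?_⟩
    intro z hz
    obtain ⟨x, y, hx, hy, hxy, rfl⟩ := hz
    refine ⟨y * (coord (l + 2) b - coord (l + 2) a), ?_⟩
    have h1 := sub_eq_dir hl
    have : x • a + y • b = a + y • (b - a) := by
      obtain rfl : x = 1 - y := by linarith
      module
    change x • a + y • b = _
    rw [this, h1, Complex.real_smul]
    push_cast
    ring

theorem Ed.exists_type {c : ℕ} {a b : ℂ} (e : h.Ed c a b) : ∃ l, coord l a = coord l b := by
  obtain ⟨l, hl⟩ := h.typed ⟨_, e.1⟩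
  exact ⟨l, (hasType_iff e l).1 hl⟩

theorem Ed.type_unique {c : ℕ} {a b : ℂ} (e : h.Ed c a b) {l l' : Fin 3}
    (hl : coord l a = coord l b) (hl' : coord l' a = coord l' b) : l = l' := by
  by_contra hne
  exact e.ne (coord_ext hne hl hl')

theorem height_eq {a b : ℂ} (hab : s(a, b) ∈ h.edges) {l : Fin 3} (hl : coord l a = coord l b) :
    h.height ⟨_, hab⟩ = coord l a := by
  have e : h.Ed _ a b := ⟨hab, rfl⟩
  have h1 := (h.typed ⟨_, hab⟩).choose_spec
  have h2 := (hasType_iff e _).1 h1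
  have h3 : h.edgeType ⟨_, hab⟩ = l := e.type_unique h2 hl
  obtain ⟨-, hx⟩ := h1.choose_spec
  obtain ⟨r, hr⟩ := hx (left_mem_segment ℝ a b)
  have h4 : coord (h.edgeType ⟨_, hab⟩) a = h.height ⟨_, hab⟩ + r * inc (h.edgeType ⟨_, hab⟩)
      (h.edgeType ⟨_, hab⟩) := (congrArg _ hr).trans (coord_add_dir _ _ _ _)
  have h0 : ∀ k, inc k k = 0 := fun k => by simp [inc]
  rw [h0, mul_zero, add_zero, h3] at h4
  exact h4.symm

theorem Ed.exists_dart {c : ℕ} {a b : ℂ} (e : h.Ed c a b) : ∃ l σ, h.Dart c l σ a b := by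
  obtain ⟨l, hl⟩ := e.exists_type
  have hne : coord (l + 2) b - coord (l + 2) a ≠ 0 := fun hh =>
    e.ne (coord_ext (i := l) (j := l + 2) (by omega) hl (by linarith))
  rcases lt_or_gt_of_ne hne with h1 | h1
  · exact ⟨l, -1, e, hl, Or.inr rfl, by linarith⟩
  · exact ⟨l, 1, e, hl, Or.inl rfl, by linarith⟩

theorem Ed.dart_of_type {c : ℕ} {a b : ℂ} (e : h.Ed c a b) {l : Fin 3}
    (hl : coord l a = coord l b) : ∃ σ, h.Dart c l σ a b := by
  obtain ⟨l', σ, d⟩ := e.exists_dart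
  rw [e.type_unique hl d.2.1]
  exact ⟨σ, d⟩

theorem Dart.symm {c : ℕ} {l : Fin 3} {σ : ℝ} {a b : ℂ} (d : h.Dart c l σ a b) :
    h.Dart c l (-σ) b a := by
  obtain ⟨h1, h2, h3, h4⟩ := d
  refine ⟨h1.symm, h2.symm, ?_, by linarith⟩
  rcases h3 with rfl | rfl <;> simp

/-- Two darts with the same source either coincide, or have the same sign, different types, and
colours in the allowed cyclic order. -/
theorem Dart.corner {c c' : ℕ} {l l' : Fin 3} {σ σ' : ℝ} {v w w' : ℂ} (d : h.Dart c l σ v w)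
    (d' : h.Dart c' l' σ' v w') (hne : w ≠ w') : l ≠ l' ∧ σ = σ' ∧
      (l' = l + 1 → (c, c') ∈ ({(0, 0), (1, 1), (0, 1), (1, 3), (3, 0)} : Set (ℕ × ℕ))) := by
  obtain ⟨⟨e, rfl⟩, h2, h3, h4⟩ := d
  obtain ⟨⟨e', rfl⟩, h2', h3', h4'⟩ := d'
  obtain ⟨h5, h6⟩ := h.corner v w w' e e' hne
  rw [sub_eq_dir h2, sub_eq_dir h2'] at h5 h6
  have n1 : coord (l + 2) w - coord (l + 2) v ≠ 0 := fun hh => by simp [hh] at h4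
  have n2 : coord (l' + 2) w' - coord (l' + 2) v ≠ 0 := fun hh => by simp [hh] at h4'
  obtain ⟨h7, h8⟩ := angle_two_pi_div_three n1 n2 h5
  refine ⟨h7, ?_, fun hl => h6 ?_⟩
  · rcases h3 with rfl | rfl <;> rcases h3' with rfl | rfl
    · rfl
    · nlinarith
    · nlinarith
    · rfl
  · subst hl
    rw [det2_dir]
    have h9 : inc (l + 1) l = -1 := by fin_cases l <;> simp [inc]
    rw [h9]
    have : 0 < √3 / 2 := by positivity
    rw [neg_neg, mul_one]
    exact mul_pos h8 this

theorem Dart.sign_unique {c c' : ℕ} {l l' : Fin 3} {σ σ' : ℝ} {v w w' : ℂ}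
    (d : h.Dart c l σ v w) (d' : h.Dart c' l' σ' v w') : σ = σ' := by
  by_cases hw : w = w'
  · subst hw
    have hl := d.1.type_unique d.2.1 d'.2.1
    subst hl
    obtain ⟨-, -, h3, h4⟩ := d
    obtain ⟨-, -, h3', h4'⟩ := d'
    rcases h3 with rfl | rfl <;> rcases h3' with rfl | rfl
    · rfl
    · linarith
    · linarith
    · rfl
  · exact (d.corner d' hw).2.1

theorem Dart.target_unique {c c' : ℕ} {l : Fin 3} {σ σ' : ℝ} {v w w' : ℂ}
    (d : h.Dart c l σ v w) (d' : h.Dart c' l σ' v w') : w = w' := by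
  by_contra hw
  exact (d.corner d' hw).1 rfl

/-- The sign `s(v)` is opposite to the common sign of the darts leaving `v`. -/
theorem Dart.sign_eq {c : ℕ} {l : Fin 3} {σ : ℝ} {v w : ℂ} (d : h.Dart c l σ v w) :
    h.sign v = -σ := by
  classical
  have hex : (∃ (l : Fin 3) (r : ℝ), 0 < r ∧ s(v, v - r * dir l) ∈ h.edges) ↔ σ = -1 := by
    constructor
    · rintro ⟨l', r, hr, he⟩
      obtain ⟨c', e⟩ := exists_Ed he
      have hw : v - (r : ℂ) * dir l' = v + ((-r : ℝ) : ℂ) * dir l' := by push_cast; ring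
      have h1 : coord l' v = coord l' (v - r * dir l') := by
        rw [hw, coord_add_dir]; simp [inc]
      have h2 : coord (l' + 2) (v - r * dir l') - coord (l' + 2) v = -r := by
        have h2 : inc (l' + 2) l' = 1 := by fin_cases l' <;> simp [inc]
        rw [hw, coord_add_dir, h2]; ring
      exact d.sign_unique (σ' := -1) ⟨e, h1, Or.inr rfl, by rw [h2]; linarith⟩
    · rintro rfl
      refine ⟨l, coord (l + 2) v - coord (l + 2) w, by linarith [d.2.2.2], ?_⟩
      have h1 := eq_add_dir d.2.1
      have : v - ((coord (l + 2) v - coord (l + 2) w : ℝ) : ℂ) * dir l = w := by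
        conv_rhs => rw [h1]
        push_cast
        ring
      rw [this]
      exact d.1.1
  unfold sign
  by_cases hs : σ = -1
  · rw [if_pos (hex.2 hs), hs]; norm_num
  · rw [if_neg fun hh => hs (hex.1 hh)]
    rcases d.2.2.1 with h1 | h1
    · rw [h1]
    · exact absurd h1 hs

/-- The edge at a boundary vertex. -/
theorem Ed.boundary {c : ℕ} {v w : ℂ} (e : h.Ed c v w) {i : Fin 3} (hv : v ∈ side i) :
    (c = 0 ∧ h.Dart 0 (i + 1) 1 v w) ∨ (c = 1 ∧ h.Dart 1 (i + 2) (-1) v w) := by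
  have hv0 : coord i v = 0 := hv.2
  have hw0 : 0 ≤ coord i w := mem_triangle e.symm.mem i
  have s1 := coord_sum i v
  have s2 := coord_sum i w
  have hc := e.2
  rcases h.side_color i ⟨_, e.1⟩ v (by simp) hv with ⟨h1, h2⟩ | ⟨h1, h2⟩
  · left
    obtain rfl : c = 0 := by rw [← hc, h1]
    have h3 := (hasType_iff e _).1 h2
    have h4 : coord i w ≠ 0 := fun hh => e.ne (coord_ext (i := i) (j := i + 1) (by omega)
      (by rw [hv0, hh]) h3)
    refine ⟨rfl, e, h3, Or.inl rfl, ?_⟩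
    rw [show i + 1 + 2 = i by omega, hv0]
    have : 0 < coord i w := lt_of_le_of_ne hw0 h4.symm
    linarith
  · right
    obtain rfl : c = 1 := by rw [← hc, h1]
    have h3 := (hasType_iff e _).1 h2
    have h4 : coord i w ≠ 0 := fun hh => e.ne (coord_ext (i := i) (j := i + 2) (by omega)
      (by rw [hv0, hh]) h3)
    refine ⟨rfl, e, h3, Or.inr rfl, ?_⟩
    rw [show i + 2 + 2 = i + 1 by omega]
    have : 0 < coord i w := lt_of_le_of_ne hw0 h4.symm
    linarith

theorem Ed.pos_of_boundary {c : ℕ} {v w : ℂ} (e : h.Ed c v w) {i : Fin 3} (hv : v ∈ side i) :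
    0 < coord i w := by
  have s1 := coord_sum i v
  have s2 := coord_sum i w
  have hv0 : coord i v = 0 := hv.2
  rcases e.boundary hv with ⟨-, -, h1, -, h2⟩ | ⟨-, -, h1, -, h2⟩
  · rw [show i + 1 + 2 = i by omega] at h2
    linarith
  · rw [show i + 2 + 2 = i + 1 by omega] at h2
    linarith

theorem Ed.unique_of_boundary {c c' : ℕ} {v w w' : ℂ} (e : h.Ed c v w) (e' : h.Ed c' v w')
    {i : Fin 3} (hv : v ∈ side i) : w = w' ∧ c = c' := by
  have key : w = w' := by
    rcases e.boundary hv with ⟨-, d⟩ | ⟨-, d⟩ <;> rcases e'.boundary hv with ⟨-, d'⟩ | ⟨-, d'⟩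
    · exact d.target_unique d'
    · have := d.sign_unique d'; norm_num at this
    · have := d.sign_unique d'; norm_num at this
    · exact d.target_unique d'
  subst key
  exact ⟨rfl, e.color_unique e'⟩

theorem side_unique {v : ℂ} (hv : v ∈ h.vertices) {i j : Fin 3} (hi : v ∈ side i)
    (hj : v ∈ side j) : i = j := by
  obtain ⟨c, w, e⟩ := exists_Ed_of_mem hv
  rcases e.boundary hi with ⟨-, d⟩ | ⟨-, d⟩ <;> rcases e.boundary hj with ⟨-, d'⟩ | ⟨-, d'⟩
  · have := e.type_unique d.2.1 d'.2.1; omega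
  · have := d.sign_unique d'; norm_num at this
  · have := d.sign_unique d'; norm_num at this
  · have := e.type_unique d.2.1 d'.2.1; omega

/-- No edge joins two boundary vertices. -/
theorem Ed.not_boundary {c : ℕ} {v w : ℂ} (e : h.Ed c v w) {i j : Fin 3} (hv : v ∈ side i) :
    w ∉ side j := by
  intro hw
  rcases e.boundary hv with ⟨hc, d⟩ | ⟨hc, d⟩ <;>
    rcases e.symm.boundary hw with ⟨hc', d'⟩ | ⟨hc', d'⟩
  · have := d.symm.sign_unique d'; norm_num at this
  · omega
  · omega
  · have := d.symm.sign_unique d'; norm_num at this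

/-- `v` is a vertex of degree three. -/
def Inner (h : TriHoneycomb n) (v : ℂ) : Prop := v ∈ h.vertices ∧ ∀ i, v ∉ side i

theorem Inner.pos {v : ℂ} (hv : h.Inner v) (i : Fin 3) : 0 < coord i v :=
  lt_of_le_of_ne (mem_triangle hv.1 i) fun hh => hv.2 i ⟨mem_triangle hv.1, hh.symm⟩

theorem inner_or_side {v : ℂ} (hv : v ∈ h.vertices) : h.Inner v ∨ ∃ i, v ∈ side i := by
  by_cases hs : ∃ i, v ∈ side i
  · exact Or.inr hs
  · exact Or.inl ⟨hv, fun i hi => hs ⟨i, hi⟩⟩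

theorem Ed.inner_of_side {c : ℕ} {v w : ℂ} (e : h.Ed c v w) {i : Fin 3} (hv : v ∈ side i) :
    h.Inner w := ⟨e.symm.mem, fun _ => e.not_boundary hv⟩

/-- At an inner vertex there is one edge of each type, all leaving with the same sign. -/
theorem Inner.exists_dart {v : ℂ} (hv : h.Inner v) :
    ∃ σ, ∀ l, ∃ c w, h.Dart c l σ v w := by
  have hdeg : h.toHoneycomb.degree v = 3 := by
    rcases h.degree_eq v hv.1 with h1 | h1
    · have : v ∈ h.toHoneycomb.support ∩ ⋃ i, side i := by
        rw [h.support_inter_boundary]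
        exact ⟨hv.1, h1⟩
      obtain ⟨i, hi⟩ := mem_iUnion.1 this.2
      exact absurd hi (hv.2 i)
    · exact h1
  obtain ⟨c₀, w₀, e₀⟩ := exists_Ed_of_mem hv.1
  obtain ⟨l₀, σ, d₀⟩ := e₀.exists_dart
  refine ⟨σ, ?_⟩
  have hedge : ∀ e : {e ∈ h.edges | v ∈ e}, ∃ (l : Fin 3) (c : ℕ) (w : ℂ),
      h.Dart c l σ v w ∧ (e : Sym2 ℂ) = s(v, w) := by
    rintro ⟨e, he, hve⟩
    obtain ⟨w, rfl⟩ := Sym2.mem_iff_exists.1 hve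
    obtain ⟨c, e'⟩ := exists_Ed he
    obtain ⟨l, σ', d⟩ := e'.exists_dart
    rw [d.sign_unique d₀] at d
    exact ⟨l, c, w, d, rfl⟩
  choose f c w hd hw using hedge
  have hinj : Function.Injective f := by
    intro e e' hee
    have h1 := hd e
    have h2 := hd e'
    rw [← hee] at h2
    exact Subtype.ext (by rw [hw e, hw e', h1.target_unique h2])
  have hfin : Finite {e ∈ h.edges | v ∈ e} :=
    (h.finite_edges.subset fun e he => he.1).to_subtype
  have hsurj : Function.Surjective f := by
    refine (hinj.bijective_of_nat_card_le ?_).2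
    rw [Nat.card_coe_set_eq]
    change _ ≤ h.toHoneycomb.degree v
    rw [hdeg]
    simp
  intro l
  obtain ⟨e, rfl⟩ := hsurj l
  exact ⟨c e, w e, hd e⟩

/-- The three colours at an inner vertex. -/
theorem Inner.colors {v : ℂ} (hv : h.Inner v) {c : ℕ} {l : Fin 3} {σ : ℝ} {w : ℂ}
    (d : h.Dart c l σ v w) : ∃ c₁ w₁ c₂ w₂, h.Dart c₁ (l + 1) σ v w₁ ∧ h.Dart c₂ (l + 2) σ v w₂ ∧
      ((c = 0 ∧ (c₁ = 0 ∧ c₂ = 0 ∨ c₁ = 1 ∧ c₂ = 3)) ∨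
       (c = 1 ∧ (c₁ = 1 ∧ c₂ = 1 ∨ c₁ = 3 ∧ c₂ = 0)) ∨ (c = 3 ∧ c₁ = 0 ∧ c₂ = 1)) := by
  obtain ⟨σ', hall⟩ := hv.exists_dart
  obtain ⟨c₁, w₁, d₁⟩ := hall (l + 1)
  obtain ⟨c₂, w₂, d₂⟩ := hall (l + 2)
  obtain rfl : σ = σ' := d.sign_unique d₁
  have hne : ∀ {c c' : ℕ} {k k' : Fin 3} {x x' : ℂ}, h.Dart c k σ v x → h.Dart c' k' σ v x' →
      k ≠ k' → x ≠ x' := by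
    rintro c c' k k' x x' e e' hk rfl
    exact hk (e.1.type_unique e.2.1 e'.2.1)
  have q1 := (d.corner d₁ (hne d d₁ (by omega))).2.2 rfl
  have q2 := (d₁.corner d₂ (hne d₁ d₂ (by omega))).2.2 (by omega)
  have q3 := (d₂.corner d (hne d₂ d (by omega))).2.2 (by omega)
  refine ⟨c₁, w₁, c₂, w₂, d₁, d₂, ?_⟩
  simp only [Set.mem_insert_iff, Set.mem_singleton_iff, Prod.mk.injEq] at q1 q2 q3
  omega

theorem mem_openSegment_lineMap {a b : ℂ} {t : ℝ} (h0 : 0 < t) (h1 : t < 1) :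
    a + t • (b - a) ∈ openSegment ℝ a b :=
  ⟨1 - t, t, by linarith, h0, by ring, by module⟩

/-- No vertex lies in the interior of an edge: one of the edges at the vertex would overlap it. -/
theorem Ed.not_mem_openSegment {c : ℕ} {a b : ℂ} (e : h.Ed c a b) {v : ℂ} (hv : v ∈ h.vertices) :
    v ∉ openSegment ℝ a b := by
  rintro ⟨x, y, hx, hy, hxy, rfl⟩
  set v := x • a + y • b with hvdef
  rcases inner_or_side hv with hin | ⟨i, hi⟩
  · obtain ⟨l, hl⟩ := e.exists_type
    obtain ⟨σ, hall⟩ := hin.exists_dart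
    obtain ⟨c', w, d⟩ := hall l
    set ρ := coord (l + 2) w - coord (l + 2) v with hρ
    set τ := coord (l + 2) b - coord (l + 2) a with hτ
    have hwv : w - v = (ρ : ℂ) * dir l := sub_eq_dir d.2.1
    have hba : b - a = (τ : ℂ) * dir l := sub_eq_dir hl
    have hτ0 : τ ≠ 0 := fun hh => e.ne (coord_ext (i := l) (j := l + 2) (by omega) hl (by linarith))
    have hva : v = a + y • (b - a) := by
      rw [hvdef]
      obtain rfl : x = 1 - y := by linarith
      module
    have hne : s(v, w) ≠ s(a, b) := by
      intro hh
      have hvm : v ∈ s(a, b) := by rw [← hh]; simp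
      rcases Sym2.mem_iff.1 hvm with h1 | h1
      · rw [h1] at hva
        have : y • (b - a) = 0 := by simpa using hva.symm
        rcases smul_eq_zero.1 this with h2 | h2
        · exact hy.ne' h2
        · exact e.ne (sub_eq_zero.1 h2).symm
      · have : x • (b - a) = 0 := by
          obtain rfl : x = 1 - y := by linarith
          rw [h1] at hva
          rw [sub_smul, one_smul]
          nth_rewrite 1 [hva]
          simp
        rcases smul_eq_zero.1 this with h2 | h2
        · exact hx.ne' h2
        · exact e.ne (sub_eq_zero.1 h2).symm
    set K := |ρ / τ| with hK
    have hK0 : 0 ≤ K := abs_nonneg _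
    -- A point of `vw` so close to `v` that it is still an interior point of `ab`.
    obtain ⟨ε, hε0, hε1, hεx, hεy⟩ : ∃ ε : ℝ, 0 < ε ∧ ε < 1 ∧ ε * K < x ∧ ε * K < y := by
      have hm : 0 < min x y := lt_min hx hy
      refine ⟨min x y / (2 * (1 + K)), by positivity, ?_, ?_, ?_⟩
      · rw [div_lt_one (by positivity)]
        have : min x y ≤ x := min_le_left _ _
        nlinarith
      · rw [div_mul_eq_mul_div, div_lt_iff₀ (by positivity)]
        have : min x y ≤ x := min_le_left _ _
        nlinarith
      · rw [div_mul_eq_mul_div, div_lt_iff₀ (by positivity)]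
        have : min x y ≤ y := min_le_right _ _
        nlinarith
    have habs : |ε * (ρ / τ)| = ε * K := by rw [abs_mul, abs_of_pos hε0]
    have hle := abs_le.1 habs.le
    have hz1 : v + ε • (w - v) ∈ openSegment ℝ v w := mem_openSegment_lineMap hε0 hε1
    have hz2 : v + ε • (w - v) ∈ openSegment ℝ a b := by
      have h3 : v + ε • (w - v) = a + (y + ε * (ρ / τ)) • (b - a) := by
        have h4 : w - v = (ρ / τ) • (b - a) := by
          rw [hwv, hba, Complex.real_smul]
          push_cast
          have : (τ : ℂ) ≠ 0 := Complex.ofReal_ne_zero.2 hτ0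
          field_simp
        rw [h4]
        nth_rewrite 1 [hva]
        module
      rw [h3]
      exact mem_openSegment_lineMap (by linarith) (by linarith)
    have hl' := d.2.1
    rcases h.crossing ⟨_, d.1.1⟩ ⟨_, e.1⟩ (fun hh => hne (congrArg Subtype.val hh))
      ⟨_, hz1, hz2⟩ with ⟨-, -, h5⟩ | ⟨-, -, h5⟩
    · have := angleFromTo_type d.1.ne e.ne hl' hl h5; omega
    · have := angleFromTo_type e.ne d.1.ne hl hl' h5; omega
  · have h1 : coord i v = x * coord i a + y * coord i b := coord_convex i a b hxy
    have h2 : coord i v = 0 := hi.2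
    have ha := mem_triangle e.mem i
    have hb := mem_triangle e.symm.mem i
    have ha0 : coord i a = 0 := by nlinarith
    have := e.pos_of_boundary ⟨mem_triangle e.mem, ha0⟩
    nlinarith

/-- Two distinct edges meet only at a common end point or in a regular crossing. -/
theorem Ed.meet {c c' : ℕ} {a b a' b' z : ℂ} {l l' : Fin 3} (e : h.Ed c a b) (e' : h.Ed c' a' b')
    (hl : coord l a = coord l b) (hl' : coord l' a' = coord l' b') (hne : s(a, b) ≠ s(a', b'))
    (hz : z ∈ segment ℝ a b) (hz' : z ∈ segment ℝ a' b') :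
    (z ∈ s(a, b) ∧ z ∈ s(a', b')) ∨
      (z ∈ openSegment ℝ a b ∧ z ∈ openSegment ℝ a' b' ∧
        ((c = 0 ∧ c' = 1 ∧ l' = l + 2) ∨ (c' = 0 ∧ c = 1 ∧ l = l' + 2))) := by
  have key : ∀ {x y : ℂ}, z ∈ segment ℝ x y → z ∈ s(x, y) ∨ z ∈ openSegment ℝ x y := by
    intro x y hzz
    rw [← insert_endpoints_openSegment] at hzz
    rcases hzz with rfl | rfl | hzz
    · left; simp
    · left; simp
    · exact Or.inr hzz
  have hvert : ∀ {k : ℕ} {x y : ℂ}, h.Ed k x y → z ∈ s(x, y) → z ∈ h.vertices :=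
    fun ek hzz => ⟨_, ek.1, hzz⟩
  rcases key hz with h1 | h1 <;> rcases key hz' with h2 | h2
  · exact Or.inl ⟨h1, h2⟩
  · exact absurd h2 (e'.not_mem_openSegment (hvert e h1))
  · exact absurd h1 (e.not_mem_openSegment (hvert e' h2))
  · refine Or.inr ⟨h1, h2, ?_⟩
    rcases h.crossing ⟨_, e.1⟩ ⟨_, e'.1⟩ (fun hh => hne (congrArg Subtype.val hh))
      ⟨_, h1, h2⟩ with ⟨h3, h4, h5⟩ | ⟨h3, h4, h5⟩
    · exact Or.inl ⟨by rw [← e.2, h3], by rw [← e'.2, h4],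
        angleFromTo_type e.ne e'.ne hl hl' h5⟩
    · exact Or.inr ⟨by rw [← e'.2, h3], by rw [← e.2, h4],
        angleFromTo_type e'.ne e.ne hl' hl h5⟩

end TriHoneycomb

/-! ### Monotone paths in the triangle -/

section Paths

open Relation

theorem coord_sum_of_ne {a b c : Fin 3} (hab : a ≠ b) (hbc : b ≠ c) (hac : a ≠ c) (z : ℂ) :
    coord a z + coord b z + coord c z = 1 := by
  have h := coord_sum a z
  obtain ⟨rfl, rfl⟩ | ⟨rfl, rfl⟩ : (b = a + 1 ∧ c = a + 2) ∨ (b = a + 2 ∧ c = a + 1) := by omega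
  · exact h
  · linarith

theorem coord_lineMap (k : Fin 3) (x y : ℂ) (t : ℝ) :
    coord k (x + t • (y - x)) = coord k x + t * (coord k y - coord k x) := by
  have h : x + t • (y - x) = (1 - t) • x + t • y := by module
  rw [h, coord_convex k x y (by ring)]
  ring

theorem mem_segment_lineMap {x y : ℂ} {t : ℝ} (h0 : 0 ≤ t) (h1 : t ≤ 1) :
    x + t • (y - x) ∈ segment ℝ x y :=
  ⟨1 - t, t, by linarith, h0, by ring, by module⟩

theorem exists_lineMap_of_mem {x y z : ℂ} (h : z ∈ segment ℝ x y) :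
    ∃ t : ℝ, 0 ≤ t ∧ t ≤ 1 ∧ z = x + t • (y - x) := by
  obtain ⟨u, v, hu, hv, huv, rfl⟩ := h
  refine ⟨v, hv, by linarith, ?_⟩
  obtain rfl : u = 1 - v := by linarith
  module

/-- The step from `x` to `y` increases `v_c - v_a` at least as fast as it changes `v_b`. -/
def Steep (a b c : Fin 3) (x y : ℂ) : Prop :=
  coord c x - coord a x < coord c y - coord a y ∧
    |coord b y - coord b x| ≤ (coord c y - coord a y) - (coord c x - coord a x)

/-- A path of steep steps is the graph of a function with Lipschitz constant `1` in the coordinates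
`(v_c - v_a, v_b)`. The function is prolonged with slope `1` before and slope `0` after the path; it
is nonnegative from the start of the path on if `v_b` is nonnegative on the path. Every parameter
value on the path, except the initial one, lies on a step that starts strictly before it. The last
clause says that the graph contains the first step, if this is determined by its starting point. -/
theorem exists_curve {a b c : Fin 3} {R : ℂ → ℂ → Prop} (hR : ∀ x y, R x y → Steep a b c x y)
    {r p : ℂ} (hrp : ReflTransGen R r p) : ∃ f : ℝ → ℝ, (∀ s t, |f s - f t| ≤ |s - t|) ∧
      (∀ t ≤ coord c r - coord a r, f t = coord b r + (t - (coord c r - coord a r))) ∧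
      (∀ t, coord c p - coord a p ≤ t → f t = coord b p) ∧
      (0 ≤ coord b r → (∀ x y, R x y → 0 ≤ coord b y) →
        ∀ t, coord c r - coord a r ≤ t → 0 ≤ f t) ∧
      (∀ t, coord c r - coord a r < t → t ≤ coord c p - coord a p →
        ∃ x y, R x y ∧ coord c x - coord a x < t ∧ t ≤ coord c y - coord a y ∧
          coord c y - coord a y ≤ coord c p - coord a p ∧
          ∀ w ∈ segment ℝ x y, coord b w = f (coord c w - coord a w)) ∧
      coord c r - coord a r ≤ coord c p - coord a p ∧
      (∀ y, (∀ x', R r x' → x' = y) → r ≠ p → coord c y - coord a y ≤ coord c p - coord a p ∧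
        ∀ w ∈ segment ℝ r y, coord b w = f (coord c w - coord a w)) := by
  induction hrp with
  | refl =>
    refine ⟨fun t => coord b r + min (t - (coord c r - coord a r)) 0, fun s t => ?_, fun t ht => ?_,
      fun t ht => ?_, fun h0 _ t ht => ?_, fun t h1 h2 => absurd h1 (not_lt.2 h2), le_rfl,
      fun y _ hy => absurd rfl hy⟩
    · have := abs_min_sub_min_le_max (s - (coord c r - coord a r)) 0 (t - (coord c r - coord a r)) 0
      simp only [sub_self, abs_zero] at this
      rw [max_eq_left (abs_nonneg _)] at this
      rw [show coord b r + min (s - (coord c r - coord a r)) 0 -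
        (coord b r + min (t - (coord c r - coord a r)) 0) =
        min (s - (coord c r - coord a r)) 0 - min (t - (coord c r - coord a r)) 0 by ring]
      rwa [show s - (coord c r - coord a r) - (t - (coord c r - coord a r)) = s - t by ring] at this
    · simp only
      rw [min_eq_left (by linarith)]
    · simp only
      rw [min_eq_right (by linarith), add_zero]
    · simp only
      rw [min_eq_right (by linarith), add_zero]
      exact h0
  | @tail x y hrx hxy ih =>
    obtain ⟨f, f1, f2, f3, f4, f5, f6, f7⟩ := ih
    -- For one more step from `x` to `y`, keep `f` up to the parameter `X` of `x`, and continue with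
    -- the slope `m` of the step, and with slope `0` after the parameter `Y` of `y`.
    obtain ⟨s1, s2⟩ := hR x y hxy
    set X := coord c x - coord a x with hX
    set Y := coord c y - coord a y with hY
    set m := (coord b y - coord b x) / (Y - X) with hm
    have hYX : 0 < Y - X := by linarith
    have hm1 : |m| ≤ 1 := by
      rw [hm, abs_div, abs_of_pos hYX, div_le_one hYX]
      exact s2
    have hmY : m * (Y - X) = coord b y - coord b x := div_mul_cancel₀ _ hYX.ne'
    have hfX : f X = coord b x := f3 X le_rfl
    set k : ℝ → ℝ := fun t => coord b x + m * (min t Y - X) with hk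
    have hkX : k X = coord b x := by simp [hk, min_eq_left s1.le]
    have hkl : ∀ s t, |k s - k t| ≤ |s - t| := by
      intro s t
      rw [show k s - k t = m * (min s Y - min t Y) by simp only [hk]; ring, abs_mul]
      have h1 := abs_min_sub_min_le_max s Y t Y
      simp only [sub_self, abs_zero] at h1
      rw [max_eq_left (abs_nonneg _)] at h1
      calc |m| * |min s Y - min t Y| ≤ 1 * |s - t| :=
            mul_le_mul hm1 h1 (abs_nonneg _) zero_le_one
        _ = |s - t| := one_mul _
    have hmix : ∀ s t, s ≤ X → X < t → |f s - k t| ≤ |s - t| := by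
      intro s t hs ht
      have h1 := f1 s X
      have h2 := hkl X t
      rw [hfX] at h1
      rw [hkX] at h2
      have h3 : |f s - k t| ≤ |f s - coord b x| + |coord b x - k t| := abs_sub_le _ _ _
      rw [abs_of_nonpos (by linarith : s - X ≤ 0)] at h1
      rw [abs_of_neg (by linarith : X - t < 0)] at h2
      rw [abs_of_neg (by linarith : s - t < 0)]
      linarith
    have hkint : ∀ w ∈ segment ℝ x y, coord b w = k (coord c w - coord a w) ∧
        X ≤ coord c w - coord a w ∧ coord c w - coord a w ≤ Y := by
      intro w hw
      obtain ⟨τ, h0, h1, rfl⟩ := exists_lineMap_of_mem hw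
      have e : coord c (x + τ • (y - x)) - coord a (x + τ • (y - x)) = X + τ * (Y - X) := by
        rw [coord_lineMap, coord_lineMap, hX, hY]; ring
      rw [e, coord_lineMap]
      have h2 : X + τ * (Y - X) ≤ Y := by nlinarith
      refine ⟨?_, by nlinarith, h2⟩
      simp only [hk]
      rw [min_eq_left h2, ← hmY]
      ring
    refine ⟨fun t => if t ≤ X then f t else k t, fun s t => ?_, fun t ht => ?_, fun t ht => ?_,
      fun h0 hpos t ht => ?_, fun t h1 h2 => ?_, by linarith, fun y' hy' _ => ?_⟩
    · simp only
      split_ifs with h1 h2 h2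
      · exact f1 s t
      · exact hmix s t h1 (not_le.1 h2)
      · rw [abs_sub_comm, abs_sub_comm s t]
        exact hmix t s h2 (not_le.1 h1)
      · exact hkl s t
    · simp only
      rw [if_pos (by linarith)]
      exact f2 t ht
    · simp only
      rw [if_neg (by linarith)]
      simp only [hk]
      rw [min_eq_right ht, hmY]
      ring
    · simp only
      split_ifs with h1
      · exact f4 h0 hpos t ht
      · have hbx : 0 ≤ coord b x := by
          rw [← hfX]; exact f4 h0 hpos X f6
        have hby := hpos x y hxy
        simp only [hk]
        set μ := min t Y with hμ
        have h2 : X ≤ μ := le_min (by linarith) s1.le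
        have h3 : μ ≤ Y := min_le_right _ _
        have h4 : (coord b x + m * (μ - X)) * (Y - X) =
            coord b x * (Y - μ) + coord b y * (μ - X) := by
          linear_combination (μ - X) * hmY
        have h5 : 0 ≤ coord b x * (Y - μ) + coord b y * (μ - X) :=
          add_nonneg (mul_nonneg hbx (by linarith)) (mul_nonneg hby (by linarith))
        rw [← h4] at h5
        exact nonneg_of_mul_nonneg_left h5 hYX
    · by_cases h3 : t ≤ X
      · obtain ⟨x', y', g1, g2, g3, g4, g5⟩ := f5 t h1 h3
        refine ⟨x', y', g1, g2, g3, by linarith, fun w hw => ?_⟩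
        have h4 : coord c w - coord a w ≤ X := by
          obtain ⟨τ, h5, h6, rfl⟩ := exists_lineMap_of_mem hw
          rw [coord_lineMap, coord_lineMap]
          have h7 := (hR x' y' g1).1
          nlinarith
        simp only
        rw [if_pos h4]
        exact g5 w hw
      · refine ⟨x, y, hxy, not_le.1 h3, h2, le_rfl, fun w hw => ?_⟩
        obtain ⟨w1, w2, w3⟩ := hkint w hw
        simp only
        split_ifs with h4
        · rw [w1, le_antisymm h4 w2, hkX, hfX]
        · exact w1
    · by_cases hrx' : r = x
      · subst hrx'
        obtain rfl := hy' y hxy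
        refine ⟨le_rfl, fun w hw => ?_⟩
        obtain ⟨w1, w2, w3⟩ := hkint w hw
        simp only
        split_ifs with h4
        · rw [w1, le_antisymm h4 w2, hkX, hfX]
        · exact w1
      · obtain ⟨g1, g2⟩ := f7 y' hy' hrx'
        refine ⟨by linarith, fun w hw => ?_⟩
        have h4 : coord c w - coord a w ≤ X := by
          obtain ⟨τ, h5, h6, rfl⟩ := exists_lineMap_of_mem hw
          rw [coord_lineMap, coord_lineMap]
          have h7 : coord c r - coord a r ≤ X := f6
          nlinarith
        simp only
        rw [if_pos h4]
        exact g2 w hw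

/-- Along a chain of segments, a continuous function that changes sign has a zero. -/
theorem exists_zero_of_chain {R : ℂ → ℂ → Prop} {g : ℂ → ℝ} (hg : Continuous g) {s t : ℂ}
    (hst : ReflTransGen R s t) (hne : s ≠ t) (hs : 0 ≤ g s) (ht : g t ≤ 0) :
    ∃ x y, R x y ∧ ∃ z ∈ segment ℝ x y, g z = 0 := by
  induction hst using ReflTransGen.head_induction_on with
  | refl => exact absurd rfl hne
  | @head s u hsu hut ih =>
    by_cases hu : g u ≤ 0
    · have hp : IsPreconnected (segment ℝ s u) := (convex_segment s u).isPreconnected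
      obtain ⟨z, hz, hz0⟩ := hp.intermediate_value (right_mem_segment ℝ s u)
        (left_mem_segment ℝ s u) hg.continuousOn ⟨hu, hs⟩
      exact ⟨s, u, hsu, z, hz, hz0⟩
    · exact ih (by rintro rfl; exact hu ht) (not_le.1 hu).le

theorem exists_mem_segment_value {a c : Fin 3} {x y : ℂ} {t : ℝ}
    (h1 : coord c x - coord a x ≤ t) (h2 : t ≤ coord c y - coord a y) :
    ∃ w ∈ segment ℝ x y, coord c w - coord a w = t := by
  have hp : IsPreconnected (segment ℝ x y) := (convex_segment x y).isPreconnected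
  exact hp.intermediate_value (left_mem_segment ℝ x y) (right_mem_segment ℝ x y)
    ((coord_continuous c).sub (coord_continuous a)).continuousOn ⟨h1, h2⟩

theorem coord_frame_ext {a b c : Fin 3} (hab : a ≠ b) (hbc : b ≠ c) (hac : a ≠ c) {z w : ℂ}
    (h1 : coord c z - coord a z = coord c w - coord a w) (h2 : coord b z = coord b w) : z = w := by
  have s1 := coord_sum_of_ne hab hbc hac z
  have s2 := coord_sum_of_ne hab hbc hac w
  exact coord_ext hab (by linarith) h2

theorem continuous_of_abs_sub_le {f : ℝ → ℝ} (hf : ∀ s t, |f s - f t| ≤ |s - t|) :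
    Continuous f :=
  (LipschitzWith.of_dist_le_mul (K := 1) fun s t => by
    simpa [Real.dist_eq] using hf s t).continuous

/-- A steep path from the side `∂_b T` to the side `∂_a T` separates the triangle: any path in the
triangle with end points on different sides of it meets it. -/
theorem exists_crossing {a b c : Fin 3} (hab : a ≠ b) (hbc : b ≠ c) (hac : a ≠ c)
    {RA RB : ℂ → ℂ → Prop} (hA : ∀ x y, RA x y → Steep a b c x y ∧ 0 ≤ coord b y)
    (hB : ∀ x y, RB x y → segment ℝ x y ⊆ triangle)
    {r p s t : ℂ} (hrp : ReflTransGen RA r p) (hst : ReflTransGen RB s t) (hrpn : r ≠ p)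
    (hstn : s ≠ t) (hr : r ∈ side b) (hrc : 0 < coord c r) (hp : p ∈ side a)
    (hs : coord c s = 0 ∨ (coord a s = 0 ∧ coord b p ≤ coord b s))
    (ht : (coord a t = 0 ∧ coord b t ≤ coord b p) ∨ (coord b t = 0 ∧ coord c r ≤ coord c t)) :
    ∃ x y x' y', RA x y ∧ RB x' y' ∧ ∃ z, z ∈ segment ℝ x y ∧ z ∈ segment ℝ x' y' := by
  obtain ⟨f, f1, f2, f3, f4, f5, f6, -⟩ := exists_curve (fun x y hxy => (hA x y hxy).1) hrp
  have hrb : coord b r = 0 := hr.2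
  have hpa : coord a p = 0 := hp.2
  have sr := coord_sum_of_ne hab hbc hac r
  have sp := coord_sum_of_ne hab hbc hac p
  have ss := coord_sum_of_ne hab hbc hac s
  have st := coord_sum_of_ne hab hbc hac t
  have f4' := f4 hrb.ge fun x y hxy => (hA x y hxy).2
  have fr := f2 _ le_rfl
  have fp := f3 _ le_rfl
  -- The point `s` lies above the graph or on it, and `t` below it or on it.
  have hgs : 0 ≤ coord b s - f (coord c s - coord a s) := by
    rcases hs with h1 | ⟨h1, h2⟩
    · by_cases h3 : coord c s - coord a s ≤ coord c r - coord a r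
      · rw [f2 _ h3]; linarith
      · have h4 := f1 (coord c s - coord a s) (coord c r - coord a r)
        have h5 := (abs_le.1 (h4.trans (abs_of_pos (by linarith)).le)).2
        linarith
    · have h4 := f1 (coord c s - coord a s) (coord c p - coord a p)
      have h5 := (abs_le.1 (h4.trans (abs_of_nonpos (by linarith)).le)).2
      linarith
  have hgt : coord b t - f (coord c t - coord a t) ≤ 0 := by
    rcases ht with ⟨h1, h2⟩ | ⟨h1, h2⟩
    · rw [f3 _ (by linarith)]; linarith
    · have := f4' (coord c t - coord a t) (by linarith)
      linarith
  have hcont : Continuous fun w => coord b w - f (coord c w - coord a w) :=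
    (coord_continuous b).sub ((continuous_of_abs_sub_le f1).comp
      ((coord_continuous c).sub (coord_continuous a)))
  obtain ⟨x', y', hxy', z, hz, hz0⟩ := exists_zero_of_chain hcont hst hstn hgs hgt
  have hzT := hB x' y' hxy' hz
  have sz := coord_sum_of_ne hab hbc hac z
  have hza := hzT a
  have hzb := hzT b
  -- The crossing point is on the path and not on a prolongation: these leave the triangle, since
  -- `v_b` is negative before and `v_a` after the path.
  have h1 : coord c r - coord a r ≤ coord c z - coord a z := by
    by_contra hlt
    rw [f2 _ (not_le.1 hlt).le] at hz0
    linarith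
  have h2 : coord c z - coord a z ≤ coord c p - coord a p := by
    by_contra hlt
    rw [f3 _ (not_le.1 hlt).le] at hz0
    linarith
  rcases h1.eq_or_lt with h1 | h1
  · have hzr : z = r := by
      refine coord_frame_ext hab hbc hac h1.symm ?_
      rw [← h1, fr] at hz0
      linarith
    rcases hrp.cases_head with h3 | ⟨y, hy, -⟩
    · exact absurd h3 hrpn
    · exact ⟨r, y, x', y', hy, hxy', z, hzr ▸ left_mem_segment ℝ _ _, hz⟩
  · obtain ⟨x, y, g1, g2, g3, -, g5⟩ := f5 _ h1 h2
    obtain ⟨w, hw, hwt⟩ := exists_mem_segment_value g2.le g3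
    have hwz : w = z := by
      refine coord_frame_ext hab hbc hac hwt ?_
      rw [g5 w hw, hwt]
      linarith
    exact ⟨x, y, x', y', g1, hxy', z, hwz ▸ hw, hz⟩

end Paths

namespace TriHoneycomb

open Relation

variable {n : ℕ} {h : TriHoneycomb n}

/-- A path that can be continued at every inner vertex ends on the boundary. -/
theorem exists_chain_end {Q : ℂ → ℂ → Prop} {φ : ℂ → ℝ} (hQ : ∀ x y, Q x y → y ∈ h.vertices)
    (hmono : ∀ x y, Q x y → φ x < φ y) (hnext : ∀ x y, Q x y → h.Inner y → ∃ z, Q y z)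
    {x y : ℂ} (hxy : Q x y) : ∃ x' b i, ReflTransGen Q x x' ∧ Q x' b ∧ b ∈ side i := by
  set S : Set ℂ := {y' | ∃ x', ReflTransGen Q x x' ∧ Q x' y'} with hS
  have hfin : S.Finite := h.finite_vertices.subset fun y' ⟨x', _, h2⟩ => hQ x' y' h2
  obtain ⟨b, ⟨x', h1, h2⟩, hmax⟩ := hfin.exists_maximalFor φ S ⟨y, x, ReflTransGen.refl, hxy⟩
  rcases inner_or_side (hQ x' b h2) with hin | ⟨i, hi⟩
  · obtain ⟨z, hz⟩ := hnext x' b h2 hin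
    have h3 := hmono b z hz
    exact absurd (hmax ⟨b, h1.tail h2, hz⟩ h3.le) (not_le.2 h3)
  · exact ⟨x', b, i, h1, h2, hi⟩

end TriHoneycomb

/-! ### Connectedness of a honeycomb -/

namespace TriHoneycomb

open Relation

variable {n : ℕ} {h : TriHoneycomb n}

theorem Dart.steep {c : ℕ} {l : Fin 3} {σ : ℝ} {x y : ℂ} (d : h.Dart c l σ x y) (i : Fin 3) {τ : ℝ}
    (hi : (l = i + 2 ∧ σ = τ) ∨ (l = i + 1 ∧ σ = -τ) ∨ (l = i ∧ σ = τ)) :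
    (τ = 1 → Steep i (i + 1) (i + 2) x y) ∧ (τ = -1 → Steep i (i + 1) (i + 2) y x) := by
  obtain ⟨-, h2, -, h4⟩ := d
  have s1 := coord_sum i x
  have s2 := coord_sum i y
  rcases hi with ⟨rfl, rfl⟩ | ⟨rfl, rfl⟩ | ⟨rfl, rfl⟩
  · rw [show i + 2 + 2 = i + 1 by omega] at h4
    refine ⟨?_, ?_⟩ <;> rintro rfl <;> refine ⟨by linarith, ?_⟩ <;> rw [abs_le] <;>
      constructor <;> linarith
  · rw [show i + 1 + 2 = i by omega] at h4
    refine ⟨?_, ?_⟩ <;> rintro rfl <;> refine ⟨by linarith, ?_⟩ <;> rw [abs_le] <;>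
      constructor <;> linarith
  · refine ⟨?_, ?_⟩ <;> rintro rfl <;> refine ⟨by linarith, ?_⟩ <;> rw [abs_le] <;>
      constructor <;> linarith

/-- The steps of a monotone path along edges of colour `0` and `3`. -/
def Rule0 (h : TriHoneycomb n) (i : Fin 3) (σ : ℝ) (x y : ℂ) : Prop :=
  h.Dart 0 (i + 2) σ x y ∨ h.Dart 0 (i + 1) (-σ) x y ∨ h.Dart 3 (i + 1) (-σ) x y ∨
    h.Dart 3 i σ x y

/-- The steps of a monotone path along edges of colour `1`. -/
def Rule1 (h : TriHoneycomb n) (i : Fin 3) (σ : ℝ) (x y : ℂ) : Prop :=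
  h.Dart 1 (i + 2) σ x y ∨ h.Dart 1 (i + 1) (-σ) x y

/-- Two vertices joined by an edge. -/
def Nbr (h : TriHoneycomb n) (x y : ℂ) : Prop := s(x, y) ∈ h.edges

/-- Two vertices joined by an edge of colour `0` or `3`. -/
def Nbr03 (h : TriHoneycomb n) (x y : ℂ) : Prop := h.Ed 0 x y ∨ h.Ed 3 x y

theorem Nbr.symm {x y : ℂ} (e : h.Nbr x y) : h.Nbr y x := by
  unfold Nbr at *
  rwa [Sym2.eq_swap]

theorem Nbr03.symm {x y : ℂ} (e : h.Nbr03 x y) : h.Nbr03 y x := e.imp Ed.symm Ed.symm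

theorem Nbr03.nbr {x y : ℂ} (e : h.Nbr03 x y) : h.Nbr x y := e.elim (fun e => e.1) fun e => e.1

theorem Rule0.nbr03 {i : Fin 3} {σ : ℝ} {x y : ℂ} (d : h.Rule0 i σ x y) : h.Nbr03 x y := by
  rcases d with d | d | d | d
  · exact Or.inl d.1
  · exact Or.inl d.1
  · exact Or.inr d.1
  · exact Or.inr d.1

theorem Rule1.ed {i : Fin 3} {σ : ℝ} {x y : ℂ} (d : h.Rule1 i σ x y) : h.Ed 1 x y :=
  d.elim (fun d => d.1) fun d => d.1

theorem Rule0.steep {i : Fin 3} {σ : ℝ} {x y : ℂ} (d : h.Rule0 i σ x y) :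
    (σ = 1 → Steep i (i + 1) (i + 2) x y) ∧ (σ = -1 → Steep i (i + 1) (i + 2) y x) := by
  rcases d with d | d | d | d <;> exact d.steep i (by simp)

theorem Rule1.steep {i : Fin 3} {σ : ℝ} {x y : ℂ} (d : h.Rule1 i σ x y) :
    (σ = 1 → Steep i (i + 1) (i + 2) x y) ∧ (σ = -1 → Steep i (i + 1) (i + 2) y x) := by
  rcases d with d | d <;> exact d.steep i (by simp)

theorem Rule0.sign {i : Fin 3} {σ : ℝ} {x y : ℂ} (d : h.Rule0 i σ x y) : σ = 1 ∨ σ = -1 := by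
  rcases d with d | d | d | d
  · exact d.2.2.1
  · exact d.2.2.1.elim (fun h => Or.inr (by linarith)) fun h => Or.inl (by linarith)
  · exact d.2.2.1.elim (fun h => Or.inr (by linarith)) fun h => Or.inl (by linarith)
  · exact d.2.2.1

/-- At an inner vertex, the path along edges of colour `0` and `3` can be continued. -/
theorem Rule0.next {i : Fin 3} {σ : ℝ} {x y : ℂ} (d : h.Rule0 i σ x y) (hy : h.Inner y) :
    ∃ z, h.Rule0 i σ y z := by
  rcases d with d | d | d | d
  · obtain ⟨c₁, w₁, c₂, w₂, d₁, d₂, hc⟩ := hy.colors d.symm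
    rw [show i + 2 + 2 = i + 1 by omega] at d₂
    refine ⟨w₂, ?_⟩
    rcases hc with ⟨-, ⟨-, rfl⟩ | ⟨-, rfl⟩⟩ | ⟨h0, -⟩ | ⟨h0, -⟩
    · exact Or.inr (Or.inl d₂)
    · exact Or.inr (Or.inr (Or.inl d₂))
    · exact absurd h0 (by norm_num)
    · exact absurd h0 (by norm_num)
  · obtain ⟨c₁, w₁, c₂, w₂, d₁, d₂, hc⟩ := hy.colors d.symm
    rw [show i + 1 + 2 = i by omega, neg_neg] at d₂
    rw [show i + 1 + 1 = i + 2 by omega, neg_neg] at d₁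
    rcases hc with ⟨-, ⟨rfl, rfl⟩ | ⟨-, rfl⟩⟩ | ⟨h0, -⟩ | ⟨h0, -⟩
    · exact ⟨w₁, Or.inl d₁⟩
    · exact ⟨w₂, Or.inr (Or.inr (Or.inr d₂))⟩
    · exact absurd h0 (by norm_num)
    · exact absurd h0 (by norm_num)
  · obtain ⟨c₁, w₁, c₂, w₂, d₁, d₂, hc⟩ := hy.colors d.symm
    rw [show i + 1 + 1 = i + 2 by omega, neg_neg] at d₁
    rcases hc with ⟨h0, -⟩ | ⟨h0, -⟩ | ⟨-, rfl, -⟩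
    · exact absurd h0 (by norm_num)
    · exact absurd h0 (by norm_num)
    · exact ⟨w₁, Or.inl d₁⟩
  · obtain ⟨c₁, w₁, c₂, w₂, d₁, d₂, hc⟩ := hy.colors d.symm
    rcases hc with ⟨h0, -⟩ | ⟨h0, -⟩ | ⟨-, rfl, -⟩
    · exact absurd h0 (by norm_num)
    · exact absurd h0 (by norm_num)
    · exact ⟨w₁, Or.inr (Or.inl d₁)⟩

theorem chain_mono {R E : ℂ → ℂ → Prop} (hRE : ∀ x y, R x y → E x y) {x y : ℂ}
    (hxy : ReflTransGen R x y) : ReflTransGen E x y := by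
  induction hxy with
  | refl => exact ReflTransGen.refl
  | tail _ hab ih => exact ih.tail (hRE _ _ hab)

/-- Chains of steps of a relation contained in `E` stay in the `E`-component of their start. -/
theorem chain_restrict {R E : ℂ → ℂ → Prop} (hRE : ∀ x y, R x y → E x y) {x y : ℂ}
    (hxy : ReflTransGen R x y) : ReflTransGen (fun a b => ReflTransGen E x a ∧ R a b) x y := by
  induction hxy with
  | refl => exact ReflTransGen.refl
  | @tail a b hxa hab ih => exact ih.tail ⟨chain_mono hRE hxa, hab⟩

/-- The path along edges of colour `0` and `3` ends on the boundary with an edge of colour `0`, on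
the side prescribed by its direction: an edge of colour `0` and type `l` ends on no side but
`∂_{l-1}T`. -/
theorem Rule0.exists_end {i : Fin 3} {σ : ℝ} {x y : ℂ} (d : h.Rule0 i σ x y) :
    ∃ p w, ReflTransGen (h.Rule0 i σ) y p ∧ h.Ed 0 p w ∧ (σ = 1 → p ∈ side i) ∧
      (σ = -1 → p ∈ side (i + 1)) := by
  have hσ := d.sign
  obtain ⟨x', b, k, h1, h2, h3⟩ := exists_chain_end (h := h)
    (Q := fun a b => ReflTransGen (h.Rule0 i σ) y b ∧ h.Rule0 i σ a b)
    (φ := fun v => σ * (coord (i + 2) v - coord i v))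
    (fun a b hab => hab.2.nbr03.elim (fun e => e.symm.mem) fun e => e.symm.mem)
    (fun a b hab => by
      have := hab.2.steep
      rcases hσ with rfl | rfl
      · have := (this.1 rfl).1; linarith
      · have := (this.2 rfl).1; linarith)
    (fun a b hab hb => by
      obtain ⟨z, hz⟩ := hab.2.next hb
      exact ⟨z, hab.1.tail hz, hz⟩)
    ⟨ReflTransGen.refl, d⟩
  have hb : ReflTransGen (h.Rule0 i σ) y b := h2.1
  refine ⟨b, x', hb, ?_⟩
  rcases h2.2 with d | d | d | d
  · refine ⟨d.1.symm, ?_⟩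
    rcases d.1.symm.boundary h3 with ⟨-, d'⟩ | ⟨h0, -⟩
    · have := d.1.symm.type_unique d.symm.2.1 d'.2.1
      obtain rfl : k = i + 1 := by omega
      have := d.symm.sign_unique d'
      exact ⟨fun h => by linarith, fun _ => h3⟩
    · exact absurd h0 (by norm_num)
  · refine ⟨d.1.symm, ?_⟩
    rcases d.1.symm.boundary h3 with ⟨-, d'⟩ | ⟨h0, -⟩
    · have := d.1.symm.type_unique d.symm.2.1 d'.2.1
      obtain rfl : k = i := by omega
      have := d.symm.sign_unique d'
      exact ⟨fun _ => h3, fun h => by linarith⟩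
    · exact absurd h0 (by norm_num)
  · rcases d.1.symm.boundary h3 with ⟨h0, -⟩ | ⟨h0, -⟩ <;> exact absurd h0 (by norm_num)
  · rcases d.1.symm.boundary h3 with ⟨h0, -⟩ | ⟨h0, -⟩ <;> exact absurd h0 (by norm_num)

/-- A set of vertices closed under adjacency, all whose edges have colour `1`. -/
def Pure1 (h : TriHoneycomb n) (P : ℂ → Prop) : Prop :=
  ∀ x y c, P x → h.Ed c x y → c = 1 ∧ P y

theorem Rule1.next {P : ℂ → Prop} (hP : h.Pure1 P) {i : Fin 3} {σ : ℝ} {x y : ℂ} (hx : P x)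
    (d : h.Rule1 i σ x y) (hy : h.Inner y) : ∃ z, h.Rule1 i σ y z := by
  have hPy := (hP x y 1 hx d.ed).2
  rcases d with d | d
  · obtain ⟨c₁, w₁, c₂, w₂, d₁, d₂, -⟩ := hy.colors d.symm
    rw [show i + 2 + 2 = i + 1 by omega] at d₂
    obtain ⟨rfl, -⟩ := hP y w₂ c₂ hPy d₂.1
    exact ⟨w₂, Or.inr d₂⟩
  · obtain ⟨c₁, w₁, c₂, w₂, d₁, d₂, -⟩ := hy.colors d.symm
    rw [show i + 1 + 1 = i + 2 by omega, neg_neg] at d₁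
    obtain ⟨rfl, -⟩ := hP y w₁ c₁ hPy d₁.1
    exact ⟨w₁, Or.inl d₁⟩

theorem Rule1.sign {i : Fin 3} {σ : ℝ} {x y : ℂ} (d : h.Rule1 i σ x y) : σ = 1 ∨ σ = -1 := by
  rcases d with d | d
  · exact d.2.2.1
  · exact d.2.2.1.elim (fun h => Or.inr (by linarith)) fun h => Or.inl (by linarith)

theorem Pure1.closed {P : ℂ → Prop} (hP : h.Pure1 P) {x y : ℂ} (hx : P x)
    {R : ℂ → ℂ → Prop} (hR : ∀ a b, R a b → h.Nbr a b) (hxy : ReflTransGen R x y) : P y := by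
  induction hxy with
  | refl => exact hx
  | tail _ hab ih =>
    obtain ⟨c, e⟩ := exists_Ed (hR _ _ hab)
    exact (hP _ _ c ih e).2

/-- The path along edges of colour `1` ends on the side prescribed by its direction. -/
theorem Rule1.exists_end {P : ℂ → Prop} (hP : h.Pure1 P) {i : Fin 3} {σ : ℝ} {x y : ℂ} (hx : P x)
    (d : h.Rule1 i σ x y) :
    ∃ p w, ReflTransGen (h.Rule1 i σ) y p ∧ h.Ed 1 p w ∧ P p ∧ (σ = 1 → p ∈ side i) ∧
      (σ = -1 → p ∈ side (i + 2)) := by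
  have hσ := d.sign
  obtain ⟨x', b, k, h1, h2, h3⟩ := exists_chain_end (h := h)
    (Q := fun a b => (P a ∧ ReflTransGen (h.Rule1 i σ) y b) ∧ h.Rule1 i σ a b)
    (φ := fun v => σ * (coord (i + 2) v - coord i v))
    (fun a b hab => hab.2.ed.symm.mem)
    (fun a b hab => by
      have := hab.2.steep
      rcases hσ with rfl | rfl
      · have := (this.1 rfl).1; linarith
      · have := (this.2 rfl).1; linarith)
    (fun a b hab hb => by
      obtain ⟨z, hz⟩ := hab.2.next hP hab.1.1 hb
      exact ⟨z, ⟨(hP _ _ _ hab.1.1 hab.2.ed).2, hab.1.2.tail hz⟩, hz⟩)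
    ⟨⟨hx, ReflTransGen.refl⟩, d⟩
  refine ⟨b, x', h2.1.2, h2.2.ed.symm, (hP _ _ _ h2.1.1 h2.2.ed).2, ?_⟩
  rcases h2.2 with d | d
  · rcases d.1.symm.boundary h3 with ⟨h0, -⟩ | ⟨-, d'⟩
    · exact absurd h0 (by norm_num)
    · have := d.1.symm.type_unique d.symm.2.1 d'.2.1
      obtain rfl : k = i := by omega
      have := d.symm.sign_unique d'
      exact ⟨fun _ => h3, fun h => by linarith⟩
  · rcases d.1.symm.boundary h3 with ⟨h0, -⟩ | ⟨-, d'⟩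
    · exact absurd h0 (by norm_num)
    · have := d.1.symm.type_unique d.symm.2.1 d'.2.1
      obtain rfl : k = i + 2 := by omega
      have := d.symm.sign_unique d'
      exact ⟨fun h => by linarith, fun _ => h3⟩

/-- Every edge of colour `0` is connected to the side `∂₀T` by edges of colour `0` and `3`. -/
theorem Ed.exists_end_zero {x y : ℂ} (e : h.Ed 0 x y) :
    ∃ p w, p ∈ side 0 ∧ h.Ed 0 p w ∧ ReflTransGen h.Nbr03 x p := by
  have key : ∀ x y, (h.Rule0 0 1 x y ∨ h.Rule0 2 (-1) x y) →
      ∃ p w, p ∈ side 0 ∧ h.Ed 0 p w ∧ ReflTransGen h.Nbr03 x p := by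
    rintro x y (d | d)
    · obtain ⟨p, w, h1, h2, h3, -⟩ := d.exists_end
      exact ⟨p, w, h3 rfl, h2, .head d.nbr03 (chain_mono (fun _ _ => Rule0.nbr03) h1)⟩
    · obtain ⟨p, w, h1, h2, -, h3⟩ := d.exists_end
      exact ⟨p, w, h3 rfl, h2, .head d.nbr03 (chain_mono (fun _ _ => Rule0.nbr03) h1)⟩
  have key' : ∀ x y, (h.Rule0 0 1 y x ∨ h.Rule0 2 (-1) y x) →
      ∃ p w, p ∈ side 0 ∧ h.Ed 0 p w ∧ ReflTransGen h.Nbr03 x p := by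
    intro x y hd
    obtain ⟨p, w, h1, h2, h3⟩ := key y x hd
    have : h.Nbr03 y x := hd.elim Rule0.nbr03 Rule0.nbr03
    exact ⟨p, w, h1, h2, .head this.symm h3⟩
  obtain ⟨l, σ, d⟩ := e.exists_dart
  rcases d.2.2.1 with rfl | rfl <;> fin_cases l
  · exact key x y (Or.inr (Or.inr (Or.inl (by rw [neg_neg]; exact d))))
  · exact key' x y (Or.inl (Or.inr (Or.inl d.symm)))
  · exact key x y (Or.inl (Or.inl d))
  · exact key' x y (Or.inr (Or.inr (Or.inl d.symm)))
  · exact key x y (Or.inl (Or.inr (Or.inl d)))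
  · exact key' x y (Or.inl (Or.inl (by have := d.symm; rwa [neg_neg] at this)))

theorem reflTransGen_symm {R : ℂ → ℂ → Prop} (hR : ∀ x y, R x y → R y x) {x y : ℂ}
    (hxy : ReflTransGen R x y) : ReflTransGen R y x := by
  exact chain_mono (fun a b hab => hR _ _ hab) hxy.swap

theorem coord_pos_of_side {v : ℂ} (hv : v ∈ h.vertices) {i j : Fin 3} (hi : v ∈ side i)
    (hij : i ≠ j) : 0 < coord j v :=
  lt_of_le_of_ne (mem_triangle hv j) fun hh =>
    hij (side_unique hv hi ⟨mem_triangle hv, hh.symm⟩)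

theorem ne_of_side {v w : ℂ} (hv : v ∈ h.vertices) {i j : Fin 3} (hi : v ∈ side i)
    (hj : w ∈ side j) (hij : i ≠ j) : v ≠ w := by
  rintro rfl
  exact hij (side_unique hv hi hj)

/-- Two edges with a common point, none of them of colour `1`, share a vertex. -/
theorem Nbr03.meet {x y x' y' z : ℂ} (e : h.Nbr03 x y) (e' : h.Nbr03 x' y')
    (hz : z ∈ segment ℝ x y) (hz' : z ∈ segment ℝ x' y') :
    ∃ v, v ∈ s(x, y) ∧ v ∈ s(x', y') := by
  obtain ⟨c, hc, e⟩ : ∃ c, (c = 0 ∨ c = 3) ∧ h.Ed c x y := by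
    rcases e with e | e
    · exact ⟨0, by simp, e⟩
    · exact ⟨3, by simp, e⟩
  obtain ⟨c', hc', e'⟩ : ∃ c, (c = 0 ∨ c = 3) ∧ h.Ed c x' y' := by
    rcases e' with e | e
    · exact ⟨0, by simp, e⟩
    · exact ⟨3, by simp, e⟩
  by_cases hs : s(x, y) = s(x', y')
  · exact ⟨x, by simp, by rw [← hs]; simp⟩
  obtain ⟨l, hl⟩ := e.exists_type
  obtain ⟨l', hl'⟩ := e'.exists_type
  rcases e.meet e' hl hl' hs hz hz' with h1 | ⟨-, -, h1 | h1⟩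
  · exact ⟨z, h1⟩
  · omega
  · omega

/-- Two edges of colour `0` ending on `∂₀T` are connected by edges of colour `0` and `3`: the
monotone path from `p` to `∂₁T` meets the one from `p'` to `∂₂T`, and edges of these colours meet in
vertices. -/
theorem nbr03_connected_aux {p p' w w' : ℂ} (hp : p ∈ side 0) (hp' : p' ∈ side 0)
    (e : h.Ed 0 p w) (e' : h.Ed 0 p' w') (hle : coord 1 p' ≤ coord 1 p) :
    ReflTransGen h.Nbr03 p p' := by
  have dA : h.Rule0 0 (-1) p w := by
    rcases e.boundary hp with ⟨-, d⟩ | ⟨h0, -⟩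
    · exact Or.inr (Or.inl (by rw [neg_neg]; exact d))
    · exact absurd h0 (by norm_num)
  have dB : h.Rule0 2 1 p' w' := by
    rcases e'.boundary hp' with ⟨-, d⟩ | ⟨h0, -⟩
    · exact Or.inl d
    · exact absurd h0 (by norm_num)
  obtain ⟨r, wr, hpr, er, -, hr⟩ := dA.exists_end
  obtain ⟨s, ws, hps, es, hs, -⟩ := dB.exists_end
  replace hr : r ∈ side 1 := hr rfl
  replace hs := hs rfl
  have cA := (chain_restrict (fun _ _ => Rule0.nbr03)
    (ReflTransGen.head (r := h.Rule0 0 (-1)) dA hpr)).swap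
  have cB := (chain_restrict (fun _ _ => Rule0.nbr03)
    (ReflTransGen.head (r := h.Rule0 2 1) dB hps)).swap
  obtain ⟨x, y, x', y', ⟨a1, a2⟩, ⟨b1, b2⟩, z, hz, hz'⟩ :=
    exists_crossing (a := 0) (b := 1) (c := 2) (by decide) (by decide) (by decide)
    (fun x y hxy => ⟨hxy.2.steep.2 rfl, mem_triangle (hxy.2.nbr03.elim Ed.mem Ed.mem) 1⟩)
    (fun x y hxy => hxy.2.nbr03.symm.elim Ed.segment_subset Ed.segment_subset)
    cA cB (ne_of_side er.mem hr hp (by decide)) (ne_of_side es.mem hs hp' (by decide)) hr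
    (coord_pos_of_side er.mem hr (by decide)) hp (Or.inl hs.2) (Or.inl ⟨hp'.2, hle⟩)
  obtain ⟨v, hv, hv'⟩ := a2.nbr03.symm.meet b2.nbr03.symm hz hz'
  have hpv : ReflTransGen h.Nbr03 p v := by
    rcases Sym2.mem_iff.1 hv with rfl | rfl
    · exact a1.tail a2.nbr03
    · exact a1
  have hpv' : ReflTransGen h.Nbr03 p' v := by
    rcases Sym2.mem_iff.1 hv' with rfl | rfl
    · exact b1.tail b2.nbr03
    · exact b1
  exact hpv.trans (reflTransGen_symm (fun _ _ => Nbr03.symm) hpv')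

/-- All edges of colour `0` lie in one component of the part of colours `0` and `3`. -/
theorem nbr03_connected {x y x' y' : ℂ} (e : h.Ed 0 x y) (e' : h.Ed 0 x' y') :
    ReflTransGen h.Nbr03 x x' := by
  obtain ⟨p, w, hp, ep, h1⟩ := e.exists_end_zero
  obtain ⟨p', w', hp', ep', h2⟩ := e'.exists_end_zero
  have h2' := reflTransGen_symm (fun _ _ => Nbr03.symm) h2
  rcases le_total (coord 1 p') (coord 1 p) with hle | hle
  · exact (h1.trans (nbr03_connected_aux hp hp' ep ep' hle)).trans h2'
  · exact (h1.trans (reflTransGen_symm (fun _ _ => Nbr03.symm)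
      (nbr03_connected_aux hp' hp ep' ep hle))).trans h2'

end TriHoneycomb

namespace TriHoneycomb

open Relation

variable {n : ℕ} {h : TriHoneycomb n}

theorem exists_nbr_inner {v : ℂ} (hv : v ∈ h.vertices) :
    ∃ w, h.Inner w ∧ ReflTransGen h.Nbr v w := by
  rcases inner_or_side hv with hin | ⟨i, hi⟩
  · exact ⟨v, hin, ReflTransGen.refl⟩
  · obtain ⟨c, w, e⟩ := exists_Ed_of_mem hv
    exact ⟨w, e.inner_of_side hi, ReflTransGen.single e.1⟩

theorem Rule1.nbr {i : Fin 3} {σ : ℝ} {x y : ℂ} (d : h.Rule1 i σ x y) : h.Nbr x y := d.ed.1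

/-- A component consisting of edges of colour `1` reaches every side of the triangle. -/
theorem Pure1.exists_side_end {P : ℂ → Prop} (hP : h.Pure1 P) {v : ℂ} (hv : v ∈ h.vertices)
    (hPv : P v) (i : Fin 3) : ∃ b w, b ∈ side i ∧ h.Ed 1 b w ∧ P b ∧ ReflTransGen h.Nbr v b := by
  obtain ⟨u, hu, huv⟩ := exists_nbr_inner hv
  have hPu : P u := hP.closed hPv (fun _ _ h => h) huv
  obtain ⟨σ, hall⟩ := hu.exists_dart
  obtain ⟨x, d⟩ : ∃ x, h.Rule1 i 1 u x := by
    obtain ⟨c, w, d⟩ := hall (i + 2)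
    obtain ⟨c', w', d'⟩ := hall (i + 1)
    obtain ⟨rfl, -⟩ := hP _ _ _ hPu d.1
    obtain ⟨rfl, -⟩ := hP _ _ _ hPu d'.1
    rcases d.2.2.1 with rfl | rfl
    · exact ⟨w, Or.inl d⟩
    · exact ⟨w', Or.inr d'⟩
  obtain ⟨b, w, h1, h2, h3, h4, -⟩ := d.exists_end hP hPu
  exact ⟨b, w, h4 rfl, h2, h3,
    huv.trans (.head d.nbr (chain_mono (fun _ _ => Rule1.nbr) h1))⟩

theorem Rule0.unique_of_pos {x y z : ℂ} (d : h.Dart 0 1 1 x y) (d' : h.Rule0 2 1 x z) : z = y := by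
  rcases d' with d' | d' | d' | d'
  · exact d'.target_unique d
  · have := d'.sign_unique d; norm_num at this
  · have := d'.sign_unique d; norm_num at this
  · by_contra hne
    have := (d.corner d' (Ne.symm hne)).2.2 (by decide)
    simp at this

theorem Rule1.unique_of_neg {x y z : ℂ} (d : h.Dart 1 0 (-1) x y) (d' : h.Rule1 2 1 x z) :
    z = y := by
  rcases d' with d' | d'
  · have := d'.sign_unique d; norm_num at this
  · exact d'.target_unique d

/-- A path of colours `0` and `3` and a path of colour `1` which cross cannot both end on the
side `∂₂T`: after a crossing the latter stays on the wrong side of the former. -/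
theorem crossing_paths_absurd {P : ℂ → Prop} (hP : h.Pure1 P) {y x y' x' z : ℂ}
    (dA : h.Dart 0 1 1 y x) (dB : h.Dart 1 0 (-1) y' x') (hPy : P y')
    (hz : z ∈ openSegment ℝ y x) (hz' : z ∈ openSegment ℝ y' x') : False := by
  have rA : h.Rule0 2 1 y x := Or.inl dA
  have rB : h.Rule1 2 1 y' x' := Or.inr dB
  obtain ⟨p, wp, hyp, ep, hp, -⟩ := rA.exists_end
  obtain ⟨b, wb, hyb, eb, hPb, hb, -⟩ := rB.exists_end hP hPy
  replace hp := hp rfl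
  replace hb := hb rfl
  have cA : ReflTransGen (h.Rule0 2 1) y p := hyp.head rA
  have cB : ReflTransGen (fun u v => P u ∧ h.Rule1 2 1 u v) y' b := by
    refine chain_mono (fun u v huv => ⟨?_, huv.2⟩)
      (chain_restrict (R := h.Rule1 2 1) (fun u v huv => huv.nbr) (hyb.head rB))
    exact hP.closed hPy (fun _ _ h => h) huv.1
  have hyp' : y ≠ p := by
    rintro rfl
    rcases dA.1.boundary hp with ⟨-, d⟩ | ⟨h0, -⟩
    · have := dA.1.type_unique dA.2.1 d.2.1
      exact absurd this (by decide)
    · exact absurd h0 (by norm_num)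
  have hyb' : y' ≠ b := by
    rintro rfl
    rcases dB.1.boundary hb with ⟨h0, -⟩ | ⟨-, d⟩
    · exact absurd h0 (by norm_num)
    · have := dB.1.type_unique dB.2.1 d.2.1
      exact absurd this (by decide)
  obtain ⟨f, f1, -, f3, -, f5, f6, f7⟩ := exists_curve (a := 2) (b := 0) (c := 1)
    (fun u v (huv : h.Rule0 2 1 u v) => huv.steep.1 rfl) cA
  obtain ⟨k, k1, -, k3, -, k5, k6, k7⟩ := exists_curve (a := 2) (b := 0) (c := 1)
    (fun u v (huv : P u ∧ h.Rule1 2 1 u v) => huv.2.steep.1 rfl) cB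
  obtain ⟨-, hfz⟩ := f7 x (fun w hw => Rule0.unique_of_pos dA hw) hyp'
  obtain ⟨hkx, hkz⟩ := k7 x' (fun w hw => Rule1.unique_of_neg dB hw.2) hyb'
  set φ : ℂ → ℝ := fun v => coord 1 v - coord 2 v with hφ
  have hφp : φ p = coord 1 p := by have : coord 2 p = 0 := hp.2; simp [hφ, this]
  have hφb : φ b = coord 1 b := by have : coord 2 b = 0 := hb.2; simp [hφ, this]
  have hsp := coord_sum 0 p
  have hsb := coord_sum 0 b
  have hp2 : coord 2 p = 0 := hp.2
  have hb2 : coord 2 b = 0 := hb.2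
  simp only [zero_add] at hsp hsb
  -- On the side, colours do not decrease, so the path of colour `1` ends at the smaller parameter.
  have hbp : φ b ≤ φ p := by
    rw [hφp, hφb]
    by_contra hlt
    have : coord 0 b < coord 0 p := by linarith
    have := h.color_mono 2 ⟨_, eb.1⟩ ⟨_, ep.1⟩ b p (by simp) (by simp) hb hp this
    rw [eb.2, ep.2] at this
    omega
  -- interior points of a step lie strictly between its end points
  have hopen : ∀ {u v w : ℂ}, Steep 2 0 1 u v → w ∈ openSegment ℝ u v → φ u < φ w ∧ φ w < φ v := by
    rintro u v w hs ⟨α, β, hα, hβ, hαβ, rfl⟩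
    have h1 := hs.1
    simp only [hφ]
    rw [coord_convex _ _ _ hαβ, coord_convex _ _ _ hαβ]
    obtain rfl : α = 1 - β := by linarith
    constructor <;> nlinarith
  obtain ⟨hz1, hz2⟩ := hopen (rA.steep.1 rfl) hz
  obtain ⟨hz3, hz4⟩ := hopen (rB.steep.1 rfl) hz'
  have hzb : φ z ≤ φ b := hz4.le.trans hkx
  have hfc := continuous_of_abs_sub_le f1
  have hkc := continuous_of_abs_sub_le k1
  -- The last common parameter of the two graphs.
  set S : Set ℝ := Icc (φ z) (φ b) ∩ {t | f t = k t} with hS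
  have hScomp : IsCompact S := isCompact_Icc.inter_right (isClosed_eq hfc hkc)
  have hzS : φ z ∈ S := by
    refine ⟨⟨le_rfl, hzb⟩, ?_⟩
    have e1 := hfz z (openSegment_subset_segment ℝ _ _ hz)
    have e2 := hkz z (openSegment_subset_segment ℝ _ _ hz')
    exact e1.symm.trans e2
  obtain ⟨t, ⟨⟨ht1, ht2⟩, ht3⟩, htmax⟩ := hScomp.exists_isGreatest ⟨_, hzS⟩
  obtain ⟨a₁, a₂, rA', g1, g2, g3, g4⟩ := f5 t (hz1.trans_le ht1) (ht2.trans hbp)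
  obtain ⟨b₁, b₂, ⟨hPb₁, rB'⟩, g1', g2', g3', g4'⟩ := k5 t (hz3.trans_le ht1) ht2
  obtain ⟨w, hw, hwt⟩ := exists_mem_segment_value g1.le g2
  obtain ⟨w', hw', hwt'⟩ := exists_mem_segment_value g1'.le g2'
  obtain rfl : w = w' := by
    refine coord_frame_ext (a := 2) (b := 0) (c := 1) (by decide) (by decide) (by decide)
      (hwt.trans hwt'.symm) ?_
    rw [g4 w hw, g4' w' hw', hwt, hwt']
    exact ht3
  -- the common point at the last parameter is a crossing
  obtain ⟨lB, σB, dB', hlB⟩ : ∃ lB σB, h.Dart 1 lB σB b₁ b₂ ∧ (lB = 1 ∨ (lB = 0 ∧ σB = -1)) := by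
    rcases rB' with d | d
    · exact ⟨_, _, d, Or.inl (by decide)⟩
    · exact ⟨_, _, d, Or.inr ⟨by decide, rfl⟩⟩
  obtain ⟨cA', lA, σA, dA', hlA⟩ : ∃ cA lA σA, h.Dart cA lA σA a₁ a₂ ∧
      ((cA = 0 ∧ ((lA = 1 ∧ σA = 1) ∨ lA = 0)) ∨ cA = 3) := by
    rcases rA' with d | d | d | d
    · exact ⟨_, _, _, d, Or.inl ⟨rfl, Or.inl ⟨by decide, rfl⟩⟩⟩
    · exact ⟨_, _, _, d, Or.inl ⟨rfl, Or.inr (by decide)⟩⟩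
    · exact ⟨_, _, _, d, Or.inr rfl⟩
    · exact ⟨_, _, _, d, Or.inr rfl⟩
  have hcA : cA' ≠ 1 := by rcases hlA with ⟨h1, -⟩ | h1 <;> omega
  have hne : s(a₁, a₂) ≠ s(b₁, b₂) := fun hs =>
    hcA ((dA'.1.congr hs).color_unique dB'.1)
  rcases dA'.1.meet dB'.1 dA'.2.1 dB'.2.1 hne hw hw' with ⟨h1, h2⟩ | ⟨h1, h2, h3⟩
  · -- a common vertex would carry edges of both kinds
    have hPw : P w := by
      rcases Sym2.mem_iff.1 h2 with rfl | rfl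
      · exact hPb₁
      · exact (hP _ _ _ hPb₁ dB'.1).2
    obtain ⟨w₁, hw₁⟩ : ∃ w₁, h.Ed cA' w w₁ := by
      rcases Sym2.mem_iff.1 h1 with rfl | rfl
      · exact ⟨_, dA'.1⟩
      · exact ⟨_, dA'.1.symm⟩
    exact hcA (hP _ _ _ hPw hw₁).1
  · obtain ⟨hA1, hA2, hB1⟩ : lA = 1 ∧ σA = 1 ∧ lB = 0 := by
      rcases h3 with ⟨e1, e2, e3⟩ | ⟨e1, e2, e3⟩
      · rcases hlA with ⟨-, ⟨e4, e5⟩ | e4⟩ | e4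
        · subst e4
          exact ⟨rfl, e5, e3⟩
        · subst e4
          exfalso
          rcases hlB with h5 | ⟨h5, -⟩ <;> rw [h5] at e3 <;> exact absurd e3 (by decide)
        · omega
      · omega
    subst hA1 hA2 hB1
    obtain ⟨-, q1⟩ := hopen (rA'.steep.1 rfl) h1
    obtain ⟨-, q2⟩ := hopen (rB'.steep.1 rfl) h2
    have q3 : coord 0 a₁ = coord 0 a₂ - (φ a₂ - φ a₁) := by
      have e1 := dA'.2.1
      have e2 := coord_sum 0 a₁
      have e3 := coord_sum 0 a₂
      simp only [zero_add] at e2 e3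
      simp only [hφ]
      linarith
    have q4 : coord 0 b₁ = coord 0 b₂ := dB'.2.1
    set t' := min (φ a₂) (φ b₂) with ht'
    have htt' : t < t' := by
      rw [← hwt]
      exact lt_min q1 q2
    -- on the crossing edges the first path rises with slope one, and the second one is level
    have hft' : f t' = f t + (t' - t) := by
      obtain ⟨u, hu, hut⟩ := exists_mem_segment_value (a := 2) (c := 1) (t := t')
        (g1.le.trans htt'.le) (min_le_left _ _)
      have hline : ∀ u ∈ segment ℝ a₁ a₂, coord 0 u = coord 0 a₁ + (φ u - φ a₁) := by
        intro u hu
        obtain ⟨τ, -, -, rfl⟩ := exists_lineMap_of_mem hu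
        simp only [hφ] at q3 ⊢
        rw [coord_lineMap, coord_lineMap, coord_lineMap]
        linear_combination (-τ) * q3
      have e1 := g4 u hu
      have e2 := g4 w hw
      rw [hut] at e1
      rw [hwt] at e2
      have e3 := hline u hu
      have e4 := hline w hw
      simp only [hφ] at e3 e4
      rw [hut] at e3
      rw [hwt] at e4
      linarith
    have hkt' : k t' = k t := by
      obtain ⟨u, hu, hut⟩ := exists_mem_segment_value (a := 2) (c := 1) (t := t')
        (g1'.le.trans htt'.le) (min_le_right _ _)
      have hline : ∀ u ∈ segment ℝ b₁ b₂, coord 0 u = coord 0 b₁ := by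
        intro u hu
        obtain ⟨τ, -, -, rfl⟩ := exists_lineMap_of_mem hu
        rw [coord_lineMap, q4]
        ring
      have e1 := g4' u hu
      have e2 := g4' w hw'
      rw [hut] at e1
      rw [hwt] at e2
      rw [← e1, ← e2, hline u hu, hline w hw']
    have ht'b : t' ≤ φ b := (min_le_right _ _).trans g3'
    -- at the end of the second path the first one is not above it
    have hend : f (φ b) ≤ k (φ b) := by
      obtain ⟨c₁, c₂, rA'', m1, m2, -, m4⟩ := f5 (φ b) (hz1.trans_le hzb) hbp
      obtain ⟨u, hu, hut⟩ := exists_mem_segment_value m1.le m2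
      have e1 := m4 u hu
      rw [hut] at e1
      rw [← e1, k3 _ le_rfl]
      have hu2 : 0 ≤ coord 2 u := rA''.nbr03.elim
        (fun e => e.segment_subset hu 2) fun e => e.segment_subset hu 2
      have e2 := coord_sum 0 u
      simp only [zero_add] at e2
      rw [hφb] at hut
      linarith
    obtain ⟨t'', hm, hz0⟩ := isPreconnected_Icc.intermediate_value (f := fun t => f t - k t)
      (right_mem_Icc.2 ht'b) (left_mem_Icc.2 ht'b) (hfc.sub hkc).continuousOn
      (show (0 : ℝ) ∈ Icc _ _ from ⟨by linarith, by
        have : f t = k t := ht3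
        linarith⟩)
    have := htmax (show t'' ∈ S from ⟨⟨by linarith [hm.1], hm.2⟩, sub_eq_zero.1 hz0⟩)
    linarith [hm.1]

/-- An edge of colour `0` and a component consisting of edges of colour `1` exclude each other. -/
theorem Pure1.absurd_of_ed_zero {P : ℂ → Prop} (hP : h.Pure1 P) {v : ℂ} (hv : v ∈ h.vertices)
    (hPv : P v) {x y : ℂ} (e : h.Ed 0 x y) : False := by
  obtain ⟨p, w, hp, ep, -⟩ := e.exists_end_zero
  obtain ⟨b, wb, hb, eb, hPb, -⟩ := hP.exists_side_end hv hPv 0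
  have dA : h.Rule0 0 (-1) p w := by
    rcases ep.boundary hp with ⟨-, d⟩ | ⟨h0, -⟩
    · exact Or.inr (Or.inl (by rw [neg_neg]; exact d))
    · exact absurd h0 (by norm_num)
  have dB : h.Rule1 1 1 b wb := by
    rcases eb.boundary hb with ⟨h0, -⟩ | ⟨-, d⟩
    · exact absurd h0 (by norm_num)
    · exact Or.inr d
  obtain ⟨r, wr, hpr, er, -, hr⟩ := dA.exists_end
  obtain ⟨t, wt, hbt, et, hPt, ht, -⟩ := dB.exists_end hP hPb
  replace hr : r ∈ side 1 := hr rfl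
  replace ht := ht rfl
  have cA : ReflTransGen (fun u v => h.Rule0 0 (-1) v u) r p :=
    (ReflTransGen.head (r := h.Rule0 0 (-1)) dA hpr).swap
  have cB : ReflTransGen (fun u v => P u ∧ h.Rule1 1 1 u v) b t := by
    refine chain_mono (fun u v huv => ⟨?_, huv.2⟩)
      (chain_restrict (R := h.Rule1 1 1) (fun u v huv => huv.nbr) (hbt.head dB))
    exact hP.closed hPb (fun _ _ h => h) huv.1
  -- On `∂₀T` colour `1` is farther from the common corner of `∂₀T` and `∂₁T` than colour `0`, and
  -- on `∂₁T` it is nearer, so two paths joining these sides in the two colours have to meet.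
  have hle : coord 1 p ≤ coord 1 b := by
    by_contra hlt
    have := h.color_mono 0 ⟨_, eb.1⟩ ⟨_, ep.1⟩ b p (by simp) (by simp) hb hp (not_le.1 hlt)
    rw [eb.2, ep.2] at this
    omega
  have hle' : coord 2 r ≤ coord 2 t := by
    by_contra hlt
    have := h.color_mono 1 ⟨_, et.1⟩ ⟨_, er.1⟩ t r (by simp) (by simp) ht hr (not_le.1 hlt)
    rw [et.2, er.2] at this
    omega
  obtain ⟨x, y, x', y', a, ⟨hPx, b'⟩, z, hz, hz'⟩ :=
    exists_crossing (a := 0) (b := 1) (c := 2) (by decide) (by decide) (by decide)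
    (fun x y (hxy : h.Rule0 0 (-1) y x) =>
      ⟨hxy.steep.2 rfl, mem_triangle (hxy.nbr03.elim Ed.mem Ed.mem) 1⟩)
    (fun x y hxy => hxy.2.ed.segment_subset)
    cA cB (ne_of_side er.mem hr hp (by decide)) (ne_of_side eb.mem hb ht (by decide)) hr
    (coord_pos_of_side er.mem hr (by decide)) hp (Or.inr ⟨hb.2, hle⟩) (Or.inr ⟨ht.2, hle'⟩)
  obtain ⟨cA', lA, σA, dA', hlA⟩ : ∃ cA lA σA, h.Dart cA lA σA y x ∧
      ((cA = 0 ∧ ((lA = 1 ∧ σA = 1) ∨ lA = 2)) ∨ cA = 3) := by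
    rcases a with d | d | d | d
    · exact ⟨_, _, _, d, Or.inl ⟨rfl, Or.inr (by decide)⟩⟩
    · exact ⟨_, _, _, d, Or.inl ⟨rfl, Or.inl ⟨by decide, neg_neg _⟩⟩⟩
    · exact ⟨_, _, _, d, Or.inr rfl⟩
    · exact ⟨_, _, _, d, Or.inr rfl⟩
  obtain ⟨lB, σB, dB', hlB⟩ : ∃ lB σB, h.Dart 1 lB σB x' y' ∧ ((lB = 0 ∧ σB = 1) ∨ lB = 2) := by
    rcases b' with d | d
    · exact ⟨_, _, d, Or.inl ⟨by decide, rfl⟩⟩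
    · exact ⟨_, _, d, Or.inr (by decide)⟩
  have hcA : cA' ≠ 1 := by rcases hlA with ⟨h1, -⟩ | h1 <;> omega
  have hne : s(y, x) ≠ s(x', y') := fun hs => hcA ((dA'.1.congr hs).color_unique dB'.1)
  rw [segment_symm] at hz
  rcases dA'.1.meet dB'.1 dA'.2.1 dB'.2.1 hne hz hz' with ⟨h1, h2⟩ | ⟨h1, h2, h3⟩
  · have hPw : P z := by
      rcases Sym2.mem_iff.1 h2 with rfl | rfl
      · exact hPx
      · exact (hP _ _ _ hPx dB'.1).2
    obtain ⟨w₁, hw₁⟩ : ∃ w₁, h.Ed cA' z w₁ := by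
      rcases Sym2.mem_iff.1 h1 with rfl | rfl
      · exact ⟨_, dA'.1⟩
      · exact ⟨_, dA'.1.symm⟩
    exact hcA (hP _ _ _ hPw hw₁).1
  · rcases h3 with ⟨e1, e2, e3⟩ | ⟨e1, e2, e3⟩
    · rcases hlA with ⟨-, ⟨rfl, rfl⟩ | rfl⟩ | e4
      · rcases hlB with ⟨rfl, rfl⟩ | rfl
        · subst e1
          rw [openSegment_symm] at h2
          exact crossing_paths_absurd hP dA' dB'.symm (hP _ _ _ hPx dB'.1).2 h1 h2
        · exact absurd e3 (by decide)
      · rcases hlB with ⟨rfl, -⟩ | rfl <;> exact absurd e3 (by decide)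
      · omega
    · omega

/-- If all edges have colour `1`, then two edges ending on `∂₁T` are connected: the monotone path
from `p` to `∂₀T` meets the one from `p'` to `∂₂T`. -/
theorem pure1_connected_aux (hP : h.Pure1 fun _ => True) {p p' w w' : ℂ} (hp : p ∈ side 1)
    (hp' : p' ∈ side 1) (e : h.Ed 1 p w) (e' : h.Ed 1 p' w') (hle : coord 0 p' ≤ coord 0 p) :
    ReflTransGen h.Nbr p p' := by
  have dA : h.Rule1 1 (-1) p w := by
    rcases e.boundary hp with ⟨h0, -⟩ | ⟨-, d⟩
    · exact absurd h0 (by norm_num)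
    · exact Or.inl d
  have dB : h.Rule1 2 1 p' w' := by
    rcases e'.boundary hp' with ⟨h0, -⟩ | ⟨-, d⟩
    · exact absurd h0 (by norm_num)
    · exact Or.inr d
  obtain ⟨r, wr, hpr, er, -, -, hr⟩ := dA.exists_end hP trivial
  obtain ⟨s, ws, hps, es, -, hs, -⟩ := dB.exists_end hP trivial
  replace hr : r ∈ side 0 := hr rfl
  replace hs := hs rfl
  have cA := (chain_restrict (fun _ _ => Rule1.nbr)
    (ReflTransGen.head (r := h.Rule1 1 (-1)) dA hpr)).swap
  have cB := (chain_restrict (fun _ _ => Rule1.nbr)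
    (ReflTransGen.head (r := h.Rule1 2 1) dB hps)).swap
  obtain ⟨x, y, x', y', ⟨a1, a2⟩, ⟨b1, b2⟩, z, hz, hz'⟩ :=
    exists_crossing (a := 1) (b := 0) (c := 2) (by decide) (by decide) (by decide)
    (fun x y hxy => ⟨by
      have := hxy.2.ed
      rcases hxy.2 with d | d
      · obtain ⟨-, h2, -, h4⟩ := d
        have s1 := coord_sum 0 x
        have s2 := coord_sum 0 y
        simp only [Fin.reduceAdd, zero_add] at h2 h4 s1 s2
        refine ⟨by linarith, ?_⟩
        rw [abs_le]
        constructor <;> linarith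
      · obtain ⟨-, h2, -, h4⟩ := d
        have s1 := coord_sum 0 x
        have s2 := coord_sum 0 y
        simp only [Fin.reduceAdd, zero_add] at h2 h4 s1 s2
        refine ⟨by linarith, ?_⟩
        rw [abs_le]
        constructor <;> linarith, mem_triangle hxy.2.ed.mem 0⟩)
    (fun x y hxy => hxy.2.ed.symm.segment_subset)
    cA cB (ne_of_side er.mem hr hp (by decide)) (ne_of_side es.mem hs hp' (by decide)) hr
    (coord_pos_of_side er.mem hr (by decide)) hp (Or.inl hs.2) (Or.inl ⟨hp'.2, hle⟩)
  have hmeet : ∃ v, v ∈ s(x, y) ∧ v ∈ s(x', y') := by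
    by_cases hss : s(x, y) = s(x', y')
    · exact ⟨x, by simp, by rw [← hss]; simp⟩
    obtain ⟨l, hl⟩ := a2.ed.symm.exists_type
    obtain ⟨l', hl'⟩ := b2.ed.symm.exists_type
    rcases a2.ed.symm.meet b2.ed.symm hl hl' hss hz hz' with h1 | ⟨-, -, h1 | h1⟩
    · exact ⟨z, h1⟩
    · omega
    · omega
  obtain ⟨v, hv, hv'⟩ := hmeet
  have hpv : ReflTransGen h.Nbr p v := by
    rcases Sym2.mem_iff.1 hv with rfl | rfl
    · exact a1.tail a2.nbr
    · exact a1
  have hpv' : ReflTransGen h.Nbr p' v := by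
    rcases Sym2.mem_iff.1 hv' with rfl | rfl
    · exact b1.tail b2.nbr
    · exact b1
  exact hpv.trans (reflTransGen_symm (fun _ _ => Nbr.symm) hpv')

/-- The structure graph of a triangular honeycomb is connected. -/
theorem nbr_connected {v w : ℂ} (hv : v ∈ h.vertices) (hw : w ∈ h.vertices) :
    ReflTransGen h.Nbr v w := by
  by_cases h0 : ∃ x y, h.Ed 0 x y
  · obtain ⟨x, y, e⟩ := h0
    have key : ∀ v ∈ h.vertices, ReflTransGen h.Nbr v x := by
      intro v hv
      by_contra hvx
      -- The component of a vertex not connected to `x` has only edges of colour `1`.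
      have hP : h.Pure1 fun u => u ∈ h.vertices ∧ ReflTransGen h.Nbr v u := by
        rintro a b c ⟨ha, hva⟩ ec
        have hb : b ∈ h.vertices ∧ ReflTransGen h.Nbr v b := ⟨ec.symm.mem, hva.tail ec.1⟩
        refine ⟨?_, hb⟩
        rcases ec.color_mem with rfl | rfl | rfl
        · exact absurd (hva.trans (chain_mono (fun _ _ => Nbr03.nbr) (nbr03_connected ec e))) hvx
        · rfl
        · exfalso
          -- an edge of colour `3` is adjacent to an edge of colour `0`
          rcases inner_or_side ha with hin | ⟨i, hi⟩
          · obtain ⟨l, σ, d⟩ := ec.exists_dart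
            obtain ⟨c₁, w₁, c₂, w₂, d₁, -, hc⟩ := hin.colors d
            rcases hc with ⟨h0, -⟩ | ⟨h0, -⟩ | ⟨-, rfl, -⟩
            · exact absurd h0 (by norm_num)
            · exact absurd h0 (by norm_num)
            · exact hvx (hva.trans (chain_mono (fun _ _ => Nbr03.nbr) (nbr03_connected d₁.1 e)))
          · rcases ec.boundary hi with ⟨h0, -⟩ | ⟨h0, -⟩ <;> exact absurd h0 (by norm_num)
      exact hP.absurd_of_ed_zero hv ⟨hv, ReflTransGen.refl⟩ e
    exact (key v hv).trans (reflTransGen_symm (fun _ _ => Nbr.symm) (key w hw))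
  · have hP : h.Pure1 fun _ => True := by
      rintro a b c - ec
      refine ⟨?_, trivial⟩
      rcases ec.color_mem with rfl | rfl | rfl
      · exact absurd ⟨_, _, ec⟩ h0
      · rfl
      · exfalso
        rcases inner_or_side ec.mem with hin | ⟨i, hi⟩
        · obtain ⟨l, σ, d⟩ := ec.exists_dart
          obtain ⟨c₁, w₁, c₂, w₂, d₁, -, hc⟩ := hin.colors d
          rcases hc with ⟨h0, -⟩ | ⟨h0, -⟩ | ⟨-, rfl, -⟩
          · exact absurd h0 (by norm_num)
          · exact absurd h0 (by norm_num)
          · exact h0 ⟨_, _, d₁.1⟩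
        · rcases ec.boundary hi with ⟨h0, -⟩ | ⟨h0, -⟩ <;> exact absurd h0 (by norm_num)
    obtain ⟨p, wp, hp, ep, -, hvp⟩ := hP.exists_side_end hv trivial 1
    obtain ⟨p', wp', hp', ep', -, hwp⟩ := hP.exists_side_end hw trivial 1
    have hpp : ReflTransGen h.Nbr p p' := by
      rcases le_total (coord 0 p') (coord 0 p) with hle | hle
      · exact pure1_connected_aux hP hp hp' ep ep' hle
      · exact reflTransGen_symm (fun _ _ => Nbr.symm) (pure1_connected_aux hP hp' hp ep' ep hle)
    exact (hvp.trans hpp).trans (reflTransGen_symm (fun _ _ => Nbr.symm) hwp)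

end TriHoneycomb

/-! ### Finiteness of the set of structure graphs -/

namespace TriHoneycomb

open Relation

variable {n : ℕ} {h : TriHoneycomb n}

/-- The steps of a zigzag path: edges of type `i + 2` and `i + 1`, of any colour, are traversed
alternately in positive and in negative direction. -/
def Zig (h : TriHoneycomb n) (i : Fin 3) (x y : ℂ) : Prop :=
  ∃ c, h.Dart c (i + 2) 1 x y ∨ h.Dart c (i + 1) (-1) x y

theorem Zig.forward_unique {i : Fin 3} {x y y' : ℂ} (d : h.Zig i x y) (d' : h.Zig i x y') :
    y = y' := by
  obtain ⟨c, d | d⟩ := d <;> obtain ⟨c', d' | d'⟩ := d'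
  · exact d.target_unique d'
  · have := d.sign_unique d'; norm_num at this
  · have := d.sign_unique d'; norm_num at this
  · exact d.target_unique d'

theorem Zig.backward_unique {i : Fin 3} {x x' y : ℂ} (d : h.Zig i x y) (d' : h.Zig i x' y) :
    x = x' := by
  obtain ⟨c, d | d⟩ := d <;> obtain ⟨c', d' | d'⟩ := d'
  · exact d.symm.target_unique d'.symm
  · have := d.symm.sign_unique d'.symm; norm_num at this
  · have := d.symm.sign_unique d'.symm; norm_num at this
  · exact d.symm.target_unique d'.symm

theorem Zig.coord_lt {i : Fin 3} {x y : ℂ} (d : h.Zig i x y) : coord i y < coord i x ∧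
    coord (i + 1) x ≤ coord (i + 1) y ∧ coord (i + 2) x ≤ coord (i + 2) y := by
  have s1 := coord_sum i x
  have s2 := coord_sum i y
  obtain ⟨c, ⟨-, h2, -, h4⟩ | ⟨-, h2, -, h4⟩⟩ := d
  · rw [show i + 2 + 2 = i + 1 by omega] at h4
    exact ⟨by linarith, by linarith, by linarith⟩
  · rw [show i + 1 + 2 = i by omega] at h4
    exact ⟨by linarith, by linarith, by linarith⟩

theorem Zig.chain_coord_le {i : Fin 3} {x y : ℂ} (hxy : ReflTransGen (h.Zig i) x y) :
    coord i y ≤ coord i x ∧ coord (i + 1) x ≤ coord (i + 1) y ∧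
      coord (i + 2) x ≤ coord (i + 2) y := by
  induction hxy with
  | refl => exact ⟨le_rfl, le_rfl, le_rfl⟩
  | tail _ hab ih =>
    obtain ⟨h1, h2, h3⟩ := hab.coord_lt
    exact ⟨by linarith, by linarith, by linarith⟩

theorem vertices_subset_support : h.vertices ⊆ h.support := by
  rintro v ⟨e, he, hv⟩
  refine mem_biUnion he ?_
  obtain ⟨w, rfl⟩ := Sym2.mem_iff_exists.1 hv
  exact left_mem_segment ℝ v w

theorem support_side (i : Fin 3) : h.support ∩ side i = h.vertices ∩ side i := by
  apply Subset.antisymm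
  · rintro v ⟨h1, h2⟩
    refine ⟨?_, h2⟩
    have : v ∈ h.support ∩ ⋃ i, side i := ⟨h1, mem_iUnion.2 ⟨i, h2⟩⟩
    rw [h.support_inter_boundary] at this
    exact this.1
  · exact inter_subset_inter_left _ vertices_subset_support

/-- A zigzag path of kind `i` ends on `∂_iT`: it can be continued at every inner vertex, and the
direction of its last step determines the side. -/
theorem Zig.exists_end {i : Fin 3} {x y : ℂ} (d : h.Zig i x y) :
    ∃ p ∈ h.vertices ∩ side i, ReflTransGen (h.Zig i) x p := by
  have hmem : ∀ a b, h.Zig i a b → b ∈ h.vertices := by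
    rintro a b ⟨c, d | d⟩ <;> exact d.1.symm.mem
  obtain ⟨x', b, k, h1, h2, h3⟩ := exists_chain_end (h := h) (Q := h.Zig i)
    (φ := fun v => - coord i v) hmem
    (fun a b hab => by
      have := hab.coord_lt
      linarith)
    (fun a b hab hb => by
      obtain ⟨σ, hall⟩ := hb.exists_dart
      obtain ⟨c, d | d⟩ := hab
      · obtain ⟨c', z, d'⟩ := hall (i + 1)
        have := d.symm.sign_unique d'
        subst this
        exact ⟨z, c', Or.inr d'⟩
      · obtain ⟨c', z, d'⟩ := hall (i + 2)
        have := d.symm.sign_unique d'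
        rw [neg_neg] at this
        subst this
        exact ⟨z, c', Or.inl d'⟩)
    d
  refine ⟨b, ⟨hmem _ _ h2, ?_⟩, h1.tail h2⟩
  obtain ⟨c, d | d⟩ := h2
  · rcases d.1.symm.boundary h3 with ⟨rfl, d'⟩ | ⟨rfl, d'⟩
    · have := d.symm.sign_unique d'; norm_num at this
    · have := d.1.symm.type_unique d.symm.2.1 d'.2.1
      obtain rfl : i = k := by omega
      exact h3
  · rcases d.1.symm.boundary h3 with ⟨rfl, d'⟩ | ⟨rfl, d'⟩
    · have := d.1.symm.type_unique d.symm.2.1 d'.2.1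
      obtain rfl : i = k := by omega
      exact h3
    · have := d.symm.sign_unique d'; norm_num at this

/-- A zigzag path of kind `i` and one of kind `i + 1` share at most one edge of type `i + 2`. -/
theorem zig_unique {i : Fin 3} {c c' : ℕ} {v w v' w' p p' : ℂ} (d : h.Dart c (i + 2) 1 v w)
    (d' : h.Dart c' (i + 2) 1 v' w') (hp : ReflTransGen (h.Zig i) v p)
    (hp' : ReflTransGen (h.Zig (i + 1)) w p') (gp : ReflTransGen (h.Zig i) v' p)
    (gp' : ReflTransGen (h.Zig (i + 1)) w' p') : v = v' := by
  -- Suppose that `v'` comes after `v` on the first path. The coordinates are monotone along both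
  -- kinds of paths, in incompatible ways, which excludes that a path of the second kind joins `w`
  -- and `w'`.
  have key : ∀ {c c' : ℕ} {v w v' w' : ℂ}, h.Dart c (i + 2) 1 v w → h.Dart c' (i + 2) 1 v' w' →
      ReflTransGen (h.Zig i) v v' →
      (ReflTransGen (h.Zig (i + 1)) w w' ∨ ReflTransGen (h.Zig (i + 1)) w' w) → v = v' := by
    intro c c' v w v' w' d d' hvv hww
    by_contra hne
    rcases hvv.cases_head with h1 | ⟨u, hvu, huv⟩
    · exact hne h1
    obtain rfl : w = u := Zig.forward_unique ⟨c, Or.inl d⟩ hvu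
    rcases hww with hww | hww
    · have h1 := (Zig.chain_coord_le hww).2.2
      have h2 := (Zig.chain_coord_le huv).1
      have h3 := (Zig.coord_lt ⟨c', Or.inl d'⟩).1
      rw [show i + 1 + 2 = i by omega] at h1
      linarith
    · have h1 := (Zig.chain_coord_le hww).2.1
      rw [show i + 1 + 1 = i + 2 by omega] at h1
      rcases huv.cases_head with rfl | ⟨u, hwu, huv'⟩
      · have := d.symm.sign_unique d'; norm_num at this
      · have h2 := (Zig.chain_coord_le huv').2.2
        have h3 := d'.2.1
        obtain ⟨c₁, d₁ | d₁⟩ := hwu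
        · have := d.symm.sign_unique d₁; norm_num at this
        · have s1 := coord_sum i w
          have s2 := coord_sum i u
          have h4 := d₁.2.1
          have h5 := d₁.2.2.2
          rw [show i + 1 + 2 = i by omega] at h5
          linarith
  -- Steps are unique backwards, so two paths with the same end are nested.
  have tot : ∀ {j : Fin 3} {a b p : ℂ}, ReflTransGen (h.Zig j) a p → ReflTransGen (h.Zig j) b p →
      ReflTransGen (h.Zig j) a b ∨ ReflTransGen (h.Zig j) b a := by
    intro j a b p ha hb
    have := ReflTransGen.total_of_right_unique (r := Function.swap (h.Zig j))
      (fun x y z hy hz => Zig.backward_unique hy hz) ha.swap hb.swap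
    exact this.symm.imp (fun h => h.swap) fun h => h.swap
  rcases tot hp gp with h1 | h1
  · exact key d d' h1 (tot hp' gp')
  · exact (key d' d h1 (tot hp' gp').symm).symm

/-- An edge is determined by its type and by the boundary points where its two zigzag paths end, so
there are at most `n * n` edges of each type. -/
theorem ncard_vertices_le (h : TriHoneycomb n) : h.vertices.ncard ≤ 6 * (n * n) := by
  -- The edges of type `i + 2`, oriented in positive direction.
  set D : Fin 3 → Set (ℂ × ℂ) := fun i => {p | ∃ c, h.Dart c (i + 2) 1 p.1 p.2} with hD
  have hDc : ∀ i, (D i).Finite ∧ (D i).ncard ≤ n * n := by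
    intro i
    have hex : ∀ q ∈ D i, ∃ r : ℂ × ℂ, r ∈ (h.vertices ∩ side i) ×ˢ (h.vertices ∩ side (i + 1)) ∧
        ReflTransGen (h.Zig i) q.1 r.1 ∧ ReflTransGen (h.Zig (i + 1)) q.2 r.2 := by
      rintro ⟨v, w⟩ ⟨c, d⟩
      obtain ⟨p, hp, hvp⟩ := Zig.exists_end (h := h) (i := i) ⟨c, Or.inl d⟩
      obtain ⟨p', hp', hwp⟩ := Zig.exists_end (h := h) (i := i + 1) (x := w) (y := v) ⟨c, Or.inr (by
        rw [show i + 1 + 1 = i + 2 by omega]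
        exact d.symm)⟩
      exact ⟨(p, p'), ⟨hp, hp'⟩, hvp, hwp⟩
    choose! r hr1 hr2 hr3 using hex
    have hinj : InjOn r (D i) := by
      rintro ⟨v, w⟩ hq ⟨v', w'⟩ hq' heq
      have a1 := hr2 _ hq
      have a2 := hr3 _ hq
      have b1 := hr2 _ hq'
      have b2 := hr3 _ hq'
      rw [heq] at a1 a2
      obtain ⟨c, d⟩ := hq
      obtain ⟨c', d'⟩ := hq'
      obtain rfl : v = v' := zig_unique d d' a1 a2 b1 b2
      obtain rfl : w = w' := d.target_unique d'
      rfl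
    have hfin : ((h.vertices ∩ side i) ×ˢ (h.vertices ∩ side (i + 1))).Finite :=
      (h.finite_vertices.inter_of_left _).prod (h.finite_vertices.inter_of_left _)
    refine ⟨Set.Finite.of_finite_image (hfin.subset (image_subset_iff.2 hr1)) hinj, ?_⟩
    refine (ncard_le_ncard_of_injOn r hr1 hinj hfin).trans ?_
    rw [ncard_prod, ← support_side, ← support_side, h.ncard_side, h.ncard_side]
  have hsub : h.vertices ⊆ (Prod.fst '' D 0 ∪ Prod.snd '' D 0) ∪
      ((Prod.fst '' D 1 ∪ Prod.snd '' D 1) ∪ (Prod.fst '' D 2 ∪ Prod.snd '' D 2)) := by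
    intro v hv
    obtain ⟨c, w, e⟩ := exists_Ed_of_mem hv
    obtain ⟨l, σ, d⟩ := e.exists_dart
    obtain ⟨i, rfl⟩ : ∃ i, l = i + 2 := ⟨l + 1, by omega⟩
    have : v ∈ Prod.fst '' D i ∪ Prod.snd '' D i := by
      rcases d.2.2.1 with rfl | rfl
      · exact Or.inl ⟨(v, w), ⟨c, d⟩, rfl⟩
      · refine Or.inr ⟨(w, v), ⟨c, ?_⟩, rfl⟩
        have := d.symm
        rwa [neg_neg] at this
    fin_cases i
    · exact Or.inl this
    · exact Or.inr (Or.inl this)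
    · exact Or.inr (Or.inr this)
  have hU : ∀ i, (Prod.fst '' D i ∪ Prod.snd '' D i).Finite ∧
      (Prod.fst '' D i ∪ Prod.snd '' D i).ncard ≤ n * n + n * n := fun i =>
    ⟨((hDc i).1.image _).union ((hDc i).1.image _), (ncard_union_le _ _).trans
      (add_le_add ((ncard_image_le (hDc i).1).trans (hDc i).2)
        ((ncard_image_le (hDc i).1).trans (hDc i).2))⟩
  refine (ncard_le_ncard hsub ((hU 0).1.union ((hU 1).1.union (hU 2).1))).trans ?_
  refine (ncard_union_le _ _).trans ?_
  have h1 := ncard_union_le (Prod.fst '' D 1 ∪ Prod.snd '' D 1) (Prod.fst '' D 2 ∪ Prod.snd '' D 2)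
  have h2 := (hU 0).2
  have h3 := (hU 1).2
  have h4 := (hU 2).2
  omega

/-- A finite type of codes for structure graphs on vertices in `Fin B`: the set of vertices, the
edges of each colour, the vertices on the sides, and their order. -/
abbrev Code (B : ℕ) : Type :=
  (Fin B → Prop) × (Fin 4 → Fin B → Fin B → Prop) × (Fin 3 → Fin B → Prop) ×
    (Fin 3 → Fin B → Fin B → Prop)

theorem exists_embedding (h : TriHoneycomb n) :
    ∃ f : h.vertices → Fin (6 * (n * n)), Function.Injective f := by
  have := h.finite_vertices.to_subtype
  have : Fintype h.vertices := Fintype.ofFinite _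
  obtain ⟨f⟩ : Nonempty (h.vertices ↪ Fin (6 * (n * n))) := by
    apply Function.Embedding.nonempty_of_card_le
    rw [Fintype.card_fin, ← Nat.card_eq_fintype_card]
    exact h.ncard_vertices_le
  exact ⟨f, f.injective⟩

/-- The code of the structure graph of a honeycomb, read through an arbitrary numbering of the
vertices. -/
def code (h : TriHoneycomb n) : Code (6 * (n * n)) :=
  let f := h.exists_embedding.choose
  ⟨fun x => ∃ a, f a = x, fun c x y => ∃ a b, f a = x ∧ f b = y ∧ h.Ed c a b,
    fun i x => ∃ a, f a = x ∧ (a : ℂ) ∈ side i,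
    fun i x y => ∃ a b, f a = x ∧ f b = y ∧ coord (i + 1) (a : ℂ) < coord (i + 1) (b : ℂ)⟩

/-- Honeycombs with the same code have isomorphic structure graphs: equal numbers are matched. -/
theorem nonempty_iso_of_code_eq {h h' : TriHoneycomb n} (hc : h.code = h'.code) :
    Nonempty (Iso h h') := by
  set f := h.exists_embedding.choose with hf
  set f' := h'.exists_embedding.choose with hf'
  have finj : Function.Injective f := h.exists_embedding.choose_spec
  have finj' : Function.Injective f' := h'.exists_embedding.choose_spec
  simp only [code, ← hf, ← hf', Prod.mk.injEq, funext_iff, eq_iff_iff] at hc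
  obtain ⟨h1, h2, h3, h4⟩ := hc
  have hr : range f = range f' := by
    ext x
    exact h1 x
  set g : h.vertices ≃ h'.vertices := (Equiv.ofInjective f finj).trans
    ((Equiv.setCongr hr).trans (Equiv.ofInjective f' finj').symm) with hg
  have hfg : ∀ a, f' (g a) = f a := by
    intro a
    have := Equiv.apply_ofInjective_symm finj' (Equiv.setCongr hr (Equiv.ofInjective f finj a))
    exact this
  have ed : ∀ (c : Fin 4) (a b : h.vertices), h.Ed c a b ↔ h'.Ed c (g a) (g b) := by
    intro c a b
    have := h2 c (f a) (f b)
    constructor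
    · intro e
      obtain ⟨a', b', ha, hb, e'⟩ := this.1 ⟨a, b, rfl, rfl, e⟩
      rw [← hfg] at ha hb
      rwa [← finj' ha, ← finj' hb]
    · intro e
      obtain ⟨a', b', ha, hb, e'⟩ := this.2 ⟨g a, g b, hfg a, hfg b, e⟩
      rwa [← finj ha, ← finj hb]
  have col : ∀ {k : TriHoneycomb n} {a b : ℂ} (hab : s(a, b) ∈ k.edges),
      ∃ c : Fin 4, k.Ed c a b := by
    intro k a b hab
    rcases k.color_mem ⟨_, hab⟩ with hh | hh | hh
    · exact ⟨0, hab, hh⟩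
    · exact ⟨1, hab, hh⟩
    · exact ⟨3, hab, hh⟩
  refine ⟨⟨g, fun a b => ⟨fun hab => ?_, fun hab => ?_⟩, fun a b hab hab' => ?_, fun i a => ?_,
    fun i a b _ _ => ?_⟩⟩
  · obtain ⟨c, e⟩ := col hab
    exact ((ed c a b).1 e).1
  · obtain ⟨c, e⟩ := col hab
    exact ((ed c a b).2 e).1
  · obtain ⟨c, e⟩ := col hab
    rw [e.2, ((ed c a b).1 e).2]
  · constructor
    · intro ha
      obtain ⟨a', ha', hs⟩ := (h3 i (f a)).1 ⟨a, rfl, ha⟩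
      rw [← hfg] at ha'
      rwa [← finj' ha']
    · intro ha
      obtain ⟨a', ha', hs⟩ := (h3 i (f a)).2 ⟨g a, hfg a, ha⟩
      rwa [← finj ha']
  · constructor
    · intro ha
      obtain ⟨a', b', ha', hb', hs⟩ := (h4 i (f a) (f b)).1 ⟨a, b, rfl, rfl, ha⟩
      rw [← hfg] at ha' hb'
      rwa [← finj' ha', ← finj' hb']
    · intro ha
      obtain ⟨a', b', ha', hb', hs⟩ := (h4 i (f a) (f b)).2 ⟨g a, g b, hfg a, hfg b, ha⟩
      rwa [← finj ha', ← finj hb']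

end TriHoneycomb

/-- There are finitely many structure graphs: a class is determined by the codes of the triangles.
-/
instance finite_graphClass {ι : Type} [Finite ι] {p : ℕ} (𝒯 : TriangleGluing ι p) (n : ℕ) :
    Finite (GraphClass 𝒯 n) := by
  refine Finite.of_injective
    (fun (G : GraphClass 𝒯 n) (i : ι) => ((Quotient.out G).tri i).code) fun G G' hG => ?_
  rw [← Quotient.out_eq G, ← Quotient.out_eq G']
  refine Quotient.sound ⟨fun i => ?_⟩
  exact Classical.choice (TriHoneycomb.nonempty_iso_of_code_eq (congrFun hG i))

/-! ### Deformations of a honeycomb -/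

theorem angle_dir_of_pos {l l' : Fin 3} {r r' : ℝ} (hl : l ≠ l') (hr : 0 < r * r') :
    InnerProductGeometry.angle ((r : ℂ) * dir l) ((r' : ℂ) * dir l') = 2 * Real.pi / 3 := by
  have h1 : Real.arccos (1 / 2) = Real.pi / 3 := by
    rw [← Real.cos_pi_div_three]
    exact Real.arccos_cos (by positivity) (by linarith [Real.pi_pos])
  rw [InnerProductGeometry.angle, inner_dir, norm_dir, norm_dir, if_neg hl, ← abs_mul,
    abs_of_pos hr, mul_div_cancel_left₀ _ hr.ne', neg_div, Real.arccos_neg, h1]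
  ring

theorem angle_dir_of_neg {l l' : Fin 3} {r r' : ℝ} (hl : l ≠ l') (hr : r * r' < 0) :
    InnerProductGeometry.angle ((r : ℂ) * dir l) ((r' : ℂ) * dir l') = Real.pi / 3 := by
  have h1 := angle_dir_of_pos (r := r) (r' := -r') hl (by linarith)
  have h2 : (((-r' : ℝ) : ℂ) * dir l') = -((r' : ℂ) * dir l') := by push_cast; ring
  rw [h2, InnerProductGeometry.angle_neg_right] at h1
  linarith

theorem inc_neg_iff {k l : Fin 3} : inc k l < 0 ↔ k = l + 1 := by
  unfold inc
  split_ifs with h1 h2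
  · subst h1
    simp
  · simp [h2]
  · simp only [h2, iff_false]
    norm_num

theorem angleFromTo_of_type {a b a' b' : ℂ} {l : Fin 3} (hab : a ≠ b) (hab' : a' ≠ b')
    (h : coord l a = coord l b) (h' : coord (l + 2) a' = coord (l + 2) b') :
    AngleFromTo s(a, b) s(a', b') (Real.pi / 3) := by
  have key : ∀ x y x' y' : ℂ, coord l x = coord l y → coord (l + 2) x' = coord (l + 2) y' →
      coord (l + 2) x < coord (l + 2) y → coord (l + 2 + 2) y' < coord (l + 2 + 2) x' →
      0 < det2 (y - x) (y' - x') ∧ InnerProductGeometry.angle (y - x) (y' - x') = Real.pi / 3 := by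
    intro x y x' y' e e' hlt hlt'
    rw [sub_eq_dir e, sub_eq_dir e', det2_dir]
    have h0 : (coord (l + 2) y - coord (l + 2) x) *
        (coord (l + 2 + 2) y' - coord (l + 2 + 2) x') < 0 :=
      mul_neg_of_pos_of_neg (by linarith) (by linarith)
    have h1 : inc (l + 2) l = 1 := by fin_cases l <;> simp [inc]
    refine ⟨?_, angle_dir_of_neg (by omega) h0⟩
    rw [h1]
    have h3 : 0 < √3 := by positivity
    nlinarith
  have hne : coord (l + 2) a ≠ coord (l + 2) b := fun hh =>
    hab (coord_ext (i := l) (j := l + 2) (by omega) h hh)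
  have hne' : coord (l + 2 + 2) a' ≠ coord (l + 2 + 2) b' := fun hh =>
    hab' (coord_ext (i := l + 2) (j := l + 2 + 2) (by omega) h' hh)
  rcases lt_or_gt_of_ne hne with h1 | h1 <;> rcases lt_or_gt_of_ne hne' with h2 | h2
  · exact ⟨a, b, b', a', rfl, Sym2.eq_swap, key a b b' a' h h'.symm h1 h2⟩
  · exact ⟨a, b, a', b', rfl, rfl, key a b a' b' h h' h1 h2⟩
  · exact ⟨b, a, b', a', Sym2.eq_swap, Sym2.eq_swap, key b a b' a' h.symm h'.symm h1 h2⟩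
  · exact ⟨b, a, a', b', Sym2.eq_swap, rfl, key b a a' b' h.symm h' h1 h2⟩

theorem convex_triangle : Convex ℝ triangle := by
  intro x hx y hy α β hα hβ hαβ k
  rw [coord_convex k x y hαβ]
  exact add_nonneg (mul_nonneg hα (hx k)) (mul_nonneg hβ (hy k))

theorem hasType_of_coord_eq {a b : ℂ} {l : Fin 3} (ha : a ∈ triangle) (hl : coord l a = coord l b) :
    HasType s(a, b) l := by
  refine ⟨a, ha, ?_⟩
  rintro z (hz : z ∈ segment ℝ a b)
  obtain ⟨t, -, -, rfl⟩ := exists_lineMap_of_mem hz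
  refine ⟨t * (coord (l + 2) b - coord (l + 2) a), ?_⟩
  rw [sub_eq_dir hl, Complex.real_smul]
  push_cast
  ring

namespace TriHoneycomb

variable {n : ℕ}

/-- A displacement of the vertices of a honeycomb that keeps the combinatorial structure: the
edges keep their directions, the boundary vertices stay on their sides in the same order, and
disjoint edges stay disjoint. -/
structure IsDeformation (h : TriHoneycomb n) (pos : ℂ → ℂ) : Prop where
  injOn : InjOn pos h.vertices
  mem : ∀ a ∈ h.vertices, pos a ∈ triangle
  side_iff : ∀ a ∈ h.vertices, ∀ i, pos a ∈ side i ↔ a ∈ side i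
  type_eq : ∀ a b l, s(a, b) ∈ h.edges → coord l a = coord l b → coord l (pos a) = coord l (pos b)
  orient : ∀ a b l, s(a, b) ∈ h.edges → coord l a = coord l b →
    coord (l + 2) a < coord (l + 2) b → coord (l + 2) (pos a) < coord (l + 2) (pos b)
  order : ∀ i, ∀ a ∈ h.vertices, ∀ b ∈ h.vertices, a ∈ side i → b ∈ side i →
    coord (i + 1) a < coord (i + 1) b → coord (i + 1) (pos a) < coord (i + 1) (pos b)
  disjoint : ∀ a b a' b', s(a, b) ∈ h.edges → s(a', b') ∈ h.edges →
    Disjoint (segment ℝ a b) (segment ℝ a' b') →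
    Disjoint (segment ℝ (pos a) (pos b)) (segment ℝ (pos a') (pos b'))

namespace IsDeformation

variable {h : TriHoneycomb n} {pos : ℂ → ℂ} (D : h.IsDeformation pos)

include D

theorem map_injOn : InjOn (Sym2.map pos) h.edges := by
  intro e he e' he' heq
  induction e using Sym2.ind with
  | _ a b =>
  induction e' using Sym2.ind with
  | _ a' b' =>
  obtain ⟨c, e⟩ := exists_Ed he
  obtain ⟨c', e'⟩ := exists_Ed he'
  simp only [Sym2.map_mk, Sym2.eq_iff] at heq ⊢
  rcases heq with ⟨h1, h2⟩ | ⟨h1, h2⟩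
  · exact Or.inl ⟨D.injOn e.mem e'.mem h1, D.injOn e.symm.mem e'.symm.mem h2⟩
  · exact Or.inr ⟨D.injOn e.mem e'.symm.mem h1, D.injOn e.symm.mem e'.mem h2⟩

omit D in
theorem exists_of_mem {v w : ℂ} (hvw : s(v, w) ∈ Sym2.map pos '' h.edges) :
    ∃ a b, s(a, b) ∈ h.edges ∧ v = pos a ∧ w = pos b := by
  obtain ⟨e, he, heq⟩ := hvw
  induction e using Sym2.ind with
  | _ a b =>
  simp only [Sym2.map_mk, Sym2.eq_iff] at heq
  rcases heq with ⟨rfl, rfl⟩ | ⟨rfl, rfl⟩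
  · exact ⟨a, b, he, rfl, rfl⟩
  · exact ⟨b, a, by rwa [Sym2.eq_swap], rfl, rfl⟩

theorem mem_edges_iff {a b : ℂ} (ha : a ∈ h.vertices) (hb : b ∈ h.vertices) :
    s(pos a, pos b) ∈ Sym2.map pos '' h.edges ↔ s(a, b) ∈ h.edges := by
  constructor
  · intro hab
    obtain ⟨a', b', he, h1, h2⟩ := exists_of_mem hab
    obtain ⟨c, e⟩ := exists_Ed he
    rwa [D.injOn ha e.mem h1, D.injOn hb e.symm.mem h2]
  · intro hab
    exact ⟨_, hab, rfl⟩

omit D in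
/-- The colour of a displaced edge is that of the original edge. -/
def color (h : TriHoneycomb n) (pos : ℂ → ℂ) (e : Sym2.map pos '' h.edges) : ℕ :=
  h.color ⟨e.2.choose, e.2.choose_spec.1⟩

theorem color_eq {a b : ℂ} (hab : s(a, b) ∈ h.edges)
    (hab' : s(pos a, pos b) ∈ Sym2.map pos '' h.edges) :
    color h pos ⟨_, hab'⟩ = h.color ⟨_, hab⟩ := by
  unfold color
  congr 1
  exact Subtype.ext (D.map_injOn hab'.choose_spec.1 hab hab'.choose_spec.2)

theorem dart {c : ℕ} {l : Fin 3} {σ : ℝ} {a b : ℂ} (d : h.Dart c l σ a b) :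
    coord l (pos a) = coord l (pos b) ∧
      0 < σ * (coord (l + 2) (pos b) - coord (l + 2) (pos a)) := by
  obtain ⟨e, h2, h3, h4⟩ := d
  refine ⟨D.type_eq a b l e.1 h2, ?_⟩
  rcases h3 with rfl | rfl
  · have := D.orient a b l e.1 h2 (by linarith)
    linarith
  · have := D.orient b a l e.symm.1 h2.symm (by linarith)
    linarith

/-- Displaced edges cross only as the original ones do: edges with a common vertex meet there only,
and disjoint edges stay disjoint. -/
theorem crossing {a b a' b' : ℂ} (hab : s(a, b) ∈ h.edges) (hab' : s(a', b') ∈ h.edges)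
    (hne : s(a, b) ≠ s(a', b')) {z : ℂ} (hz : z ∈ openSegment ℝ (pos a) (pos b))
    (hz' : z ∈ openSegment ℝ (pos a') (pos b')) :
    (h.color ⟨_, hab⟩ = 0 ∧ h.color ⟨_, hab'⟩ = 1 ∧
      AngleFromTo s(pos a, pos b) s(pos a', pos b') (Real.pi / 3)) ∨
    (h.color ⟨_, hab'⟩ = 0 ∧ h.color ⟨_, hab⟩ = 1 ∧
      AngleFromTo s(pos a', pos b') s(pos a, pos b) (Real.pi / 3)) := by
  obtain ⟨c, e⟩ := exists_Ed hab
  obtain ⟨c', e'⟩ := exists_Ed hab'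
  rw [show h.color ⟨_, hab⟩ = c from e.2, show h.color ⟨_, hab'⟩ = c' from e'.2]
  obtain ⟨l, hl⟩ := e.exists_type
  obtain ⟨l', hl'⟩ := e'.exists_type
  have q := D.type_eq a b l hab hl
  have q' := D.type_eq a' b' l' hab' hl'
  have pne : pos a ≠ pos b := fun hh => e.ne (D.injOn e.mem e.symm.mem hh)
  have pne' : pos a' ≠ pos b' := fun hh => e'.ne (D.injOn e'.mem e'.symm.mem hh)
  have hdis : ¬ Disjoint (segment ℝ a b) (segment ℝ a' b') := fun hd =>
    disjoint_left.1 (D.disjoint a b a' b' hab hab' hd) (openSegment_subset_segment _ _ _ hz)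
      (openSegment_subset_segment _ _ _ hz')
  obtain ⟨y, hy, hy'⟩ := not_disjoint_iff.1 hdis
  rcases e.meet e' hl hl' hne hy hy' with ⟨h1, h2⟩ | ⟨-, -, ⟨h1, h2, h3⟩ | ⟨h1, h2, h3⟩⟩
  · -- edges with a common end point have different directions, so the lines meet there only
    exfalso
    have key : ∀ {x y x' y' : ℂ}, h.Ed c x y → h.Ed c' x' y' → coord l x = coord l y →
        coord l' x' = coord l' y' → s(x, y) ≠ s(x', y') → x = x' →
        z ∈ openSegment ℝ (pos x) (pos y) → z ∈ openSegment ℝ (pos x') (pos y') → False := by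
      intro x y x' y' e e' hl hl' hne hx hz hz'
      subst hx
      obtain ⟨σ, d⟩ := e.dart_of_type hl
      obtain ⟨σ', d'⟩ := e'.dart_of_type hl'
      have hll := (d.corner d' (by rintro rfl; exact hne rfl)).1
      have pne : pos x ≠ pos y := fun hh => e.ne (D.injOn e.mem e.symm.mem hh)
      have hc : ∀ {u v w : ℂ} {k : Fin 3}, coord k u = coord k v → w ∈ openSegment ℝ u v →
          coord k w = coord k u := by
        rintro u v w k huv ⟨α, β, -, -, hαβ, rfl⟩
        rw [coord_convex k u v hαβ, ← huv, ← add_mul, hαβ, one_mul]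
      have hzx : z = pos x := coord_ext hll (hc (D.dart d).1 hz) (hc (D.dart d').1 hz')
      rw [hzx] at hz
      exact pne ((left_mem_openSegment_iff).1 hz)
    rcases Sym2.mem_iff.1 h1 with rfl | rfl <;> rcases Sym2.mem_iff.1 h2 with hh | hh
    · exact key e e' hl hl' hne hh hz hz'
    · exact key e e'.symm hl hl'.symm (by rwa [Sym2.eq_swap (a := b')]) hh hz (by
        rwa [openSegment_symm])
    · exact key e.symm e' hl.symm hl' (by rwa [Sym2.eq_swap]) hh (by rwa [openSegment_symm]) hz'
    · exact key e.symm e'.symm hl.symm hl'.symm (by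
        rwa [Sym2.eq_swap, Sym2.eq_swap (a := b')]) hh (by rwa [openSegment_symm]) (by
        rwa [openSegment_symm])
  · subst h3
    exact Or.inl ⟨h1, h2, angleFromTo_of_type pne pne' q q'⟩
  · subst h3
    exact Or.inr ⟨h1, h2, angleFromTo_of_type pne' pne q' q⟩

/-- The displaced edges, as a honeycomb in the triangle. -/
def planar : Honeycomb triangle where
  edges := Sym2.map pos '' h.edges
  finite_edges := h.finite_edges.image _
  nontrivial e := by
    induction e using Sym2.ind with
    | _ v w =>
    intro hvw
    obtain ⟨a, b, hab, rfl, rfl⟩ := exists_of_mem hvw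
    obtain ⟨c, e⟩ := exists_Ed hab
    simpa using fun hh => e.ne (D.injOn e.mem e.symm.mem hh)
  seg_subset e := by
    induction e using Sym2.ind with
    | _ v w =>
    intro hvw
    obtain ⟨a, b, hab, rfl, rfl⟩ := exists_of_mem hvw
    obtain ⟨c, e⟩ := exists_Ed hab
    exact convex_triangle.segment_subset (D.mem a e.mem) (D.mem b e.symm.mem)
  color := color h pos
  color_mem e := h.color_mem _
  crossing := by
    rintro ⟨e, he⟩ ⟨e', he'⟩ hne
    induction e using Sym2.ind with
    | _ v w =>
    induction e' using Sym2.ind with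
    | _ v' w' =>
    obtain ⟨a, b, hab, rfl, rfl⟩ := exists_of_mem he
    obtain ⟨a', b', hab', rfl, rfl⟩ := exists_of_mem he'
    rintro ⟨z, hz, hz'⟩
    rw [D.color_eq hab, D.color_eq hab']
    refine D.crossing hab hab' (fun hh => hne ?_) hz hz'
    have := congrArg (Sym2.map pos) hh
    exact Subtype.ext this
  corner v w w' hw hw' hne := by
    obtain ⟨a, b, hab, rfl, rfl⟩ := exists_of_mem hw
    obtain ⟨a', b', hab', h1, rfl⟩ := exists_of_mem hw'
    obtain ⟨c, e⟩ := exists_Ed hab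
    obtain ⟨c', e'⟩ := exists_Ed hab'
    obtain rfl : a = a' := D.injOn e.mem e'.mem h1
    obtain ⟨l, σ, d⟩ := e.exists_dart
    obtain ⟨l', σ', d'⟩ := e'.exists_dart
    have hbb : b ≠ b' := by rintro rfl; exact hne rfl
    obtain ⟨h2, rfl, h3⟩ := d.corner d' hbb
    obtain ⟨p1, p2⟩ := D.dart d
    obtain ⟨p1', p2'⟩ := D.dart d'
    have hpos : 0 < (coord (l + 2) (pos b) - coord (l + 2) (pos a)) *
        (coord (l' + 2) (pos b') - coord (l' + 2) (pos a)) := by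
      rcases d.2.2.1 with rfl | rfl
      · exact mul_pos (by linarith) (by linarith)
      · exact mul_pos_of_neg_of_neg (by linarith) (by linarith)
    rw [sub_eq_dir p1, sub_eq_dir p1', det2_dir]
    refine ⟨angle_dir_of_pos h2 hpos, fun hdet => ?_⟩
    have h4 : l' = l + 1 := by
      rw [← inc_neg_iff]
      have h5 := pos_of_mul_pos_right hdet hpos.le
      have h6 : 0 < √3 / 2 := by positivity
      have h7 := pos_of_mul_pos_right h5 h6.le
      linarith
    rw [D.color_eq hab, D.color_eq hab', e.2, e'.2]
    exact h3 h4

theorem planar_vertices : D.planar.vertices = pos '' h.vertices := by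
  ext v
  constructor
  · rintro ⟨e, he, hv⟩
    obtain ⟨w, rfl⟩ := Sym2.mem_iff_exists.1 hv
    obtain ⟨a, b, hab, rfl, rfl⟩ := exists_of_mem he
    exact ⟨a, ⟨_, hab, by simp⟩, rfl⟩
  · rintro ⟨a, ⟨e, he, ha⟩, rfl⟩
    exact ⟨_, ⟨e, he, rfl⟩, Sym2.mem_map.2 ⟨a, ha, rfl⟩⟩

theorem planar_degree {a : ℂ} (ha : a ∈ h.vertices) :
    D.planar.degree (pos a) = h.toHoneycomb.degree a := by
  have hset : {e ∈ D.planar.edges | pos a ∈ e} = Sym2.map pos '' {e ∈ h.edges | a ∈ e} := by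
    ext e
    constructor
    · rintro ⟨⟨e, he, rfl⟩, hv⟩
      obtain ⟨b, hb, hba⟩ := Sym2.mem_map.1 hv
      exact ⟨e, ⟨he, D.injOn ⟨e, he, hb⟩ ha hba ▸ hb⟩, rfl⟩
    · rintro ⟨e, ⟨he, hv⟩, rfl⟩
      exact ⟨⟨e, he, rfl⟩, Sym2.mem_map.2 ⟨a, hv, rfl⟩⟩
  unfold Honeycomb.degree
  rw [hset]
  exact (D.map_injOn.mono (sep_subset _ _)).ncard_image

theorem planar_support_side (i : Fin 3) :
    D.planar.support ∩ side i = pos '' (h.vertices ∩ side i) := by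
  apply Subset.antisymm
  · rintro z ⟨hz, hzi⟩
    obtain ⟨e, he, hze⟩ := mem_iUnion₂.1 hz
    induction e using Sym2.ind with
    | _ v w =>
    obtain ⟨a, b, hab, rfl, rfl⟩ := exists_of_mem he
    obtain ⟨c, e⟩ := exists_Ed hab
    have hmem : ∀ x ∈ h.vertices, z = pos x → z ∈ pos '' (h.vertices ∩ side i) := by
      rintro x hx rfl
      exact ⟨x, ⟨hx, (D.side_iff x hx i).1 hzi⟩, rfl⟩
    obtain ⟨t, h0, h1, rfl⟩ := exists_lineMap_of_mem (show z ∈ segment ℝ (pos a) (pos b) from hze)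
    rcases h0.eq_or_lt with rfl | h0
    · exact hmem a e.mem (by simp)
    rcases h1.eq_or_lt with rfl | h1
    · exact hmem b e.symm.mem (by simp)
    exfalso
    have h2 := hzi.2
    rw [coord_lineMap] at h2
    have ha := D.mem a e.mem i
    have hb := D.mem b e.symm.mem i
    have h3 : coord i (pos a) = 0 := by nlinarith
    have h4 : coord i (pos b) = 0 := by nlinarith
    exact e.not_boundary ((D.side_iff a e.mem i).1 ⟨D.mem a e.mem, h3⟩)
      ((D.side_iff b e.symm.mem i).1 ⟨D.mem b e.symm.mem, h4⟩)
  · rintro _ ⟨a, ⟨ha, hai⟩, rfl⟩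
    refine ⟨?_, (D.side_iff a ha i).2 hai⟩
    obtain ⟨c, b, e⟩ := exists_Ed_of_mem ha
    exact mem_iUnion₂.2 ⟨_, ⟨_, e.1, rfl⟩, left_mem_segment ℝ _ _⟩

/-- The displaced edges, as a triangular honeycomb. -/
def honeycomb : TriHoneycomb n where
  toHoneycomb := D.planar
  degree_eq := by
    intro v hv
    rw [D.planar_vertices] at hv
    obtain ⟨a, ha, rfl⟩ := hv
    rw [D.planar_degree ha]
    exact h.degree_eq a ha
  support_inter_boundary := by
    have hb := h.support_inter_boundary
    simp only [inter_iUnion, support_side] at hb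
    simp only [inter_iUnion, D.planar_support_side]
    rw [← image_iUnion, hb, D.planar_vertices]
    ext v
    constructor
    · rintro ⟨a, ⟨ha, hd⟩, rfl⟩
      exact ⟨⟨a, ha, rfl⟩, (D.planar_degree ha).trans hd⟩
    · rintro ⟨⟨a, ha, rfl⟩, hd⟩
      exact ⟨a, ⟨ha, (D.planar_degree ha).symm.trans hd⟩, rfl⟩
  typed := by
    rintro ⟨e, he⟩
    induction e using Sym2.ind with
    | _ v w =>
    obtain ⟨a, b, hab, rfl, rfl⟩ := exists_of_mem he
    obtain ⟨c, e⟩ := exists_Ed hab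
    obtain ⟨l, hl⟩ := e.exists_type
    exact ⟨l, hasType_of_coord_eq (D.mem a e.mem) (D.type_eq a b l hab hl)⟩
  ncard_side i := by
    rw [D.planar_support_side, (D.injOn.mono inter_subset_left).ncard_image,
      ← support_side, h.ncard_side]
  side_color := by
    rintro i ⟨e, he⟩ v hv hvi
    obtain ⟨w, rfl⟩ := Sym2.mem_iff_exists.1 hv
    obtain ⟨a, b, hab, rfl, rfl⟩ := exists_of_mem he
    obtain ⟨c, e⟩ := exists_Ed hab
    have hai := (D.side_iff a e.mem i).1 hvi
    have hc : D.planar.color ⟨_, he⟩ = c := (D.color_eq hab he).trans e.2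
    rw [hc]
    rcases e.boundary hai with ⟨h1, d⟩ | ⟨h1, d⟩
    · exact Or.inl ⟨h1, hasType_of_coord_eq (D.mem a e.mem) (D.dart d).1⟩
    · exact Or.inr ⟨h1, hasType_of_coord_eq (D.mem a e.mem) (D.dart d).1⟩
  color_mono := by
    rintro i ⟨e₁, he₁⟩ ⟨e₂, he₂⟩ v₁ v₂ hv₁ hv₂ hi₁ hi₂ hlt
    obtain ⟨w₁, rfl⟩ := Sym2.mem_iff_exists.1 hv₁
    obtain ⟨w₂, rfl⟩ := Sym2.mem_iff_exists.1 hv₂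
    obtain ⟨a₁, b₁, hab₁, rfl, rfl⟩ := exists_of_mem he₁
    obtain ⟨a₂, b₂, hab₂, rfl, rfl⟩ := exists_of_mem he₂
    obtain ⟨c₁, e₁⟩ := exists_Ed hab₁
    obtain ⟨c₂, e₂⟩ := exists_Ed hab₂
    have g₁ := (D.side_iff a₁ e₁.mem i).1 hi₁
    have g₂ := (D.side_iff a₂ e₂.mem i).1 hi₂
    have hlt' : coord (i + 1) a₁ < coord (i + 1) a₂ := by
      by_contra hnot
      rcases (not_lt.1 hnot).eq_or_lt with heq | hlt'
      · obtain rfl : a₁ = a₂ := coord_ext (i := i) (j := i + 1) (by omega)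
          (g₁.2.trans g₂.2.symm) heq.symm
        exact lt_irrefl _ hlt
      · exact lt_asymm hlt (D.order i a₂ e₂.mem a₁ e₁.mem g₂ g₁ hlt')
    have hc₁ : D.planar.color ⟨_, he₁⟩ = h.color ⟨_, hab₁⟩ := D.color_eq hab₁ he₁
    have hc₂ : D.planar.color ⟨_, he₂⟩ = h.color ⟨_, hab₂⟩ := D.color_eq hab₂ he₂
    rw [hc₁, hc₂]
    exact h.color_mono i ⟨_, hab₁⟩ ⟨_, hab₂⟩ a₁ a₂ (by simp) (by simp) g₁ g₂ hlt'

theorem vertices_honeycomb : D.honeycomb.vertices = pos '' h.vertices := D.planar_vertices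

/-- A deformation is an isomorphism of structure graphs. -/
def iso : Iso h D.honeycomb where
  toEquiv := (Equiv.Set.imageOfInjOn pos h.vertices D.injOn).trans
    (Equiv.setCongr D.vertices_honeycomb.symm)
  adj_iff a b := (D.mem_edges_iff a.2 b.2).symm
  color_eq a b hab hab' := (D.color_eq hab hab').symm
  side_iff i a := (D.side_iff a a.2 i).symm
  order_iff i a b ha hb := by
    change _ ↔ coord (i + 1) (pos a) < coord (i + 1) (pos b)
    refine ⟨D.order i a a.2 b b.2 ha hb, fun hlt => ?_⟩
    by_contra hnot
    rcases (not_lt.1 hnot).eq_or_lt with heq | hlt'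
    · have : (a : ℂ) = b := coord_ext (i := i) (j := i + 1) (by omega)
          (ha.2.trans hb.2.symm) heq.symm
      rw [this] at hlt
      exact lt_irrefl _ hlt
    · exact lt_asymm hlt (D.order i b b.2 a a.2 hb ha hlt')

theorem iso_apply (a : h.vertices) : (D.iso.toEquiv a : ℂ) = pos a := rfl

end IsDeformation

open Topology Filter in
/-- Disjointness of segments is stable under small displacements of the end points, by compactness.
-/
theorem eventually_disjoint_segment {α : Type*} [TopologicalSpace α] {f g f' g' : α → ℂ}
    (hf : Continuous f) (hg : Continuous g) (hf' : Continuous f') (hg' : Continuous g') {x : α}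
    (hd : Disjoint (segment ℝ (f x) (g x)) (segment ℝ (f' x) (g' x))) :
    ∀ᶠ y in 𝓝 x, Disjoint (segment ℝ (f y) (g y)) (segment ℝ (f' y) (g' y)) := by
  have hK : IsCompact (Icc (0 : ℝ) 1 ×ˢ Icc (0 : ℝ) 1) := isCompact_Icc.prod isCompact_Icc
  have key := hK.eventually_forall_of_forall_eventually (x₀ := x)
    (P := fun y (t : ℝ × ℝ) => f y + t.1 • (g y - f y) ≠ f' y + t.2 • (g' y - f' y)) (by
      rintro ⟨s, t⟩ ⟨hs, ht⟩
      have c1 : Continuous fun z : α × ℝ × ℝ => f z.1 + z.2.1 • (g z.1 - f z.1) := by fun_prop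
      have c2 : Continuous fun z : α × ℝ × ℝ => f' z.1 + z.2.2 • (g' z.1 - f' z.1) := by fun_prop
      refine (isOpen_ne_fun c1 c2).mem_nhds ?_
      intro heq
      exact disjoint_left.1 hd (mem_segment_lineMap hs.1 hs.2)
        (heq ▸ mem_segment_lineMap ht.1 ht.2))
  filter_upwards [key] with y hy
  rw [disjoint_left]
  intro z hz hz'
  obtain ⟨s, s0, s1, rfl⟩ := exists_lineMap_of_mem hz
  obtain ⟨t, t0, t1, ht⟩ := exists_lineMap_of_mem hz'
  exact hy (s, t) ⟨⟨s0, s1⟩, ⟨t0, t1⟩⟩ ht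

open Classical in
/-- The extension of a displacement of the vertices to the whole plane. -/
def extendPos (h : TriHoneycomb n) (p : h.vertices → ℂ) (z : ℂ) : ℂ :=
  if hz : z ∈ h.vertices then p ⟨z, hz⟩ else z

theorem extendPos_apply {h : TriHoneycomb n} (p : h.vertices → ℂ) (a : h.vertices) :
    h.extendPos p a = p a := by
  simp [extendPos]

open Topology Filter in
/-- All small displacements of the vertices that keep the directions of the edges and the sides of
the boundary vertices are deformations. -/
theorem eventually_isDeformation (h : TriHoneycomb n) :
    ∀ᶠ p : h.vertices → ℂ in 𝓝 (fun v => (v : ℂ)),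
      (∀ (a b : h.vertices) l, s((a : ℂ), (b : ℂ)) ∈ h.edges → coord l (a : ℂ) = coord l (b : ℂ) →
        coord l (p a) = coord l (p b)) →
      (∀ (a : h.vertices) i, (a : ℂ) ∈ side i → coord i (p a) = 0) →
      h.IsDeformation (h.extendPos p) := by
  have := h.finite_vertices.to_subtype
  have hc : ∀ (k : Fin 3) (a : h.vertices), Continuous fun p : h.vertices → ℂ => coord k (p a) :=
    fun k a => (coord_continuous k).comp (continuous_apply a)
  have e1 : ∀ᶠ p : h.vertices → ℂ in 𝓝 (fun v => (v : ℂ)),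
      ∀ a b : h.vertices, a ≠ b → p a ≠ p b := by
    simp only [eventually_all]
    intro a b hab
    exact (isOpen_ne_fun (continuous_apply a) (continuous_apply b)).mem_nhds
      (fun hh => hab (Subtype.ext hh))
  have e2 : ∀ᶠ p : h.vertices → ℂ in 𝓝 (fun v => (v : ℂ)), ∀ (a : h.vertices) k,
      (a : ℂ) ∉ side k → 0 < coord k (p a) := by
    simp only [eventually_all]
    intro a k hak
    have : 0 < coord k (a : ℂ) := lt_of_le_of_ne (mem_triangle a.2 k)
      fun hh => hak ⟨mem_triangle a.2, hh.symm⟩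
    exact (hc k a).continuousAt.eventually (lt_mem_nhds this)
  have e3 : ∀ᶠ p : h.vertices → ℂ in 𝓝 (fun v => (v : ℂ)), ∀ (a b : h.vertices) k,
      coord k (a : ℂ) < coord k (b : ℂ) → coord k (p a) < coord k (p b) := by
    simp only [eventually_all]
    intro a b k hab
    exact ContinuousAt.eventually_lt (hc k a).continuousAt (hc k b).continuousAt hab
  have e4 : ∀ᶠ p : h.vertices → ℂ in 𝓝 (fun v => (v : ℂ)), ∀ (a b a' b' : h.vertices),
      Disjoint (segment ℝ (a : ℂ) (b : ℂ)) (segment ℝ (a' : ℂ) (b' : ℂ)) →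
      Disjoint (segment ℝ (p a) (p b)) (segment ℝ (p a') (p b')) := by
    simp only [eventually_all]
    intro a b a' b' hd
    exact eventually_disjoint_segment (continuous_apply a) (continuous_apply b)
      (continuous_apply a') (continuous_apply b') hd
  filter_upwards [e1, e2, e3, e4] with p p1 p2 p3 p4 ht hs
  have hmem : ∀ a ∈ h.vertices, h.extendPos p a ∈ triangle := by
    intro a ha k
    rw [extendPos_apply p ⟨a, ha⟩]
    by_cases hak : a ∈ side k
    · exact (hs ⟨a, ha⟩ k hak).ge
    · exact (p2 ⟨a, ha⟩ k hak).le
  refine ⟨?_, hmem, ?_, ?_, ?_, ?_, ?_⟩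
  · intro a ha b hb hab
    rw [extendPos_apply p ⟨a, ha⟩, extendPos_apply p ⟨b, hb⟩] at hab
    by_contra hne
    exact p1 ⟨a, ha⟩ ⟨b, hb⟩ (fun hh => hne (congrArg Subtype.val hh)) hab
  · intro a ha i
    constructor
    · rintro ⟨-, h0⟩
      rw [extendPos_apply p ⟨a, ha⟩] at h0
      by_contra hai
      exact (p2 ⟨a, ha⟩ i hai).ne' h0
    · intro hai
      refine ⟨hmem a ha, ?_⟩
      rw [extendPos_apply p ⟨a, ha⟩]
      exact hs ⟨a, ha⟩ i hai
  · intro a b l hab hl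
    obtain ⟨c, e⟩ := exists_Ed hab
    rw [extendPos_apply p ⟨a, e.mem⟩, extendPos_apply p ⟨b, e.symm.mem⟩]
    exact ht ⟨a, e.mem⟩ ⟨b, e.symm.mem⟩ l hab hl
  · intro a b l hab _ hlt
    obtain ⟨c, e⟩ := exists_Ed hab
    rw [extendPos_apply p ⟨a, e.mem⟩, extendPos_apply p ⟨b, e.symm.mem⟩]
    exact p3 ⟨a, e.mem⟩ ⟨b, e.symm.mem⟩ _ hlt
  · intro i a ha b hb _ _ hlt
    rw [extendPos_apply p ⟨a, ha⟩, extendPos_apply p ⟨b, hb⟩]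
    exact p3 ⟨a, ha⟩ ⟨b, hb⟩ _ hlt
  · intro a b a' b' hab hab' hd
    obtain ⟨c, e⟩ := exists_Ed hab
    obtain ⟨c', e'⟩ := exists_Ed hab'
    rw [extendPos_apply p ⟨a, e.mem⟩, extendPos_apply p ⟨b, e.symm.mem⟩,
      extendPos_apply p ⟨a', e'.mem⟩, extendPos_apply p ⟨b', e'.symm.mem⟩]
    exact p4 ⟨a, e.mem⟩ ⟨b, e.symm.mem⟩ ⟨a', e'.mem⟩ ⟨b', e'.symm.mem⟩ hd

end TriHoneycomb

/-! ### Boundary points and signs -/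

theorem strictAnti_eq_of_range_eq {n : ℕ} {f g : Fin n → ℝ} (hf : StrictAnti f) (hg : StrictAnti g)
    (hfg : range f = range g) : f = g := by
  have h1 : StrictMono fun i => -f i := fun i j hij => neg_lt_neg (hf hij)
  have h2 : StrictMono fun i => -g i := fun i j hij => neg_lt_neg (hg hij)
  have h3 : range (fun i => -f i) = range fun i => -g i := by
    rw [show (fun i => -f i) = Neg.neg ∘ f from rfl, show (fun i => -g i) = Neg.neg ∘ g from rfl,
      range_comp, range_comp, hfg]
  have h4 := (h1.range_inj h2).1 h3
  funext i
  have := congrFun h4 i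
  simpa using this

namespace TriHoneycomb

open Relation

variable {n : ℕ}

theorem coord_injOn_side (i : Fin 3) : InjOn (coord (i + 1)) (side i) := fun a ha b hb hab =>
  coord_ext (i := i) (j := i + 1) (by omega) (ha.2.trans hb.2.symm) hab

/-- A honeycomb has exactly `n` points on each side, and they can be listed by their coordinate. -/
theorem exists_enum (h : TriHoneycomb n) (k : Fin 3) : ∃ f : Fin n → h.vertices,
    StrictAnti (fun i => coord (k + 1) (f i : ℂ)) ∧
      (∀ i, (f i : ℂ) ∈ side k) ∧ ∀ a : h.vertices, (a : ℂ) ∈ side k → ∃ i, f i = a := by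
  have hfin : (coord (k + 1) '' (h.vertices ∩ side k)).Finite :=
    (h.finite_vertices.inter_of_left _).image _
  have hcard : hfin.toFinset.card = n := by
    rw [← ncard_eq_toFinset_card _ hfin,
      ((coord_injOn_side k).mono inter_subset_right).ncard_image, ← support_side, h.ncard_side]
  set g := hfin.toFinset.orderEmbOfFin hcard with hg
  have hex : ∀ i, ∃ a : h.vertices, (a : ℂ) ∈ side k ∧ coord (k + 1) (a : ℂ) = g (Fin.rev i) := by
    intro i
    have := hfin.toFinset.orderEmbOfFin_mem hcard (Fin.rev i)
    rw [Set.Finite.mem_toFinset] at this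
    obtain ⟨a, ⟨ha, hk⟩, he⟩ := this
    exact ⟨⟨a, ha⟩, hk, he⟩
  choose f hf1 hf2 using hex
  refine ⟨f, fun i j hij => ?_, hf1, fun a ha => ?_⟩
  · simp only [hf2]
    exact g.strictMono (Fin.rev_lt_rev.2 hij)
  · have h1 : coord (k + 1) (a : ℂ) ∈ range g := by
      rw [hg, Finset.range_orderEmbOfFin, Set.Finite.coe_toFinset]
      exact ⟨a, ⟨a.2, ha⟩, rfl⟩
    obtain ⟨i, hi⟩ := h1
    refine ⟨Fin.rev i, Subtype.ext (coord_injOn_side k (hf1 _) ha ?_)⟩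
    rw [hf2, Fin.rev_rev, hi]

/-- The points of the honeycomb on the side `∂ₖT`, in the order of decreasing coordinate
`v_{k+1}`. -/
def pt (h : TriHoneycomb n) (k : Fin 3) (i : Fin n) : h.vertices := (h.exists_enum k).choose i

variable {h h' : TriHoneycomb n}

theorem pt_strictAnti (h : TriHoneycomb n) (k : Fin 3) :
    StrictAnti fun i => coord (k + 1) (h.pt k i : ℂ) := (h.exists_enum k).choose_spec.1

theorem pt_mem_side (k : Fin 3) (i : Fin n) : (h.pt k i : ℂ) ∈ side k :=
  (h.exists_enum k).choose_spec.2.1 i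

theorem exists_pt {k : Fin 3} {a : h.vertices} (ha : (a : ℂ) ∈ side k) : ∃ i, h.pt k i = a :=
  (h.exists_enum k).choose_spec.2.2 a ha

theorem pt_injective (k : Fin 3) : Function.Injective (h.pt k) := fun i j hij =>
  (h.pt_strictAnti k).injective (by rw [hij])

theorem sideCoords_eq (h : TriHoneycomb n) (k : Fin 3) :
    h.sideCoords k = range fun i => coord (k + 1) (h.pt k i : ℂ) := by
  unfold sideCoords
  rw [support_side]
  ext t
  constructor
  · rintro ⟨a, ⟨ha, hk⟩, rfl⟩
    obtain ⟨i, hi⟩ := exists_pt (a := ⟨a, ha⟩) hk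
    exact ⟨i, by simp only [hi]⟩
  · rintro ⟨i, rfl⟩
    exact ⟨_, ⟨(h.pt k i).2, pt_mem_side k i⟩, rfl⟩

/-- An isomorphism of structure graphs respects the enumeration of the boundary points. -/
theorem Iso.map_pt (f : Iso h h') (k : Fin 3) (i : Fin n) : f.toEquiv (h.pt k i) = h'.pt k i := by
  have hs : ∀ i, (f.toEquiv (h.pt k i) : ℂ) ∈ side k := fun i =>
    (f.side_iff k _).1 (pt_mem_side k i)
  have h1 : StrictAnti fun i => coord (k + 1) (f.toEquiv (h.pt k i) : ℂ) := fun i j hij =>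
    (f.order_iff k _ _ (pt_mem_side k j) (pt_mem_side k i)).1 (h.pt_strictAnti k hij)
  have h2 : (fun i => coord (k + 1) (f.toEquiv (h.pt k i) : ℂ)) =
      fun i => coord (k + 1) (h'.pt k i : ℂ) := by
    refine strictAnti_eq_of_range_eq h1 (h'.pt_strictAnti k) (Subset.antisymm ?_ ?_)
    · rintro _ ⟨i, rfl⟩
      obtain ⟨j, hj⟩ := exists_pt (hs i)
      exact ⟨j, by simp only [hj]⟩
    · rintro _ ⟨i, rfl⟩
      have : (f.toEquiv.symm (h'.pt k i) : ℂ) ∈ side k := by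
        rw [f.side_iff, Equiv.apply_symm_apply]
        exact pt_mem_side k i
      obtain ⟨j, hj⟩ := exists_pt this
      exact ⟨j, by simp only [hj, Equiv.apply_symm_apply]⟩
  exact Subtype.ext (coord_injOn_side k (hs i) (pt_mem_side k i) (congrFun h2 i))

theorem sign_eq_or (v : ℂ) : h.sign v = 1 ∨ h.sign v = -1 := by
  unfold sign
  split_ifs
  · exact Or.inl rfl
  · exact Or.inr rfl

theorem Nbr.sign_eq {v w : ℂ} (e : h.Nbr v w) : h.sign w = -h.sign v := by
  obtain ⟨c, e⟩ := exists_Ed e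
  obtain ⟨l, σ, d⟩ := e.exists_dart
  rw [d.sign_eq, d.symm.sign_eq]

theorem Ed.sign_of_side {c : ℕ} {v w : ℂ} (e : h.Ed c v w) {k : Fin 3} (hk : v ∈ side k) :
    h.sign v = 2 * c - 1 := by
  rcases e.boundary hk with ⟨rfl, d⟩ | ⟨rfl, d⟩
  · rw [d.sign_eq]; norm_num
  · rw [d.sign_eq]; norm_num

theorem Iso.ed_iff (f : Iso h h') (c : ℕ) (a b : h.vertices) :
    h.Ed c a b ↔ h'.Ed c (f.toEquiv a) (f.toEquiv b) := by
  constructor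
  · rintro ⟨hab, hc⟩
    exact ⟨(f.adj_iff a b).1 hab, by rw [← f.color_eq a b hab, hc]⟩
  · rintro ⟨hab, hc⟩
    exact ⟨(f.adj_iff a b).2 hab, by rw [f.color_eq a b _ hab, hc]⟩

theorem Iso.inner_iff (f : Iso h h') (a : h.vertices) : h.Inner a ↔ h'.Inner (f.toEquiv a) := by
  simp only [Inner, a.2, (f.toEquiv a).2, true_and, f.side_iff]

/-- The signs of the vertices are determined by the coloured graph: they alternate along edges, and
are given by the colour at the boundary. -/
theorem Iso.sign_eq (f : Iso h h') (hn : 0 < n) (a : h.vertices) :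
    h'.sign (f.toEquiv a) = h.sign a := by
  have key : ∀ v w, ReflTransGen h.Nbr v w → ∀ (hv : v ∈ h.vertices) (hw : w ∈ h.vertices),
      h'.sign (f.toEquiv ⟨v, hv⟩) = h.sign v → h'.sign (f.toEquiv ⟨w, hw⟩) = h.sign w := by
    intro v w hvw
    induction hvw with
    | refl => exact fun _ _ hh => hh
    | @tail x y _ hxy ih =>
      intro hv hy hh
      obtain ⟨c, e⟩ := exists_Ed hxy
      have h1 := ih hv e.mem hh
      have h2 : h'.Nbr (f.toEquiv ⟨x, e.mem⟩) (f.toEquiv ⟨y, hy⟩) :=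
        (f.adj_iff ⟨x, e.mem⟩ ⟨y, hy⟩).1 hxy
      rw [Nbr.sign_eq h2, h1, Nbr.sign_eq hxy]
  set p := h.pt 0 ⟨0, hn⟩ with hp
  have hps : (p : ℂ) ∈ side 0 := pt_mem_side 0 _
  obtain ⟨c, w, e⟩ := exists_Ed_of_mem p.2
  refine key p a (nbr_connected p.2 a.2) p.2 a.2 ?_
  have e' := (f.ed_iff c p ⟨w, e.symm.mem⟩).1 e
  rw [e.sign_of_side hps]
  exact e'.sign_of_side ((f.side_iff 0 p).1 hps)

end TriHoneycomb

/-! ### The structure graph of a honeycomb on a surface -/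

namespace SurfaceHoneycomb

open TriHoneycomb Relation

variable {ι : Type} {p : ℕ} {𝒯 : TriangleGluing ι p} {n : ℕ} {h : SurfaceHoneycomb 𝒯 n}

/-- The gluing of two sides reverses the order of the points, so the `m`-th point on one side is
glued to the `m`-th last point on the other one. -/
theorem compat_pt (h : SurfaceHoneycomb 𝒯 n) {i j : ι} {k l : Fin 3} (ho : 𝒯.opp (i, k) = (j, l))
    (hne : (i, k) ≠ (j, l)) (m : Fin n) : coord (l + 1) ((h.tri j).pt l m : ℂ) =
      1 - coord (k + 1) ((h.tri i).pt k (Fin.rev m) : ℂ) := by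
  have h1 := h.compat (i, k) (by rw [ho]; exact hne.symm)
  rw [ho] at h1
  simp only [sideCoords_eq] at h1
  have h2 : StrictAnti fun m => 1 - coord (k + 1) ((h.tri i).pt k (Fin.rev m) : ℂ) := by
    intro m m' hm
    have := (h.tri i).pt_strictAnti k (Fin.rev_lt_rev.2 hm)
    simp only at this ⊢
    linarith
  refine congrFun (strictAnti_eq_of_range_eq ((h.tri j).pt_strictAnti l) h2 ?_) m
  rw [h1]
  ext t
  constructor
  · rintro ⟨_, ⟨m, rfl⟩, rfl⟩
    exact ⟨Fin.rev m, by simp⟩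
  · rintro ⟨m, rfl⟩
    exact ⟨_, ⟨Fin.rev m, rfl⟩, rfl⟩

theorem glued_pt {i j : ι} {k l : Fin 3} (ho : 𝒯.opp (i, k) = (j, l)) (hne : (i, k) ≠ (j, l))
    (m : Fin n) : h.Glued ⟨i, (h.tri i).pt k (Fin.rev m)⟩ ⟨j, (h.tri j).pt l m⟩ :=
  ⟨k, l, ho, hne, pt_mem_side _ _, pt_mem_side _ _, h.compat_pt ho hne m⟩

theorem Glued.exists_pt {i j : ι} {a : (h.tri i).vertices} {b : (h.tri j).vertices}
    (hg : h.Glued ⟨i, a⟩ ⟨j, b⟩) : ∃ k l m, 𝒯.opp (i, k) = (j, l) ∧ (i, k) ≠ (j, l) ∧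
      a = (h.tri i).pt k (Fin.rev m) ∧ b = (h.tri j).pt l m := by
  obtain ⟨k, l, ho, hne, ha, hb, hc⟩ := hg
  simp only at ho hne ha hb hc
  obtain ⟨m, rfl⟩ := TriHoneycomb.exists_pt hb
  refine ⟨k, l, m, ho, hne, Subtype.ext (coord_injOn_side k ha (pt_mem_side _ _) ?_), rfl⟩
  have := h.compat_pt ho hne m
  linarith

theorem Glued.symm {x y : Σ i, (h.tri i).vertices} (hg : h.Glued x y) : h.Glued y x := by
  obtain ⟨k, l, ho, hne, ha, hb, hc⟩ := hg
  exact ⟨l, k, by rw [← ho, 𝒯.opp_opp], hne.symm, hb, ha, by linarith⟩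

theorem Glued.unique {x y z : Σ i, (h.tri i).vertices} (hg : h.Glued x y) (hg' : h.Glued x z) :
    y = z := by
  obtain ⟨i, a⟩ := x
  obtain ⟨j, b⟩ := y
  obtain ⟨j', b'⟩ := z
  obtain ⟨k, l, ho, -, ha, hb, hc⟩ := hg
  obtain ⟨k', l', ho', -, ha', hb', hc'⟩ := hg'
  simp only at *
  obtain rfl := side_unique a.2 ha ha'
  rw [ho, Prod.mk.injEq] at ho'
  obtain ⟨rfl, rfl⟩ := ho'
  have : b = b' := Subtype.ext (coord_injOn_side l hb hb' (hc.trans hc'.symm))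
  rw [this]

theorem Glued.ne {x y : Σ i, (h.tri i).vertices} (hg : h.Glued x y) : x ≠ y := by
  rintro rfl
  obtain ⟨k, l, -, hne, ha, hb, -⟩ := hg
  rw [side_unique x.2.2 ha hb] at hne
  exact hne rfl

theorem Glued.not_inner {i : ι} {a : (h.tri i).vertices} {y : Σ i, (h.tri i).vertices}
    (hg : h.Glued ⟨i, a⟩ y) : ¬ (h.tri i).Inner a := by
  obtain ⟨k, l, -, -, ha, -, -⟩ := hg
  exact fun hi => hi.2 k ha

/-- Each boundary point is glued to at most one other point, so no chains of identifications arise.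
-/
theorem mk_eq_iff {i j : ι} {a : (h.tri i).vertices} {b : (h.tri j).vertices} :
    h.mkVertex i a = h.mkVertex j b ↔
      (⟨i, a⟩ : Σ i, (h.tri i).vertices) = ⟨j, b⟩ ∨ h.Glued ⟨i, a⟩ ⟨j, b⟩ := by
  constructor
  · intro hab
    have := Quot.eqvGen_exact hab
    generalize (⟨i, a⟩ : Σ i, (h.tri i).vertices) = x at this
    generalize (⟨j, b⟩ : Σ i, (h.tri i).vertices) = y at this
    induction this with
    | rel _ _ hg => exact Or.inr hg
    | refl => exact Or.inl rfl
    | symm _ _ _ ih => exact ih.imp Eq.symm Glued.symm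
    | trans _ _ _ _ _ ih1 ih2 =>
      rcases ih1 with rfl | h1
      · exact ih2
      · rcases ih2 with rfl | h2
        · exact Or.inr h1
        · exact Or.inl (h1.symm.unique h2)
  · rintro (hab | hg)
    · cases hab; rfl
    · exact Quot.sound hg

theorem mk_eq_of_inner {i j : ι} {a : (h.tri i).vertices} {b : (h.tri j).vertices}
    (ha : (h.tri i).Inner a) (hab : h.mkVertex i a = h.mkVertex j b) :
    (⟨i, a⟩ : Σ i, (h.tri i).vertices) = ⟨j, b⟩ :=
  (mk_eq_iff.1 hab).resolve_right fun hg => hg.not_inner ha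

theorem exists_mk (v : h.Vertex) : ∃ i a, h.mkVertex i a = v := by
  induction v using Quot.ind with
  | mk x => exact ⟨x.1, x.2, rfl⟩

/-- An inner vertex is adjacent to at most one of two points of the boundary of its triangle that
are glued to each other: otherwise its third coordinate would vanish. -/
theorem not_glued_of_nbr {i : ι} {a a' b : (h.tri i).vertices}
    (hab : s((a : ℂ), (b : ℂ)) ∈ (h.tri i).edges) (hab' : s((a' : ℂ), (b : ℂ)) ∈ (h.tri i).edges) :
    ¬ h.Glued ⟨i, a⟩ ⟨i, a'⟩ := by
  rintro ⟨k, l, ho, hne, ha, ha', hc⟩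
  simp only at ho hne ha ha' hc
  have hkl : k ≠ l := by rintro rfl; exact hne rfl
  obtain ⟨c, e⟩ := exists_Ed hab
  obtain ⟨c', e'⟩ := exists_Ed hab'
  have hb := e.inner_of_side ha
  have s1 := coord_sum k (a : ℂ)
  have s2 := coord_sum l (a' : ℂ)
  have ak : coord k (a : ℂ) = 0 := ha.2
  have al : coord l (a' : ℂ) = 0 := ha'.2
  have b0 := hb.pos 0
  have b1 := hb.pos 1
  have b2 := hb.pos 2
  have sb := coord_sum 0 (b : ℂ)
  simp only [zero_add] at sb
  rcases e.boundary ha with ⟨-, d⟩ | ⟨-, d⟩ <;> rcases e'.boundary ha' with ⟨-, d'⟩ | ⟨-, d'⟩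
  · have h1 := d.2.1
    have h2 := d'.2.1
    have h3 : coord (k + 1) (b : ℂ) + coord (l + 1) (b : ℂ) = 1 := by linarith
    fin_cases k <;> fin_cases l <;> simp at hkl h3 <;> linarith
  · have := d.symm.sign_unique d'.symm; norm_num at this
  · have := d.symm.sign_unique d'.symm; norm_num at this
  · have h1 := d.2.1
    have h2 := d'.2.1
    have h3 : coord (k + 2) (b : ℂ) + coord (l + 2) (b : ℂ) = 1 := by linarith
    fin_cases k <;> fin_cases l <;> simp at hkl h3 <;> linarith

/-- Two edges with the same end points in the structure graph are equal. -/
theorem edge_unique {i i' : ι} {a b : (h.tri i).vertices} {a' b' : (h.tri i').vertices}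
    (hab : s((a : ℂ), (b : ℂ)) ∈ (h.tri i).edges) (hab' : s((a' : ℂ), (b' : ℂ)) ∈ (h.tri i').edges)
    (h1 : h.mkVertex i a = h.mkVertex i' a') (h2 : h.mkVertex i b = h.mkVertex i' b') :
    (⟨i, a⟩ : Σ i, (h.tri i).vertices) = ⟨i', a'⟩ ∧
      (⟨i, b⟩ : Σ i, (h.tri i).vertices) = ⟨i', b'⟩ := by
  have swap : ∀ {i : ι} {a b : (h.tri i).vertices}, s((a : ℂ), (b : ℂ)) ∈ (h.tri i).edges →
      s((b : ℂ), (a : ℂ)) ∈ (h.tri i).edges := fun hh => by rwa [Sym2.eq_swap]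
  have key : ∀ {i i' : ι} {a b : (h.tri i).vertices} {a' b' : (h.tri i').vertices},
      s((a : ℂ), (b : ℂ)) ∈ (h.tri i).edges → s((a' : ℂ), (b' : ℂ)) ∈ (h.tri i').edges →
      h.Glued ⟨i, a⟩ ⟨i', a'⟩ → h.mkVertex i b = h.mkVertex i' b' → False := by
    intro i i' a b a' b' hab hab' hg h2
    obtain ⟨c, e⟩ := exists_Ed hab
    obtain ⟨k, l, -, -, ha, -, -⟩ := id hg
    have h3 := mk_eq_of_inner (e.inner_of_side ha) h2
    cases h3
    exact not_glued_of_nbr hab hab' hg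
  refine ⟨(mk_eq_iff.1 h1).resolve_right fun hg => key hab hab' hg h2,
    (mk_eq_iff.1 h2).resolve_right fun hg => key (swap hab) (swap hab') hg h1⟩

theorem mk_ne_of_edge {i : ι} {a b : (h.tri i).vertices}
    (hab : s((a : ℂ), (b : ℂ)) ∈ (h.tri i).edges) : h.mkVertex i a ≠ h.mkVertex i b := by
  obtain ⟨c, e⟩ := exists_Ed hab
  intro heq
  rcases mk_eq_iff.1 heq with h1 | ⟨k, l, -, -, ha, hb, -⟩
  · cases h1
    exact e.ne rfl
  · exact e.not_boundary ha hb

theorem adj_iff {x y : h.Vertex} : h.graph.Adj x y ↔ ∃ (i : ι) (a b : (h.tri i).vertices),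
    s((a : ℂ), (b : ℂ)) ∈ (h.tri i).edges ∧ h.mkVertex i a = x ∧ h.mkVertex i b = y := by
  unfold graph
  rw [SimpleGraph.fromRel_adj]
  constructor
  · rintro ⟨-, hh | ⟨i, a, b, hab, ha, hb⟩⟩
    · exact hh
    · exact ⟨i, b, a, by rwa [Sym2.eq_swap], hb, ha⟩
  · rintro ⟨i, a, b, hab, rfl, rfl⟩
    exact ⟨mk_ne_of_edge hab, Or.inl ⟨i, a, b, hab, rfl, rfl⟩⟩

theorem adj_of_edge {i : ι} {a b : (h.tri i).vertices}
    (hab : s((a : ℂ), (b : ℂ)) ∈ (h.tri i).edges) :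
    h.graph.Adj (h.mkVertex i a) (h.mkVertex i b) := adj_iff.2 ⟨i, a, b, hab, rfl, rfl⟩

theorem adj_mk_iff {i : ι} {a : (h.tri i).vertices} {y : h.Vertex} :
    h.graph.Adj (h.mkVertex i a) y ↔
      (∃ b : (h.tri i).vertices, s((a : ℂ), (b : ℂ)) ∈ (h.tri i).edges ∧ h.mkVertex i b = y) ∨
      ∃ (j : ι) (a' b : (h.tri j).vertices), h.Glued ⟨i, a⟩ ⟨j, a'⟩ ∧
        s((a' : ℂ), (b : ℂ)) ∈ (h.tri j).edges ∧ h.mkVertex j b = y := by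
  rw [adj_iff]
  constructor
  · rintro ⟨j, a', b, hab, ha, rfl⟩
    rcases mk_eq_iff.1 ha.symm with h1 | h1
    · cases h1
      exact Or.inl ⟨b, hab, rfl⟩
    · exact Or.inr ⟨j, a', b, h1, hab, rfl⟩
  · rintro (⟨b, hab, rfl⟩ | ⟨j, a', b, hg, hab, rfl⟩)
    · exact ⟨i, a, b, hab, rfl, rfl⟩
    · exact ⟨j, a', b, hab, (mk_eq_iff.2 (Or.inr hg)).symm, rfl⟩

/-- The structure graph is connected: the triangles are connected through their common sides, each
of which carries a vertex as `n` is positive. -/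
theorem graph_connected (h : SurfaceHoneycomb 𝒯 n) (hn : 0 < n) [Nonempty ι] :
    h.graph.Connected := by
  classical
  have tri : ∀ i (a b : (h.tri i).vertices),
      h.graph.Reachable (h.mkVertex i a) (h.mkVertex i b) := by
    intro i a b
    have key : ∀ v w, ReflTransGen (h.tri i).Nbr v w → ∀ (hv : v ∈ (h.tri i).vertices)
        (hw : w ∈ (h.tri i).vertices),
        h.graph.Reachable (h.mkVertex i ⟨v, hv⟩) (h.mkVertex i ⟨w, hw⟩) := by
      intro v w hvw
      induction hvw with
      | refl => exact fun _ _ => SimpleGraph.Reachable.refl _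
      | @tail x y _ hxy ih =>
        intro hv hy
        obtain ⟨c, e⟩ := exists_Ed hxy
        exact (ih hv e.mem).trans (adj_of_edge (a := ⟨x, e.mem⟩) (b := ⟨y, hy⟩) hxy).reachable
    exact key a b (nbr_connected a.2 b.2) a.2 b.2
  have conn : ∀ i j, ∀ (a : (h.tri i).vertices) (b : (h.tri j).vertices),
      h.graph.Reachable (h.mkVertex i a) (h.mkVertex j b) := by
    intro i j
    induction 𝒯.connected i j with
    | refl => exact tri i
    | @tail x y _ hxy ih =>
      intro a b
      obtain ⟨k, l, ho⟩ := hxy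
      by_cases hne : (x, k) = (y, l)
      · cases hne
        exact ih a b
      · have := Quot.sound (glued_pt (h := h) ho hne ⟨0, hn⟩)
        have h1 := ih a ((h.tri x).pt k (Fin.rev ⟨0, hn⟩))
        have h2 := tri y ((h.tri y).pt l ⟨0, hn⟩) b
        have h3 : h.mkVertex x ((h.tri x).pt k (Fin.rev ⟨0, hn⟩)) =
          h.mkVertex y ((h.tri y).pt l ⟨0, hn⟩) := this
        rw [h3] at h1
        exact h1.trans h2
  have hne : Nonempty h.Vertex :=
    ⟨h.mkVertex (Classical.arbitrary ι) ((h.tri _).pt 0 ⟨0, hn⟩)⟩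
  refine ⟨fun x y => ?_⟩
  obtain ⟨i, a, rfl⟩ := exists_mk x
  obtain ⟨j, b, rfl⟩ := exists_mk y
  exact conn i j a b

/-! ### Divergence of flows on the structure graph -/

section Divergence

variable [Finite ι]

theorem divg_eq_sum_of_adj {ω : h.Vertex × h.Vertex → ℝ} (hω : ω ∈ flows h.graph) (v : h.Vertex)
    (S : Finset h.Vertex) (hS : ∀ w, h.graph.Adj v w → w ∈ S) :
    divg ω v = ∑ w ∈ S, ω (v, w) := by
  refine (Finset.sum_subset (Finset.subset_univ S) fun w _ hw => ?_).symm
  exact hω.2 v w fun hh => hw (hS w hh)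

/-- At an inner vertex the divergence is the sum over the three edges, one of each type. -/
theorem divg_inner {ω : h.Vertex × h.Vertex → ℝ} (hω : ω ∈ flows h.graph) {i : ι}
    {a : (h.tri i).vertices} (ha : (h.tri i).Inner a) {c : Fin 3 → ℕ} {σ : ℝ}
    {w : Fin 3 → (h.tri i).vertices} (hw : ∀ l, (h.tri i).Dart (c l) l σ a (w l)) :
    divg ω (h.mkVertex i a) = ∑ l, ω (h.mkVertex i a, h.mkVertex i (w l)) := by
  classical
  rw [divg_eq_sum_of_adj hω _ (Finset.univ.image fun l => h.mkVertex i (w l))]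
  · rw [Finset.sum_image]
    intro l _ l' _ hll
    have h1 : w l = w l' :=
      eq_of_heq (Sigma.mk.inj (edge_unique (hw l).1.1 (hw l').1.1 rfl hll).2).2
    exact (hw l).1.type_unique (hw l).2.1 (h1 ▸ (hw l').2.1)
  · intro y hy
    rcases adj_mk_iff.1 hy with ⟨b, hab, rfl⟩ | ⟨j, a', b, hg, -⟩
    · obtain ⟨c', e⟩ := exists_Ed hab
      obtain ⟨l, σ', d⟩ := e.exists_dart
      rw [Subtype.ext (d.target_unique (hw l))]
      exact Finset.mem_image_of_mem _ (Finset.mem_univ l)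
    · exact absurd ha hg.not_inner

/-- A vertex on a free side has a single edge. -/
theorem divg_free {ω : h.Vertex × h.Vertex → ℝ} (hω : ω ∈ flows h.graph) {i : ι}
    {a b : (h.tri i).vertices} {k : Fin 3} (ha : (a : ℂ) ∈ side k) (hk : 𝒯.opp (i, k) = (i, k))
    (hab : s((a : ℂ), (b : ℂ)) ∈ (h.tri i).edges) :
    divg ω (h.mkVertex i a) = ω (h.mkVertex i a, h.mkVertex i b) := by
  classical
  rw [divg_eq_sum_of_adj hω _ {h.mkVertex i b}, Finset.sum_singleton]
  intro y hy
  rw [Finset.mem_singleton]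
  rcases adj_mk_iff.1 hy with ⟨b', hab', rfl⟩ | ⟨j, a', b', ⟨k', l, ho, hne, hk', -⟩, -⟩
  · obtain ⟨c, e⟩ := exists_Ed hab
    obtain ⟨c', e'⟩ := exists_Ed hab'
    rw [Subtype.ext (e.unique_of_boundary e' ha).1]
  · simp only at ho hne hk'
    obtain rfl := side_unique a.2 ha hk'
    exact absurd (hk.symm.trans ho) hne

/-- A vertex on two glued sides has one edge in each of the two triangles. -/
theorem divg_glued {ω : h.Vertex × h.Vertex → ℝ} (hω : ω ∈ flows h.graph) {i j : ι}
    {a b : (h.tri i).vertices} {a' b' : (h.tri j).vertices} (hg : h.Glued ⟨i, a⟩ ⟨j, a'⟩)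
    (hab : s((a : ℂ), (b : ℂ)) ∈ (h.tri i).edges)
    (hab' : s((a' : ℂ), (b' : ℂ)) ∈ (h.tri j).edges) :
    divg ω (h.mkVertex i a) = ω (h.mkVertex i a, h.mkVertex i b) +
      ω (h.mkVertex j a', h.mkVertex j b') := by
  classical
  have hm : h.mkVertex i a = h.mkVertex j a' := Quot.sound hg
  obtain ⟨c, e⟩ := exists_Ed hab
  obtain ⟨c', e'⟩ := exists_Ed hab'
  obtain ⟨k, l, -, -, hk, hl, -⟩ := id hg
  have hne : h.mkVertex i b ≠ h.mkVertex j b' := fun hh => hg.ne (edge_unique hab hab' hm hh).1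
  rw [divg_eq_sum_of_adj hω _ {h.mkVertex i b, h.mkVertex j b'}, Finset.sum_pair hne, hm]
  intro y hy
  rw [Finset.mem_insert, Finset.mem_singleton]
  rcases adj_mk_iff.1 hy with ⟨b₁, hb₁, rfl⟩ | ⟨j', a₁, b₁, hg', hb₁, rfl⟩
  · obtain ⟨c₁, e₁⟩ := exists_Ed hb₁
    exact Or.inl (by rw [Subtype.ext (e.unique_of_boundary e₁ hk).1])
  · cases hg.unique hg'
    obtain ⟨c₁, e₁⟩ := exists_Ed hb₁
    exact Or.inr (by rw [Subtype.ext (e'.unique_of_boundary e₁ hl).1])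

end Divergence

end SurfaceHoneycomb

/-! ### Label maps and their divergence -/

namespace SurfaceHoneycomb

open TriHoneycomb Relation

variable {ι : Type} {p : ℕ} {𝒯 : TriangleGluing ι p} {n : ℕ} {h h' : SurfaceHoneycomb 𝒯 n}

/-- `ω` is the label map of `h`, as a flow on the structure graph of `h` itself. -/
def IsLabel (h : SurfaceHoneycomb 𝒯 n) (ω : h.Vertex × h.Vertex → ℝ) : Prop :=
  ω ∈ flows h.graph ∧ ∀ (i : ι) (a b : (h.tri i).vertices)
    (hab : s((a : ℂ), (b : ℂ)) ∈ (h.tri i).edges),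
    ω (h.mkVertex i a, h.mkVertex i b) = (h.tri i).sign a * (h.tri i).height ⟨_, hab⟩

theorem IsLabel.apply {ω : h.Vertex × h.Vertex → ℝ} (hω : h.IsLabel ω) {i : ι}
    {a b : (h.tri i).vertices} (hab : s((a : ℂ), (b : ℂ)) ∈ (h.tri i).edges) {l : Fin 3}
    (hl : coord l (a : ℂ) = coord l (b : ℂ)) :
    ω (h.mkVertex i a, h.mkVertex i b) = (h.tri i).sign a * coord l (a : ℂ) := by
  rw [hω.2 i a b hab, height_eq hab hl]

/-- The vertices of the structure graph on the free sides. -/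
def bv (h : SurfaceHoneycomb 𝒯 n) (j : Fin p) (m : Fin n) : h.Vertex :=
  h.mkVertex (𝒯.bdry j).1 ((h.tri (𝒯.bdry j).1).pt (𝒯.bdry j).2 m)

theorem opp_bdry (j : Fin p) : 𝒯.opp (𝒯.bdry j) = 𝒯.bdry j := (𝒯.opp_eq_self_iff _).2 ⟨j, rfl⟩

theorem not_glued_bdry {j : Fin p} {m : Fin n} {y : Σ i, (h.tri i).vertices} :
    ¬ h.Glued ⟨(𝒯.bdry j).1, (h.tri (𝒯.bdry j).1).pt (𝒯.bdry j).2 m⟩ y := by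
  rintro ⟨k, l, ho, hne, ha, -, -⟩
  simp only at ho hne ha
  obtain rfl := side_unique ((h.tri (𝒯.bdry j).1).pt (𝒯.bdry j).2 m).2 ha (pt_mem_side _ _)
  have := opp_bdry (𝒯 := 𝒯) j
  exact hne (this.symm.trans ho)

theorem bv_eq_mk_iff {j : Fin p} {m : Fin n} {i : ι} {a : (h.tri i).vertices} :
    h.bv j m = h.mkVertex i a ↔
      (⟨(𝒯.bdry j).1, (h.tri (𝒯.bdry j).1).pt (𝒯.bdry j).2 m⟩ : Σ i, (h.tri i).vertices) =
        ⟨i, a⟩ := by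
  unfold bv
  rw [mk_eq_iff]
  exact or_iff_left not_glued_bdry

theorem bv_injective {j j' : Fin p} {m m' : Fin n} (hb : h.bv j m = h.bv j' m') :
    j = j' ∧ m = m' := by
  have h1 := bv_eq_mk_iff.1 hb
  have h2 : 𝒯.bdry j = 𝒯.bdry j' := by
    generalize 𝒯.bdry j = x at h1
    generalize 𝒯.bdry j' = y at h1
    obtain ⟨i, k⟩ := x
    obtain ⟨i', k'⟩ := y
    obtain ⟨rfl, h2⟩ := Sigma.mk.inj h1
    have h3 := eq_of_heq h2
    simp only at h3
    have h4 : ((h.tri i).pt k m : ℂ) ∈ side k' := by rw [h3]; exact pt_mem_side _ _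
    rw [side_unique ((h.tri i).pt k m).2 (pt_mem_side _ _) h4]
  obtain rfl := 𝒯.bdry_injective h2
  exact ⟨rfl, pt_injective _ (eq_of_heq (Sigma.mk.inj h1).2)⟩

theorem bv_ne_inner {j : Fin p} {m : Fin n} {i : ι} {a : (h.tri i).vertices}
    (ha : (h.tri i).Inner a) : h.bv j m ≠ h.mkVertex i a := by
  intro hb
  have := bv_eq_mk_iff.1 hb
  cases this
  exact ha.2 _ (pt_mem_side _ _)

theorem bv_ne_glued {j : Fin p} {m : Fin n} {i : ι} {a : (h.tri i).vertices}
    {y : Σ i, (h.tri i).vertices} (hg : h.Glued ⟨i, a⟩ y) : h.bv j m ≠ h.mkVertex i a := by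
  intro hb
  have := bv_eq_mk_iff.1 hb
  cases this
  exact not_glued_bdry hg

/-- A vertex is inner, or on a free side, or on two glued sides. -/
theorem vertex_cases (v : h.Vertex) :
    (∃ (i : ι) (a : (h.tri i).vertices), (h.tri i).Inner a ∧ h.mkVertex i a = v) ∨
    (∃ j m, h.bv j m = v) ∨
    ∃ i j k l m, 𝒯.opp (i, k) = (j, l) ∧ (i, k) ≠ (j, l) ∧
      h.mkVertex i ((h.tri i).pt k (Fin.rev m)) = v := by
  obtain ⟨i, a, rfl⟩ := exists_mk v
  rcases inner_or_side a.2 with ha | ⟨k, hk⟩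
  · exact Or.inl ⟨i, a, ha, rfl⟩
  · obtain ⟨m, rfl⟩ := exists_pt hk
    by_cases ho : 𝒯.opp (i, k) = (i, k)
    · obtain ⟨j, hj⟩ := (𝒯.opp_eq_self_iff _).1 ho
      refine Or.inr (Or.inl ⟨j, m, ?_⟩)
      unfold bv
      rw [hj]
    · exact Or.inr (Or.inr ⟨i, _, k, _, Fin.rev m, rfl, fun hh => ho hh.symm, by
        rw [Fin.rev_rev]⟩)

open Classical in
/-- The divergence of the label maps, up to the boundary values on the free sides. It depends on
the structure graph only. -/
def baseDiv (h : SurfaceHoneycomb 𝒯 n) : h.Vertex → ℝ :=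
  Quot.lift (fun x => if hx : ∃ y, h.Glued x y then
      (1 + (h.tri x.1).sign x.2) / 2 + (1 + (h.tri hx.choose.1).sign hx.choose.2) / 2 - 1
    else if (h.tri x.1).Inner x.2 then (h.tri x.1).sign x.2 else (1 + (h.tri x.1).sign x.2) / 2)
    (by
      intro x y hxy
      have hx : ∃ y, h.Glued x y := ⟨y, hxy⟩
      have hy : ∃ z, h.Glued y z := ⟨x, hxy.symm⟩
      simp only [dif_pos hx, dif_pos hy]
      rw [← hxy.unique hx.choose_spec, ← hxy.symm.unique hy.choose_spec]
      ring)

theorem baseDiv_inner {i : ι} {a : (h.tri i).vertices} (ha : (h.tri i).Inner a) :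
    h.baseDiv (h.mkVertex i a) = (h.tri i).sign a := by
  have : ¬ ∃ y, h.Glued ⟨i, a⟩ y := fun ⟨y, hy⟩ => hy.not_inner ha
  simp only [baseDiv, mkVertex, dif_neg this, if_pos ha]

theorem baseDiv_bv (j : Fin p) (m : Fin n) : h.baseDiv (h.bv j m) =
    (1 + (h.tri (𝒯.bdry j).1).sign ((h.tri (𝒯.bdry j).1).pt (𝒯.bdry j).2 m)) / 2 := by
  have h1 : ¬ ∃ y, h.Glued ⟨(𝒯.bdry j).1, (h.tri (𝒯.bdry j).1).pt (𝒯.bdry j).2 m⟩ y :=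
    fun ⟨y, hy⟩ => not_glued_bdry hy
  have h2 : ¬ (h.tri (𝒯.bdry j).1).Inner ((h.tri (𝒯.bdry j).1).pt (𝒯.bdry j).2 m) :=
    fun hi => hi.2 _ (pt_mem_side _ _)
  simp only [baseDiv, bv, mkVertex, dif_neg h1, if_neg h2]

theorem baseDiv_glued {i j : ι} {a : (h.tri i).vertices} {a' : (h.tri j).vertices}
    (hg : h.Glued ⟨i, a⟩ ⟨j, a'⟩) : h.baseDiv (h.mkVertex i a) =
      (1 + (h.tri i).sign a) / 2 + (1 + (h.tri j).sign a') / 2 - 1 := by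
  have h1 : ∃ y, h.Glued ⟨i, a⟩ y := ⟨_, hg⟩
  simp only [baseDiv, mkVertex, dif_pos h1]
  rw [← hg.unique h1.choose_spec]

theorem baseDiv_int (v : h.Vertex) : ∃ z : ℤ, h.baseDiv v = z := by
  have key : ∀ {i} (a : (h.tri i).vertices), ∃ z : ℤ, (1 + (h.tri i).sign a) / 2 = (z : ℝ) := by
    intro i a
    rcases sign_eq_or (h := h.tri i) (a : ℂ) with hs | hs <;> rw [hs]
    · exact ⟨1, by norm_num⟩
    · exact ⟨0, by norm_num⟩
  rcases vertex_cases v with ⟨i, a, ha, rfl⟩ | ⟨j, m, rfl⟩ | ⟨i, j, k, l, m, ho, hne, rfl⟩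
  · rw [baseDiv_inner ha]
    rcases sign_eq_or (h := h.tri i) (a : ℂ) with hs | hs <;> rw [hs]
    · exact ⟨1, by norm_num⟩
    · exact ⟨-1, by norm_num⟩
  · rw [baseDiv_bv]
    exact key _
  · rw [baseDiv_glued (glued_pt ho hne m)]
    obtain ⟨z, hz⟩ := key ((h.tri i).pt k (Fin.rev m))
    obtain ⟨z', hz'⟩ := key ((h.tri j).pt l m)
    exact ⟨z + z' - 1, by rw [hz, hz']; push_cast; ring⟩

open Classical in
/-- The tuple `γ` of boundary values as a function on the vertices. -/
def bterm (h : SurfaceHoneycomb 𝒯 n) (γ : Fin p → Fin n → ℝ) (v : h.Vertex) : ℝ :=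
  ∑ j, ∑ m, if h.bv j m = v then γ j m else 0

theorem bterm_bv (γ : Fin p → Fin n → ℝ) (j : Fin p) (m : Fin n) :
    h.bterm γ (h.bv j m) = γ j m := by
  unfold bterm
  rw [Finset.sum_eq_single j, Finset.sum_eq_single m, if_pos rfl]
  · intro m' _ hm
    exact if_neg fun hh => hm (bv_injective hh).2
  · simp
  · intro j' _ hj
    exact Finset.sum_eq_zero fun m' _ => if_neg fun hh => hj (bv_injective hh).1
  · simp

theorem bterm_eq_zero (γ : Fin p → Fin n → ℝ) {v : h.Vertex} (hv : ∀ j m, h.bv j m ≠ v) :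
    h.bterm γ v = 0 :=
  Finset.sum_eq_zero fun j _ => Finset.sum_eq_zero fun m _ => if_neg (hv j m)

theorem sum_bterm [Finite ι] (γ : Fin p → Fin n → ℝ) : ∑ v, h.bterm γ v = ∑ j, ∑ m, γ j m := by
  unfold bterm
  rw [Finset.sum_comm]
  refine Finset.sum_congr rfl fun j _ => ?_
  rw [Finset.sum_comm]
  refine Finset.sum_congr rfl fun m _ => ?_
  rw [Finset.sum_eq_single (h.bv j m), if_pos rfl]
  · intro v _ hv
    exact if_neg fun hh => hv hh.symm
  · simp

theorem hasBoundary_iff {γ : Fin p → Fin n → ℝ} : h.HasBoundary γ ↔ ∀ j m, γ j m =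
    coord ((𝒯.bdry j).2 + 1) ((h.tri (𝒯.bdry j).1).pt (𝒯.bdry j).2 m : ℂ) := by
  unfold HasBoundary
  constructor
  · intro hb j m
    obtain ⟨h1, h2⟩ := hb j
    rw [sideCoords_eq] at h2
    exact (congrFun (strictAnti_eq_of_range_eq (pt_strictAnti _ _) h1 h2) m).symm
  · intro hb j
    have : γ j = fun m => coord ((𝒯.bdry j).2 + 1)
        ((h.tri (𝒯.bdry j).1).pt (𝒯.bdry j).2 m : ℂ) := funext (hb j)
    rw [this, sideCoords_eq]
    exact ⟨pt_strictAnti _ _, rfl⟩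

/-- The value of a label at a boundary vertex in terms of its position on the side. The height of
the boundary edge is `v_{k+1}` for colour `0`, where the sign is `-1`, and `v_{k+2} = 1 - v_{k+1}`
for colour `1`, where the sign is `1`; in both cases the label is affine in `v_{k+1}` with slope
`-1`. -/
theorem side_value {H : TriHoneycomb n} {a b : ℂ} {k : Fin 3} (ha : a ∈ side k)
    (hab : s(a, b) ∈ H.edges) {z : ℂ} {t : ℝ} (hz : coord k z = 0)
    (hzt : ∀ l, coord l a = coord l b → coord l z = H.sign a * t) :
    t = (1 + H.sign a) / 2 - coord (k + 1) z := by
  obtain ⟨c, e⟩ := exists_Ed hab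
  have s1 := coord_sum k z
  rcases e.boundary ha with ⟨-, d⟩ | ⟨-, d⟩
  · have h1 := hzt _ d.2.1
    rw [d.sign_eq] at h1 ⊢
    linarith
  · have h1 := hzt _ d.2.1
    rw [d.sign_eq] at h1 ⊢
    linarith

theorem sign_mul_sign {H : TriHoneycomb n} (v : ℂ) : H.sign v * H.sign v = 1 := by
  rcases sign_eq_or (h := H) v with hs | hs <;> rw [hs] <;> norm_num

theorem IsLabel.side_apply {ω : h.Vertex × h.Vertex → ℝ} (hω : h.IsLabel ω) {i : ι}
    {a b : (h.tri i).vertices} (hab : s((a : ℂ), (b : ℂ)) ∈ (h.tri i).edges) {k : Fin 3}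
    (ha : (a : ℂ) ∈ side k) : ω (h.mkVertex i a, h.mkVertex i b) =
      (1 + (h.tri i).sign a) / 2 - coord (k + 1) (a : ℂ) := by
  refine side_value ha hab ha.2 fun l hl => ?_
  rw [hω.apply hab hl, ← mul_assoc, sign_mul_sign, one_mul]

theorem exists_nbr {H : TriHoneycomb n} (a : H.vertices) :
    ∃ b : H.vertices, s((a : ℂ), (b : ℂ)) ∈ H.edges := by
  obtain ⟨c, b, e⟩ := exists_Ed_of_mem a.2
  exact ⟨⟨b, e.symm.mem⟩, e.1⟩

theorem exists_darts {H : TriHoneycomb n} {a : H.vertices} (ha : H.Inner a) :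
    ∃ (c : Fin 3 → ℕ) (σ : ℝ) (w : Fin 3 → H.vertices), ∀ l, H.Dart (c l) l σ a (w l) := by
  obtain ⟨σ, hall⟩ := ha.exists_dart
  choose c w hw using hall
  exact ⟨c, σ, fun l => ⟨w l, (hw l).1.symm.mem⟩, hw⟩

/-- The divergence of a label map is determined by the structure graph and the boundary values: the
heights of the three edges at an inner vertex are its coordinates, with sum `1`, and at glued sides
the position cancels. -/
theorem IsLabel.divg_eq [Finite ι] {ω : h.Vertex × h.Vertex → ℝ} (hω : h.IsLabel ω)
    {γ : Fin p → Fin n → ℝ} (hγ : h.HasBoundary γ) (v : h.Vertex) :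
    divg ω v = h.baseDiv v - h.bterm γ v := by
  rcases vertex_cases v with ⟨i, a, ha, rfl⟩ | ⟨j, m, rfl⟩ | ⟨i, j, k, l, m, ho, hne, rfl⟩
  · obtain ⟨c, σ, w, hw⟩ := exists_darts ha
    rw [divg_inner hω.1 ha hw, baseDiv_inner ha, bterm_eq_zero γ fun j m => bv_ne_inner ha]
    simp only [fun l => hω.apply (hw l).1.1 (hw l).2.1]
    rw [← Finset.mul_sum, Fin.sum_univ_three]
    have := coord_sum 0 (a : ℂ)
    simp only [zero_add] at this
    rw [this]
    ring
  · obtain ⟨b, hab⟩ := exists_nbr ((h.tri (𝒯.bdry j).1).pt (𝒯.bdry j).2 m)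
    have h1 := divg_free hω.1 (pt_mem_side _ _) (opp_bdry j) hab
    rw [baseDiv_bv, bterm_bv, hasBoundary_iff.1 hγ]
    exact h1.trans (hω.side_apply hab (pt_mem_side _ _))
  · have hg := glued_pt (h := h) ho hne m
    obtain ⟨b, hab⟩ := exists_nbr ((h.tri i).pt k (Fin.rev m))
    obtain ⟨b', hab'⟩ := exists_nbr ((h.tri j).pt l m)
    rw [divg_glued hω.1 hg hab hab', baseDiv_glued hg, bterm_eq_zero γ fun j m => bv_ne_glued hg,
      hω.side_apply hab (pt_mem_side _ _), hω.side_apply hab' (pt_mem_side _ _),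
      h.compat_pt ho hne m]
    ring

theorem IsLabel.abs_le_one {ω : h.Vertex × h.Vertex → ℝ} (hω : h.IsLabel ω)
    (e : h.Vertex × h.Vertex) : |ω e| ≤ 1 := by
  obtain ⟨x, y⟩ := e
  by_cases hxy : h.graph.Adj x y
  · obtain ⟨i, a, b, hab, rfl, rfl⟩ := adj_iff.1 hxy
    obtain ⟨c, e⟩ := exists_Ed hab
    obtain ⟨l, hl⟩ := e.exists_type
    rw [hω.apply hab hl, abs_mul]
    have h1 : |(h.tri i).sign a| = 1 := by
      rcases sign_eq_or (h := h.tri i) (a : ℂ) with hs | hs <;> rw [hs] <;> simp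
    have h2 := mem_triangle a.2 l
    have h3 := mem_triangle a.2 (l + 1)
    have h4 := mem_triangle a.2 (l + 2)
    have h5 := coord_sum l (a : ℂ)
    rw [h1, one_mul, abs_of_nonneg h2]
    linarith
  · rw [hω.1.2 x y hxy]
    simp

/-! ### Transport along isomorphisms of structure graphs -/

theorem Iso.map_glued (f : h.Iso h') {x y : Σ i, (h.tri i).vertices} (hg : h.Glued x y) :
    h'.Glued ⟨x.1, (f x.1).toEquiv x.2⟩ ⟨y.1, (f y.1).toEquiv y.2⟩ := by
  obtain ⟨i, a⟩ := x
  obtain ⟨j, b⟩ := y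
  obtain ⟨k, l, m, ho, hne, rfl, rfl⟩ := hg.exists_pt
  simp only [(f i).map_pt, (f j).map_pt]
  exact glued_pt ho hne m

/-- The map on vertices of the structure graphs induced by an isomorphism. -/
def Iso.vmap (f : h.Iso h') : h.Vertex → h'.Vertex :=
  Quot.map (fun x => ⟨x.1, (f x.1).toEquiv x.2⟩) fun _ _ hg => f.map_glued hg

/-- The inverse isomorphism. -/
def Iso.symm (f : h.Iso h') : h'.Iso h := fun i => (f i).symm

/-- The composition of isomorphisms. -/
def Iso.trans {h'' : SurfaceHoneycomb 𝒯 n} (f : h.Iso h') (g : h'.Iso h'') : h.Iso h'' :=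
  fun i => (f i).trans (g i)

theorem Iso.vmap_mk (f : h.Iso h') (i : ι) (a : (h.tri i).vertices) :
    f.vmap (h.mkVertex i a) = h'.mkVertex i ((f i).toEquiv a) := rfl

theorem Iso.vmap_symm_vmap (f : h.Iso h') (v : h.Vertex) : f.symm.vmap (f.vmap v) = v := by
  obtain ⟨i, a, rfl⟩ := exists_mk v
  rw [f.vmap_mk, f.symm.vmap_mk]
  exact congrArg _ ((f i).toEquiv.symm_apply_apply a)

theorem Iso.vmap_vmap_symm (f : h.Iso h') (v : h'.Vertex) : f.vmap (f.symm.vmap v) = v := by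
  obtain ⟨i, a, rfl⟩ := exists_mk v
  rw [f.symm.vmap_mk, f.vmap_mk]
  exact congrArg _ ((f i).toEquiv.apply_symm_apply a)

/-- The bijection between the vertices of the structure graphs induced by an isomorphism. -/
def Iso.vequiv (f : h.Iso h') : h.Vertex ≃ h'.Vertex :=
  ⟨f.vmap, f.symm.vmap, f.vmap_symm_vmap, f.vmap_vmap_symm⟩

theorem Iso.adj_vmap (f : h.Iso h') {x y : h.Vertex} (hxy : h.graph.Adj x y) :
    h'.graph.Adj (f.vmap x) (f.vmap y) := by
  obtain ⟨i, a, b, hab, rfl, rfl⟩ := adj_iff.1 hxy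
  exact adj_iff.2 ⟨i, _, _, ((f i).adj_iff a b).1 hab, rfl, rfl⟩

theorem Iso.adj_vmap_iff (f : h.Iso h') {x y : h.Vertex} :
    h'.graph.Adj (f.vmap x) (f.vmap y) ↔ h.graph.Adj x y := by
  refine ⟨fun hh => ?_, f.adj_vmap⟩
  have := f.symm.adj_vmap hh
  rwa [f.vmap_symm_vmap, f.vmap_symm_vmap] at this

/-- The pull-back of functions on pairs of vertices. -/
def Iso.pull (f : h.Iso h') (ω : h'.Vertex × h'.Vertex → ℝ) : h.Vertex × h.Vertex → ℝ :=
  fun e => ω (f.vmap e.1, f.vmap e.2)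

theorem Iso.pull_mem_flows (f : h.Iso h') {ω : h'.Vertex × h'.Vertex → ℝ}
    (hω : ω ∈ flows h'.graph) : f.pull ω ∈ flows h.graph :=
  ⟨fun _ _ => hω.1 _ _, fun _ _ hvw => hω.2 _ _ fun hh => hvw (f.adj_vmap_iff.1 hh)⟩

theorem Iso.pull_pull_symm (f : h.Iso h') (ω : h.Vertex × h.Vertex → ℝ) :
    f.pull (f.symm.pull ω) = ω := by
  funext e
  simp only [pull, f.vmap_symm_vmap]

theorem Iso.pull_symm_pull (f : h.Iso h') (ω : h'.Vertex × h'.Vertex → ℝ) :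
    f.symm.pull (f.pull ω) = ω := by
  funext e
  simp only [pull, f.vmap_vmap_symm]

theorem Iso.divg_pull [Finite ι] (f : h.Iso h') (ω : h'.Vertex × h'.Vertex → ℝ) (v : h.Vertex) :
    divg (f.pull ω) v = divg ω (f.vmap v) :=
  f.vequiv.sum_comp fun w => ω (f.vmap v, w)

theorem Iso.vmap_bv (f : h.Iso h') (j : Fin p) (m : Fin n) : f.vmap (h.bv j m) = h'.bv j m := by
  unfold bv
  rw [f.vmap_mk, (f _).map_pt]

theorem Iso.bterm_vmap (f : h.Iso h') (γ : Fin p → Fin n → ℝ) (v : h.Vertex) :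
    h'.bterm γ (f.vmap v) = h.bterm γ v := by
  have : ∀ j m, h'.bv j m = f.vmap v ↔ h.bv j m = v := fun j m => by
    rw [← f.vmap_bv]
    exact f.vequiv.apply_eq_iff_eq (x := h.bv j m) (y := v)
  unfold bterm
  refine Finset.sum_congr rfl fun j _ => Finset.sum_congr rfl fun m _ => ?_
  by_cases hv : h.bv j m = v
  · rw [if_pos hv, if_pos ((this j m).2 hv)]
  · rw [if_neg hv, if_neg fun hh => hv ((this j m).1 hh)]

/-- The structure graph determines the divergence: the signs of the vertices are determined by the
colours. -/
theorem Iso.baseDiv_vmap (f : h.Iso h') (hn : 0 < n) (v : h.Vertex) :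
    h'.baseDiv (f.vmap v) = h.baseDiv v := by
  rcases vertex_cases v with ⟨i, a, ha, rfl⟩ | ⟨j, m, rfl⟩ | ⟨i, j, k, l, m, ho, hne, rfl⟩
  · rw [f.vmap_mk, baseDiv_inner (((f i).inner_iff a).1 ha), baseDiv_inner ha, (f i).sign_eq hn]
  · rw [f.vmap_bv, baseDiv_bv, baseDiv_bv, ← (f _).map_pt, (f _).sign_eq hn]
  · have hg := glued_pt (h := h) ho hne m
    rw [f.vmap_mk, baseDiv_glued (f.map_glued hg), baseDiv_glued hg, (f i).sign_eq hn,
      (f j).sign_eq hn]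

/-- A flow belongs to the label set of a structure graph if and only if an isomorphism carries it to
the label map of a honeycomb with the given boundary. -/
theorem mem_labelSet_iff {h₀ : SurfaceHoneycomb 𝒯 n} {γ : Fin p → Fin n → ℝ}
    {ω : h₀.Vertex × h₀.Vertex → ℝ} : ω ∈ labelSet h₀ γ ↔
      ∃ h : SurfaceHoneycomb 𝒯 n, h.HasBoundary γ ∧ ∃ f : h.Iso h₀, h.IsLabel (f.pull ω) := by
  constructor
  · rintro ⟨hω, h, hγ, f, hf⟩
    exact ⟨h, hγ, f, f.pull_mem_flows hω, hf⟩
  · rintro ⟨h, hγ, f, h1, h2⟩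
    refine ⟨?_, h, hγ, f, h2⟩
    rw [← f.pull_symm_pull ω]
    exact f.symm.pull_mem_flows h1

theorem divg_of_mem_labelSet [Finite ι] (hn : 0 < n) {h₀ : SurfaceHoneycomb 𝒯 n}
    {γ : Fin p → Fin n → ℝ} {ω : h₀.Vertex × h₀.Vertex → ℝ} (hω : ω ∈ labelSet h₀ γ)
    (v : h₀.Vertex) : divg ω v = h₀.baseDiv v - h₀.bterm γ v := by
  obtain ⟨h, hγ, f, hf⟩ := mem_labelSet_iff.1 hω
  have := hf.divg_eq hγ (f.symm.vmap v)
  rwa [f.divg_pull, ← f.baseDiv_vmap hn, ← f.bterm_vmap, f.vmap_vmap_symm] at this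

theorem abs_le_one_of_mem_labelSet {h₀ : SurfaceHoneycomb 𝒯 n}
    {γ : Fin p → Fin n → ℝ} {ω : h₀.Vertex × h₀.Vertex → ℝ} (hω : ω ∈ labelSet h₀ γ)
    (e : h₀.Vertex × h₀.Vertex) : |ω e| ≤ 1 := by
  obtain ⟨h, hγ, f, hf⟩ := mem_labelSet_iff.1 hω
  have := hf.abs_le_one (f.symm.vmap e.1, f.symm.vmap e.2)
  simpa only [Iso.pull, f.vmap_vmap_symm] using this

/-- The label sets of isomorphic honeycombs correspond. -/
theorem Iso.pull_mem_labelSet_iff {h₀ h₁ : SurfaceHoneycomb 𝒯 n} (g : h₁.Iso h₀)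
    {γ : Fin p → Fin n → ℝ} {ω : h₀.Vertex × h₀.Vertex → ℝ} :
    g.pull ω ∈ labelSet h₁ γ ↔ ω ∈ labelSet h₀ γ := by
  have key : ∀ {h₀ h₁ : SurfaceHoneycomb 𝒯 n} (g : h₁.Iso h₀) {ω : h₀.Vertex × h₀.Vertex → ℝ},
      ω ∈ labelSet h₀ γ → g.pull ω ∈ labelSet h₁ γ := by
    intro h₀ h₁ g ω hω
    obtain ⟨h, hγ, f, hf⟩ := mem_labelSet_iff.1 hω
    refine mem_labelSet_iff.2 ⟨h, hγ, f.trans g.symm, ?_⟩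
    have : (f.trans g.symm).pull (g.pull ω) = f.pull ω := by
      funext e
      have h1 : ∀ v, g.vmap ((f.trans g.symm).vmap v) = f.vmap v := by
        intro v
        obtain ⟨i, a, rfl⟩ := exists_mk v
        rw [vmap_mk, vmap_mk, vmap_mk]
        exact congrArg _ ((g i).toEquiv.apply_symm_apply _)
      simp only [pull, h1]
    rwa [this]
  refine ⟨fun hh => ?_, key g⟩
  have := key g.symm hh
  rwa [g.pull_symm_pull] at this

end SurfaceHoneycomb

/-! ### The label sets are relatively open in affine spaces of flows -/

theorem exists_inc_sq {k l : Fin 3} (hkl : k ≠ l) : inc k l * inc k l = 1 := by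
  unfold inc
  rw [if_neg hkl]
  split_ifs <;> norm_num

namespace SurfaceHoneycomb

open TriHoneycomb Relation

variable {ι : Type} {p : ℕ} {𝒯 : TriangleGluing ι p} {n : ℕ} {h : SurfaceHoneycomb 𝒯 n}

/-- The position of a vertex as a function of the flow: it reproduces the position in `h` for the
label map of `h`, and the values of the flow at the vertex are the heights of lines through the
position. -/
theorem IsLabel.exists_pos [Finite ι] {ω₀ : h.Vertex × h.Vertex → ℝ} (hω₀ : h.IsLabel ω₀) (i : ι)
    (a : (h.tri i).vertices) : ∃ P : (h.Vertex × h.Vertex → ℝ) → ℂ, Continuous P ∧ P ω₀ = a ∧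
      ∀ ω ∈ flows h.graph,
        ((h.tri i).Inner a → divg ω (h.mkVertex i a) = (h.tri i).sign a) →
        (∀ (b : (h.tri i).vertices) l, s((a : ℂ), (b : ℂ)) ∈ (h.tri i).edges →
          coord l (a : ℂ) = coord l (b : ℂ) →
          coord l (P ω) = (h.tri i).sign a * ω (h.mkVertex i a, h.mkVertex i b)) ∧
        ∀ k, (a : ℂ) ∈ side k → coord k (P ω) = 0 := by
  rcases inner_or_side a.2 with ha | ⟨k, hk⟩
  · obtain ⟨c, σ, w, hw⟩ := exists_darts ha
    set y : (h.Vertex × h.Vertex → ℝ) → Fin 3 → ℝ := fun ω l =>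
      (h.tri i).sign a * ω (h.mkVertex i a, h.mkVertex i (w l)) with hy
    have hy0 : ∀ l, y ω₀ l = coord l (a : ℂ) := by
      intro l
      simp only [hy]
      rw [hω₀.apply (hw l).1.1 (hw l).2.1, ← mul_assoc, sign_mul_sign, one_mul]
    -- Two of the three values determine the position; the third one agrees because the values have
    -- sum `1` by the condition on the divergence.
    refine ⟨fun ω => (a + ((y ω 1 - coord 1 (a : ℂ) : ℝ) : ℂ) * dir 2) +
      ((coord 2 (a : ℂ) - y ω 2 : ℝ) : ℂ) * dir 1, ?_, ?_, fun ω hω hd => ⟨?_, ?_⟩⟩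
    · simp only [hy]
      fun_prop
    · simp only [hy0]
      simp
    · intro b l hab hl
      have hb : b = w l := by
        obtain ⟨c', e⟩ := exists_Ed hab
        obtain ⟨σ', d⟩ := e.dart_of_type hl
        exact Subtype.ext (d.target_unique (hw l))
      subst hb
      have hsum := hd ha
      rw [divg_inner hω ha hw, Fin.sum_univ_three] at hsum
      have hsum' : y ω 0 + y ω 1 + y ω 2 = 1 := by
        simp only [hy]
        rw [← mul_add, ← mul_add, hsum, sign_mul_sign]
      have s1 := coord_sum 0 (a : ℂ)
      simp only [zero_add] at s1
      rw [coord_add_dir, coord_add_dir]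
      change _ = y ω l
      (fin_cases l <;> simp [inc]) <;> linarith
    · exact fun k hk => absurd hk (ha.2 k)
  · obtain ⟨b, hab⟩ := exists_nbr a
    obtain ⟨c, e⟩ := exists_Ed hab
    obtain ⟨l, hl⟩ := e.exists_type
    have hlk : l ≠ k := by
      rintro rfl
      have := e.pos_of_boundary hk
      rw [← hl] at this
      exact this.ne' hk.2
    -- Move `a` along its side until the height of its only edge is the value of the flow; the type
    -- of this edge is not that of the side, as `hlk` says.
    refine ⟨fun ω => a + ((inc l k * ((h.tri i).sign a * ω (h.mkVertex i a, h.mkVertex i b) -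
      coord l (a : ℂ)) : ℝ) : ℂ) * dir k, ?_, ?_, fun ω hω hd => ⟨?_, ?_⟩⟩
    · fun_prop
    · simp only
      rw [hω₀.apply hab hl, ← mul_assoc, sign_mul_sign, one_mul]
      simp
    · intro b' l' hab' hl'
      obtain ⟨c', e'⟩ := exists_Ed hab'
      obtain rfl : b = b' := Subtype.ext (e.unique_of_boundary e' hk).1
      obtain rfl := e.type_unique hl hl'
      rw [coord_add_dir]
      have := exists_inc_sq hlk
      linear_combination ((h.tri i).sign a * ω (h.mkVertex i a, h.mkVertex i b) -
      coord l (a : ℂ)) * this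
    · intro k' hk'
      obtain rfl := side_unique a.2 hk hk'
      rw [coord_add_dir, hk.2]
      simp [inc]

theorem pt_honeycomb {H : TriHoneycomb n} {pos : ℂ → ℂ} (D : H.IsDeformation pos) (k : Fin 3)
    (m : Fin n) : (D.honeycomb.pt k m : ℂ) = pos (H.pt k m) := by
  rw [← D.iso.map_pt, D.iso_apply]

open Topology Filter in
/-- Flows close to the label map of `h` with the same divergence away from the free sides are the
label maps of deformations of `h`. -/
theorem IsLabel.eventually [Finite ι] (hn : 0 < n) {ω₀ : h.Vertex × h.Vertex → ℝ}
    (hω₀ : h.IsLabel ω₀) : ∀ᶠ ω in 𝓝 ω₀, ω ∈ flows h.graph →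
      (∃ γ : Fin p → Fin n → ℝ, ∀ v, divg ω v = h.baseDiv v - h.bterm γ v) →
      ∃ (h' : SurfaceHoneycomb 𝒯 n) (f : h'.Iso h), h'.IsLabel (f.pull ω) := by
  choose P hPc hP0 hP using hω₀.exists_pos
  have hev : ∀ i, ∀ᶠ ω in 𝓝 ω₀,
      (∀ (a b : (h.tri i).vertices) l, s((a : ℂ), (b : ℂ)) ∈ (h.tri i).edges →
        coord l (a : ℂ) = coord l (b : ℂ) → coord l (P i a ω) = coord l (P i b ω)) →
      (∀ (a : (h.tri i).vertices) k, (a : ℂ) ∈ side k → coord k (P i a ω) = 0) →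
      (h.tri i).IsDeformation ((h.tri i).extendPos fun a => P i a ω) := by
    intro i
    have hc : Continuous fun ω => fun a : (h.tri i).vertices => P i a ω :=
      continuous_pi fun a => hPc i a
    have ht := hc.tendsto ω₀
    simp only [hP0] at ht
    exact ht.eventually (h.tri i).eventually_isDeformation
  filter_upwards [eventually_all.2 hev] with ω hω hfl ⟨γ, hγ⟩
  have hinner : ∀ i (a : (h.tri i).vertices), (h.tri i).Inner a →
      divg ω (h.mkVertex i a) = (h.tri i).sign a := by
    intro i a ha
    rw [hγ, baseDiv_inner ha, bterm_eq_zero γ fun j m => bv_ne_inner ha, sub_zero]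
  have hP1 : ∀ i (a b : (h.tri i).vertices) l, s((a : ℂ), (b : ℂ)) ∈ (h.tri i).edges →
      coord l (a : ℂ) = coord l (b : ℂ) →
      coord l (P i a ω) = (h.tri i).sign a * ω (h.mkVertex i a, h.mkVertex i b) :=
    fun i a => (hP i a ω hfl (hinner i a)).1
  have hP2 : ∀ i (a : (h.tri i).vertices) k, (a : ℂ) ∈ side k → coord k (P i a ω) = 0 :=
    fun i a => (hP i a ω hfl (hinner i a)).2
  have D : ∀ i, (h.tri i).IsDeformation ((h.tri i).extendPos fun a => P i a ω) := by
    intro i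
    refine hω i (fun a b l hab hl => ?_) (hP2 i)
    have hab' : s((b : ℂ), (a : ℂ)) ∈ (h.tri i).edges := by rwa [Sym2.eq_swap]
    rw [hP1 i a b l hab hl, hP1 i b a l hab' hl.symm, hfl.1, Nbr.sign_eq (h := h.tri i) hab]
    ring
  have hpt : ∀ i k m, ((D i).honeycomb.pt k m : ℂ) = P i ((h.tri i).pt k m) ω := by
    intro i k m
    rw [pt_honeycomb, extendPos_apply]
  -- the value of the flow at a boundary vertex gives the new position on the side
  have hval : ∀ i k m (b : (h.tri i).vertices),
      s(((h.tri i).pt k m : ℂ), (b : ℂ)) ∈ (h.tri i).edges →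
      ω (h.mkVertex i ((h.tri i).pt k m), h.mkVertex i b) =
        (1 + (h.tri i).sign ((h.tri i).pt k m)) / 2 -
          coord (k + 1) (P i ((h.tri i).pt k m) ω) := by
    intro i k m b hab
    exact side_value (pt_mem_side k m) hab (hP2 i _ k (pt_mem_side k m))
      fun l hl => hP1 i _ b l hab hl
  have hcompat : ∀ x, 𝒯.opp x ≠ x → ((D (𝒯.opp x).1).honeycomb).sideCoords (𝒯.opp x).2 =
      (fun t => 1 - t) '' ((D x.1).honeycomb).sideCoords x.2 := by
    rintro ⟨i, k⟩ hne
    obtain ⟨⟨j, l⟩, ho⟩ : ∃ y, 𝒯.opp (i, k) = y := ⟨_, rfl⟩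
    rw [ho] at hne ⊢
    simp only [sideCoords_eq, hpt]
    -- The divergence condition at a vertex on two glued sides says that its two new positions
    -- match.
    have hrel : ∀ m, coord (l + 1) (P j ((h.tri j).pt l m) ω) =
        1 - coord (k + 1) (P i ((h.tri i).pt k (Fin.rev m)) ω) := by
      intro m
      have hg := glued_pt (h := h) ho hne.symm m
      obtain ⟨b, hab⟩ := exists_nbr ((h.tri i).pt k (Fin.rev m))
      obtain ⟨b', hab'⟩ := exists_nbr ((h.tri j).pt l m)
      have h1 := hγ (h.mkVertex i ((h.tri i).pt k (Fin.rev m)))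
      rw [divg_glued hfl hg hab hab', baseDiv_glued hg, bterm_eq_zero γ fun j m => bv_ne_glued hg,
        hval _ _ _ _ hab, hval _ _ _ _ hab'] at h1
      linarith
    ext t
    constructor
    · rintro ⟨m, rfl⟩
      exact ⟨_, ⟨Fin.rev m, rfl⟩, (hrel m).symm⟩
    · rintro ⟨_, ⟨m, rfl⟩, rfl⟩
      refine ⟨Fin.rev m, ?_⟩
      have := hrel (Fin.rev m)
      rwa [Fin.rev_rev] at this
  set h' : SurfaceHoneycomb 𝒯 n := ⟨fun i => (D i).honeycomb, hcompat⟩ with hh'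
  set f : h'.Iso h := fun i => (D i).iso.symm with hf
  refine ⟨h', f, f.pull_mem_flows hfl, fun i a b hab => ?_⟩
  obtain ⟨a₀, rfl⟩ := (D i).iso.toEquiv.surjective a
  obtain ⟨b₀, rfl⟩ := (D i).iso.toEquiv.surjective b
  have hab₀ : s((a₀ : ℂ), (b₀ : ℂ)) ∈ (h.tri i).edges := ((D i).iso.adj_iff a₀ b₀).2 hab
  obtain ⟨c, e⟩ := exists_Ed hab₀
  obtain ⟨l, hl⟩ := e.exists_type
  have h1 : coord l (((D i).iso.toEquiv a₀ : ℂ)) = coord l ((D i).iso.toEquiv b₀ : ℂ) := by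
    rw [(D i).iso_apply, (D i).iso_apply]
    exact (D i).type_eq _ _ l hab₀ hl
  have h2 : (D i).honeycomb.height ⟨_, hab⟩ = coord l ((D i).iso.toEquiv a₀ : ℂ) := height_eq hab h1
  have h3 : (D i).honeycomb.sign ((D i).iso.toEquiv a₀) = (h.tri i).sign a₀ :=
    (D i).iso.sign_eq hn a₀
  have h4 : f.pull ω (h'.mkVertex i ((D i).iso.toEquiv a₀), h'.mkVertex i ((D i).iso.toEquiv b₀)) =
      ω (h.mkVertex i a₀, h.mkVertex i b₀) := by
    simp only [Iso.pull, Iso.vmap_mk]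
    have : ∀ x, (f i).toEquiv ((D i).iso.toEquiv x) = x := fun x =>
      (D i).iso.toEquiv.symm_apply_apply x
    rw [this, this]
  refine h4.trans ?_
  refine Eq.trans ?_ (congrArg₂ (· * ·) h3.symm h2.symm)
  rw [(D i).iso_apply, extendPos_apply, hP1 i a₀ b₀ l hab₀ hl, ← mul_assoc, sign_mul_sign, one_mul]

theorem exists_hasBoundary (h : SurfaceHoneycomb 𝒯 n) : ∃ γ, h.HasBoundary γ :=
  ⟨_, hasBoundary_iff.2 fun _ _ => rfl⟩

theorem Iso.continuous_pull {h' : SurfaceHoneycomb 𝒯 n} (f : h.Iso h') : Continuous f.pull :=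
  continuous_pi fun _ => continuous_apply _

open Topology Filter in
/-- For each structure graph there is one open set of functions on pairs of vertices which cuts out
the label sets from the affine spaces of flows with the appropriate divergence, for all boundary
values. -/
theorem exists_open_labelSet [Finite ι] (hn : 0 < n) (h₀ : SurfaceHoneycomb 𝒯 n) :
    ∃ U : Set (h₀.Vertex × h₀.Vertex → ℝ), IsOpen U ∧ ∀ γ : Fin p → Fin n → ℝ, labelSet h₀ γ =
      {ω | ω ∈ flows h₀.graph ∧ ∀ v, divg ω v = h₀.baseDiv v - h₀.bterm γ v} ∩ U := by
  -- The open set is the interior of the set of all flows with some admissible boundary values which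
  -- are label maps, together with all other functions; the boundary values are read off the
  -- divergence.
  set Q : Set (h₀.Vertex × h₀.Vertex → ℝ) := {ω | ω ∈ flows h₀.graph →
    (∃ γ : Fin p → Fin n → ℝ, ∀ v, divg ω v = h₀.baseDiv v - h₀.bterm γ v) →
    ∃ γ, ω ∈ labelSet h₀ γ} with hQ
  refine ⟨interior Q, isOpen_interior, fun γ => Subset.antisymm (fun ω hω => ?_) ?_⟩
  · refine ⟨⟨hω.1, divg_of_mem_labelSet hn hω⟩, ?_⟩
    rw [mem_interior_iff_mem_nhds]
    obtain ⟨h, hγ, f, hf⟩ := mem_labelSet_iff.1 hω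
    have hev := (f.continuous_pull.tendsto ω).eventually (hf.eventually hn)
    filter_upwards [hev] with ω' hω' hfl ⟨γ', hγ'⟩
    obtain ⟨h', f', hl⟩ := hω' (f.pull_mem_flows hfl) ⟨γ', fun v => by
      rw [f.divg_pull, hγ', f.baseDiv_vmap hn, f.bterm_vmap]⟩
    obtain ⟨γ'', hγ''⟩ := h'.exists_hasBoundary
    refine ⟨γ'', f.pull_mem_labelSet_iff.1 ?_⟩
    exact mem_labelSet_iff.2 ⟨h', hγ'', f', hl⟩
  · rintro ω ⟨⟨h1, h2⟩, h3⟩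
    obtain ⟨γ', hω⟩ := interior_subset h3 h1 ⟨γ, h2⟩
    have : γ = γ' := by
      funext j m
      have h4 := divg_of_mem_labelSet hn hω (h₀.bv j m)
      rw [h2, bterm_bv, bterm_bv] at h4
      linarith
    rwa [this]

end SurfaceHoneycomb

/-! ### Honeycomb volumes: measurability, finiteness, invariance -/

namespace SurfaceHoneycomb

open TriHoneycomb

variable {ι : Type} [Finite ι] {p : ℕ} {𝒯 : TriangleGluing ι p} {n : ℕ}
  {h h₀ : SurfaceHoneycomb 𝒯 n}

/-- The label set read in a chart. -/
def chartSet (h₀ : SurfaceHoneycomb 𝒯 n) {κ : Type} (o : κ → h₀.Vertex × h₀.Vertex)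
    (γ : Fin p → Fin n → ℝ) : Set (κ → ℝ) := (fun ω k => ω (o k)) '' labelSet h₀ γ

theorem sub_mem_divFree (hn : 0 < n) {γ : Fin p → Fin n → ℝ} {ω ω' : h₀.Vertex × h₀.Vertex → ℝ}
    (hω : ω ∈ labelSet h₀ γ) (hω' : ω' ∈ labelSet h₀ γ) : ω - ω' ∈ divFree h₀.graph := by
  rw [mem_divFree_iff]
  refine ⟨(flows _).sub_mem hω.1 hω'.1, ?_⟩
  funext v
  rw [divg_sub, Pi.sub_apply, divg_of_mem_labelSet hn hω, divg_of_mem_labelSet hn hω', sub_self]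
  rfl

theorem flowVolume_labelSet [Nonempty ι] (hn : 0 < n) {κ : Type} [Fintype κ]
    {o : κ → h₀.Vertex × h₀.Vertex} (ho : IsChart h₀.graph o) (γ : Fin p → Fin n → ℝ) :
    flowVolume h₀.graph (labelSet h₀ γ) = volume (h₀.chartSet o γ) := by
  classical
  exact ho.flowVolume_eq (h₀.graph_connected hn) fun _ hω _ hω' => sub_mem_divFree hn hω hω'

/-- The label sets in a chart depend measurably on the boundary values: a section expresses the flow
linearly in its coordinates and its divergence, so membership is an open condition on the closed set
where the divergence has total sum zero. -/
theorem measurableSet_chartSet [Nonempty ι] (hn : 0 < n) {κ : Type} [Fintype κ]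
    {o : κ → h₀.Vertex × h₀.Vertex} (ho : IsChart h₀.graph o) :
    MeasurableSet {q : (Fin p → Fin n → ℝ) × (κ → ℝ) | q.2 ∈ h₀.chartSet o q.1} := by
  classical
  obtain ⟨U, hU, hlab⟩ := h₀.exists_open_labelSet hn
  obtain ⟨J, hJ, -⟩ := ho.exists_section (h₀.graph_connected hn)
  set δ : (Fin p → Fin n → ℝ) → h₀.Vertex → ℝ := fun γ v => h₀.baseDiv v - h₀.bterm γ v with hδ
  have hδc : Continuous δ := by
    refine continuous_pi fun v => continuous_const.sub ?_
    unfold bterm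
    refine continuous_finsetSum _ fun j _ => continuous_finsetSum _ fun m _ => ?_
    split_ifs
    · fun_prop
    · fun_prop
  have hJc : Continuous J := J.continuous_of_finiteDimensional
  have hset : {q : (Fin p → Fin n → ℝ) × (κ → ℝ) | q.2 ∈ h₀.chartSet o q.1} =
      {q | ∑ v, δ q.1 v = 0} ∩ (fun q => J (q.2, δ q.1)) ⁻¹' U := by
    ext ⟨γ, z⟩
    simp only [chartSet, mem_ofPred_eq, mem_inter_iff, mem_preimage, mem_image, hlab]
    constructor
    · rintro ⟨ω, ⟨⟨h1, h2⟩, h3⟩, rfl⟩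
      have h4 : divg ω = δ γ := funext h2
      have h5 : ∑ v, δ γ v = 0 := by rw [← h4]; exact sum_divg h1
      obtain ⟨g1, g2, g3⟩ := hJ (fun k => ω (o k)) (δ γ) h5
      refine ⟨h5, ?_⟩
      have h6 : J (fun k => ω (o k), δ γ) - ω = 0 := by
        refine ho.inj _ ?_ fun k => ?_
        · rw [mem_divFree_iff, divg_sub, g2, h4, sub_self]
          exact ⟨(flows _).sub_mem g1 h1, rfl⟩
        · rw [Pi.sub_apply, g3, sub_self]
      rwa [sub_eq_zero.1 h6]
    · rintro ⟨h5, h6⟩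
      obtain ⟨g1, g2, g3⟩ := hJ z (δ γ) h5
      exact ⟨_, ⟨⟨g1, fun v => congrFun g2 v⟩, h6⟩, funext g3⟩
  rw [hset]
  refine MeasurableSet.inter ?_ ?_
  · refine (isClosed_eq ?_ continuous_const).measurableSet
    exact continuous_finsetSum _ fun v _ => (continuous_apply v).comp (hδc.comp continuous_fst)
  · refine (hU.preimage (hJc.comp ?_)).measurableSet
    exact continuous_snd.prodMk (hδc.comp continuous_fst)

theorem measurable_flowVolume_labelSet [Nonempty ι] (hn : 0 < n) (h₀ : SurfaceHoneycomb 𝒯 n) :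
    Measurable fun γ : Fin p → Fin n → ℝ => flowVolume h₀.graph (labelSet h₀ γ) := by
  obtain ⟨κ, _, o, ho, -⟩ := exists_isChart (h₀.graph_connected hn)
  simp only [flowVolume_labelSet hn ho]
  exact measurable_measure_prodMk_left (measurableSet_chartSet hn ho)

theorem flowVolume_labelSet_ne_top [Nonempty ι] (hn : 0 < n) (h₀ : SurfaceHoneycomb 𝒯 n)
    (γ : Fin p → Fin n → ℝ) : flowVolume h₀.graph (labelSet h₀ γ) ≠ ⊤ := by
  obtain ⟨κ, _, o, ho, -⟩ := exists_isChart (h₀.graph_connected hn)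
  rw [flowVolume_labelSet hn ho]
  have hsub : h₀.chartSet o γ ⊆ Icc (fun _ => -1) fun _ => 1 := by
    rintro _ ⟨ω, hω, rfl⟩
    exact ⟨fun k => (abs_le.1 (abs_le_one_of_mem_labelSet hω _)).1,
      fun k => (abs_le.1 (abs_le_one_of_mem_labelSet hω _)).2⟩
  exact ((measure_mono hsub).trans_lt isCompact_Icc.measure_lt_top).ne

/-- The honeycomb volume depends on the isomorphism class of the structure graph only. -/
theorem flowVolume_labelSet_congr [Nonempty ι] (hn : 0 < n) (f : h.Iso h₀)
    (γ : Fin p → Fin n → ℝ) :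
    flowVolume h.graph (labelSet h γ) = flowVolume h₀.graph (labelSet h₀ γ) := by
  obtain ⟨κ, _, o, ho, -⟩ := exists_isChart (h₀.graph_connected hn)
  set o' : κ → h.Vertex × h.Vertex := fun k => (f.symm.vmap (o k).1, f.symm.vmap (o k).2) with ho'
  have hval : ∀ (ω : h₀.Vertex × h₀.Vertex → ℝ) k, f.pull ω (o' k) = ω (o k) := by
    intro ω k
    simp only [ho', Iso.pull, f.vmap_vmap_symm]
  have hdf : ∀ {h h₀ : SurfaceHoneycomb 𝒯 n} (f : h.Iso h₀), ∀ ω ∈ divFree h₀.graph,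
      f.pull ω ∈ divFree h.graph := by
    intro h h₀ f ω hω
    rw [mem_divFree_iff] at hω ⊢
    refine ⟨f.pull_mem_flows hω.1, funext fun v => ?_⟩
    rw [f.divg_pull, hω.2]
    rfl
  have hch : IsChart h.graph o' := by
    refine ⟨fun ω hω hk => ?_, fun z => ?_, fun z hz => ?_⟩
    · have h1 := ho.inj (f.symm.pull ω) (hdf f.symm ω hω) hk
      rw [← f.pull_pull_symm ω, h1]
      rfl
    · obtain ⟨ω, h1, h2⟩ := ho.ext z
      exact ⟨f.pull ω, hdf f ω h1, fun k => (hval ω k).trans (h2 k)⟩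
    · obtain ⟨ω, h1, h2, h3⟩ := ho.int z hz
      exact ⟨f.pull ω, hdf f ω h1, fun e => h2 _, fun k => (hval ω k).trans (h3 k)⟩
  rw [flowVolume_labelSet hn ho, flowVolume_labelSet hn hch]
  congr 1
  ext z
  constructor
  · rintro ⟨ω, hω, rfl⟩
    refine ⟨f.symm.pull ω, ?_, rfl⟩
    exact f.pull_mem_labelSet_iff.1 (by rwa [f.pull_pull_symm])
  · rintro ⟨ω, hω, rfl⟩
    exact ⟨f.pull ω, f.pull_mem_labelSet_iff.2 hω, funext fun k => hval ω k⟩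

theorem honeyVolume_mk [Nonempty ι] (hn : 0 < n) (h : SurfaceHoneycomb 𝒯 n)
    (γ : Fin p → Fin n → ℝ) :
    honeyVolume (Quotient.mk (graphSetoid 𝒯 n) h) γ = flowVolume h.graph (labelSet h γ) := by
  obtain ⟨f⟩ : Nonempty ((Quotient.out (Quotient.mk (graphSetoid 𝒯 n) h)).Iso h) :=
    Quotient.exact (Quotient.out_eq (Quotient.mk (graphSetoid 𝒯 n) h))
  exact flowVolume_labelSet_congr hn f γ

theorem measurable_honeyVolume [Nonempty ι] (hn : 0 < n) (G : GraphClass 𝒯 n) :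
    Measurable fun γ : Fin p → Fin n → ℝ => honeyVolume G γ :=
  measurable_flowVolume_labelSet hn _

theorem honeyVolume_ne_top [Nonempty ι] (hn : 0 < n) (G : GraphClass 𝒯 n)
    (γ : Fin p → Fin n → ℝ) : honeyVolume G γ ≠ ⊤ := flowVolume_labelSet_ne_top hn _ γ

/-- A label set is empty unless the boundary values have the sum prescribed by the structure
graph. -/
theorem sum_of_mem_labelSet (hn : 0 < n) {γ : Fin p → Fin n → ℝ}
    {ω : h₀.Vertex × h₀.Vertex → ℝ} (hω : ω ∈ labelSet h₀ γ) :
    ∑ j, ∑ m, γ j m = ∑ v, h₀.baseDiv v := by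
  have h1 := sum_divg hω.1
  simp only [divg_of_mem_labelSet hn hω, Finset.sum_sub_distrib, sum_bterm] at h1
  linarith

theorem sum_baseDiv_int (h₀ : SurfaceHoneycomb 𝒯 n) : ∃ z : ℤ, ∑ v, h₀.baseDiv v = z := by
  choose z hz using fun v => h₀.baseDiv_int v
  exact ⟨∑ v, z v, by simp [hz]⟩

end SurfaceHoneycomb

/-! ### Gluing a triangle to a surface: honeycombs and structure graphs -/

namespace TriangleGluing

variable {ι : Type} [DecidableEq ι] {q : ℕ} {𝒯 : TriangleGluing ι (q + 1)}

theorem glueTriangle_opp_none_zero :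
    𝒯.glueTriangle.opp (none, 0) = liftSide (𝒯.bdry (Fin.last q)) := by
  simp [glueTriangle, glueOpp]

theorem glueTriangle_opp_none {k : Fin 3} (hk : k ≠ 0) :
    𝒯.glueTriangle.opp (none, k) = (none, k) := by
  simp [glueTriangle, glueOpp, hk]

theorem glueTriangle_opp_last :
    𝒯.glueTriangle.opp (liftSide (𝒯.bdry (Fin.last q))) = (none, 0) := by
  rw [← glueTriangle_opp_none_zero, 𝒯.glueTriangle.opp_opp]

theorem glueTriangle_opp_some {x : ι × Fin 3} (hx : x ≠ 𝒯.bdry (Fin.last q)) :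
    𝒯.glueTriangle.opp (liftSide x) = liftSide (𝒯.opp x) := by
  obtain ⟨i, k⟩ := x
  simp [glueTriangle, glueOpp, liftSide, hx]

theorem ne_last_of_opp_ne {x : ι × Fin 3} (hx : 𝒯.opp x ≠ x) : x ≠ 𝒯.bdry (Fin.last q) := by
  rintro rfl
  exact hx ((𝒯.opp_eq_self_iff _).2 ⟨_, rfl⟩)

theorem liftSide_injective : Function.Injective (liftSide : ι × Fin 3 → Option ι × Fin 3) := by
  rintro ⟨i, k⟩ ⟨j, l⟩ hh
  simpa [liftSide] using hh

end TriangleGluing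

namespace SurfaceHoneycomb

open TriHoneycomb TriangleGluing

section SideVal

variable {ι : Type} {p : ℕ} {𝒯 : TriangleGluing ι p} {n : ℕ}

/-- The coordinate of the `m`-th point of a honeycomb on the side `x`, in decreasing order. -/
def sideVal (h : SurfaceHoneycomb 𝒯 n) (x : ι × Fin 3) (m : Fin n) : ℝ :=
  coord (x.2 + 1) ((h.tri x.1).pt x.2 m : ℂ)

theorem hasBoundary_iff_sideVal {h : SurfaceHoneycomb 𝒯 n} {γ : Fin p → Fin n → ℝ} :
    h.HasBoundary γ ↔ ∀ j, γ j = h.sideVal (𝒯.bdry j) := by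
  rw [hasBoundary_iff]
  exact ⟨fun hh j => funext (hh j), fun hh j m => congrFun (hh j) m⟩

theorem sideVal_mem_Hreg (h : SurfaceHoneycomb 𝒯 n) (x : ι × Fin 3) : h.sideVal x ∈ Hreg n := by
  refine ⟨(h.tri x.1).pt_strictAnti x.2, fun m => ?_⟩
  have hp := pt_mem_side (h := h.tri x.1) x.2 m
  have h1 := coord_pos_of_side ((h.tri x.1).pt x.2 m).2 hp (j := x.2 + 1) (by
    generalize x.2 = k; fin_cases k <;> decide)
  have h2 := coord_pos_of_side ((h.tri x.1).pt x.2 m).2 hp (j := x.2 + 2) (by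
    generalize x.2 = k; fin_cases k <;> decide)
  have h3 := coord_sum x.2 ((h.tri x.1).pt x.2 m : ℂ)
  have h4 : coord x.2 ((h.tri x.1).pt x.2 m : ℂ) = 0 := hp.2
  unfold sideVal
  exact ⟨h1.le, by linarith⟩

theorem sideVal_opp (h : SurfaceHoneycomb 𝒯 n) {x : ι × Fin 3} (hx : 𝒯.opp x ≠ x) (m : Fin n) :
    h.sideVal (𝒯.opp x) m = 1 - h.sideVal x (Fin.rev m) :=
  h.compat_pt (i := x.1) (k := x.2) (j := (𝒯.opp x).1) (l := (𝒯.opp x).2) rfl hx.symm m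

end SideVal

section Restrict

variable {ι : Type} [DecidableEq ι] {q : ℕ} {𝒯 : TriangleGluing ι (q + 1)} {n : ℕ}

/-- The restriction of a honeycomb on the enlarged surface to the original surface. -/
def restrictBase (h : SurfaceHoneycomb 𝒯.glueTriangle n) : SurfaceHoneycomb 𝒯 n where
  tri i := h.tri (some i)
  compat x hx := by
    have h1 := 𝒯.glueTriangle_opp_some (ne_last_of_opp_ne hx)
    have h2 := h.compat (liftSide x) (by rw [h1]; exact fun hh => hx (liftSide_injective hh))
    rw [h1] at h2
    exact h2

/-- The restriction of a honeycomb on the enlarged surface to the new triangle. -/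
def restrictNew (h : SurfaceHoneycomb 𝒯.glueTriangle n) : SurfaceHoneycomb singleTriangle n where
  tri _ := h.tri none
  compat _ hx := absurd rfl hx

/-- The honeycomb on the enlarged surface made of honeycombs on the two pieces with the same points
on the common side. -/
def glue (h₂ : SurfaceHoneycomb 𝒯 n) (h₁ : SurfaceHoneycomb singleTriangle n)
    (hc : h₁.sideVal ((), 0) = dualTuple (h₂.sideVal (𝒯.bdry (Fin.last q)))) :
    SurfaceHoneycomb 𝒯.glueTriangle n where
  tri
    | none => h₁.tri ()
    | some i => h₂.tri i
  compat := by
    have e1 : (h₁.tri ()).sideCoords 0 =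
        (fun t => 1 - t) ''
          (h₂.tri (𝒯.bdry (Fin.last q)).1).sideCoords (𝒯.bdry (Fin.last q)).2 := by
      rw [sideCoords_eq, sideCoords_eq]
      have h2 : (fun m => coord (0 + 1) ((h₁.tri ()).pt 0 m : ℂ)) =
        dualTuple (h₂.sideVal (𝒯.bdry (Fin.last q))) := hc
      rw [h2]
      ext t
      constructor
      · rintro ⟨m, rfl⟩
        exact ⟨_, ⟨Fin.rev m, rfl⟩, rfl⟩
      · rintro ⟨_, ⟨m, rfl⟩, rfl⟩
        exact ⟨Fin.rev m, by simp [dualTuple, sideVal]⟩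
    rintro ⟨_ | i, k⟩ hx
    · by_cases hk : k = 0
      · subst hk
        rw [glueTriangle_opp_none_zero]
        simp only [liftSide]
        rw [e1, image_image]
        simp
      · exact absurd (glueTriangle_opp_none hk) hx
    · by_cases hk : (i, k) = 𝒯.bdry (Fin.last q)
      · have h1 : 𝒯.glueTriangle.opp (some i, k) = (none, 0) := by
          have := 𝒯.glueTriangle_opp_last
          rwa [← hk] at this
        rw [h1]
        simp only
        rw [e1, ← hk]
      · have h1 := 𝒯.glueTriangle_opp_some hk
        have h2 : 𝒯.opp (i, k) ≠ (i, k) := by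
          intro hh
          rw [hh] at h1
          exact hx h1
        have h3 := h₂.compat (i, k) h2
        have h4 : 𝒯.glueTriangle.opp (some i, k) = liftSide (𝒯.opp (i, k)) := h1
        rw [h4]
        exact h3

/-- The boundary values of the original surface: `u` on the last free side. -/
def baseBoundary (γ : Fin (q + 2) → Fin n → ℝ) (u : Fin n → ℝ) : Fin (q + 1) → Fin n → ℝ :=
  Fin.snoc (α := fun _ => Fin n → ℝ) (fun i : Fin q => γ (Fin.castAdd 2 i)) u

/-- The boundary values of the new triangle: `ũ` on the side glued to the original surface. -/
def newBoundary (γ : Fin (q + 2) → Fin n → ℝ) (u : Fin n → ℝ) : Fin 3 → Fin n → ℝ :=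
  ![dualTuple u, γ (Fin.natAdd q 0), γ (Fin.natAdd q 1)]

theorem dualTuple_sideVal (h : SurfaceHoneycomb 𝒯.glueTriangle n) :
    h.restrictNew.sideVal ((), 0) =
      dualTuple (h.restrictBase.sideVal (𝒯.bdry (Fin.last q))) := by
  funext m
  have h1 := h.sideVal_opp (x := liftSide (𝒯.bdry (Fin.last q)))
    (by rw [glueTriangle_opp_last]; simp [liftSide]) m
  rw [glueTriangle_opp_last] at h1
  exact h1

/-- A honeycomb on the enlarged surface has boundary `γ` if and only if, for some `u`, its
restrictions have the boundary values `(γ, u)` and `(ũ, γ)`. -/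
theorem hasBoundary_glueTriangle_iff {h : SurfaceHoneycomb 𝒯.glueTriangle n}
    {γ : Fin (q + 2) → Fin n → ℝ} : h.HasBoundary γ ↔
      ∃ u, h.restrictBase.HasBoundary (baseBoundary γ u) ∧
        h.restrictNew.HasBoundary (newBoundary γ u) := by
  simp only [hasBoundary_iff_sideVal]
  have hb : ∀ i : Fin q, h.sideVal (𝒯.glueTriangle.bdry (Fin.castAdd 2 i)) =
      h.restrictBase.sideVal (𝒯.bdry i.castSucc) := by
    intro i
    have : 𝒯.glueTriangle.bdry (Fin.castAdd 2 i) = liftSide (𝒯.bdry i.castSucc) := by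
      simp [glueTriangle]
    rw [this]
    rfl
  have hn : ∀ i : Fin 2, h.sideVal (𝒯.glueTriangle.bdry (Fin.natAdd q i)) =
      h.restrictNew.sideVal ((), i.succ) := by
    intro i
    have : 𝒯.glueTriangle.bdry (Fin.natAdd q i) = (none, i.succ) := by
      fin_cases i <;> simp [glueTriangle]
    rw [this]
    rfl
  constructor
  · intro hγ
    refine ⟨h.restrictBase.sideVal (𝒯.bdry (Fin.last q)), fun j => ?_, fun j => ?_⟩
    · refine Fin.lastCases ?_ (fun i => ?_) j
      · simp [baseBoundary]
      · simp [baseBoundary, hγ, hb]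
    · refine Fin.cases ?_ (fun i => ?_) j
      · exact (dualTuple_sideVal h).symm
      · have h1 : singleTriangle.bdry i.succ = ((), i.succ) := rfl
        rw [h1, ← hn, ← hγ]
        fin_cases i <;> rfl
  · rintro ⟨u, h2, h1⟩ j
    refine Fin.addCases (fun i => ?_) (fun i => ?_) j
    · rw [hb, ← h2]
      simp [baseBoundary]
    · rw [hn]
      have h3 : singleTriangle.bdry i.succ = ((), i.succ) := rfl
      rw [← h3, ← h1]
      fin_cases i <;> rfl

theorem exists_glue {γ : Fin (q + 2) → Fin n → ℝ} {u : Fin n → ℝ} {h₂ : SurfaceHoneycomb 𝒯 n}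
    {h₁ : SurfaceHoneycomb singleTriangle n} (hb₂ : h₂.HasBoundary (baseBoundary γ u))
    (hb₁ : h₁.HasBoundary (newBoundary γ u)) :
    ∃ h : SurfaceHoneycomb 𝒯.glueTriangle n, h.restrictBase = h₂ ∧ h.restrictNew = h₁ := by
  have h2 := hasBoundary_iff_sideVal.1 hb₂ (Fin.last q)
  have h1 := hasBoundary_iff_sideVal.1 hb₁ 0
  refine ⟨glue h₂ h₁ ?_, rfl, rfl⟩
  rw [← h2]
  refine Eq.trans h1.symm ?_
  simp [newBoundary, baseBoundary]

theorem mem_Hreg_of_hasBoundary {γ : Fin (q + 2) → Fin n → ℝ} {u : Fin n → ℝ}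
    {h₂ : SurfaceHoneycomb 𝒯 n} (hb₂ : h₂.HasBoundary (baseBoundary γ u)) : u ∈ Hreg n := by
  have h2 := hasBoundary_iff_sideVal.1 hb₂ (Fin.last q)
  have h3 : u = h₂.sideVal (𝒯.bdry (Fin.last q)) := by
    rw [← h2]; simp [baseBoundary]
  rw [h3]
  exact h₂.sideVal_mem_Hreg _

/-! The structure graph of a honeycomb on the enlarged surface. -/

variable {h : SurfaceHoneycomb 𝒯.glueTriangle n}

theorem glued_some_some_iff {i j : ι} {a : (h.tri (some i)).vertices}
    {b : (h.tri (some j)).vertices} :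
    h.Glued ⟨some i, a⟩ ⟨some j, b⟩ ↔ h.restrictBase.Glued ⟨i, a⟩ ⟨j, b⟩ := by
  constructor
  · rintro ⟨k, l, ho, hne, ha, hb, hc⟩
    simp only at ho hne ha hb hc
    have hx : (i, k) ≠ 𝒯.bdry (Fin.last q) := by
      intro hh
      have := 𝒯.glueTriangle_opp_last
      rw [← hh] at this
      have h2 := this.symm.trans ho
      simp at h2
    have h1 := 𝒯.glueTriangle_opp_some hx
    exact ⟨k, l, liftSide_injective (h1.symm.trans ho), fun hh => hne (congrArg liftSide hh),
      ha, hb, hc⟩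
  · rintro ⟨k, l, ho, hne, ha, hb, hc⟩
    simp only at ho hne ha hb hc
    have h1 := 𝒯.glueTriangle_opp_some (x := (i, k))
      (ne_last_of_opp_ne (by rw [ho]; exact hne.symm))
    rw [ho] at h1
    exact ⟨k, l, h1, fun hh => hne (liftSide_injective hh), ha, hb, hc⟩

/-- The points of the new triangle on `∂₀T` are glued to those on the last free side of the original
surface, in reversed order, and there are no other identifications. -/
theorem glued_some_none_iff {i : ι} {a : (h.tri (some i)).vertices} {b : (h.tri none).vertices} :
    h.Glued ⟨some i, a⟩ ⟨none, b⟩ ↔ ∃ m,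
      (⟨i, a⟩ : Σ i, (h.restrictBase.tri i).vertices) = ⟨(𝒯.bdry (Fin.last q)).1,
        (h.restrictBase.tri (𝒯.bdry (Fin.last q)).1).pt (𝒯.bdry (Fin.last q)).2 m⟩ ∧
      b = (h.tri none).pt 0 (Fin.rev m) := by
  have hlast := 𝒯.glueTriangle_opp_last
  constructor
  · intro hg
    obtain ⟨k, l, m, ho, hne, rfl, rfl⟩ := hg.exists_pt
    have h1 : 𝒯.glueTriangle.opp (none, l) = (some i, k) := by
      rw [← ho, 𝒯.glueTriangle.opp_opp]
    have hl : l = 0 := by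
      by_contra hl
      rw [glueTriangle_opp_none hl] at h1
      simp at h1
    subst hl
    rw [glueTriangle_opp_none_zero] at h1
    have h2 : 𝒯.bdry (Fin.last q) = (i, k) := liftSide_injective h1
    refine ⟨Fin.rev m, ?_, by rw [Fin.rev_rev]⟩
    rw [h2]
    rfl
  · rintro ⟨m, h1, rfl⟩
    obtain ⟨i₀, k₀, hb⟩ : ∃ i₀ k₀, 𝒯.bdry (Fin.last q) = (i₀, k₀) := ⟨_, _, rfl⟩
    rw [hb] at h1 hlast
    cases h1
    have := glued_pt (h := h) hlast (by simp) (Fin.rev m)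
    rw [Fin.rev_rev] at this
    exact this

theorem not_glued_none_none {a b : (h.tri none).vertices} : ¬ h.Glued ⟨none, a⟩ ⟨none, b⟩ := by
  rintro ⟨k, l, ho, hne, -⟩
  simp only at ho hne
  by_cases hk : k = 0
  · subst hk
    rw [glueTriangle_opp_none_zero] at ho
    simp [liftSide] at ho
  · rw [glueTriangle_opp_none hk] at ho
    exact hne ho

theorem not_glued_singleTriangle {h : SurfaceHoneycomb singleTriangle n}
    {x y : Σ i, (h.tri i).vertices} : ¬ h.Glued x y := by
  rintro ⟨k, l, ho, hne, -⟩
  exact hne ho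

/-- The inclusion of the structure graph of the original surface. -/
def inBase (h : SurfaceHoneycomb 𝒯.glueTriangle n) : h.restrictBase.Vertex → h.Vertex :=
  Quot.map (fun x => ⟨some x.1, x.2⟩) fun _ _ hg => glued_some_some_iff.2 hg

/-- The inclusion of the structure graph of the new triangle. -/
def inNew (h : SurfaceHoneycomb 𝒯.glueTriangle n) : h.restrictNew.Vertex → h.Vertex :=
  Quot.map (fun x => ⟨none, x.2⟩) fun _ _ hg => absurd hg not_glued_singleTriangle

theorem inBase_mk (i : ι) (a : (h.restrictBase.tri i).vertices) :
    h.inBase (h.restrictBase.mkVertex i a) = h.mkVertex (some i) a := rfl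

theorem inNew_mk (a : (h.restrictNew.tri ()).vertices) :
    h.inNew (h.restrictNew.mkVertex () a) = h.mkVertex none a := rfl

/-- The neighbour of the boundary vertex `m` on the side `∂₀` of a single triangle, the vertices on
this side being listed in the order of the side they are glued to. -/
def zeroNbr (h : SurfaceHoneycomb singleTriangle n) (m : Fin n) : h.Vertex :=
  h.mkVertex () (exists_nbr ((h.tri ()).pt 0 (Fin.rev m))).choose

/-- The structure graph on the enlarged surface is the gluing of the two structure graphs; the
vertices of the new triangle on `∂₀T` are pendant. -/
theorem isGluing (h : SurfaceHoneycomb 𝒯.glueTriangle n) :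
    IsGluing h.restrictBase.graph h.restrictNew.graph h.graph h.inBase h.inNew
      (h.restrictBase.bv (Fin.last q)) (fun m => h.restrictNew.bv 0 (Fin.rev m))
      h.restrictNew.zeroNbr where
  inj₂ x y hxy := by
    obtain ⟨i, a, rfl⟩ := exists_mk x
    obtain ⟨j, b, rfl⟩ := exists_mk y
    rw [inBase_mk, inBase_mk] at hxy
    rcases mk_eq_iff.1 hxy with h1 | h1
    · cases h1
      rfl
    · exact mk_eq_iff.2 (Or.inr (glued_some_some_iff.1 h1))
  inj₁ x y hxy := by
    obtain ⟨⟨⟩, a, rfl⟩ := exists_mk x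
    obtain ⟨⟨⟩, b, rfl⟩ := exists_mk y
    rw [inNew_mk, inNew_mk] at hxy
    rcases mk_eq_iff.1 hxy with h1 | h1
    · cases h1
      rfl
    · exact absurd h1 not_glued_none_none
  injb₂ m m' hm := (bv_injective hm).2
  injb₁ m m' hm := Fin.rev_injective (bv_injective hm).2
  surj v := by
    obtain ⟨_ | i, a, rfl⟩ := exists_mk v
    · exact Or.inr ⟨h.restrictNew.mkVertex () a, rfl⟩
    · exact Or.inl ⟨h.restrictBase.mkVertex i a, rfl⟩
  meet x y := by
    obtain ⟨i, a, rfl⟩ := exists_mk x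
    obtain ⟨⟨⟩, b, rfl⟩ := exists_mk y
    have h0 : h.inBase (h.restrictBase.mkVertex i a) = h.inNew (h.restrictNew.mkVertex () b) ↔
        (⟨some i, a⟩ : Σ i, (h.tri i).vertices) = ⟨none, b⟩ ∨ h.Glued ⟨some i, a⟩ ⟨none, b⟩ :=
      mk_eq_iff (h := h)
    have h1 : ∀ m, h.restrictBase.mkVertex i a = h.restrictBase.bv (Fin.last q) m ↔
        (⟨i, a⟩ : Σ i, (h.restrictBase.tri i).vertices) = ⟨(𝒯.bdry (Fin.last q)).1,
        (h.restrictBase.tri (𝒯.bdry (Fin.last q)).1).pt (𝒯.bdry (Fin.last q)).2 m⟩ := fun m => by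
      rw [eq_comm, bv_eq_mk_iff, eq_comm]
    have h2 : ∀ m, h.restrictNew.mkVertex () b = h.restrictNew.bv 0 m ↔
        b = (h.tri none).pt 0 m := fun m => by
      constructor
      · intro hh
        have := bv_eq_mk_iff.1 hh.symm
        cases this
        rfl
      · rintro rfl
        rfl
    simp only [h1, h2]
    refine h0.trans (Iff.trans ⟨fun hh => hh.resolve_left fun hh => ?_, Or.inr⟩
      glued_some_none_iff)
    cases hh
  adj v w := by
    rw [adj_iff]
    constructor
    · rintro ⟨_ | i, a, b, hab, rfl, rfl⟩
      · exact Or.inr ⟨h.restrictNew.mkVertex () a, h.restrictNew.mkVertex () b,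
          adj_of_edge hab, rfl, rfl⟩
      · exact Or.inl ⟨h.restrictBase.mkVertex i a, h.restrictBase.mkVertex i b,
          adj_of_edge hab, rfl, rfl⟩
    · rintro (⟨x, y, hxy, rfl, rfl⟩ | ⟨x, y, hxy, rfl, rfl⟩)
      · obtain ⟨i, a, b, hab, rfl, rfl⟩ := adj_iff.1 hxy
        exact ⟨some i, a, b, hab, rfl, rfl⟩
      · obtain ⟨i, a, b, hab, rfl, rfl⟩ := adj_iff.1 hxy
        exact ⟨none, a, b, hab, rfl, rfl⟩
  pendant m y := by
    have hspec := (exists_nbr ((h.restrictNew.tri ()).pt 0 (Fin.rev m))).choose_spec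
    constructor
    · intro hy
      rcases adj_mk_iff.1 hy with ⟨b, hab, rfl⟩ | ⟨j, a', b, hg, -⟩
      · obtain ⟨c, e⟩ := exists_Ed hab
        obtain ⟨c', e'⟩ := exists_Ed hspec
        exact congrArg _ (Subtype.ext (e.unique_of_boundary e' (pt_mem_side _ _)).1)
      · exact absurd hg not_glued_singleTriangle
    · rintro rfl
      exact adj_of_edge hspec
  c_ne m k hk := by
    have hspec := (exists_nbr ((h.restrictNew.tri ()).pt 0 (Fin.rev m))).choose_spec
    obtain ⟨c, e⟩ := exists_Ed hspec
    exact bv_ne_inner (e.inner_of_side (pt_mem_side _ _)) hk.symm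
  not_adj₂ m k hmk := by
    obtain ⟨i, a, b, hab, ha, hb⟩ := adj_iff.1 hmk
    obtain ⟨c, e⟩ := exists_Ed hab
    have h1 := bv_eq_mk_iff.1 ha.symm
    have h2 := bv_eq_mk_iff.1 hb.symm
    cases h1
    have h3 := eq_of_heq (Sigma.mk.inj h2).2
    subst h3
    exact e.not_boundary (pt_mem_side _ _) (pt_mem_side _ _)

/-! ### Gluing a triangle to a surface: label maps -/

/-- The restriction of a flow to the structure graph of the original surface. -/
def resBase (h : SurfaceHoneycomb 𝒯.glueTriangle n) (ω : h.Vertex × h.Vertex → ℝ) :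
    h.restrictBase.Vertex × h.restrictBase.Vertex → ℝ := fun p => ω (h.inBase p.1, h.inBase p.2)

/-- The restriction of a flow to the structure graph of the new triangle. -/
def resNew (h : SurfaceHoneycomb 𝒯.glueTriangle n) (ω : h.Vertex × h.Vertex → ℝ) :
    h.restrictNew.Vertex × h.restrictNew.Vertex → ℝ := fun p => ω (h.inNew p.1, h.inNew p.2)

variable {h₀ : SurfaceHoneycomb 𝒯.glueTriangle n}

/-- The restriction of an isomorphism to the original surface. -/
def Iso.restrictBase (f : h.Iso h₀) : h.restrictBase.Iso h₀.restrictBase := fun i => f (some i)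

/-- The restriction of an isomorphism to the new triangle. -/
def Iso.restrictNew (f : h.Iso h₀) : h.restrictNew.Iso h₀.restrictNew := fun _ => f none

/-- The isomorphism made of isomorphisms on the two pieces. -/
def Iso.ofRestrict (f₂ : h.restrictBase.Iso h₀.restrictBase)
    (f₁ : h.restrictNew.Iso h₀.restrictNew) : h.Iso h₀
  | none => f₁ ()
  | some i => f₂ i

theorem Iso.vmap_inBase (f : h.Iso h₀) (x : h.restrictBase.Vertex) :
    f.vmap (h.inBase x) = h₀.inBase (f.restrictBase.vmap x) := by
  obtain ⟨i, a, rfl⟩ := exists_mk x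
  rfl

theorem Iso.vmap_inNew (f : h.Iso h₀) (x : h.restrictNew.Vertex) :
    f.vmap (h.inNew x) = h₀.inNew (f.restrictNew.vmap x) := by
  obtain ⟨i, a, rfl⟩ := exists_mk x
  rfl

theorem Iso.resBase_pull (f : h.Iso h₀) (ω : h₀.Vertex × h₀.Vertex → ℝ) :
    h.resBase (f.pull ω) = f.restrictBase.pull (h₀.resBase ω) := by
  funext p
  simp only [resBase, Iso.pull, f.vmap_inBase]

theorem Iso.resNew_pull (f : h.Iso h₀) (ω : h₀.Vertex × h₀.Vertex → ℝ) :
    h.resNew (f.pull ω) = f.restrictNew.pull (h₀.resNew ω) := by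
  funext p
  simp only [resNew, Iso.pull, f.vmap_inNew]

theorem isLabel_iff [Finite ι] {ω : h.Vertex × h.Vertex → ℝ} (hω : ω ∈ flows h.graph) :
    h.IsLabel ω ↔ h.restrictBase.IsLabel (h.resBase ω) ∧ h.restrictNew.IsLabel (h.resNew ω) := by
  constructor
  · intro hl
    exact ⟨⟨h.isGluing.res₂_mem hω, fun i a b hab => hl.2 (some i) a b hab⟩,
      ⟨h.isGluing.res₁_mem hω, fun i a b hab => hl.2 none a b hab⟩⟩
  · rintro ⟨h2, h1⟩
    refine ⟨hω, ?_⟩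
    rintro (_ | i) a b hab
    · exact h1.2 () a b hab
    · exact h2.2 i a b hab

/-- The label maps on the enlarged surface are the flows whose restrictions are label maps, for some
common boundary values `u` on the glued side. -/
theorem mem_labelSet_glueTriangle_iff [Finite ι] {γ : Fin (q + 2) → Fin n → ℝ}
    {ω : h₀.Vertex × h₀.Vertex → ℝ} (hω : ω ∈ flows h₀.graph) : ω ∈ labelSet h₀ γ ↔
      ∃ u, h₀.resBase ω ∈ labelSet h₀.restrictBase (baseBoundary γ u) ∧
        h₀.resNew ω ∈ labelSet h₀.restrictNew (newBoundary γ u) := by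
  constructor
  · intro hl
    obtain ⟨h, hγ, f, hf⟩ := mem_labelSet_iff.1 hl
    obtain ⟨u, hb₂, hb₁⟩ := hasBoundary_glueTriangle_iff.1 hγ
    obtain ⟨l₂, l₁⟩ := (isLabel_iff hf.1).1 hf
    rw [f.resBase_pull] at l₂
    rw [f.resNew_pull] at l₁
    exact ⟨u, mem_labelSet_iff.2 ⟨_, hb₂, _, l₂⟩, mem_labelSet_iff.2 ⟨_, hb₁, _, l₁⟩⟩
  · rintro ⟨u, l₂, l₁⟩
    obtain ⟨h₂, hb₂, f₂, hf₂⟩ := mem_labelSet_iff.1 l₂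
    obtain ⟨h₁, hb₁, f₁, hf₁⟩ := mem_labelSet_iff.1 l₁
    obtain ⟨h, rfl, rfl⟩ := exists_glue hb₂ hb₁
    set f : h.Iso h₀ := Iso.ofRestrict f₂ f₁ with hf
    refine mem_labelSet_iff.2 ⟨h, hasBoundary_glueTriangle_iff.2 ⟨u, hb₂, hb₁⟩, f,
      (isLabel_iff (f.pull_mem_flows hω)).2 ⟨?_, ?_⟩⟩
    · rw [f.resBase_pull]
      exact hf₂
    · rw [f.resNew_pull]
      exact hf₁

end Restrict

end SurfaceHoneycomb

/-! ### Tuples with prescribed sum and the slice measure -/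

section Complete

variable {n : ℕ} {j : Fin n}

/-- The tuple with sum `K` and with the given coordinates other than the `j`-th one. -/
def completeTuple (j : Fin n) (K : ℝ) (w : {i : Fin n // i ≠ j} → ℝ) : Fin n → ℝ :=
  fun i => if h : i = j then K - ∑ l, w l else w ⟨i, h⟩

theorem sum_eq_add_sum_ne (u : Fin n → ℝ) : ∑ i, u i = u j + ∑ i : {i : Fin n // i ≠ j}, u i := by
  rw [← Finset.add_sum_erase _ _ (Finset.mem_univ j),
    Finset.sum_subtype (p := fun i => i ≠ j) _ (by simp) u]

theorem sum_completeTuple (K : ℝ) (w : {i : Fin n // i ≠ j} → ℝ) :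
    ∑ i, completeTuple j K w i = K := by
  rw [sum_eq_add_sum_ne (j := j)]
  have : ∀ i : {i : Fin n // i ≠ j}, completeTuple j K w i = w i := fun i => by
    simp [completeTuple, i.2]
  simp only [this]
  simp [completeTuple]

theorem eq_completeTuple {K : ℝ} {u : Fin n → ℝ} (hu : ∑ i, u i = K) :
    u = completeTuple j K fun i => u i := by
  funext i
  by_cases hi : i = j
  · subst hi
    rw [sum_eq_add_sum_ne (j := i)] at hu
    simp only [completeTuple, dif_pos]
    linarith
  · simp [completeTuple, hi]

theorem measurable_completeTuple (K : ℝ) : Measurable (completeTuple j K) := by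
  refine measurable_pi_iff.2 fun i => ?_
  unfold completeTuple
  split_ifs
  · exact measurable_const.sub (Finset.measurable_sum _ fun l _ => measurable_pi_apply l)
  · exact measurable_pi_apply _

theorem measurableSet_Hreg (n : ℕ) : MeasurableSet (Hreg n) := by
  have : Hreg n = (⋂ (i : Fin n) (k : Fin n) (_ : i < k), {u | u k < u i}) ∩
      ⋂ i : Fin n, {u | 0 ≤ u i ∧ u i < 1} := by
    ext u
    simp only [Hreg, mem_ofPred_eq, mem_inter_iff, mem_iInter]
    exact and_congr_left fun _ => ⟨fun hu _ _ hik => hu hik, fun hu _ _ hik => hu _ _ hik⟩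
  rw [this]
  refine MeasurableSet.inter ?_ ?_
  · refine MeasurableSet.iInter fun i => MeasurableSet.iInter fun k => MeasurableSet.iInter fun _ =>
      measurableSet_lt (measurable_pi_apply _) (measurable_pi_apply _)
  · exact MeasurableSet.iInter fun i => (measurableSet_le measurable_const
      (measurable_pi_apply _)).inter (measurableSet_lt (measurable_pi_apply _) measurable_const)

/-- A function supported by the regular tuples with sum `K` is integrated over a single piece of
the slice. -/
theorem lintegral_sliceMeasure {θ K : ℝ} (hK : ∃ k : ℤ, K = θ + k) {F : (Fin n → ℝ) → ℝ≥0∞}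
    (hF : Measurable F) (hsupp : ∀ u, F u ≠ 0 → u ∈ Hreg n ∧ ∑ i, u i = K) :
    ∫⁻ u, F u ∂(sliceMeasure n θ j) = ∫⁻ w, F (completeTuple j K w) := by
  obtain ⟨k₀, rfl⟩ := hK
  have hind : (Hreg n).indicator F = F := by
    rw [indicator_eq_self]
    exact fun u hu => (hsupp u hu).1
  unfold sliceMeasure
  rw [← lintegral_indicator (measurableSet_Hreg n), hind, lintegral_sum_measure,
    tsum_eq_single k₀]
  · exact lintegral_map hF (measurable_completeTuple (θ + k₀))
  · intro k hk
    refine (lintegral_map hF (measurable_completeTuple (j := j) (θ + k))).trans ?_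
    refine (lintegral_congr fun w => ?_).trans lintegral_zero
    by_contra hne
    have := (hsupp _ hne).2
    rw [sum_completeTuple] at this
    have h2 : (k : ℝ) = k₀ := by linarith
    exact hk (by exact_mod_cast h2)

end Complete

namespace SurfaceHoneycomb

open TriHoneycomb TriangleGluing

variable {ι : Type} [DecidableEq ι] [Finite ι] {q : ℕ} {𝒯 : TriangleGluing ι (q + 1)} {n : ℕ}
  {γ : Fin (q + 2) → Fin n → ℝ}

/-! ### The volume of the glued label set -/

theorem measurable_baseBoundary (γ : Fin (q + 2) → Fin n → ℝ) :
    Measurable (baseBoundary γ) := by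
  refine measurable_pi_iff.2 fun i => ?_
  refine Fin.lastCases ?_ (fun i => ?_) i
  · simp only [baseBoundary, Fin.snoc_last]
    exact measurable_id
  · simp only [baseBoundary, Fin.snoc_castSucc]
    exact measurable_const

theorem measurable_newBoundary (γ : Fin (q + 2) → Fin n → ℝ) :
    Measurable (newBoundary γ) := by
  refine measurable_pi_iff.2 fun i => ?_
  fin_cases i
  · refine measurable_pi_iff.2 fun m => ?_
    exact measurable_const.sub (measurable_pi_apply _)
  · exact measurable_const
  · exact measurable_const

/-- The sum of the boundary values on the last free side, which is determined by the structure
graph and the other boundary values. -/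
def lastSum (h₂ : SurfaceHoneycomb 𝒯 n) (γ : Fin (q + 2) → Fin n → ℝ) : ℝ :=
  ∑ v, h₂.baseDiv v - ∑ i : Fin q, ∑ m, γ (Fin.castAdd 2 i) m

theorem sum_eq_lastSum (hn : 0 < n) {h₂ : SurfaceHoneycomb 𝒯 n} {u : Fin n → ℝ}
    {ω : h₂.Vertex × h₂.Vertex → ℝ} (hω : ω ∈ labelSet h₂ (baseBoundary γ u)) :
    ∑ m, u m = h₂.lastSum γ := by
  have := sum_of_mem_labelSet hn hω
  rw [Fin.sum_univ_castSucc] at this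
  simp only [baseBoundary, Fin.snoc_castSucc, Fin.snoc_last] at this
  unfold lastSum
  linarith

/-- The shift between the boundary values on the glued side and the values of label maps on the
edges of the new triangle ending there. -/
def sideShift (h₁ : SurfaceHoneycomb singleTriangle n) (m : Fin n) : ℝ :=
  h₁.baseDiv (h₁.bv 0 (Fin.rev m)) - 1

/-- The value of a label map on the edge of the new triangle ending at the `m`-th point of the glued
side is the position `u m` of this point, up to an integer which depends on the structure graph
only. -/
theorem apply_zeroNbr (hn : 0 < n) (h : SurfaceHoneycomb 𝒯.glueTriangle n) {u : Fin n → ℝ}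
    {ω : h.restrictNew.Vertex × h.restrictNew.Vertex → ℝ}
    (hω : ω ∈ labelSet h.restrictNew (newBoundary γ u)) (m : Fin n) :
    ω (h.restrictNew.bv 0 (Fin.rev m), h.restrictNew.zeroNbr m) =
      u m + h.restrictNew.sideShift m := by
  have h1 := h.isGluing.divg_b₁ hω.1 m
  rw [divg_of_mem_labelSet hn hω, bterm_bv] at h1
  rw [← h1]
  simp [newBoundary, dualTuple, sideShift]
  ring

/-- The label set of the enlarged surface, in the chart made of charts of the two pieces and of all
the edges but one that end on the glued side. -/
theorem chartSet_glueChart (hn : 0 < n) (h : SurfaceHoneycomb 𝒯.glueTriangle n) (j : Fin n)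
    {κ₂ κ₁ : Type} (o₂ : κ₂ → h.restrictBase.Vertex × h.restrictBase.Vertex)
    (o₁ : κ₁ → h.restrictNew.Vertex × h.restrictNew.Vertex) :
    h.chartSet (IsGluing.glueChart h.inBase h.inNew (fun m => h.restrictNew.bv 0 (Fin.rev m))
      h.restrictNew.zeroNbr o₂ o₁ j) γ = {z | ∃ u : Fin n → ℝ,
        (∀ i : {i : Fin n // i ≠ j}, z (Sum.inr i) = u i + h.restrictNew.sideShift i) ∧
        (fun k => z (Sum.inl (Sum.inl k))) ∈ h.restrictBase.chartSet o₂ (baseBoundary γ u) ∧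
        (fun k => z (Sum.inl (Sum.inr k))) ∈ h.restrictNew.chartSet o₁ (newBoundary γ u)} := by
  ext z
  constructor
  · rintro ⟨ω, hω, rfl⟩
    obtain ⟨u, h2, h1⟩ := (mem_labelSet_glueTriangle_iff hω.1).1 hω
    exact ⟨u, fun i => apply_zeroNbr hn h h1 i, ⟨_, h2, rfl⟩, ⟨_, h1, rfl⟩⟩
  · rintro ⟨u, hz, ⟨ω₂, h2, hz₂⟩, ⟨ω₁, h1, hz₁⟩⟩
    have r2 : h.resBase (IsGluing.glueFlow h.inBase h.inNew ω₂ ω₁) = ω₂ :=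
      funext fun p => h.isGluing.glueFlow_apply₂ ω₂ h1.1 p.1 p.2
    have r1 : h.resNew (IsGluing.glueFlow h.inBase h.inNew ω₂ ω₁) = ω₁ :=
      funext fun p => h.isGluing.glueFlow_apply₁ ω₁ h2.1 p.1 p.2
    refine ⟨IsGluing.glueFlow h.inBase h.inNew ω₂ ω₁,
      (mem_labelSet_glueTriangle_iff (h.isGluing.glueFlow_mem h2.1 h1.1)).2 ⟨u, ?_, ?_⟩, ?_⟩
    · rwa [r2]
    · rwa [r1]
    · funext k
      rcases k with (k | k) | i
      · exact (congrFun r2 (o₂ k)).trans (congrFun hz₂ k)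
      · exact (congrFun r1 (o₁ k)).trans (congrFun hz₁ k)
      · rw [hz i, ← apply_zeroNbr hn h h1 i]
        exact congrFun r1 (_, _)

/-- Fubini: the volume of the label set of the enlarged surface is the integral, over the boundary
values on the glued side, of the product of the volumes of the label sets of the two pieces. -/
theorem flowVolume_glueTriangle (hn : 0 < n) (h : SurfaceHoneycomb 𝒯.glueTriangle n) (j : Fin n)
    (γ : Fin (q + 2) → Fin n → ℝ) :
    flowVolume h.graph (labelSet h γ) = ∫⁻ w,
      flowVolume h.restrictBase.graph (labelSet h.restrictBase
        (baseBoundary γ (completeTuple j (h.restrictBase.lastSum γ) w))) *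
      flowVolume h.restrictNew.graph (labelSet h.restrictNew
        (newBoundary γ (completeTuple j (h.restrictBase.lastSum γ) w))) := by
  classical
  have : Nonempty ι := ⟨(𝒯.bdry (Fin.last q)).1⟩
  obtain ⟨κ₂, _, o₂, ho₂, -⟩ := exists_isChart (h.restrictBase.graph_connected hn)
  obtain ⟨κ₁, _, o₁, ho₁, -⟩ := exists_isChart (h.restrictNew.graph_connected hn)
  have ho := h.isGluing.isChart ho₂ ho₁ (h.restrictBase.graph_connected hn)
    (h.restrictNew.graph_connected hn) j
  rw [flowVolume_labelSet hn ho]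
  simp only [flowVolume_labelSet hn ho₂, flowVolume_labelSet hn ho₁]
  set K := h.restrictBase.lastSum γ with hK
  set β : {i : Fin n // i ≠ j} → ℝ := fun i => h.restrictNew.sideShift i with hβ
  -- The pendant coordinates are those of `u` shifted by `β`; the omitted coordinate of `u` is
  -- determined by the sum `K`.
  set A : Set ((κ₂ ⊕ κ₁ → ℝ) × ({i : Fin n // i ≠ j} → ℝ)) :=
    {p | (fun k => p.1 (Sum.inl k)) ∈
        h.restrictBase.chartSet o₂ (baseBoundary γ (completeTuple j K (p.2 - β))) ∧
      (fun k => p.1 (Sum.inr k)) ∈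
        h.restrictNew.chartSet o₁ (newBoundary γ (completeTuple j K (p.2 - β)))} with hA
  have hcomp : Measurable fun p : (κ₂ ⊕ κ₁ → ℝ) × ({i : Fin n // i ≠ j} → ℝ) =>
      completeTuple j K (p.2 - β) :=
    (measurable_completeTuple K).comp (measurable_snd.sub_const β)
  have hAm : MeasurableSet A := by
    refine MeasurableSet.inter ?_ ?_
    · refine (measurableSet_chartSet hn ho₂).preimage
        (((measurable_baseBoundary γ).comp hcomp).prodMk ?_)
      exact measurable_pi_iff.2 fun k => (measurable_pi_apply _).comp measurable_fst
    · refine (measurableSet_chartSet hn ho₁).preimage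
        (((measurable_newBoundary γ).comp hcomp).prodMk ?_)
      exact measurable_pi_iff.2 fun k => (measurable_pi_apply _).comp measurable_fst
  have hset : h.chartSet (IsGluing.glueChart h.inBase h.inNew
      (fun m => h.restrictNew.bv 0 (Fin.rev m)) h.restrictNew.zeroNbr o₂ o₁ j) γ =
      MeasurableEquiv.sumPiEquivProdPi
        (fun _ : (κ₂ ⊕ κ₁) ⊕ {i : Fin n // i ≠ j} => ℝ) ⁻¹' A := by
    rw [chartSet_glueChart hn]
    ext z
    constructor
    · rintro ⟨u, hz, h2, h1⟩
      have hu : u = completeTuple j K ((fun i => z (Sum.inr i)) - β) := by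
        obtain ⟨ω, hω, -⟩ := id h2
        have he : (fun i : {i : Fin n // i ≠ j} => z (Sum.inr i)) - β =
            fun i : {i : Fin n // i ≠ j} => u i := by
          funext i
          simp [hz, hβ]
        rw [he]
        exact eq_completeTuple (sum_eq_lastSum hn hω)
      rw [hu] at h2 h1
      exact ⟨h2, h1⟩
    · rintro ⟨h2, h1⟩
      refine ⟨_, fun i => ?_, h2, h1⟩
      have hi := i.2
      simp [completeTuple, hi, hβ]
      rfl
  rw [hset, (volume_measurePreserving_sumPiEquivProdPi _).measure_preimage_equiv,
    Measure.volume_eq_prod, Measure.prod_apply_symm hAm]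
  refine Eq.trans ?_ (lintegral_sub_right_eq_self (fun w =>
    volume (h.restrictBase.chartSet o₂ (baseBoundary γ (completeTuple j K w))) *
      volume (h.restrictNew.chartSet o₁ (newBoundary γ (completeTuple j K w)))) β)
  refine lintegral_congr fun w => ?_
  have hprod : (fun y => (y, w)) ⁻¹' A =
      MeasurableEquiv.sumPiEquivProdPi (fun _ : κ₂ ⊕ κ₁ => ℝ) ⁻¹'
        (h.restrictBase.chartSet o₂ (baseBoundary γ (completeTuple j K (w - β))) ×ˢ
          h.restrictNew.chartSet o₁ (newBoundary γ (completeTuple j K (w - β)))) := rfl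
  rw [hprod, (volume_measurePreserving_sumPiEquivProdPi _).measure_preimage_equiv,
    Measure.volume_eq_prod, Measure.prod_prod]

/-! ### Summation over structure graphs -/

/-- The summand of the gluing formula given by a pair of structure graphs. -/
def pairIntegrand (γ : Fin (q + 2) → Fin n → ℝ) (G : GraphClass singleTriangle n × GraphClass 𝒯 n)
    (u : Fin n → ℝ) : ℝ≥0∞ :=
  honeyVolume G.2 (baseBoundary γ u) * honeyVolume G.1 (newBoundary γ u)

/-- The structure graphs of the restrictions to the two pieces. -/
def restrictClass (G : GraphClass 𝒯.glueTriangle n) :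
    GraphClass singleTriangle n × GraphClass 𝒯 n :=
  (Quotient.mk (graphSetoid singleTriangle n) (restrictNew (Quotient.out G)),
    Quotient.mk (graphSetoid 𝒯 n) (restrictBase (Quotient.out G)))

theorem restrictClass_mk (h : SurfaceHoneycomb 𝒯.glueTriangle n) :
    restrictClass (Quotient.mk (graphSetoid 𝒯.glueTriangle n) h) =
      (Quotient.mk (graphSetoid singleTriangle n) h.restrictNew,
        Quotient.mk (graphSetoid 𝒯 n) h.restrictBase) := by
  obtain ⟨f⟩ : Nonempty ((Quotient.out (Quotient.mk (graphSetoid 𝒯.glueTriangle n) h)).Iso h) :=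
    Quotient.exact (Quotient.out_eq (Quotient.mk (graphSetoid 𝒯.glueTriangle n) h))
  exact Prod.ext (Quotient.sound ⟨Iso.restrictNew f⟩) (Quotient.sound ⟨Iso.restrictBase f⟩)

/-- A structure graph of the enlarged surface is determined by its restrictions. -/
theorem restrictClass_injective :
    Function.Injective (restrictClass : GraphClass 𝒯.glueTriangle n → _) := by
  intro G G' hG
  obtain ⟨f₁⟩ : Nonempty ((restrictNew (Quotient.out G)).Iso (restrictNew (Quotient.out G'))) :=
    Quotient.exact (Prod.ext_iff.1 hG).1
  obtain ⟨f₂⟩ : Nonempty ((restrictBase (Quotient.out G)).Iso (restrictBase (Quotient.out G'))) :=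
    Quotient.exact (Prod.ext_iff.1 hG).2
  rw [← Quotient.out_eq G, ← Quotient.out_eq G']
  exact Quotient.sound ⟨Iso.ofRestrict f₂ f₁⟩

theorem nonempty_labelSet_of_honeyVolume_ne_zero {ι : Type} [Finite ι] [Nonempty ι] {p : ℕ}
    {𝒯 : TriangleGluing ι p} (hn : 0 < n) {h : SurfaceHoneycomb 𝒯 n} {γ : Fin p → Fin n → ℝ}
    (hv : honeyVolume (Quotient.mk (graphSetoid 𝒯 n) h) γ ≠ 0) : (labelSet h γ).Nonempty := by
  rw [honeyVolume_mk hn] at hv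
  by_contra he
  rw [not_nonempty_iff_eq_empty] at he
  exact hv (by simp [he, flowVolume])

/-- The boundary values for which a pair of structure graphs contributes to the gluing formula. -/
theorem of_pairIntegrand_ne_zero (hn : 0 < n) {h₂ : SurfaceHoneycomb 𝒯 n}
    {h₁ : SurfaceHoneycomb singleTriangle n} {u : Fin n → ℝ}
    (hne : pairIntegrand γ (Quotient.mk (graphSetoid singleTriangle n) h₁,
      Quotient.mk (graphSetoid 𝒯 n) h₂) u ≠ 0) :
    u ∈ Hreg n ∧ ∑ i, u i = h₂.lastSum γ ∧ (Quotient.mk (graphSetoid singleTriangle n) h₁,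
      Quotient.mk (graphSetoid 𝒯 n) h₂) ∈ range (restrictClass (𝒯 := 𝒯)) := by
  have : Nonempty ι := ⟨(𝒯.bdry (Fin.last q)).1⟩
  obtain ⟨ω₂, l₂⟩ := nonempty_labelSet_of_honeyVolume_ne_zero hn (left_ne_zero_of_mul hne)
  obtain ⟨ω₁, l₁⟩ := nonempty_labelSet_of_honeyVolume_ne_zero hn (right_ne_zero_of_mul hne)
  obtain ⟨k₂, b₂, f₂, -⟩ := mem_labelSet_iff.1 l₂
  obtain ⟨k₁, b₁, f₁, -⟩ := mem_labelSet_iff.1 l₁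
  obtain ⟨h, rfl, rfl⟩ := exists_glue b₂ b₁
  refine ⟨mem_Hreg_of_hasBoundary b₂, sum_eq_lastSum hn l₂,
    Quotient.mk (graphSetoid 𝒯.glueTriangle n) h, ?_⟩
  rw [restrictClass_mk]
  exact Prod.ext (Quotient.sound ⟨f₁⟩) (Quotient.sound ⟨f₂⟩)

theorem measurable_pairIntegrand (hn : 0 < n) (γ : Fin (q + 2) → Fin n → ℝ)
    (G : GraphClass singleTriangle n × GraphClass 𝒯 n) : Measurable (pairIntegrand γ G) := by
  have : Nonempty ι := ⟨(𝒯.bdry (Fin.last q)).1⟩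
  exact ((measurable_honeyVolume hn G.2).comp (measurable_baseBoundary γ)).mul
    ((measurable_honeyVolume hn G.1).comp (measurable_newBoundary γ))

/-- The volume of one structure graph of the enlarged surface is the integral of the summand of its
restrictions. The sum of `u` is prescribed by the structure graph and differs from `θ` by an
integer, so that exactly one piece of the slice contributes. -/
theorem honeyVolume_glueTriangle (hn : 0 < n) {θ : ℝ}
    (hθ : ∃ m : ℤ, θ = -(∑ i : Fin q, ∑ j, γ (Fin.castAdd 2 i) j) + m) (j : Fin n)
    (G : GraphClass 𝒯.glueTriangle n) :
    honeyVolume G γ = ∫⁻ u, pairIntegrand γ (restrictClass G) u ∂(sliceMeasure n θ j) := by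
  have : Nonempty ι := ⟨(𝒯.bdry (Fin.last q)).1⟩
  obtain ⟨h, rfl⟩ := Quotient.exists_rep G
  rw [lintegral_sliceMeasure (K := h.restrictBase.lastSum γ) ?_ (measurable_pairIntegrand hn γ _)]
  · refine (honeyVolume_mk hn h γ).trans ((flowVolume_glueTriangle hn h j γ).trans ?_)
    refine lintegral_congr fun w => ?_
    have := restrictClass_mk h
    unfold pairIntegrand
    rw [this, honeyVolume_mk hn, honeyVolume_mk hn]
  · intro u hu
    rw [restrictClass_mk] at hu
    obtain ⟨h1, h2, -⟩ := of_pairIntegrand_ne_zero hn hu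
    exact ⟨h1, h2⟩
  · obtain ⟨m, rfl⟩ := hθ
    obtain ⟨z, hz⟩ := sum_baseDiv_int h.restrictBase
    refine ⟨z - m, ?_⟩
    rw [lastSum, hz]
    push_cast
    ring

/-- Pairs of structure graphs which are not the restrictions of one structure graph of the enlarged
surface do not contribute: honeycombs with a common `u` can be glued. -/
theorem lintegral_pairIntegrand_eq_zero (hn : 0 < n)
    {G : GraphClass singleTriangle n × GraphClass 𝒯 n} (hG : G ∉ range (restrictClass (𝒯 := 𝒯)))
    (μ : Measure (Fin n → ℝ)) : ∫⁻ u, pairIntegrand γ G u ∂μ = 0 := by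
  refine (lintegral_congr fun u => ?_).trans lintegral_zero
  by_contra hne
  obtain ⟨G₁, G₂⟩ := G
  obtain ⟨h₁, rfl⟩ := Quotient.exists_rep G₁
  obtain ⟨h₂, rfl⟩ := Quotient.exists_rep G₂
  exact hG (of_pairIntegrand_ne_zero hn hne).2.2

end SurfaceHoneycomb

end HoneycombGluing

end

theorem mainTheorem7 (n : ℕ) (hn : 3 ≤ n) {ι : Type} [Finite ι] [DecidableEq ι] (q : ℕ)
    (𝒯 : HoneycombGluing.TriangleGluing ι (q + 1))
    (γ : Fin (q + 2) → Fin n → ℝ) (hγ : ∀ i, γ i ∈ HoneycombGluing.Hreg n)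
    (hsum : ∃ m : ℕ, ∑ i, ∑ j, γ i j = m) (θ : ℝ)
    (hθ : ∃ m : ℤ, θ = -(∑ i : Fin q, ∑ j, γ (Fin.castAdd 2 i) j) + m) (j : Fin n) :
    AEMeasurable (HoneycombGluing.gluingIntegrand 𝒯 γ) (HoneycombGluing.sliceMeasure n θ j) ∧
    (∑' G : HoneycombGluing.GraphClass 𝒯.glueTriangle n, HoneycombGluing.honeyVolume G γ) ≠ ⊤ ∧
    (∑' G : HoneycombGluing.GraphClass 𝒯.glueTriangle n, HoneycombGluing.honeyVolume G γ) =
      ∫⁻ u, HoneycombGluing.gluingIntegrand 𝒯 γ u ∂(HoneycombGluing.sliceMeasure n θ j) := by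
  have hn0 : 0 < n := by omega
  have : Nonempty ι := ⟨(𝒯.bdry (Fin.last q)).1⟩
  have hmeas := HoneycombGluing.SurfaceHoneycomb.measurable_pairIntegrand (𝒯 := 𝒯) hn0 γ
  refine ⟨(Measurable.tsum hmeas).aemeasurable, ?_, ?_⟩
  · have := Fintype.ofFinite (HoneycombGluing.GraphClass 𝒯.glueTriangle n)
    rw [tsum_fintype]
    exact ENNReal.sum_ne_top.2 fun G _ =>
      HoneycombGluing.SurfaceHoneycomb.honeyVolume_ne_top hn0 G γ
  · refine Eq.trans ?_ (MeasureTheory.lintegral_tsum fun G => (hmeas G).aemeasurable).symm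
    simp only [HoneycombGluing.SurfaceHoneycomb.honeyVolume_glueTriangle hn0 hθ j]
    refine HoneycombGluing.SurfaceHoneycomb.restrictClass_injective.tsum_eq
      (f := fun G => ∫⁻ u, HoneycombGluing.SurfaceHoneycomb.pairIntegrand γ G u
        ∂(HoneycombGluing.sliceMeasure n θ j)) fun G hG => ?_
    by_contra hr
    exact hG (HoneycombGluing.SurfaceHoneycomb.lintegral_pairIntegrand_eq_zero hn0 hr _)
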